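/- Let $p\ge 2$ be an integer, $\mathfrak q=e^{i\pi/p}$, and for a parameter $v$ put $[n]_v=\frac{v^n-v^{-n}}{v-v^{-1}}$, $[n]_v!=[1]_v[2]_v\cdots[n]_v$; write $[n]=[n]_{\mathfrak q}$. **The algebras.** $U_v$ denotes the quantum $s\ell(2)$, generated by $E,F,K^{\pm1}$ with $$KEK^{-1}=v^2E,\quad KFK^{-1}=v^{-2}F,\quad [E,F]=\frac{K-K^{-1}}{v-v^{-1}}.$$ The restricted quantum group $\overline U_{\mathfrak q}$ is the complex algebra with the same generators and these relations at $v=\mathfrak q$ together with $E^p=F^p=0$, $K^{2p}=1$. Let $LU_{\mathfrak q}$ be the complex algebra generated by $E,F,K^{\pm1},e,f,h$ subject to the relations of $\overline U_{\mathfrak q}$ for $E,F,K$, the relations $[h,e]=e$, $[h,f]=-f$, $[e,f]=2h$, and the mixed relations $$[h,K]=[E,e]=[K,e]=[F,f]=[K,f]=0,$$ $$[F,e]=\frac1{[p-1]!}K^p\,\frac{\mathfrak qK-\mathfrak q^{-1}K^{-1}}{\mathfrak q-\mathfrak q^{-1}}\,E^{p-1},\qquad [E,f]=\frac{(-1)^{p+1}}{[p-1]!}F^{p-1}\,\frac{\mathfrak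 qK-\mathfrak q^{-1}K^{-1}}{\mathfrak q-\mathfrak q^{-1}},$$ $$[h,E]=\tfrac12EA,\qquad [h,F]=-\tfrac12AF,$$ where $$A=\sum_{s=1}^{p-1}\frac{(u_s(\mathfrak q^{-s-1})-u_s(\mathfrak q^{s-1}))K+\mathfrak q^{s-1}u_s(\mathfrak q^{s-1})-\mathfrak q^{-s-1}u_s(\mathfrak q^{-s-1})}{(\mathfrak q^{s-1}-\mathfrak q^{-s-1})\,u_s(\mathfrak q^{-s-1})\,u_s(\mathfrak q^{s-1})}\,u_s(K)\,\mathbf e_s,\qquad u_s(x)=\prod_{\substack{1\le n\le p-1\\ n\ne s}}(x-\mathfrak q^{s-1-2n}),$$ $$\mathbf e_s=\frac1{\psi_s(\beta_s)}\Bigl(\psi_s(\mathbf C)-\frac{\psi_s'(\beta_s)}{\psi_s(\beta_s)}(\mathbf C-\beta_s)\psi_s(\mathbf C)\Bigr),\qquad \psi_s(x)=(x-\beta_0)(x-\beta_p)\prod_{\substack{1\le j\le p-1\\ j\ne s}}(x-\beta_j)^2,$$ $\beta_j=\mathfrak q^j+\mathfrak q^{-j}$ and $\mathbf C=(\mathfrak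 q-\mathfrak q^{-1})^2EF+\mathfrak q^{-1}K+\mathfrak qK^{-1}$. **Hopf structures.** $U_v$ (over $\mathbb C(v)$) and $\overline U_{\mathfrak q}$ are Hopf algebras with $$\Delta(E)=1\otimes E+E\otimes K,\quad \Delta(F)=K^{-1}\otimes F+F\otimes1,\quad \Delta(K)=K\otimes K,$$ $$S(E)=-EK^{-1},\quad S(F)=-KF,\quad S(K)=K^{-1},\quad \epsilon(E)=\epsilon(F)=0,\ \epsilon(K)=1,$$ and $U(s\ell(2))$ is a Hopf algebra in which the elements of $s\ell(2)$ are primitive. The following holds. 1. $LU_{\mathfrak q}$ is a Hopf algebra, with $\Delta,S,\epsilon$ as above on $E,F,K$ and $$\Delta(e)=e\otimes1+K^p\otimes e+\frac1{[p-1]!}\sum_{r=1}^{p-1}\frac{\mathfrak q^{r(p-r)}}{[r]}K^pE^{p-r}\otimes E^rK^{-r},$$ $$\Delta(f)=f\otimes1+K^p\otimes f+\frac{(-1)^p}{[p-1]!}\sum_{s=1}^{p-1}\frac{\mathfrak q^{-s(p-s)}}{[s]}K^{p+s}F^s\otimes F^{p-s},\qquad \Delta(h)=\tfrac12[\Delta(e),\Delta(f)],$$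 $$S(e)=-K^pe,\quad S(f)=-K^pf,\quad S(h)=-h,\quad \epsilon(e)=\epsilon(f)=\epsilon(h)=0.$$ 2. $LU_{\mathfrak q}$ is the limit of $U_v$ with divided powers as $v\to\mathfrak q$. Let $R\subset\mathbb C(v)$ be the ring of rational functions regular at $v=\mathfrak q$, and let $U_R\subset U_v$ be the $R$-subalgebra generated by $E,F,K^{\pm1}$, $$e=\frac{K^pE^p}{[p]_v!},\qquad f=\frac{(-1)^pF^p}{[p]_v!},\qquad h=\tfrac12[e,f].$$ There is a surjective ring homomorphism $\pi:U_R\to LU_{\mathfrak q}$ with kernel $(v-\mathfrak q)U_R$ that sends $E,F,K,e,f,h$ to the generators of the same names and satisfies $\pi(cx)=c(\mathfrak q)\pi(x)$ for $c\in R$, $x\in U_R$. It carries the Hopf structure of $U_v$ to that of $LU_{\mathfrak q}$: for each $x\in U_R$ one can write $\Delta(x)=\sum_iy_i\otimes z_i$ with $y_i,z_i\in U_R$ and $\Delta(\pi(x))=\sum_i\pi(y_i)\otimes\pi(z_i)$; moreover $S(x)\in U_R$ and $S(\pi(x))=\pi(S(x))$; and $\epsilon(x)\in R$ and $\epsilon(\pi(x))=\epsilon(x)|_{v=\mathfrak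 q}$. 3. The homomorphism $\overline U_{\mathfrak q}\to LU_{\mathfrak q}$ that sends generators to the generators of the same names is an injective homomorphism of Hopf algebras. The left ideal $I$ of $LU_{\mathfrak q}$ generated by the image of the augmentation ideal $\ker\epsilon\subset\overline U_{\mathfrak q}$ is a two-sided Hopf ideal, and $LU_{\mathfrak q}/I$ is isomorphic, as a Hopf algebra, to $U(s\ell(2))$, where the classes of $e,f,h$ correspond to $\begin{pmatrix}0&1\\0&0\end{pmatrix},\begin{pmatrix}0&0\\1&0\end{pmatrix},\tfrac12\begin{pmatrix}1&0\\0&-1\end{pmatrix}$. -/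

import Mathlib

open scoped TensorProduct

noncomputable section

namespace LusztigLimit

/-! ### Hopf algebra structures on a given algebra -/

/-- A Hopf algebra structure on a given `R`-algebra `A`. -/
structure HopfStructure (R A : Type*) [CommRing R] [Ring A] [Algebra R A] where
  comul : A →ₐ[R] A ⊗[R] A
  counit : A →ₐ[R] R
  antipode : A →ₗ[R] A
  coassoc : (Algebra.TensorProduct.assoc R R R A A A).toAlgHom.comp
      ((Algebra.TensorProduct.map comul (.id R A)).comp comul)
      = (Algebra.TensorProduct.map (.id R A) comul).comp comul
  rTensor_counit : (Algebra.TensorProduct.map counit (.id R A)).comp comul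
      = (Algebra.TensorProduct.lid R A).symm
  lTensor_counit : (Algebra.TensorProduct.map (.id R A) counit).comp comul
      = (Algebra.TensorProduct.rid R R A).symm
  antipode_left : LinearMap.mul' R A ∘ₗ antipode.rTensor A ∘ₗ comul.toLinearMap
      = Algebra.linearMap R A ∘ₗ counit.toLinearMap
  antipode_right : LinearMap.mul' R A ∘ₗ antipode.lTensor A ∘ₗ comul.toLinearMap
      = Algebra.linearMap R A ∘ₗ counit.toLinearMap

/-- The corresponding Mathlib Hopf algebra; its algebra structure is the given one. -/
abbrev HopfStructure.toHopfAlgebra {R A : Type*} [CommRing R] [Ring A] [Algebra R A]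
    (H : HopfStructure R A) : HopfAlgebra R A :=
  letI : Bialgebra R A :=
    Bialgebra.ofAlgHom H.comul H.counit H.coassoc H.rTensor_counit H.lTensor_counit
  { antipode := H.antipode
    mul_antipode_rTensor_comul := H.antipode_left
    mul_antipode_lTensor_comul := H.antipode_right }

/-- An algebra homomorphism that respects comultiplication, counit and antipode. -/
structure HopfStructure.IsHom {R A B : Type*} [CommRing R] [Ring A] [Algebra R A]
    [Ring B] [Algebra R B] (HA : HopfStructure R A) (HB : HopfStructure R B)
    (φ : A →ₐ[R] B) : Prop where
  comul : ∀ x, HB.comul (φ x) = Algebra.TensorProduct.map φ φ (HA.comul x)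
  counit : ∀ x, HB.counit (φ x) = HA.counit x
  antipode : ∀ x, HB.antipode (φ x) = φ (HA.antipode x)

/-! ### Quantum integers -/

/-- `[n] = (v ^ n - v ^ (-n)) / (v - v⁻¹)`. -/
def qInt {k : Type*} [Field k] (v : k) (n : ℕ) : k := (v ^ n - v⁻¹ ^ n) / (v - v⁻¹)

/-- `[n]! = [1] [2] ⋯ [n]`. -/
def qFact {k : Type*} [Field k] (v : k) (n : ℕ) : k := ∏ m ∈ Finset.Icc 1 n, qInt v m

/-- `q = exp (i π / p)`. -/
def qRoot (p : ℕ) : ℂ := Complex.exp (Complex.I * Real.pi / p)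

/-! ### Quantum `sl(2)` and its restricted version -/

/-- The generators `E, F, K, K⁻¹`. -/
inductive QGen | E | F | K | Kinv

section QGen
variable (k : Type*) [Field k]

abbrev QGen.toE : FreeAlgebra k QGen := FreeAlgebra.ι k QGen.E
abbrev QGen.toF : FreeAlgebra k QGen := FreeAlgebra.ι k QGen.F
abbrev QGen.toK : FreeAlgebra k QGen := FreeAlgebra.ι k QGen.K
abbrev QGen.toKinv : FreeAlgebra k QGen := FreeAlgebra.ι k QGen.Kinv

end QGen

open QGen in
/-- The relations of `U_v(sl(2))`. -/
inductive UqRel {k : Type*} [Field k] (v : k) :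
    FreeAlgebra k QGen → FreeAlgebra k QGen → Prop
  | K_mul_Kinv : UqRel v (toK k * toKinv k) 1
  | Kinv_mul_K : UqRel v (toKinv k * toK k) 1
  | K_E : UqRel v (toK k * toE k * toKinv k) (v ^ 2 • toE k)
  | K_F : UqRel v (toK k * toF k * toKinv k) (v⁻¹ ^ 2 • toF k)
  | E_F : UqRel v (toE k * toF k - toF k * toE k) ((v - v⁻¹)⁻¹ • (toK k - toKinv k))

/-- The quantum group `U_v(sl(2))` over the field `k`. -/
def Uq {k : Type*} [Field k] (v : k) := RingQuot (UqRel v)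

instance {k : Type*} [Field k] (v : k) : Ring (Uq v) :=
  inferInstanceAs (Ring (RingQuot (UqRel v)))

instance {k : Type*} [Field k] (v : k) : Algebra k (Uq v) :=
  inferInstanceAs (Algebra k (RingQuot (UqRel v)))

/-- The image in `U_v(sl(2))` of a generator. -/
def Uq.gen {k : Type*} [Field k] (v : k) (g : QGen) : Uq v :=
  RingQuot.mkAlgHom k (UqRel v) (FreeAlgebra.ι k g)

open QGen in
/-- The relations of the restricted quantum `sl(2)` at `q = exp (i π / p)`. -/
inductive ResRel (p : ℕ) : FreeAlgebra ℂ QGen → FreeAlgebra ℂ QGen → Prop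
  | quantum {x y : FreeAlgebra ℂ QGen} (h : UqRel (qRoot p) x y) : ResRel p x y
  | E_pow : ResRel p (toE ℂ ^ p) 0
  | F_pow : ResRel p (toF ℂ ^ p) 0
  | K_pow : ResRel p (toK ℂ ^ (2 * p)) 1

/-- The restricted quantum group. -/
def Ures (p : ℕ) := RingQuot (ResRel p)

instance (p : ℕ) : Ring (Ures p) := inferInstanceAs (Ring (RingQuot (ResRel p)))

instance (p : ℕ) : Algebra ℂ (Ures p) := inferInstanceAs (Algebra ℂ (RingQuot (ResRel p)))

/-- The image in the restricted quantum group of a generator. -/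
def Ures.gen (p : ℕ) (g : QGen) : Ures p := RingQuot.mkAlgHom ℂ (ResRel p) (FreeAlgebra.ι ℂ g)

/-- The standard comultiplication, counit and antipode on `E, F, K`. -/
structure HasQuantumValues {k A : Type*} [Field k] [Ring A] [Algebra k A]
    (H : HopfStructure k A) (E F K Kinv : A) : Prop where
  comul_E : H.comul E = 1 ⊗ₜ[k] E + E ⊗ₜ[k] K
  comul_F : H.comul F = Kinv ⊗ₜ[k] F + F ⊗ₜ[k] 1
  comul_K : H.comul K = K ⊗ₜ[k] K
  antipode_E : H.antipode E = -(E * Kinv)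
  antipode_F : H.antipode F = -(K * F)
  antipode_K : H.antipode K = Kinv
  counit_E : H.counit E = 0
  counit_F : H.counit F = 0
  counit_K : H.counit K = 1

/-! ### The element `A` -/

open Polynomial in
/-- `ψ_s`, for `1 ≤ s ≤ p - 1`, with `β_j = q ^ j + q ^ (-j)`. -/
def psi (p s : ℕ) : ℂ[X] :=
  (X - C (qRoot p ^ 0 + (qRoot p)⁻¹ ^ 0)) * (X - C (qRoot p ^ p + (qRoot p)⁻¹ ^ p)) *
    ∏ j ∈ (Finset.Icc 1 (p - 1)).erase s, (X - C (qRoot p ^ j + (qRoot p)⁻¹ ^ j)) ^ 2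

open Polynomial in
/-- `u_s(X) = ∏_{n ≠ s} (X - q ^ (s - 1 - 2 n))`, the product over `1 ≤ n ≤ p - 1`. -/
def uPoly (p s : ℕ) : ℂ[X] :=
  ∏ n ∈ (Finset.Icc 1 (p - 1)).erase s, (X - C (qRoot p ^ ((s : ℤ) - 1 - 2 * (n : ℤ))))

section Elements
variable (p : ℕ) {A : Type*} [Ring A] [Algebra ℂ A] (E F K Kinv : A)

/-- The Casimir element. -/
def casimir : A :=
  ((qRoot p - (qRoot p)⁻¹) ^ 2) • (E * F) + (qRoot p)⁻¹ • K + qRoot p • Kinv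

/-- The central idempotent `e_s`, for `1 ≤ s ≤ p - 1`. -/
def idem (s : ℕ) : A :=
  let β : ℂ := qRoot p ^ s + (qRoot p)⁻¹ ^ s
  let c : A := casimir p E F K Kinv
  ((psi p s).eval β)⁻¹ • (Polynomial.aeval c (psi p s)
    - ((psi p s).derivative.eval β / (psi p s).eval β) •
      ((c - algebraMap ℂ A β) * Polynomial.aeval c (psi p s)))

/-- The element `A`; in the `s`-th summand, `a = q ^ (s - 1)` and `b = q ^ (-s - 1)`. -/
def elemA : A :=
  ∑ s ∈ Finset.Icc 1 (p - 1),
    let a : ℂ := qRoot p ^ ((s : ℤ) - 1)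
    let b : ℂ := qRoot p ^ (-(s : ℤ) - 1)
    let ua : ℂ := (uPoly p s).eval a
    let ub : ℂ := (uPoly p s).eval b
    ((a - b) * ub * ua)⁻¹ •
      (((ub - ua) • K + algebraMap ℂ A (a * ua - b * ub)) *
        Polynomial.aeval K (uPoly p s) * idem p E F K Kinv s)

/-- `(q K - q⁻¹ K⁻¹) / (q - q⁻¹)`. -/
def qBracketK : A :=
  (qRoot p - (qRoot p)⁻¹)⁻¹ • (qRoot p • K - (qRoot p)⁻¹ • Kinv)

end Elements

/-! ### The Lusztig limit by generators and relations -/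

/-- The generators `E, F, K, K⁻¹` and `e, f, h`. -/
inductive LGen | q (g : QGen) | e | f | h

namespace LGen
abbrev E' : FreeAlgebra ℂ LGen := FreeAlgebra.ι ℂ (LGen.q QGen.E)
abbrev F' : FreeAlgebra ℂ LGen := FreeAlgebra.ι ℂ (LGen.q QGen.F)
abbrev K' : FreeAlgebra ℂ LGen := FreeAlgebra.ι ℂ (LGen.q QGen.K)
abbrev Kinv' : FreeAlgebra ℂ LGen := FreeAlgebra.ι ℂ (LGen.q QGen.Kinv)
abbrev e' : FreeAlgebra ℂ LGen := FreeAlgebra.ι ℂ LGen.e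
abbrev f' : FreeAlgebra ℂ LGen := FreeAlgebra.ι ℂ LGen.f
abbrev h' : FreeAlgebra ℂ LGen := FreeAlgebra.ι ℂ LGen.h

/-- Words in `E, F, K, K⁻¹` as words in all the generators. -/
def incl : FreeAlgebra ℂ QGen →ₐ[ℂ] FreeAlgebra ℂ LGen :=
  FreeAlgebra.lift ℂ fun g => FreeAlgebra.ι ℂ (LGen.q g)
end LGen

open LGen in
/-- The defining relations of the Lusztig limit. -/
inductive LRel (p : ℕ) : FreeAlgebra ℂ LGen → FreeAlgebra ℂ LGen → Prop
  | restricted {x y : FreeAlgebra ℂ QGen} (r : ResRel p x y) : LRel p (incl x) (incl y)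
  | h_e : LRel p (h' * e' - e' * h') e'
  | h_f : LRel p (h' * f' - f' * h') (-f')
  | e_f : LRel p (e' * f' - f' * e') (2 • h')
  | h_K : LRel p (h' * K' - K' * h') 0
  | E_e : LRel p (E' * e' - e' * E') 0
  | K_e : LRel p (K' * e' - e' * K') 0
  | F_f : LRel p (F' * f' - f' * F') 0
  | K_f : LRel p (K' * f' - f' * K') 0
  | F_e : LRel p (F' * e' - e' * F')
      ((qFact (qRoot p) (p - 1))⁻¹ • (K' ^ p * qBracketK p K' Kinv' * E' ^ (p - 1)))
  | E_f : LRel p (E' * f' - f' * E')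
      (((-1) ^ (p + 1) / qFact (qRoot p) (p - 1)) • (F' ^ (p - 1) * qBracketK p K' Kinv'))
  | h_E : LRel p (h' * E' - E' * h') ((1 / 2 : ℂ) • (E' * elemA p E' F' K' Kinv'))
  | h_F : LRel p (h' * F' - F' * h') (-((1 / 2 : ℂ) • (elemA p E' F' K' Kinv' * F')))

/-- The algebra `LU_q(sl(2))`. -/
def LU (p : ℕ) := RingQuot (LRel p)

instance (p : ℕ) : Ring (LU p) := inferInstanceAs (Ring (RingQuot (LRel p)))

instance (p : ℕ) : Algebra ℂ (LU p) := inferInstanceAs (Algebra ℂ (RingQuot (LRel p)))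

/-- The image in `LU_q(sl(2))` of a generator. -/
def LU.gen (p : ℕ) (g : LGen) : LU p := RingQuot.mkAlgHom ℂ (LRel p) (FreeAlgebra.ι ℂ g)

namespace LU
variable (p : ℕ)
abbrev E : LU p := gen p (.q .E)
abbrev F : LU p := gen p (.q .F)
abbrev K : LU p := gen p (.q .K)
abbrev Kinv : LU p := gen p (.q .Kinv)
abbrev e : LU p := gen p .e
abbrev f : LU p := gen p .f
abbrev h : LU p := gen p .h
end LU

open LU in
/-- The comultiplication, antipode and counit of the Lusztig limit on the generators. -/
structure HasLusztigValues (p : ℕ) (H : HopfStructure ℂ (LU p)) : Prop where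
  quantum : HasQuantumValues H (E p) (F p) (K p) (Kinv p)
  comul_e : H.comul (e p) = e p ⊗ₜ[ℂ] 1 + (K p ^ p) ⊗ₜ[ℂ] e p +
    (qFact (qRoot p) (p - 1))⁻¹ • ∑ r ∈ Finset.Icc 1 (p - 1),
      (qRoot p ^ (r * (p - r)) / qInt (qRoot p) r) •
        ((K p ^ p * E p ^ (p - r)) ⊗ₜ[ℂ] (E p ^ r * Kinv p ^ r))
  comul_f : H.comul (f p) = f p ⊗ₜ[ℂ] 1 + (K p ^ p) ⊗ₜ[ℂ] f p +
    ((-1) ^ p / qFact (qRoot p) (p - 1)) • ∑ s ∈ Finset.Icc 1 (p - 1),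
      ((qRoot p)⁻¹ ^ (s * (p - s)) / qInt (qRoot p) s) •
        ((K p ^ (p + s) * F p ^ s) ⊗ₜ[ℂ] (F p ^ (p - s)))
  comul_h : H.comul (h p) =
    (1 / 2 : ℂ) • (H.comul (e p) * H.comul (f p) - H.comul (f p) * H.comul (e p))
  antipode_e : H.antipode (e p) = -(K p ^ p * e p)
  antipode_f : H.antipode (f p) = -(K p ^ p * f p)
  antipode_h : H.antipode (h p) = -h p
  counit_e : H.counit (e p) = 0
  counit_f : H.counit (f p) = 0
  counit_h : H.counit (h p) = 0

/-! ### `U(sl(2))` -/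

/-- `sl(2)` over the complex numbers. -/
abbrev Sl2 := LieAlgebra.SpecialLinear.sl (Fin 2) ℂ

/-- The matrix unit `E₁₂`. -/
abbrev sl2e : Sl2 := LieAlgebra.SpecialLinear.single 0 1 (by decide) 1

/-- The matrix unit `E₂₁`. -/
abbrev sl2f : Sl2 := LieAlgebra.SpecialLinear.single 1 0 (by decide) 1

/-- The diagonal matrix with entries `1/2, -1/2`, so that `[h, e] = e` and `[e, f] = 2 h`. -/
abbrev sl2h : Sl2 := LieAlgebra.SpecialLinear.singleSubSingle 0 1 (1 / 2)

/-- The universal enveloping algebra `U(sl(2))`. -/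
abbrev USl2 := UniversalEnvelopingAlgebra ℂ Sl2

/-- The standard Hopf structure on `U(sl(2))`: elements of `sl(2)` are primitive. -/
structure HasPrimitiveValues (H : HopfStructure ℂ USl2) : Prop where
  comul_ι : ∀ x : Sl2, H.comul (UniversalEnvelopingAlgebra.ι ℂ x) =
    UniversalEnvelopingAlgebra.ι ℂ x ⊗ₜ[ℂ] 1 + 1 ⊗ₜ[ℂ] UniversalEnvelopingAlgebra.ι ℂ x
  counit_ι : ∀ x : Sl2, H.counit (UniversalEnvelopingAlgebra.ι ℂ x) = 0
  antipode_ι : ∀ x : Sl2, H.antipode (UniversalEnvelopingAlgebra.ι ℂ x) =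
    -UniversalEnvelopingAlgebra.ι ℂ x

/-! ### Divided powers in generic quantum `sl(2)` -/

/-- The ring of rational functions in one variable over `ℂ` that are regular at `a`. -/
def regularAt (a : ℂ) : Subalgebra ℂ (RatFunc ℂ) where
  carrier := {x | ∃ n d : Polynomial ℂ, d.eval a ≠ 0 ∧
    x = algebraMap (Polynomial ℂ) (RatFunc ℂ) n / algebraMap (Polynomial ℂ) (RatFunc ℂ) d}
  mul_mem' := by
    rintro _ _ ⟨n, d, hd, rfl⟩ ⟨n', d', hd', rfl⟩
    refine ⟨n * n', d * d', ?_, ?_⟩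
    · rw [Polynomial.eval_mul]; exact mul_ne_zero hd hd'
    · rw [map_mul, map_mul, div_mul_div_comm]
  add_mem' := by
    rintro _ _ ⟨n, d, hd, rfl⟩ ⟨n', d', hd', rfl⟩
    have key : ∀ b : Polynomial ℂ, b.eval a ≠ 0 →
        algebraMap (Polynomial ℂ) (RatFunc ℂ) b ≠ 0 := by
      intro b hb h0
      exact hb (by rw [(map_eq_zero_iff _ (RatFunc.algebraMap_injective ℂ)).mp h0,
        Polynomial.eval_zero])
    refine ⟨n * d' + d * n', d * d', ?_, ?_⟩
    · rw [Polynomial.eval_mul]; exact mul_ne_zero hd hd'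
    · rw [div_add_div _ _ (key d hd) (key d' hd'), map_add, map_mul, map_mul, map_mul]
  algebraMap_mem' := by
    intro r
    refine ⟨Polynomial.C r, 1, by simp, ?_⟩
    rw [map_one, div_one, RatFunc.algebraMap_C, RatFunc.algebraMap_eq_C]

/-- The quantum group with generic parameter: the parameter is the variable `X` of `ℂ(X)`. -/
abbrev Ugen := Uq (RatFunc.X : RatFunc ℂ)

namespace Ugen
abbrev E : Ugen := Uq.gen RatFunc.X .E
abbrev F : Ugen := Uq.gen RatFunc.X .F
abbrev K : Ugen := Uq.gen RatFunc.X .K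
abbrev Kinv : Ugen := Uq.gen RatFunc.X .Kinv

/-- `e = K ^ p E ^ p / [p]!`. -/
def e (p : ℕ) : Ugen := (qFact (RatFunc.X : RatFunc ℂ) p)⁻¹ • (K ^ p * E ^ p)

/-- `f = (-1) ^ p F ^ p / [p]!`. -/
def f (p : ℕ) : Ugen := ((-1) ^ p / qFact (RatFunc.X : RatFunc ℂ) p) • F ^ p

/-- `h = [e, f] / 2`. -/
def h (p : ℕ) : Ugen := (1 / 2 : RatFunc ℂ) • (e p * f p - f p * e p)
end Ugen

open Ugen in
/-- The form of generic `U_q(sl(2))` with divided powers: the subalgebra generated by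
`E, F, K, K⁻¹, e, f, h` over the functions of the parameter regular at `exp (i π / p)`. -/
def DividedForm (p : ℕ) : Subalgebra (regularAt (qRoot p)) Ugen :=
  Algebra.adjoin (regularAt (qRoot p)) {E, F, K, Kinv, e p, f p, h p}

/-- `π` is the limit of the form with divided powers as the parameter tends to
`q = exp (i π / p)`: it specializes scalars at `q`, is the quotient map modulo (parameter `- q`),
matches the generators, and carries comultiplication, counit and antipode to those of `LU p`. -/
structure IsLimitMap (p : ℕ) (Hgen : HopfStructure (RatFunc ℂ) Ugen)
    (H : HopfStructure ℂ (LU p)) (π : DividedForm p →+* LU p) : Prop where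
  map_smul : ∀ (c : regularAt (qRoot p)) (x : DividedForm p),
    π (c • x) = RatFunc.eval (RingHom.id ℂ) (qRoot p) (c : RatFunc ℂ) • π x
  surjective : Function.Surjective π
  map_eq_zero_iff : ∀ x : DividedForm p, π x = 0 ↔
    ∃ y : DividedForm p, (x : Ugen) = (RatFunc.X - RatFunc.C (qRoot p)) • (y : Ugen)
  map_E : ∃ x : DividedForm p, (x : Ugen) = Ugen.E ∧ π x = LU.E p
  map_F : ∃ x : DividedForm p, (x : Ugen) = Ugen.F ∧ π x = LU.F p
  map_K : ∃ x : DividedForm p, (x : Ugen) = Ugen.K ∧ π x = LU.K p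
  map_e : ∃ x : DividedForm p, (x : Ugen) = Ugen.e p ∧ π x = LU.e p
  map_f : ∃ x : DividedForm p, (x : Ugen) = Ugen.f p ∧ π x = LU.f p
  map_h : ∃ x : DividedForm p, (x : Ugen) = Ugen.h p ∧ π x = LU.h p
  comul : ∀ x : DividedForm p, ∃ (n : ℕ) (y z : Fin n → DividedForm p),
    Hgen.comul (x : Ugen) = ∑ i, (y i : Ugen) ⊗ₜ[RatFunc ℂ] (z i : Ugen) ∧
    H.comul (π x) = ∑ i, π (y i) ⊗ₜ[ℂ] π (z i)
  counit : ∀ x : DividedForm p, Hgen.counit (x : Ugen) ∈ regularAt (qRoot p) ∧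
    H.counit (π x) = RatFunc.eval (RingHom.id ℂ) (qRoot p) (Hgen.counit (x : Ugen))
  antipode : ∀ x : DividedForm p, ∃ y : DividedForm p,
    (y : Ugen) = Hgen.antipode (x : Ugen) ∧ H.antipode (π x) = π y

/-! ### The restricted quantum group inside the limit, and the quotient -/

/-- The left ideal generated by the image under `j` of the augmentation ideal (the kernel of the
counit) of the restricted quantum group. -/
def augmentationIdeal {p : ℕ} (Hres : HopfStructure ℂ (Ures p)) (j : Ures p →ₐ[ℂ] LU p) :
    Ideal (LU p) :=
  Ideal.span (j '' {x | Hres.counit x = 0})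

/-- `I` is a (two-sided) Hopf ideal and the Hopf algebra `LU p / I` is `U(sl(2))`, by an
isomorphism that sends the classes of `e, f, h` to the standard generators. -/
def IsHopfIdealWithQuotientUSl2 {p : ℕ} (H : HopfStructure ℂ (LU p))
    (Hsl : HopfStructure ℂ USl2) (I : Ideal (LU p)) : Prop :=
  letI := H.toHopfAlgebra
  letI := Hsl.toHopfAlgebra
  ∃ (_ : I.IsTwoSided) (_ : I.IsHopfIdeal ℂ) (φ : (LU p ⧸ I) ≃ₐc[ℂ] USl2),
    φ (Ideal.Quotient.mk I (LU.e p)) = UniversalEnvelopingAlgebra.ι ℂ sl2e ∧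
    φ (Ideal.Quotient.mk I (LU.f p)) = UniversalEnvelopingAlgebra.ι ℂ sl2f ∧
    φ (Ideal.Quotient.mk I (LU.h p)) = UniversalEnvelopingAlgebra.ι ℂ sl2h

end LusztigLimit

end

/-! Write `q` for `qRoot p`, `v` for the generic parameter, `x^(n)` for the divided power `x^n /
[n]!`, and call the quotient of the divided-power form by `v - q` the special fiber. Everything
follows once the presented algebra `LU p` is identified with the special fiber
(`LU.toSpecialFiber_bijective`): the fiber inherits a Hopf structure from generic quantum sl(2), and
its values on generators are limits of generic formulas.

Relations in the fiber. Those without `h` are limits of generic commutation formulas, in which a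
zero `[p]` cancels against `[p]!`. For `h`, expand `E^(p) F^(p)`. The last term of the expansion is
`[K; 0] ⋯ [K; 1 - p] / [p]!`; its numerator is, up to units and modulo `v - q`, the element `K^(2p)
- 1`. Hence `K^(2p) = 1` in the fiber, and `h` is a multiple of `Y = (K^(2p) - 1) / (v - q)` plus
terms that commute with `e` and `f` (`SpecialFiber.exists_h_eq`). Since `K^(2p)` commutes with `e`
up to the factor `v^(4p²)`, the derivative of that factor at `q` yields `[h, e] = e`, and likewise
for `f`. The brackets of `h` with `E` and `F` need no limit: they follow formally from the other
relations (`IsPreLimit.commutator_E`, `IsPreLimit.commutator_F`). On a vector `z` of weight `q^k`,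
the commutator of `[e, f]` and `E` is a polynomial in the Casimir element applied to `E z`. The
polynomial is a sum that collapses to a single product of factors `C - β`. Now `E z` is annihilated
by such a product of degree `p - 1`, and modulo it the surviving product is, after normalization,
the idempotent `e_s`. The element `A` selects the right `s` for each weight.

Comparison. The relations give a surjection from `LU p` to the fiber. The monomials `f^i h^j F^a K^c
E^b e^l` with `a, b < p` and `c < 2p` span `LU p`, because commutators of `e, f, h` with the
restricted part stay in the restricted part. Their images are independent
(`SpecialFiber.linearIndependent_monomial`): quantum sl(2) acts by left multiplication on formal
sums of `F^(a) 1_n E^(b)`, where `1_n` is the idempotent of weight `n`; the divided-power form acts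
with coefficients regular at `q`; and each monomial has a leading coefficient which, as a function
of `n`, specializes to a nowhere zero function times `hValue^j q^(cn)`. The functions `q^(cn)` are
periodic in `n`, while `hValue` takes infinitely many values on each residue class, so different `j`
and `c` are independent. The same monomials with `i = j = l = 0` show that the restricted quantum
group embeds.

Hopf structure. The functions regular at `q` form a valuation ring, over which torsion-free modules
are flat. So the tensor powers of the form embed in those of the generic algebra, and the generic
structure restricts to the form as soon as it does so on generators; the quantum binomial theorem
provides this for `e` and `f`. Being linear, the structure descends modulo `v - q`.

Quotient. The left ideal generated by the augmentation ideal of the restricted part is two-sided,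
because commutators with `e, f, h` stay in the restricted part and the counit of a commutator is
zero. The map to `U(sl(2))` with `E, F ↦ 0` and `K ↦ 1` factors through the quotient; its inverse
comes from the universal property of `U(sl(2))`. -/

noncomputable section

namespace LusztigLimit

/-! ### Construction and transport of Hopf structures -/

section Generators
variable {R A : Type*} [CommRing R] [Ring A] [Algebra R A]

/-- An antihomomorphism turns `t * (y ⊗ z)` into `S y`, the contribution of `t`, and `z`, in this
order. If the middle factor is a scalar it can be pulled out. The antipode axiom is therefore
multiplicative and need only be tested on generators. -/
lemma mul_rTensor_antihom (S : A →ₐ[R] Aᵐᵒᵖ) (t u : A ⊗[R] A) (c : R)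
    (ht : LinearMap.mul' R A (((MulOpposite.opLinearEquiv R).symm.toLinearMap ∘ₗ
      S.toLinearMap).rTensor A t) = algebraMap R A c) :
    LinearMap.mul' R A (((MulOpposite.opLinearEquiv R).symm.toLinearMap ∘ₗ
      S.toLinearMap).rTensor A (t * u)) = c • LinearMap.mul' R A
        (((MulOpposite.opLinearEquiv R).symm.toLinearMap ∘ₗ S.toLinearMap).rTensor A u) := by
  induction u using TensorProduct.induction_on with
  | zero => simp
  | add u v hu hv => rw [mul_add, map_add, map_add, hu, hv, map_add, map_add, smul_add]
  | tmul y z =>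
    have key : ∀ t : A ⊗[R] A, LinearMap.mul' R A
        (((MulOpposite.opLinearEquiv R).symm.toLinearMap ∘ₗ S.toLinearMap).rTensor A
          (t * y ⊗ₜ z)) = (S y).unop * LinearMap.mul' R A
        (((MulOpposite.opLinearEquiv R).symm.toLinearMap ∘ₗ S.toLinearMap).rTensor A t) * z := by
      intro t
      induction t using TensorProduct.induction_on with
      | zero => simp
      | add u v hu hv => rw [add_mul, map_add, map_add, hu, hv, map_add, map_add, mul_add, add_mul]
      | tmul a b => simp [mul_assoc]
    rw [key, ht, ← Algebra.commutes, mul_assoc, Algebra.algebraMap_eq_smul_one, smul_mul_assoc,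
      one_mul]
    simp

lemma mul_lTensor_antihom (S : A →ₐ[R] Aᵐᵒᵖ) (t u : A ⊗[R] A) (c : R)
    (hu : LinearMap.mul' R A (((MulOpposite.opLinearEquiv R).symm.toLinearMap ∘ₗ
      S.toLinearMap).lTensor A u) = algebraMap R A c) :
    LinearMap.mul' R A (((MulOpposite.opLinearEquiv R).symm.toLinearMap ∘ₗ
      S.toLinearMap).lTensor A (t * u)) = c • LinearMap.mul' R A
        (((MulOpposite.opLinearEquiv R).symm.toLinearMap ∘ₗ S.toLinearMap).lTensor A t) := by
  induction t using TensorProduct.induction_on with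
  | zero => simp
  | add t v ht hv => rw [add_mul, map_add, map_add, ht, hv, map_add, map_add, smul_add]
  | tmul y z =>
    have key : ∀ u : A ⊗[R] A, LinearMap.mul' R A
        (((MulOpposite.opLinearEquiv R).symm.toLinearMap ∘ₗ S.toLinearMap).lTensor A
          (y ⊗ₜ z * u)) = y * LinearMap.mul' R A
        (((MulOpposite.opLinearEquiv R).symm.toLinearMap ∘ₗ S.toLinearMap).lTensor A u) *
          (S z).unop := by
      intro t
      induction t using TensorProduct.induction_on with
      | zero => simp
      | add u v hu hv => rw [mul_add, map_add, map_add, hu, hv, map_add, map_add, mul_add, add_mul]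
      | tmul a b => simp [mul_assoc]
    rw [key, hu, ← Algebra.commutes, mul_assoc, Algebra.algebraMap_eq_smul_one, smul_mul_assoc,
      one_mul]
    simp

/-- A Hopf structure from algebra maps `Δ`, `ε` and an anti-endomorphism `S` that satisfy the
axioms on a set of generators. -/
def HopfStructure.ofGenerators (s : Set A) (hs : Algebra.adjoin R s = ⊤)
    (Δ : A →ₐ[R] A ⊗[R] A) (ε : A →ₐ[R] R) (S : A →ₐ[R] Aᵐᵒᵖ)
    (coassoc : ∀ x ∈ s, Algebra.TensorProduct.assoc R R R A A A
      (Algebra.TensorProduct.map Δ (.id R A) (Δ x)) =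
        Algebra.TensorProduct.map (.id R A) Δ (Δ x))
    (counit_left : ∀ x ∈ s, Algebra.TensorProduct.map ε (.id R A) (Δ x) = 1 ⊗ₜ x)
    (counit_right : ∀ x ∈ s, Algebra.TensorProduct.map (.id R A) ε (Δ x) = x ⊗ₜ 1)
    (antipode_left : ∀ x ∈ s, LinearMap.mul' R A (((MulOpposite.opLinearEquiv R).symm.toLinearMap ∘ₗ
      S.toLinearMap).rTensor A (Δ x)) = algebraMap R A (ε x))
    (antipode_right : ∀ x ∈ s, LinearMap.mul' R A (((MulOpposite.opLinearEquiv R).symm.toLinearMap ∘ₗ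
      S.toLinearMap).lTensor A (Δ x)) = algebraMap R A (ε x)) :
    HopfStructure R A where
  comul := Δ
  counit := ε
  antipode := (MulOpposite.opLinearEquiv R).symm.toLinearMap ∘ₗ S.toLinearMap
  coassoc := AlgHom.ext_of_adjoin_eq_top hs coassoc
  rTensor_counit := AlgHom.ext_of_adjoin_eq_top hs counit_left
  lTensor_counit := AlgHom.ext_of_adjoin_eq_top hs counit_right
  antipode_left := by
    ext x
    have hx : x ∈ Algebra.adjoin R s := hs ▸ Algebra.mem_top
    induction hx using Algebra.adjoin_induction with
    | mem x hx => exact antipode_left x hx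
    | algebraMap r => simp [Algebra.TensorProduct.algebraMap_apply]
    | add x y _ _ hx hy => rw [map_add, hx, hy, map_add]
    | mul x y _ _ hx hy =>
      simp only [LinearMap.comp_apply, AlgHom.toLinearMap_apply, map_mul,
        Algebra.linearMap_apply] at hx hy ⊢
      rw [mul_rTensor_antihom S _ _ _ hx, hy, Algebra.smul_def]
  antipode_right := by
    ext x
    have hx : x ∈ Algebra.adjoin R s := hs ▸ Algebra.mem_top
    induction hx using Algebra.adjoin_induction with
    | mem x hx => exact antipode_right x hx
    | algebraMap r => simp [Algebra.TensorProduct.algebraMap_apply]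
    | add x y _ _ hx hy => rw [map_add, hx, hy, map_add]
    | mul x y _ _ hx hy =>
      simp only [LinearMap.comp_apply, AlgHom.toLinearMap_apply, map_mul,
        Algebra.linearMap_apply] at hx hy ⊢
      rw [mul_lTensor_antihom S _ _ _ hy, hx, Algebra.smul_def, ← map_mul, mul_comm, map_mul]

lemma HopfStructure.antipode_mul (H : HopfStructure R A) (x y : A) :
    H.antipode (x * y) = H.antipode y * H.antipode x :=
  letI := H.toHopfAlgebra
  HopfAlgebra.antipode_mul_antidistrib (R := R) x y

lemma HopfStructure.antipode_one (H : HopfStructure R A) : H.antipode 1 = 1 :=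
  letI := H.toHopfAlgebra
  HopfAlgebra.antipode_one (R := R)

lemma HopfStructure.antipode_pow (H : HopfStructure R A) (x : A) (n : ℕ) :
    H.antipode (x ^ n) = H.antipode x ^ n := by
  induction n with
  | zero => simp [H.antipode_one]
  | succ n ih => rw [pow_succ, H.antipode_mul, ih, ← pow_succ']

lemma HopfStructure.lid_counit (H : HopfStructure R A) (x : A) :
    Algebra.TensorProduct.lid R A (Algebra.TensorProduct.map H.counit (.id R A) (H.comul x)) = x := by
  have := DFunLike.congr_fun H.rTensor_counit x
  simp only [AlgHom.comp_apply] at this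
  rw [this]; exact (Algebra.TensorProduct.lid R A).apply_symm_apply x

lemma HopfStructure.rid_counit (H : HopfStructure R A) (x : A) :
    Algebra.TensorProduct.rid R R A (Algebra.TensorProduct.map (.id R A) H.counit (H.comul x)) = x := by
  have := DFunLike.congr_fun H.lTensor_counit x
  simp only [AlgHom.comp_apply] at this
  rw [this]; exact (Algebra.TensorProduct.rid R R A).apply_symm_apply x

end Generators

section Semilinear
variable {R k A A' A'' B B' B'' : Type*} [CommRing R] [CommRing k] [Algebra R k]
  [Ring A] [Algebra R A] [Ring A'] [Algebra R A'] [Ring A''] [Algebra R A'']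
  [Ring B] [Algebra R B] [Algebra k B] [IsScalarTower R k B]
  [Ring B'] [Algebra R B'] [Algebra k B'] [IsScalarTower R k B']
  [Ring B''] [Algebra R B''] [Algebra k B''] [IsScalarTower R k B'']

variable (k) in
/-- The map of tensor products induced by two algebra maps that extend scalars from `R` to `k`. -/
def tensorMap (φ : A →ₐ[R] B) (ψ : A' →ₐ[R] B') : A ⊗[R] A' →ₐ[R] B ⊗[k] B' :=
  Algebra.TensorProduct.lift
    ((Algebra.TensorProduct.includeLeft (R := k) (S := R) (A := B) (B := B')).comp φ)
    (((Algebra.TensorProduct.includeRight (R := k) (A := B) (B := B')).restrictScalars R).comp ψ)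
    (fun x y => (Commute.one_right (φ x)).tmul (Commute.one_left (ψ y)))

@[simp] lemma tensorMap_tmul (φ : A →ₐ[R] B) (ψ : A' →ₐ[R] B') (x : A) (y : A') :
    tensorMap k φ ψ (x ⊗ₜ y) = φ x ⊗ₜ ψ y := by
  change (φ x ⊗ₜ[k] (1 : B')) * ((1 : B) ⊗ₜ[k] ψ y) = _
  rw [Algebra.TensorProduct.tmul_mul_tmul, mul_one, one_mul]

lemma tensorMap_smul_tmul (φ : A →ₐ[R] B) (ψ : A' →ₐ[R] B') (c : R) (x : A) (y : A') :
    tensorMap k φ ψ (c • (x ⊗ₜ y)) = algebraMap R k c • (φ x ⊗ₜ ψ y) := by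
  rw [map_smul, tensorMap_tmul, algebraMap_smul]

lemma tensorMap_add (φ : A →ₐ[R] B) (ψ : A' →ₐ[R] B') (s t : A ⊗[R] A') :
    tensorMap k φ ψ (s + t) = tensorMap k φ ψ s + tensorMap k φ ψ t := map_add _ _ _

lemma tensorMap_sum {ι : Type*} (φ : A →ₐ[R] B) (ψ : A' →ₐ[R] B') (s : Finset ι)
    (t : ι → A ⊗[R] A') :
    tensorMap k φ ψ (∑ i ∈ s, t i) = ∑ i ∈ s, tensorMap k φ ψ (t i) := map_sum _ _ _

/-- The image of `c [s, t]` under `tensorMap`. -/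
lemma tensorMap_smul_commutator (φ : A →ₐ[R] B) (ψ : A' →ₐ[R] B') (c : R) (s t : A ⊗[R] A') :
    tensorMap k φ ψ (c • (s * t - t * s)) = algebraMap R k c •
      (tensorMap k φ ψ s * tensorMap k φ ψ t - tensorMap k φ ψ t * tensorMap k φ ψ s) := by
  rw [map_smul, map_sub, map_mul, map_mul, algebraMap_smul]

/-- A homomorphism of Hopf algebras that extends scalars from `R` to `k`. -/
structure HopfStructure.IsSemiHom (HA : HopfStructure R A) (HB : HopfStructure k B)
    (φ : A →ₐ[R] B) : Prop where
  comul : ∀ x, HB.comul (φ x) = tensorMap k φ φ (HA.comul x)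
  counit : ∀ x, HB.counit (φ x) = algebraMap R k (HA.counit x)
  antipode : ∀ x, HB.antipode (φ x) = φ (HA.antipode x)

variable (Δ : A →ₐ[R] A ⊗[R] A) (ε : A →ₐ[R] R) (S : A →ₗ[R] A)
  (Δ' : B →ₐ[k] B ⊗[k] B) (ε' : B →ₐ[k] k) (S' : B →ₗ[k] B) (φ : A →ₐ[R] B)

lemma tensorMap_assoc (φ : A →ₐ[R] B) (ψ : A' →ₐ[R] B') (χ : A'' →ₐ[R] B'')
    (t : (A ⊗[R] A') ⊗[R] A'') :
    tensorMap k φ (tensorMap k ψ χ) (Algebra.TensorProduct.assoc R R R A A' A'' t) =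
      Algebra.TensorProduct.assoc k k k B B' B'' (tensorMap k (tensorMap k φ ψ) χ t) := by
  induction t using TensorProduct.induction_on with
  | zero => simp
  | add x y hx hy => simp only [map_add, hx, hy]
  | tmul x z =>
    induction x using TensorProduct.induction_on with
    | zero => simp
    | add x y hx hy => simp only [map_add, hx, hy, TensorProduct.add_tmul]
    | tmul x y => simp

lemma tensorMap_map_left (h : ∀ x, Δ' (φ x) = tensorMap k φ φ (Δ x)) (t : A ⊗[R] A) :
    tensorMap k (tensorMap k φ φ) φ (Algebra.TensorProduct.map Δ (.id R A) t) =
      Algebra.TensorProduct.map Δ' (.id k B) (tensorMap k φ φ t) := by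
  induction t using TensorProduct.induction_on with
  | zero => simp
  | add x y hx hy => simp only [map_add, hx, hy]
  | tmul x y => simp [h]

lemma tensorMap_map_right (h : ∀ x, Δ' (φ x) = tensorMap k φ φ (Δ x)) (t : A ⊗[R] A) :
    tensorMap k φ (tensorMap k φ φ) (Algebra.TensorProduct.map (.id R A) Δ t) =
      Algebra.TensorProduct.map (.id k B) Δ' (tensorMap k φ φ t) := by
  induction t using TensorProduct.induction_on with
  | zero => simp
  | add x y hx hy => simp only [map_add, hx, hy]
  | tmul x y => simp [h]

lemma map_lid_counit (h : ∀ x, ε' (φ x) = algebraMap R k (ε x)) (t : A ⊗[R] A) :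
    φ (Algebra.TensorProduct.lid R A (Algebra.TensorProduct.map ε (.id R A) t)) =
      Algebra.TensorProduct.lid k B (Algebra.TensorProduct.map ε' (.id k B)
        (tensorMap k φ φ t)) := by
  induction t using TensorProduct.induction_on with
  | zero => simp
  | add x y hx hy => simp only [map_add, hx, hy]
  | tmul x y => simp [h]

lemma map_rid_counit (h : ∀ x, ε' (φ x) = algebraMap R k (ε x)) (t : A ⊗[R] A) :
    φ (Algebra.TensorProduct.rid R R A (Algebra.TensorProduct.map (.id R A) ε t)) =
      Algebra.TensorProduct.rid k k B (Algebra.TensorProduct.map (.id k B) ε'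
        (tensorMap k φ φ t)) := by
  induction t using TensorProduct.induction_on with
  | zero => simp
  | add x y hx hy => simp only [map_add, hx, hy]
  | tmul x y => simp [h]

lemma map_mul_rTensor (h : ∀ x, S' (φ x) = φ (S x)) (t : A ⊗[R] A) :
    φ (LinearMap.mul' R A (S.rTensor A t)) =
      LinearMap.mul' k B (S'.rTensor B (tensorMap k φ φ t)) := by
  induction t using TensorProduct.induction_on with
  | zero => simp
  | add x y hx hy => simp only [map_add, hx, hy]
  | tmul x y => simp [h]

lemma map_mul_lTensor (h : ∀ x, S' (φ x) = φ (S x)) (t : A ⊗[R] A) :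
    φ (LinearMap.mul' R A (S.lTensor A t)) =
      LinearMap.mul' k B (S'.lTensor B (tensorMap k φ φ t)) := by
  induction t using TensorProduct.induction_on with
  | zero => simp
  | add x y hx hy => simp only [map_add, hx, hy]
  | tmul x y => simp [h]

/-- A Hopf structure restricts along an injective map whose image is stable. -/
theorem HopfStructure.exists_restrict (HB : HopfStructure k B) (hφ : Function.Injective φ)
    (hk : Function.Injective (algebraMap R k))
    (h2 : Function.Injective (tensorMap k φ φ))
    (h3 : Function.Injective (tensorMap k φ (tensorMap k φ φ)))
    (s : Set A) (hs : Algebra.adjoin R s = ⊤)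
    (hΔ : ∀ x ∈ s, ∃ t, tensorMap k φ φ t = HB.comul (φ x))
    (hε : ∀ x ∈ s, ∃ c, algebraMap R k c = HB.counit (φ x))
    (hS : ∀ x ∈ s, ∃ y, φ y = HB.antipode (φ x)) :
    ∃ HA : HopfStructure R A, HA.IsSemiHom HB φ := by
  -- The elements whose comultiplication lands in the image form a subalgebra, so the generators
  -- decide.
  have hΔ' : ∀ x, ((HB.comul.restrictScalars R).comp φ) x ∈ (tensorMap k φ φ).range := by
    intro x
    have hx : x ∈ Algebra.adjoin R s := hs ▸ Algebra.mem_top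
    have : Algebra.adjoin R s ≤
        (tensorMap k φ φ).range.comap ((HB.comul.restrictScalars R).comp φ) :=
      Algebra.adjoin_le fun x hx => hΔ x hx
    exact this hx
  have hε' : ∀ x, ((HB.counit.restrictScalars R).comp φ) x ∈ (Algebra.ofId R k).range := by
    intro x
    have hx : x ∈ Algebra.adjoin R s := hs ▸ Algebra.mem_top
    have : Algebra.adjoin R s ≤
        (Algebra.ofId R k).range.comap ((HB.counit.restrictScalars R).comp φ) :=
      Algebra.adjoin_le fun x hx => hε x hx
    exact this hx
  have hS' : ∀ x, ∃ y, φ y = HB.antipode (φ x) := by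
    intro x
    have hx : x ∈ Algebra.adjoin R s := hs ▸ Algebra.mem_top
    induction hx using Algebra.adjoin_induction with
    | mem x hx => exact hS x hx
    | algebraMap r =>
      refine ⟨algebraMap R A r, ?_⟩
      rw [AlgHom.commutes, IsScalarTower.algebraMap_apply R k B, Algebra.algebraMap_eq_smul_one,
        map_smul, HB.antipode_one]
    | add x y _ _ hx hy =>
      obtain ⟨a, ha⟩ := hx
      obtain ⟨b, hb⟩ := hy
      exact ⟨a + b, by simp [ha, hb]⟩
    | mul x y _ _ hx hy =>
      obtain ⟨a, ha⟩ := hx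
      obtain ⟨b, hb⟩ := hy
      exact ⟨b * a, by simp [ha, hb, HB.antipode_mul]⟩
  choose S hS'' using hS'
  let Δ : A →ₐ[R] A ⊗[R] A := ((AlgEquiv.ofInjective _ h2).symm : _ →ₐ[R] _).comp
    (((HB.comul.restrictScalars R).comp φ).codRestrict _ hΔ')
  have hk' : Function.Injective (Algebra.ofId R k) := hk
  let ε : A →ₐ[R] R := ((AlgEquiv.ofInjective _ hk').symm : _ →ₐ[R] _).comp
    (((HB.counit.restrictScalars R).comp φ).codRestrict _ hε')
  let S₁ : A →ₗ[R] A :=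
    { toFun := S
      map_add' := fun x y => hφ (by simp [hS''])
      map_smul' := fun c x => hφ (by
        rw [hS'', map_smul, ← algebraMap_smul k c (φ x), map_smul, RingHom.id_apply, map_smul,
          hS'', algebraMap_smul]) }
  have hΔ₁ : ∀ x, HB.comul (φ x) = tensorMap k φ φ (Δ x) := by
    intro x
    have := AlgEquiv.apply_symm_apply (AlgEquiv.ofInjective _ h2)
      (((HB.comul.restrictScalars R).comp φ).codRestrict _ hΔ' x)
    exact (congrArg Subtype.val this).symm
  have hε₁ : ∀ x, HB.counit (φ x) = algebraMap R k (ε x) := by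
    intro x
    have := AlgEquiv.apply_symm_apply (AlgEquiv.ofInjective _ hk')
      (((HB.counit.restrictScalars R).comp φ).codRestrict _ hε' x)
    exact (congrArg Subtype.val this).symm
  have hS₁ : ∀ x, HB.antipode (φ x) = φ (S₁ x) := fun x => (hS'' x).symm
  -- Each axiom is inherited from `B` after an injective map: into the tensor cube for
  -- coassociativity, into `B` itself for the others.
  refine ⟨⟨Δ, ε, S₁, ?_, ?_, ?_, ?_, ?_⟩, hΔ₁, hε₁, hS₁⟩
  · ext x
    apply h3
    have := DFunLike.congr_fun HB.coassoc (φ x)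
    simp only [AlgHom.comp_apply] at this ⊢
    rw [tensorMap_map_right Δ HB.comul φ hΔ₁, ← hΔ₁, ← this]
    refine (tensorMap_assoc φ φ φ _).trans ?_
    rw [tensorMap_map_left Δ HB.comul φ hΔ₁, ← hΔ₁]
    rfl
  · ext x
    refine (AlgEquiv.eq_symm_apply (Algebra.TensorProduct.lid R A)).2 ?_
    simp only [AlgHom.comp_apply]
    apply hφ
    rw [map_lid_counit ε HB.counit φ hε₁, ← hΔ₁, HB.lid_counit]
  · ext x
    refine (AlgEquiv.eq_symm_apply (Algebra.TensorProduct.rid R R A)).2 ?_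
    simp only [AlgHom.comp_apply]
    apply hφ
    rw [map_rid_counit ε HB.counit φ hε₁, ← hΔ₁, HB.rid_counit]
  · ext x
    apply hφ
    have := DFunLike.congr_fun HB.antipode_left (φ x)
    simp only [LinearMap.comp_apply, AlgHom.toLinearMap_apply, Algebra.linearMap_apply] at this ⊢
    rw [map_mul_rTensor S₁ HB.antipode φ hS₁, ← hΔ₁, this, AlgHom.commutes, hε₁,
      ← IsScalarTower.algebraMap_apply]
  · ext x
    apply hφ
    have := DFunLike.congr_fun HB.antipode_right (φ x)
    simp only [LinearMap.comp_apply, AlgHom.toLinearMap_apply, Algebra.linearMap_apply] at this ⊢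
    rw [map_mul_lTensor S₁ HB.antipode φ hS₁, ← hΔ₁, this, AlgHom.commutes, hε₁,
      ← IsScalarTower.algebraMap_apply]

/-- A Hopf structure descends along a surjective map whose kernel is a Hopf ideal. -/
theorem HopfStructure.exists_descend (HA : HopfStructure R A) (hφ : Function.Surjective φ)
    (hk : Function.Surjective (algebraMap R k))
    (hΔ : ∀ x, φ x = 0 → tensorMap k φ φ (HA.comul x) = 0)
    (hε : ∀ x, φ x = 0 → algebraMap R k (HA.counit x) = 0)
    (hS : ∀ x, φ x = 0 → φ (HA.antipode x) = 0) :
    ∃ HB : HopfStructure k B, HA.IsSemiHom HB φ := by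
  let g : B → A := Function.surjInv hφ
  have hg : Function.RightInverse g φ := Function.rightInverse_surjInv hφ
  let Δr : B →+* B ⊗[k] B := (φ : A →+* B).liftOfRightInverse g hg
    ⟨((tensorMap k φ φ).comp HA.comul : A →+* B ⊗[k] B), fun x hx => hΔ x hx⟩
  have hΔr : ∀ x, Δr (φ x) = tensorMap k φ φ (HA.comul x) := fun x =>
    (φ : A →+* B).liftOfRightInverse_comp_apply g hg _ x
  let εr : B →+* k := (φ : A →+* B).liftOfRightInverse g hg
    ⟨((Algebra.ofId R k).comp HA.counit : A →+* k), fun x hx => hε x hx⟩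
  have hεr : ∀ x, εr (φ x) = algebraMap R k (HA.counit x) := fun x =>
    (φ : A →+* B).liftOfRightInverse_comp_apply g hg _ x
  let Δ : B →ₐ[k] B ⊗[k] B := { Δr with
    commutes' := fun c => by
      obtain ⟨r, rfl⟩ := hk c
      have : algebraMap k B (algebraMap R k r) = φ (algebraMap R A r) := by
        rw [AlgHom.commutes, ← IsScalarTower.algebraMap_apply]
      change Δr _ = _
      rw [this, hΔr, AlgHom.commutes, AlgHom.commutes,
        ← IsScalarTower.algebraMap_apply R k (B ⊗[k] B)] }
  let ε : B →ₐ[k] k := { εr with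
    commutes' := fun c => by
      obtain ⟨r, rfl⟩ := hk c
      have : algebraMap k B (algebraMap R k r) = φ (algebraMap R A r) := by
        rw [AlgHom.commutes, ← IsScalarTower.algebraMap_apply]
      change εr _ = _
      rw [this, hεr, AlgHom.commutes]; rfl }
  -- The antipode is not a ring homomorphism, so it is carried over through the set-theoretic
  -- section `g`; stability of the kernel makes the result independent of the section.
  have hSg : ∀ x y, φ x = φ y → φ (HA.antipode x) = φ (HA.antipode y) := by
    intro x y hxy
    rw [← sub_eq_zero, ← map_sub, ← map_sub]
    exact hS _ (by rw [map_sub, hxy, sub_self])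
  let S : B →ₗ[k] B :=
    { toFun := fun b => φ (HA.antipode (g b))
      map_add' := fun x y => by
        rw [← map_add, ← map_add]
        exact hSg _ _ (by rw [map_add, hg, hg, hg])
      map_smul' := fun c x => by
        obtain ⟨r, rfl⟩ := hk c
        rw [RingHom.id_apply, algebraMap_smul, algebraMap_smul, ← map_smul, ← map_smul]
        exact hSg _ _ (by rw [map_smul, hg, hg]) }
  have hSφ : ∀ x, S (φ x) = φ (HA.antipode x) := fun x => hSg _ _ (hg _)
  have hΔφ : ∀ x, Δ (φ x) = tensorMap k φ φ (HA.comul x) := hΔr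
  have hεφ : ∀ x, ε (φ x) = algebraMap R k (HA.counit x) := hεr
  refine ⟨⟨Δ, ε, S, ?_, ?_, ?_, ?_, ?_⟩, hΔφ, hεφ, hSφ⟩
  · ext b
    obtain ⟨x, rfl⟩ := hφ b
    have := DFunLike.congr_fun HA.coassoc x
    simp only [AlgHom.comp_apply] at this ⊢
    rw [hΔφ, ← tensorMap_map_right HA.comul Δ φ hΔφ, ← this,
      ← tensorMap_map_left HA.comul Δ φ hΔφ]
    exact (tensorMap_assoc φ φ φ _).symm
  · ext b
    obtain ⟨x, rfl⟩ := hφ b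
    refine (AlgEquiv.eq_symm_apply (Algebra.TensorProduct.lid k B)).2 ?_
    simp only [AlgHom.comp_apply]
    rw [hΔφ, ← map_lid_counit HA.counit ε φ hεφ, HA.lid_counit]
  · ext b
    obtain ⟨x, rfl⟩ := hφ b
    refine (AlgEquiv.eq_symm_apply (Algebra.TensorProduct.rid k k B)).2 ?_
    simp only [AlgHom.comp_apply]
    rw [hΔφ, ← map_rid_counit HA.counit ε φ hεφ, HA.rid_counit]
  · ext b
    obtain ⟨x, rfl⟩ := hφ b
    have := DFunLike.congr_fun HA.antipode_left x
    simp only [LinearMap.comp_apply, AlgHom.toLinearMap_apply, Algebra.linearMap_apply] at this ⊢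
    rw [hΔφ, ← map_mul_rTensor HA.antipode S φ hSφ, this, AlgHom.commutes, hεφ,
      ← IsScalarTower.algebraMap_apply]
  · ext b
    obtain ⟨x, rfl⟩ := hφ b
    have := DFunLike.congr_fun HA.antipode_right x
    simp only [LinearMap.comp_apply, AlgHom.toLinearMap_apply, Algebra.linearMap_apply] at this ⊢
    rw [hΔφ, ← map_mul_lTensor HA.antipode S φ hSφ, this, AlgHom.commutes, hεφ,
      ← IsScalarTower.algebraMap_apply]

end Semilinear

section Flat
variable {R k A A' B B' : Type*} [CommRing R] [IsDomain R] [IsBezout R] [Field k] [Algebra R k]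
  [IsFractionRing R k]
  [Ring A] [Algebra R A] [Ring A'] [Algebra R A']
  [Ring B] [Algebra R B] [Algebra k B] [IsScalarTower R k B]
  [Ring B'] [Algebra R B'] [Algebra k B'] [IsScalarTower R k B']

omit [IsDomain R] [IsBezout R] in
variable (R k B) in
include k in
lemma flat_of_fractionRing : Module.Flat R B := by
  have : Module.Flat R k := IsLocalization.flat k (nonZeroDivisors R)
  exact Module.Flat.trans R k B

include k in
variable (k) in
-- Over a Bezout domain flatness means absence of torsion. Torsion of `A` would give torsion of `B`,
-- which is flat, being a vector space over the fraction field.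
lemma flat_of_injective (φ : A →ₐ[R] B) (hφ : Function.Injective φ) : Module.Flat R A := by
  rw [Module.Flat.flat_iff_torsion_eq_bot_of_isBezout]
  have h := (Module.Flat.flat_iff_torsion_eq_bot_of_isBezout (R := R) (M := B)).1
    (flat_of_fractionRing R k B)
  rw [eq_bot_iff] at h ⊢
  rintro x ⟨a, ha⟩
  have : φ x ∈ Submodule.torsion R B := ⟨a, by
    rw [Submonoid.smul_def] at ha ⊢
    rw [← map_smul, ha, map_zero]⟩
  have := h this
  rw [Submodule.mem_bot] at this ⊢
  exact hφ (by rw [this, map_zero])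

/-- By flatness `A ⊗ A'` embeds in `B ⊗ B'` over `R`, and for vector spaces over the fraction field
the tensor products over `R` and over `k` agree. -/
lemma tensorMap_injective (φ : A →ₐ[R] B) (ψ : A' →ₐ[R] B') (hφ : Function.Injective φ)
    (hψ : Function.Injective ψ) : Function.Injective (tensorMap k φ ψ) := by
  have := flat_of_injective k ψ hψ
  have := flat_of_fractionRing R k B
  have h1 : Function.Injective (TensorProduct.map φ.toLinearMap ψ.toLinearMap) := by
    rw [← LinearMap.lTensor_comp_rTensor, LinearMap.coe_comp]
    exact (Module.Flat.lTensor_preserves_injective_linearMap _ hψ).comp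
      (Module.Flat.rTensor_preserves_injective_linearMap _ hφ)
  have h2 : ∀ t, tensorMap k φ ψ t = (IsLocalization.moduleTensorEquiv (nonZeroDivisors R) k B B').symm
      (TensorProduct.map φ.toLinearMap ψ.toLinearMap t) := by
    intro t
    rw [LinearEquiv.eq_symm_apply]
    induction t using TensorProduct.induction_on with
    | zero => simp
    | add x y hx hy => simp only [map_add, hx, hy]
    | tmul x y => simp; rfl
  intro x y hxy
  rw [h2, h2] at hxy
  exact h1 ((LinearEquiv.injective _) hxy)

end Flat

/-! ### Specialization of rational functions -/

/-- `x` is regular at `a` and takes the value `c` there. -/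
def Specializes (a : ℂ) (x : RatFunc ℂ) (c : ℂ) : Prop :=
  ∃ n d : Polynomial ℂ, d.eval a ≠ 0 ∧
    x = algebraMap (Polynomial ℂ) (RatFunc ℂ) n / algebraMap (Polynomial ℂ) (RatFunc ℂ) d ∧
    c = n.eval a / d.eval a

lemma algebraMap_ratFunc_ne_zero {a : ℂ} {d : Polynomial ℂ} (hd : d.eval a ≠ 0) :
    algebraMap (Polynomial ℂ) (RatFunc ℂ) d ≠ 0 := by
  intro h
  rw [map_eq_zero_iff _ (RatFunc.algebraMap_injective ℂ)] at h
  exact hd (by rw [h, Polynomial.eval_zero])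

namespace Specializes
variable {a : ℂ} {x y : RatFunc ℂ} {c d : ℂ}

lemma mem (h : Specializes a x c) : x ∈ regularAt a := by
  obtain ⟨n, d, hd, hx, -⟩ := h
  exact ⟨n, d, hd, hx⟩

lemma add (hx : Specializes a x c) (hy : Specializes a y d) : Specializes a (x + y) (c + d) := by
  obtain ⟨n, e, he, rfl, rfl⟩ := hx
  obtain ⟨n', e', he', rfl, rfl⟩ := hy
  refine ⟨n * e' + e * n', e * e', by simp [he, he'], ?_, ?_⟩
  · rw [div_add_div _ _ (algebraMap_ratFunc_ne_zero he) (algebraMap_ratFunc_ne_zero he')]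
    simp
  · rw [div_add_div _ _ he he']
    simp

lemma mul (hx : Specializes a x c) (hy : Specializes a y d) : Specializes a (x * y) (c * d) := by
  obtain ⟨n, e, he, rfl, rfl⟩ := hx
  obtain ⟨n', e', he', rfl, rfl⟩ := hy
  refine ⟨n * n', e * e', by simp [he, he'], ?_, ?_⟩
  · rw [div_mul_div_comm]; simp
  · rw [div_mul_div_comm]; simp

lemma ofPolynomial (P : Polynomial ℂ) :
    Specializes a (algebraMap (Polynomial ℂ) (RatFunc ℂ) P) (P.eval a) :=
  ⟨P, 1, by simp, by simp, by simp⟩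

lemma C (c : ℂ) : Specializes a (RatFunc.C c) c :=
  ⟨Polynomial.C c, 1, by simp, by simp, by simp⟩

lemma X : Specializes a RatFunc.X a := ⟨Polynomial.X, 1, by simp, by simp, by simp⟩

lemma one : Specializes a 1 1 := ⟨1, 1, by simp, by simp, by simp⟩

lemma zero : Specializes a 0 0 := ⟨0, 1, by simp, by simp, by simp⟩

lemma natCast (n : ℕ) : Specializes a n n := by
  simpa using C (a := a) (n : ℂ)

lemma neg (hx : Specializes a x c) : Specializes a (-x) (-c) := by
  simpa using (C (-1)).mul hx

lemma sub (hx : Specializes a x c) (hy : Specializes a y d) : Specializes a (x - y) (c - d) := by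
  simpa [sub_eq_add_neg] using hx.add hy.neg

lemma inv (hx : Specializes a x c) (hc : c ≠ 0) : Specializes a x⁻¹ c⁻¹ := by
  obtain ⟨n, e, he, rfl, rfl⟩ := hx
  exact ⟨e, n, (div_ne_zero_iff.1 hc).1, by rw [inv_div], by rw [inv_div]⟩

lemma div (hx : Specializes a x c) (hy : Specializes a y d) (hd : d ≠ 0) :
    Specializes a (x / y) (c / d) := by
  simpa [div_eq_mul_inv] using hx.mul (hy.inv hd)

lemma pow (hx : Specializes a x c) (n : ℕ) : Specializes a (x ^ n) (c ^ n) := by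
  induction n with
  | zero => simpa using one
  | succ n ih => simpa [pow_succ] using ih.mul hx

lemma zpow (hx : Specializes a x c) (hc : c ≠ 0) (n : ℤ) : Specializes a (x ^ n) (c ^ n) := by
  obtain ⟨n, rfl | rfl⟩ := n.eq_nat_or_neg
  · simpa using hx.pow n
  · simpa using (hx.pow n).inv (pow_ne_zero n hc)

lemma sum {ι : Type*} (s : Finset ι) {x : ι → RatFunc ℂ} {c : ι → ℂ}
    (h : ∀ i ∈ s, Specializes a (x i) (c i)) : Specializes a (∑ i ∈ s, x i) (∑ i ∈ s, c i) := by
  classical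
  induction s using Finset.induction_on with
  | empty => simpa using zero
  | insert i s hi ih =>
    rw [Finset.sum_insert hi, Finset.sum_insert hi]
    exact (h i (by simp)).add (ih fun j hj => h j (by simp [hj]))

lemma prod {ι : Type*} (s : Finset ι) {x : ι → RatFunc ℂ} {c : ι → ℂ}
    (h : ∀ i ∈ s, Specializes a (x i) (c i)) : Specializes a (∏ i ∈ s, x i) (∏ i ∈ s, c i) := by
  classical
  induction s using Finset.induction_on with
  | empty => simpa using one
  | insert i s hi ih =>
    rw [Finset.prod_insert hi, Finset.prod_insert hi]
    exact (h i (by simp)).mul (ih fun j hj => h j (by simp [hj]))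

lemma eval_eq (hx : Specializes a x c) : RatFunc.eval (RingHom.id ℂ) a x = c := by
  obtain ⟨n, d, hd, rfl, rfl⟩ := hx
  have hd0 := algebraMap_ratFunc_ne_zero hd
  set y := algebraMap (Polynomial ℂ) (RatFunc ℂ) n /
    algebraMap (Polynomial ℂ) (RatFunc ℂ) d with hy
  have h1 : y.denom.eval a ≠ 0 := by
    obtain ⟨e, he⟩ := RatFunc.denom_div_dvd n d
    intro h
    apply hd
    rw [he, Polynomial.eval_mul, ← hy, h, zero_mul]
  have h2 : y * algebraMap (Polynomial ℂ) (RatFunc ℂ) d =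
      algebraMap (Polynomial ℂ) (RatFunc ℂ) n := by
    rw [hy, div_mul_cancel₀ _ hd0]
  have h3 := congrArg (RatFunc.eval (RingHom.id ℂ) a) h2
  rw [RatFunc.eval_mul _ _ (by simpa [Polynomial.eval₂_id] using h1) (by simp)] at h3
  rw [RatFunc.eval_algebraMap, RatFunc.eval_algebraMap] at h3
  rw [eq_div_iff hd]
  simpa [Polynomial.eval₂_id] using h3

lemma unique (hx : Specializes a x c) (hy : Specializes a x d) : c = d :=
  hx.eval_eq.symm.trans hy.eval_eq

lemma exists_eq_mul (hx : Specializes a x 0) :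
    ∃ y ∈ regularAt a, x = (RatFunc.X - RatFunc.C a) * y := by
  obtain ⟨n, d, hd, rfl, h⟩ := hx
  have hn : n.IsRoot a := by
    have := (div_eq_zero_iff.1 h.symm).resolve_right hd
    exact this
  obtain ⟨m, rfl⟩ := Polynomial.dvd_iff_isRoot.2 hn
  refine ⟨_, ⟨m, d, hd, rfl⟩, ?_⟩
  rw [map_mul, mul_div_assoc]
  simp

/-- Derivatives enter the proof here. The lemma gives the leading coefficient of `[p]` at `q`, and
the factor by which `(K^(2p) - 1) / (v - q)` acts on `e` and `f` through commutators. -/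
lemma slope (P : Polynomial ℂ) : Specializes a
    ((algebraMap (Polynomial ℂ) (RatFunc ℂ) P - RatFunc.C (P.eval a)) /
      (RatFunc.X - RatFunc.C a)) (P.derivative.eval a) := by
  have hr : (P - Polynomial.C (P.eval a)).IsRoot a := by simp
  obtain ⟨m, hm⟩ := Polynomial.dvd_iff_isRoot.2 hr
  have hne : (RatFunc.X - RatFunc.C a : RatFunc ℂ) ≠ 0 := by
    have := (map_ne_zero_iff (algebraMap (Polynomial ℂ) (RatFunc ℂ))
      (RatFunc.algebraMap_injective ℂ)).2 (Polynomial.X_sub_C_ne_zero a)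
    simpa using this
  have h1 : (algebraMap (Polynomial ℂ) (RatFunc ℂ) P - RatFunc.C (P.eval a)) /
      (RatFunc.X - RatFunc.C a) = algebraMap (Polynomial ℂ) (RatFunc ℂ) m := by
    rw [div_eq_iff hne]
    have := congrArg (algebraMap (Polynomial ℂ) (RatFunc ℂ)) hm
    simp only [map_sub, map_mul, RatFunc.algebraMap_X, RatFunc.algebraMap_C] at this
    rw [this, mul_comm]
  rw [h1]
  have h2 := congrArg (fun Q => (Polynomial.derivative Q).eval a) hm
  simp only [Polynomial.derivative_sub, Polynomial.derivative_C, sub_zero,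
    Polynomial.derivative_mul, Polynomial.derivative_X, Polynomial.eval_add, Polynomial.eval_mul,
    Polynomial.eval_sub, Polynomial.eval_X, Polynomial.eval_C, one_mul,
    sub_self, zero_mul, add_zero] at h2
  rw [h2]
  exact ofPolynomial m

end Specializes

lemma exists_specializes {a : ℂ} {x : RatFunc ℂ} (hx : x ∈ regularAt a) :
    ∃ c, Specializes a x c := by
  obtain ⟨n, d, hd, rfl⟩ := hx
  exact ⟨_, n, d, hd, rfl, rfl⟩

lemma specializes_eval {a : ℂ} {x : RatFunc ℂ} (hx : x ∈ regularAt a) :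
    Specializes a x (RatFunc.eval (RingHom.id ℂ) a x) := by
  obtain ⟨c, hc⟩ := exists_specializes hx
  rwa [hc.eval_eq]

/-- The value at `a` of a function regular at `a`. -/
def evalAt (a : ℂ) : regularAt a →+* ℂ where
  toFun x := RatFunc.eval (RingHom.id ℂ) a (x : RatFunc ℂ)
  map_one' := Specializes.one.eval_eq
  map_zero' := Specializes.zero.eval_eq
  map_add' x y := ((specializes_eval x.2).add (specializes_eval y.2)).eval_eq
  map_mul' x y := ((specializes_eval x.2).mul (specializes_eval y.2)).eval_eq

instance (a : ℂ) : Algebra (regularAt a) ℂ := (evalAt a).toAlgebra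

lemma algebraMap_regularAt (a : ℂ) (x : regularAt a) :
    algebraMap (regularAt a) ℂ x = RatFunc.eval (RingHom.id ℂ) a (x : RatFunc ℂ) := rfl

lemma Specializes.algebraMap_eq {a : ℂ} {x : RatFunc ℂ} {c : ℂ} (h : Specializes a x c) :
    algebraMap (regularAt a) ℂ ⟨x, h.mem⟩ = c := h.eval_eq

lemma algebraMap_regularAt_surjective (a : ℂ) :
    Function.Surjective (algebraMap (regularAt a) ℂ) := fun c =>
  ⟨⟨RatFunc.C c, (Specializes.C c).mem⟩, (Specializes.C c).algebraMap_eq⟩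

instance (a : ℂ) : IsFractionRing (regularAt a) (RatFunc ℂ) := by
  refine IsFractionRing.of_field _ _ fun z => ?_
  refine ⟨⟨algebraMap (Polynomial ℂ) (RatFunc ℂ) z.num, (Specializes.ofPolynomial _).mem⟩,
    ⟨algebraMap (Polynomial ℂ) (RatFunc ℂ) z.denom, (Specializes.ofPolynomial _).mem⟩, ?_⟩
  exact (RatFunc.num_div_denom z).symm

/-- In lowest terms numerator and denominator do not both vanish at `a`, so the function or its
inverse is regular. Valuation rings are Bezout, which is what the flatness argument needs. -/
instance (a : ℂ) : ValuationRing (regularAt a) := by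
  rw [ValuationRing.iff_isInteger_or_isInteger (regularAt a) (RatFunc ℂ)]
  intro z
  by_cases h : z.denom.eval a = 0
  · right
    have h2 : z.num.eval a ≠ 0 := by
      intro h3
      obtain ⟨u, w, huw⟩ := RatFunc.isCoprime_num_denom z
      have := congrArg (Polynomial.eval a) huw
      simp [h, h3] at this
    refine ⟨⟨z⁻¹, z.denom, z.num, h2, ?_⟩, rfl⟩
    nth_rewrite 1 [← RatFunc.num_div_denom z]
    rw [inv_div]
  · left
    exact ⟨⟨z, z.num, z.denom, h, (RatFunc.num_div_denom z).symm⟩, rfl⟩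

/-! ### Quantum integers -/

/-- `[n]` for an integer `n`. -/
def qZ {k : Type*} [Field k] (v : k) (n : ℤ) : k := (v ^ n - v ^ (-n)) / (v - v⁻¹)

section qZ
variable {k : Type*} [Field k] (v : k)

lemma qZ_natCast (n : ℕ) : qZ v n = qInt v n := by
  simp [qZ, qInt]

@[simp] lemma qZ_zero : qZ v 0 = 0 := by simp [qZ]

lemma qZ_one (h : v - v⁻¹ ≠ 0) : qZ v 1 = 1 := by simp [qZ, h]

lemma qZ_neg (n : ℤ) : qZ v (-n) = -qZ v n := by
  simp only [qZ, neg_neg]; rw [← neg_div, neg_sub]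

lemma qInt_zero : qInt v 0 = 0 := by simp [qInt]

lemma qInt_one (h : v - v⁻¹ ≠ 0) : qInt v 1 = 1 := by simp [qInt, h]

/-- The three-term relation `[a][b + c] = [a + c][b] + [c][a - b]`. -/
lemma qZ_three_term (hv : v ≠ 0) (a b c : ℤ) :
    qZ v a * qZ v (b + c) = qZ v (a + c) * qZ v b + qZ v c * qZ v (a - b) := by
  simp only [qZ, div_mul_div_comm, ← add_div]
  congr 1
  simp only [neg_add, neg_sub, zpow_add₀ hv, zpow_sub₀ hv, zpow_neg]
  have := zpow_ne_zero a hv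
  have := zpow_ne_zero b hv
  have := zpow_ne_zero c hv
  field_simp
  ring

lemma qFact_zero : qFact v 0 = 1 := by simp [qFact]

lemma qFact_succ (n : ℕ) : qFact v (n + 1) = qFact v n * qInt v (n + 1) := by
  rw [qFact, Finset.prod_Icc_succ_top (by omega), qFact]

lemma qFact_ne_zero (n : ℕ) (h : ∀ m, 1 ≤ m → m ≤ n → qInt v m ≠ 0) : qFact v n ≠ 0 := by
  rw [qFact, Finset.prod_ne_zero_iff]
  intro m hm
  rw [Finset.mem_Icc] at hm
  exact h m hm.1 hm.2

end qZ

/-! ### The root of unity -/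

section Root
variable (p : ℕ)

lemma qRoot_ne_zero : qRoot p ≠ 0 := Complex.exp_ne_zero _

variable {p}

lemma qRoot_isPrimitiveRoot (hp : 2 ≤ p) : IsPrimitiveRoot (qRoot p) (2 * p) := by
  have h := Complex.isPrimitiveRoot_exp (2 * p) (by omega)
  have : qRoot p = Complex.exp (2 * Real.pi * Complex.I / (2 * p : ℕ)) := by
    rw [qRoot]
    congr 1
    have : (p : ℂ) ≠ 0 := by exact_mod_cast (by omega : p ≠ 0)
    push_cast
    field_simp
  rwa [this]

lemma qRoot_pow (hp : 2 ≤ p) : qRoot p ^ p = -1 := by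
  rw [qRoot, ← Complex.exp_nat_mul]
  have : (p : ℂ) ≠ 0 := by exact_mod_cast (by omega : p ≠ 0)
  rw [mul_div_cancel₀ _ this, mul_comm, Complex.exp_pi_mul_I]

lemma qRoot_zpow_eq_iff (hp : 2 ≤ p) (m n : ℤ) :
    qRoot p ^ m = qRoot p ^ n ↔ (2 * p : ℤ) ∣ m - n := by
  rw [← div_eq_one_iff_eq (zpow_ne_zero _ (qRoot_ne_zero p)), ← zpow_sub₀ (qRoot_ne_zero p),
    (qRoot_isPrimitiveRoot hp).zpow_eq_one_iff_dvd]
  push_cast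
  rfl

lemma qRoot_sub_inv_ne_zero (hp : 2 ≤ p) : qRoot p - (qRoot p)⁻¹ ≠ 0 := by
  rw [sub_ne_zero]
  intro h
  have := (qRoot_zpow_eq_iff hp 1 (-1)).1 (by simpa using h)
  have h2 := Int.le_of_dvd (by norm_num) this
  omega

lemma qZ_qRoot_eq_zero_iff (hp : 2 ≤ p) (n : ℤ) : qZ (qRoot p) n = 0 ↔ (p : ℤ) ∣ n := by
  rw [qZ, div_eq_zero_iff, or_iff_left (qRoot_sub_inv_ne_zero hp), sub_eq_zero,
    qRoot_zpow_eq_iff hp, show n - -n = 2 * n by ring]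
  exact mul_dvd_mul_iff_left (by norm_num)

lemma neg_one_zpow_neg (m : ℤ) : ((-1 : ℂ) ^ m)⁻¹ = (-1) ^ m := by
  rw [← inv_zpow]; norm_num

lemma qRoot_zpow_mul (hp : 2 ≤ p) (m : ℤ) : qRoot p ^ (p * m : ℤ) = (-1) ^ m := by
  rw [zpow_mul, zpow_natCast, qRoot_pow hp]

lemma qZ_qRoot_add_mul (hp : 2 ≤ p) (n m : ℤ) :
    qZ (qRoot p) (n + p * m) = (-1) ^ m * qZ (qRoot p) n := by
  have h1 : qRoot p ^ (-(n + p * m)) = (-1) ^ m * qRoot p ^ (-n) := by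
    rw [neg_add, zpow_add₀ (qRoot_ne_zero p), ← mul_neg, qRoot_zpow_mul hp, zpow_neg, zpow_neg, neg_one_zpow_neg, mul_comm]
  rw [qZ, qZ, zpow_add₀ (qRoot_ne_zero p), qRoot_zpow_mul hp, h1]
  ring

lemma qZ_qRoot_sub (hp : 2 ≤ p) (n : ℤ) : qZ (qRoot p) (p - n) = qZ (qRoot p) n := by
  have := qZ_qRoot_add_mul hp (-n) 1
  rw [qZ_neg] at this
  rw [show (p : ℤ) - n = -n + p * 1 by ring, this]
  simp

lemma qInt_qRoot_ne_zero (hp : 2 ≤ p) {n : ℕ} (h1 : 1 ≤ n) (h2 : n < p) :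
    qInt (qRoot p) n ≠ 0 := by
  rw [← qZ_natCast, Ne, qZ_qRoot_eq_zero_iff hp]
  intro h
  have := Int.le_of_dvd (by omega) h
  omega

lemma qInt_qRoot_self (hp : 2 ≤ p) : qInt (qRoot p) p = 0 := by
  rw [← qZ_natCast, qZ_qRoot_eq_zero_iff hp]

lemma qInt_qRoot_sub (hp : 2 ≤ p) {n : ℕ} (h : n ≤ p) :
    qInt (qRoot p) (p - n) = qInt (qRoot p) n := by
  rw [← qZ_natCast, ← qZ_natCast, Nat.cast_sub h, qZ_qRoot_sub hp]

lemma qFact_qRoot_ne_zero (hp : 2 ≤ p) {n : ℕ} (h : n < p) : qFact (qRoot p) n ≠ 0 :=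
  qFact_ne_zero _ _ fun _ h1 h2 => qInt_qRoot_ne_zero hp h1 (by omega)

/-- By the symmetry `[p - n] = [n]` at `q`, moving one factor from the second factorial to the first
does not change the product. -/
lemma qFact_qRoot_mul (hp : 2 ≤ p) {r : ℕ} (h : r + 1 ≤ p) :
    qFact (qRoot p) r * qFact (qRoot p) (p - 1 - r) = qFact (qRoot p) (p - 1) := by
  induction r with
  | zero => simp [qFact_zero]
  | succ r ih =>
    rw [← ih (by omega), qFact_succ, show p - 1 - r = (p - 1 - (r + 1)) + 1 by omega, qFact_succ,
      show p - 1 - (r + 1) + 1 = p - (r + 1) by omega, qInt_qRoot_sub hp (by omega)]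
    ring

end Root

/-! ### Generic quantum integers near the root of unity -/

section Generic

lemma ratFunc_X_pow_ne_one {n : ℕ} (hn : n ≠ 0) : (RatFunc.X : RatFunc ℂ) ^ n ≠ 1 := by
  intro h
  have h1 : (Polynomial.X : Polynomial ℂ) ^ n = 1 := by
    apply RatFunc.algebraMap_injective ℂ
    simpa using h
  have := congrArg Polynomial.natDegree h1
  simp at this
  exact hn this

lemma ratFunc_X_zpow_ne_one {n : ℤ} (hn : n ≠ 0) : (RatFunc.X : RatFunc ℂ) ^ n ≠ 1 := by
  obtain ⟨m, rfl | rfl⟩ := n.eq_nat_or_neg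
  · rw [zpow_natCast]
    exact ratFunc_X_pow_ne_one (by simpa using hn)
  · rw [zpow_neg, zpow_natCast, inv_ne_one]
    exact ratFunc_X_pow_ne_one (by simpa using hn)

lemma ratFunc_X_sub_inv_ne_zero : (RatFunc.X - RatFunc.X⁻¹ : RatFunc ℂ) ≠ 0 := by
  rw [sub_ne_zero]
  intro h
  apply ratFunc_X_pow_ne_one two_ne_zero
  rw [sq]
  nth_rewrite 2 [h]
  exact mul_inv_cancel₀ RatFunc.X_ne_zero

lemma qZ_X_ne_zero {n : ℤ} (hn : n ≠ 0) : qZ (RatFunc.X : RatFunc ℂ) n ≠ 0 := by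
  rw [qZ, div_ne_zero_iff]
  refine ⟨?_, ratFunc_X_sub_inv_ne_zero⟩
  rw [sub_ne_zero]
  intro h
  apply ratFunc_X_zpow_ne_one (n := 2 * n) (by omega)
  rw [two_mul, zpow_add₀ RatFunc.X_ne_zero]
  nth_rewrite 2 [h]
  rw [← zpow_add₀ RatFunc.X_ne_zero]
  simp

lemma qInt_X_ne_zero {n : ℕ} (hn : n ≠ 0) : qInt (RatFunc.X : RatFunc ℂ) n ≠ 0 := by
  rw [← qZ_natCast]
  exact qZ_X_ne_zero (by exact_mod_cast hn)

lemma qFact_X_ne_zero (n : ℕ) : qFact (RatFunc.X : RatFunc ℂ) n ≠ 0 :=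
  qFact_ne_zero _ _ fun _ h _ => qInt_X_ne_zero (by omega)

lemma ratFunc_X_sub_C_ne_zero (a : ℂ) : (RatFunc.X - RatFunc.C a : RatFunc ℂ) ≠ 0 := by
  have := (map_ne_zero_iff (algebraMap (Polynomial ℂ) (RatFunc ℂ))
    (RatFunc.algebraMap_injective ℂ)).2 (Polynomial.X_sub_C_ne_zero a)
  simpa using this

variable {p : ℕ}

lemma specializes_X_inv : Specializes (qRoot p) RatFunc.X⁻¹ (qRoot p)⁻¹ :=
  Specializes.X.inv (qRoot_ne_zero p)

lemma specializes_X_zpow (n : ℤ) : Specializes (qRoot p) (RatFunc.X ^ n) (qRoot p ^ n) :=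
  Specializes.X.zpow (qRoot_ne_zero p) n

lemma specializes_qZ (hp : 2 ≤ p) (n : ℤ) :
    Specializes (qRoot p) (qZ RatFunc.X n) (qZ (qRoot p) n) :=
  ((specializes_X_zpow _).sub (specializes_X_zpow _)).div
    (Specializes.X.sub specializes_X_inv) (qRoot_sub_inv_ne_zero hp)

lemma specializes_qInt (hp : 2 ≤ p) (n : ℕ) :
    Specializes (qRoot p) (qInt RatFunc.X n) (qInt (qRoot p) n) := by
  rw [← qZ_natCast, ← qZ_natCast]; exact specializes_qZ hp n

lemma specializes_qFact (hp : 2 ≤ p) (n : ℕ) :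
    Specializes (qRoot p) (qFact RatFunc.X n) (qFact (qRoot p) n) :=
  Specializes.prod _ fun m _ => specializes_qInt hp m

/-- This isolates `v^(2p) - 1`, the factor of `[p]` that vanishes at `q`. -/
lemma qInt_self_eq : qInt (RatFunc.X : RatFunc ℂ) p =
    RatFunc.X⁻¹ ^ p * (RatFunc.X ^ (2 * p) - 1) / (RatFunc.X - RatFunc.X⁻¹) := by
  rw [qInt]
  congr 1
  rw [mul_sub, mul_one, two_mul, pow_add, ← mul_assoc, ← mul_pow, inv_mul_cancel₀ RatFunc.X_ne_zero,
    one_pow, one_mul]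

/-- `[p] / (v - q)` is a unit at `q`. -/
lemma specializes_qInt_self_div (hp : 2 ≤ p) : Specializes (qRoot p)
    (qInt RatFunc.X p / (RatFunc.X - RatFunc.C (qRoot p)))
    (-(2 * p * (qRoot p)⁻¹) / (qRoot p - (qRoot p)⁻¹)) := by
  have h1 := Specializes.slope (a := qRoot p) (Polynomial.X ^ (2 * p))
  have h2 : qRoot p ^ (2 * p) = 1 := (qRoot_isPrimitiveRoot hp).pow_eq_one
  simp only [map_pow, RatFunc.algebraMap_X, Polynomial.eval_pow, Polynomial.eval_X, h2, map_one,
    Polynomial.derivative_X_pow, Polynomial.eval_mul, Polynomial.eval_C] at h1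
  have h3 : qRoot p ^ (2 * p - 1) = (qRoot p)⁻¹ := by
    rw [← mul_eq_one_iff_eq_inv₀ (qRoot_ne_zero p), ← pow_succ, Nat.sub_add_cancel (by omega), h2]
  rw [h3] at h1
  have h4 := ((specializes_X_inv (p := p)).pow p).mul h1
  have h5 := h4.div (Specializes.X.sub specializes_X_inv) (qRoot_sub_inv_ne_zero hp)
  rw [inv_pow (qRoot p), qRoot_pow hp] at h5
  convert h5 using 1
  · rw [qInt_self_eq]
    field_simp
  · push_cast
    norm_num

/-- For `m ≥ 0` the quotient is a geometric sum of `m` terms, each with value `1`. A negative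
exponent is reduced to this case by extracting a power of `z`. -/
lemma specializes_geom {a : ℂ} {z : RatFunc ℂ} (hz : Specializes a z 1) (h1 : z ≠ 1) (m : ℤ) :
    Specializes a ((z ^ m - 1) / (z - 1)) m := by
  have key : ∀ m : ℕ, Specializes a ((z ^ m - 1) / (z - 1)) m := by
    intro m
    rw [← geom_sum_eq h1]
    simpa using Specializes.sum (Finset.range m) (fun i _ => hz.pow i)
  have hz0 : z ≠ 0 := by
    rintro rfl
    exact zero_ne_one (Specializes.zero.unique hz)
  obtain ⟨m, rfl | rfl⟩ := m.eq_nat_or_neg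
  · simpa using key m
  · have := ((hz.zpow one_ne_zero (-m : ℤ)).mul (key m)).neg
    simp only [zpow_neg, zpow_natCast, one_pow, inv_one, one_mul] at this ⊢
    convert this using 1
    · have := pow_ne_zero m hz0
      field_simp
      ring
    · simp

lemma specializes_X_pow_two_mul (hp : 2 ≤ p) : Specializes (qRoot p) (RatFunc.X ^ (2 * p)) 1 := by
  simpa [(qRoot_isPrimitiveRoot hp).pow_eq_one] using Specializes.X.pow (2 * p) (a := qRoot p)

/-- With `z = v^(2p)` the quotient equals `v^(-p(m - 1)) (z^m - 1) / (z - 1)`, and `v^p` has value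
`-1` at `q`. -/
lemma specializes_qZ_mul_div (hp : 2 ≤ p) (m : ℤ) : Specializes (qRoot p)
    (qZ RatFunc.X (p * m) / qInt RatFunc.X p) ((-1) ^ (m - 1) * m) := by
  have h1 := specializes_geom (specializes_X_pow_two_mul hp) (ratFunc_X_pow_ne_one (by omega)) m
  have h2 := (specializes_X_zpow (p := p) (p * (-(m - 1)))).mul h1
  rw [qRoot_zpow_mul hp] at h2
  convert h2 using 1
  · have hX : (RatFunc.X : RatFunc ℂ) ≠ 0 := RatFunc.X_ne_zero
    have e1 : (RatFunc.X : RatFunc ℂ) ^ (2 * p) - 1 ≠ 0 :=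
      sub_ne_zero.2 (ratFunc_X_pow_ne_one (by omega))
    have e2 := ratFunc_X_sub_inv_ne_zero
    rw [qInt_self_eq, qZ, div_div_div_cancel_right₀ e2, ← mul_div_assoc, div_eq_div_iff
      (mul_ne_zero (by simp [hX]) e1) e1]
    rw [← mul_assoc]
    congr 1
    have e3 : ((RatFunc.X : RatFunc ℂ) ^ (2 * p)) ^ m = RatFunc.X ^ (p * m : ℤ) * RatFunc.X ^ (p * m : ℤ) := by
      rw [← zpow_natCast, ← zpow_mul, ← zpow_add₀ hX]; congr 1; push_cast; ring
    have e4 : (RatFunc.X : RatFunc ℂ) ^ (p * -(m - 1) : ℤ) = RatFunc.X ^ p * RatFunc.X ^ (-(p * m : ℤ)) := by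
      rw [← zpow_natCast, ← zpow_add₀ hX]; congr 1; ring
    rw [e3, e4, inv_pow, zpow_neg]
    have := pow_ne_zero p hX
    have := zpow_ne_zero (p * m : ℤ) hX
    field_simp
  · rw [zpow_neg, ← inv_zpow]
    norm_num

end Generic

/-! ### Commutation relations of quantum `sl(2)` -/

/-- The elements `E, F, K, K⁻¹` satisfy the relations of quantum `sl(2)`. -/
structure IsQuantum {k A : Type*} [Field k] [Ring A] [Algebra k A] (v : k) (E F K Kinv : A) :
    Prop where
  K_mul_Kinv : K * Kinv = 1
  Kinv_mul_K : Kinv * K = 1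
  K_E : K * E = v ^ 2 • (E * K)
  K_F : K * F = v⁻¹ ^ 2 • (F * K)
  E_F : E * F - F * E = (v - v⁻¹)⁻¹ • (K - Kinv)

/-- `E ^ n / [n]!`. -/
def dpow {k A : Type*} [Field k] [Ring A] [Algebra k A] (v : k) (x : A) (n : ℕ) : A :=
  (qFact v n)⁻¹ • x ^ n

/-- `[K; c] = (v ^ c K - v ^ (-c) K⁻¹) / (v - v⁻¹)`. -/
def bracketK {k A : Type*} [Field k] [Ring A] [Algebra k A] (v : k) (K Kinv : A) (c : ℤ) : A :=
  (v - v⁻¹)⁻¹ • (v ^ c • K - v ^ (-c) • Kinv)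

/-- `[K; c] [K; c - 1] ⋯ [K; c - t + 1]`. -/
def bracketProd {k A : Type*} [Field k] [Ring A] [Algebra k A] (v : k) (K Kinv : A) (c : ℤ) :
    ℕ → A
  | 0 => 1
  | t + 1 => bracketProd v K Kinv c t * bracketK v K Kinv (c - t)

section Dpow
variable {k A : Type*} [Field k] [Ring A] [Algebra k A] (v : k)

lemma dpow_zero (x : A) : dpow v x 0 = 1 := by simp [dpow, qFact_zero]

lemma mul_dpow (hv : ∀ n : ℕ, qInt v (n + 1) ≠ 0) (x : A) (n : ℕ) :
    x * dpow v x n = qInt v (n + 1) • dpow v x (n + 1) := by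
  rw [dpow, dpow, qFact_succ, smul_smul, mul_smul_comm, ← pow_succ', mul_inv, mul_comm (_⁻¹),
    ← mul_assoc, mul_inv_cancel₀ (hv n), one_mul]

/-- The quantum binomial theorem for divided powers. -/
lemma dpow_add (hv0 : v ≠ 0) (hv : ∀ n : ℕ, qInt v (n + 1) ≠ 0) (x y : A)
    (h : y * x = v ^ 2 • (x * y)) (n : ℕ) :
    dpow v (x + y) n = ∑ r ∈ Finset.range (n + 1),
      v ^ (r * (n - r)) • (dpow v x r * dpow v y (n - r)) := by
  induction n with
  | zero => simp [dpow_zero]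
  | succ n ih =>
    have hyx : ∀ r : ℕ, y * dpow v x r = v ^ (2 * r) • (dpow v x r * y) := by
      intro r
      have : ∀ r : ℕ, y * x ^ r = v ^ (2 * r) • (x ^ r * y) := by
        intro r
        induction r with
        | zero => simp
        | succ r ih => rw [pow_succ, ← mul_assoc, ih, smul_mul_assoc, mul_assoc, h, mul_smul_comm,
            smul_smul, ← pow_add, mul_assoc, mul_add, mul_one]
      rw [dpow, mul_smul_comm, this, smul_mul_assoc, smul_comm]
    -- Multiplying the formula for `n` by `x + y` produces the factor `[n + 1]` on the left. The two
    -- sums on the right are then extended to a common range; the added terms vanish because `[0] =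
    -- 0`.
    have e1 : qInt v (n + 1) • dpow v (x + y) (n + 1) =
        ∑ r ∈ Finset.range (n + 1), (v ^ (r * (n - r)) * qInt v (r + 1)) •
          (dpow v x (r + 1) * dpow v y (n - r)) +
        ∑ r ∈ Finset.range (n + 1), (v ^ (r * (n - r) + 2 * r) * qInt v (n + 1 - r)) •
          (dpow v x r * dpow v y (n + 1 - r)) := by
      rw [← mul_dpow v hv, ih, Finset.mul_sum, ← Finset.sum_add_distrib]
      refine Finset.sum_congr rfl fun r hr => ?_
      have hr' : r ≤ n := by simpa [Nat.lt_succ_iff] using hr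
      rw [mul_smul_comm, add_mul, smul_add]
      congr 1
      · rw [← mul_assoc, mul_dpow v hv, smul_mul_assoc, smul_smul]
      · rw [← mul_assoc, hyx, smul_mul_assoc, mul_assoc, mul_dpow v hv, mul_smul_comm, smul_smul,
          smul_smul, pow_add, show n + 1 - r = n - r + 1 by omega]
    have e2 : ∑ r ∈ Finset.range (n + 1), (v ^ (r * (n - r)) * qInt v (r + 1)) •
          (dpow v x (r + 1) * dpow v y (n - r)) =
        ∑ r ∈ Finset.range (n + 2), (v ^ ((r - 1) * (n + 1 - r)) * qInt v r) •
          (dpow v x r * dpow v y (n + 1 - r)) := by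
      rw [Finset.sum_range_succ' _ (n + 1), qInt_zero]
      simp
    have e3 : ∑ r ∈ Finset.range (n + 1), (v ^ (r * (n - r) + 2 * r) * qInt v (n + 1 - r)) •
          (dpow v x r * dpow v y (n + 1 - r)) =
        ∑ r ∈ Finset.range (n + 2), (v ^ (r * (n - r) + 2 * r) * qInt v (n + 1 - r)) •
          (dpow v x r * dpow v y (n + 1 - r)) := by
      rw [Finset.sum_range_succ _ (n + 1), Nat.sub_self, qInt_zero]
      simp
    have e4 : qInt v (n + 1) • dpow v (x + y) (n + 1) = qInt v (n + 1) •
        ∑ r ∈ Finset.range (n + 1 + 1),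
          v ^ (r * (n + 1 - r)) • (dpow v x r * dpow v y (n + 1 - r)) := by
      rw [e1, e2, e3, ← Finset.sum_add_distrib, Finset.smul_sum]
      refine Finset.sum_congr rfl fun r hr => ?_
      have hr' : r ≤ n + 1 := by simpa [Nat.lt_succ_iff] using hr
      -- What remains is the Pascal rule `v^(-(n+1-r)) [r] + v^r [n+1-r] = [n+1]`, multiplied by
      -- `v^(r(n+1-r))`. The truncated difference `n - r` at `r = n + 1` is harmless, since its
      -- coefficient contains `[0]`.
      rw [smul_smul, ← add_smul]
      congr 1
      rcases Nat.eq_zero_or_pos r with rfl | hr0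
      · simp [qInt_zero]
      obtain ⟨s, rfl⟩ : ∃ s, r = s + 1 := ⟨r - 1, by omega⟩
      obtain ⟨m, rfl⟩ : ∃ m, n = s + m := ⟨n - s, by omega⟩
      rcases Nat.eq_zero_or_pos m with rfl | hm
      · simp [qInt_zero]
      obtain ⟨l, rfl⟩ : ∃ l, m = l + 1 := ⟨m - 1, by omega⟩
      rw [show s + (l + 1) + 1 - (s + 1) = l + 1 by omega, show s + 1 - 1 = s by omega,
        show s + (l + 1) - (s + 1) = l by omega]
      simp only [qInt]
      rw [← mul_div_assoc, ← mul_div_assoc, ← add_div, div_mul_eq_mul_div]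
      congr 1
      have e : ∀ j : ℕ, v⁻¹ ^ j * v ^ j = 1 := fun j => by
        rw [← mul_pow, inv_mul_cancel₀ hv0, one_pow]
      have a1 := e s
      have a2 := e l
      have a3 : v⁻¹ * v = 1 := inv_mul_cancel₀ hv0
      have hs := pow_ne_zero s hv0
      have hl := pow_ne_zero l hv0
      simp only [inv_pow, pow_add, pow_one, mul_add, add_mul, mul_one, one_mul, two_mul]
      field_simp
      ring
    have := congrArg (fun z => (qInt v (n + 1))⁻¹ • z) e4
    simpa only [smul_smul, inv_mul_cancel₀ (hv n), one_smul] using this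

end Dpow

namespace IsQuantum
variable {k A : Type*} [Field k] [Ring A] [Algebra k A] {v : k} {E F K Kinv : A}

section
variable (h : IsQuantum v E F K Kinv)
include h

lemma Kinv_E (hv : v ≠ 0) : Kinv * E = v⁻¹ ^ 2 • (E * Kinv) := by
  have h1 : Kinv * (K * E) * Kinv = v ^ 2 • (Kinv * (E * K) * Kinv) := by
    rw [h.K_E]; simp
  rw [← mul_assoc, h.Kinv_mul_K, one_mul, mul_assoc, mul_assoc E, h.K_mul_Kinv, mul_one] at h1
  rw [h1, smul_smul, ← mul_pow, inv_mul_cancel₀ hv, one_pow, one_smul]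

lemma Kinv_F (hv : v ≠ 0) : Kinv * F = v ^ 2 • (F * Kinv) := by
  have h1 : Kinv * (K * F) * Kinv = v⁻¹ ^ 2 • (Kinv * (F * K) * Kinv) := by
    rw [h.K_F]; simp
  rw [← mul_assoc, h.Kinv_mul_K, one_mul, mul_assoc, mul_assoc F, h.K_mul_Kinv, mul_one] at h1
  rw [h1, smul_smul, ← mul_pow, mul_inv_cancel₀ hv, one_pow, one_smul]

lemma commute_K_Kinv : Commute K Kinv := by
  rw [commute_iff_eq, h.K_mul_Kinv, h.Kinv_mul_K]

lemma commute_bracketK (c d : ℤ) : Commute (bracketK v K Kinv c) (bracketK v K Kinv d) := by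
  have hc := h.commute_K_Kinv
  refine Commute.smul_left (Commute.smul_right ?_ _) _
  exact (((Commute.refl K).smul_right _).smul_left _ |>.sub_right
    ((hc.smul_right _).smul_left _)).sub_left
    (((hc.symm.smul_right _).smul_left _).sub_right (((Commute.refl Kinv).smul_right _).smul_left _))

lemma commute_bracketProd (c d : ℤ) (t : ℕ) :
    Commute (bracketK v K Kinv c) (bracketProd v K Kinv d t) := by
  induction t with
  | zero => exact Commute.one_right _
  | succ t ih => exact ih.mul_right (h.commute_bracketK _ _)

omit h in
lemma bracketProd_succ' (c : ℤ) (t : ℕ) : bracketProd v K Kinv (c + 1) (t + 1) =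
    bracketK v K Kinv (c + 1) * bracketProd v K Kinv c t := by
  induction t with
  | zero => simp [bracketProd]
  | succ t ih =>
    rw [bracketProd, ih, bracketProd, mul_assoc]
    congr 3
    push_cast; ring

lemma bracketK_E (hv : v ≠ 0) (c : ℤ) :
    E * bracketK v K Kinv c = bracketK v K Kinv (c - 2) * E := by
  simp only [bracketK, smul_mul_assoc, sub_mul, mul_smul_comm, mul_sub, h.K_E, h.Kinv_E hv,
    smul_smul]
  have e1 : v ^ (c - 2) * v ^ 2 = v ^ c := by
    rw [← zpow_natCast, ← zpow_add₀ hv]; congr 1; push_cast; ring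
  have e2 : v ^ (-(c - 2)) * v⁻¹ ^ 2 = v ^ (-c) := by
    rw [← zpow_natCast, inv_zpow', ← zpow_add₀ hv]; congr 1; push_cast; ring
  rw [e1, e2]

lemma bracketK_F (hv : v ≠ 0) (c : ℤ) :
    bracketK v K Kinv c * F = F * bracketK v K Kinv (c - 2) := by
  simp only [bracketK, smul_mul_assoc, sub_mul, mul_smul_comm, mul_sub, h.K_F, h.Kinv_F hv,
    smul_smul]
  have e1 : v ^ c * v⁻¹ ^ 2 = v ^ (c - 2) := by
    rw [← zpow_natCast, inv_zpow', ← zpow_add₀ hv]; congr 1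
  have e2 : v ^ (-c) * v ^ 2 = v ^ (-(c - 2)) := by
    rw [← zpow_natCast, ← zpow_add₀ hv]; congr 1; push_cast; ring
  rw [e1, e2]

lemma bracketProd_E (hv : v ≠ 0) (c : ℤ) (t : ℕ) :
    E * bracketProd v K Kinv c t = bracketProd v K Kinv (c - 2) t * E := by
  induction t with
  | zero => simp [bracketProd]
  | succ t ih =>
    rw [bracketProd, ← mul_assoc, ih, mul_assoc, h.bracketK_E hv, ← mul_assoc, bracketProd]
    congr 3
    ring

omit h in
-- This is the three-term relation for quantum integers with `[K; d]` in place of `[d]`; the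
-- coefficients of `K` and of `K⁻¹` are compared separately.
lemma qZ_smul_bracketK (hv : v ≠ 0) (n m d : ℤ) :
    qZ v n • bracketK v K Kinv (d - m) + qZ v m • bracketK v K Kinv (d + n) =
      qZ v (n + m) • bracketK v K Kinv d := by
  have hn := zpow_ne_zero n hv
  have hm := zpow_ne_zero m hv
  have hd := zpow_ne_zero d hv
  simp only [bracketK, smul_sub, smul_smul]
  have e1 : qZ v n * ((v - v⁻¹)⁻¹ * v ^ (d - m)) + qZ v m * ((v - v⁻¹)⁻¹ * v ^ (d + n)) =
      qZ v (n + m) * ((v - v⁻¹)⁻¹ * v ^ d) := by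
    simp only [qZ, neg_add, zpow_add₀ hv, zpow_sub₀ hv, zpow_neg]
    generalize (v - v⁻¹) = w
    simp only [div_eq_mul_inv]
    field_simp
    ring
  have e2 : qZ v n * ((v - v⁻¹)⁻¹ * v ^ (-(d - m))) + qZ v m * ((v - v⁻¹)⁻¹ * v ^ (-(d + n))) =
      qZ v (n + m) * ((v - v⁻¹)⁻¹ * v ^ (-d)) := by
    simp only [qZ, neg_add, neg_sub, zpow_add₀ hv, zpow_sub₀ hv, zpow_neg]
    generalize (v - v⁻¹) = w
    simp only [div_eq_mul_inv]
    field_simp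
    ring
  rw [← e1, ← e2, add_smul, add_smul]
  abel

lemma E_mul_F_pow (hv : v ≠ 0) (b : ℕ) : E * F ^ (b + 1) =
    F ^ (b + 1) * E + qInt v (b + 1) • (F ^ b * bracketK v K Kinv (-b)) := by
  have h0 : E * F = F * E + bracketK v K Kinv 0 := by
    rw [← sub_eq_iff_eq_add', h.E_F, bracketK]; simp
  induction b with
  | zero =>
    -- In the degenerate case all brackets are `0`, since the inverse of `0` is `0`.
    by_cases hw : v - v⁻¹ = 0
    · simp [h0, bracketK, hw, qInt]
    · simp [h0, qInt_one v hw]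
  | succ b ih =>
    have e3 := qZ_smul_bracketK (K := K) (Kinv := Kinv) hv (b + 1) 1 (-(b + 1 : ℤ))
    rw [pow_succ, ← mul_assoc, ih, add_mul, mul_assoc _ E, h0, mul_add, smul_mul_assoc,
      mul_assoc _ _ F, h.bracketK_F hv, ← mul_assoc (F ^ b), ← pow_succ, add_assoc, ← mul_assoc,
      ← pow_succ, ← mul_smul_comm, ← mul_add]
    congr 1
    rw [← mul_smul_comm]
    congr 1
    by_cases hw : v - v⁻¹ = 0
    · simp [bracketK, hw]
    · rw [qZ_one v hw, one_smul] at e3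
      rw [← qZ_natCast, ← qZ_natCast, add_comm]
      push_cast
      rw [← e3]
      congr 3 <;> ring

lemma E_pow_mul_F (hv : v ≠ 0) (b : ℕ) : E ^ (b + 1) * F =
    F * E ^ (b + 1) + qInt v (b + 1) • (bracketK v K Kinv (-b) * E ^ b) := by
  have h0 : E * F = F * E + bracketK v K Kinv 0 := by
    rw [← sub_eq_iff_eq_add', h.E_F, bracketK]; simp
  induction b with
  | zero =>
    by_cases hw : v - v⁻¹ = 0
    · simp [h0, bracketK, hw, qInt]
    · simp [h0, qInt_one v hw]
  | succ b ih =>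
    have e3 := qZ_smul_bracketK (K := K) (Kinv := Kinv) hv (b + 1) 1 (-(b + 1 : ℤ))
    rw [pow_succ', mul_assoc, ih, mul_add, ← mul_assoc E, h0, add_mul, mul_smul_comm,
      ← mul_assoc E, h.bracketK_E hv, mul_assoc F E, ← pow_succ', add_assoc,
      mul_assoc (bracketK v K Kinv _) E, ← pow_succ', ← smul_mul_assoc, ← add_mul]
    congr 1
    rw [← smul_mul_assoc]
    congr 1
    by_cases hw : v - v⁻¹ = 0
    · simp [bracketK, hw]
    · rw [qZ_one v hw, one_smul] at e3
      rw [← qZ_natCast, ← qZ_natCast]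
      push_cast
      rw [← e3, add_comm]
      congr 3 <;> ring

lemma E_mul_dpow_F (hv0 : v ≠ 0) (hv : ∀ n : ℕ, qInt v (n + 1) ≠ 0) (b : ℕ) :
    E * dpow v F (b + 1) = dpow v F (b + 1) * E + dpow v F b * bracketK v K Kinv (-b) := by
  rw [dpow, mul_smul_comm, h.E_mul_F_pow hv0, smul_add, smul_smul, qFact_succ, mul_inv,
    mul_assoc _ _ (qInt v (b + 1)), inv_mul_cancel₀ (hv b), mul_one, dpow, smul_mul_assoc,
    smul_mul_assoc]

/-- The commutation formula for divided powers. -/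
lemma dpow_E_mul_dpow_F (hv0 : v ≠ 0) (hv : ∀ n : ℕ, qInt v (n + 1) ≠ 0) (a b : ℕ) (hab : a ≤ b) :
    dpow v E a * dpow v F b = ∑ t ∈ Finset.range (a + 1), (qFact v t)⁻¹ •
      (dpow v F (b - t) * bracketProd v K Kinv (2 * t - a - b) t * dpow v E (a - t)) := by
  induction a with
  | zero => simp [dpow_zero, bracketProd, qFact_zero]
  | succ a ih =>
    -- Left multiplication by `E` turns `E^(a)` into `[a + 1] E^(a+1)`. In the term of index `t` the
    -- new `E` either passes all factors `F`, which keeps `t`, or consumes one of them, which raises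
    -- `t` by one.
    have key : qInt v (a + 1) • (dpow v E (a + 1) * dpow v F b) = qInt v (a + 1) •
        ∑ t ∈ Finset.range (a + 1 + 1), (qFact v t)⁻¹ • (dpow v F (b - t) *
          bracketProd v K Kinv (2 * t - (a + 1 : ℕ) - b) t * dpow v E (a + 1 - t)) := by
      rw [← smul_mul_assoc, ← mul_dpow v hv, mul_assoc, ih (by omega), Finset.mul_sum]
      have e1 : ∀ t ∈ Finset.range (a + 1), E * ((qFact v t)⁻¹ •
          (dpow v F (b - t) * bracketProd v K Kinv (2 * t - a - b) t * dpow v E (a - t))) =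
          ((qFact v t)⁻¹ * qInt v (a + 1 - t)) • (dpow v F (b - t) *
            bracketProd v K Kinv (2 * t - a - b - 2) t * dpow v E (a + 1 - t)) +
          (qFact v t)⁻¹ • (dpow v F (b - (t + 1)) * (bracketK v K Kinv (t + 1 - b) *
            bracketProd v K Kinv (2 * t - a - b) t) * dpow v E (a - t)) := by
        intro t ht
        have ht' : t ≤ a := by simpa [Nat.lt_succ_iff] using ht
        -- Because `t ≤ a < b`, a factor `F` is left for `E` to consume.
        obtain ⟨c, rfl⟩ : ∃ c, b = c + 1 + t := ⟨b - 1 - t, by omega⟩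
        rw [show c + 1 + t - t = c + 1 by omega, show c + 1 + t - (t + 1) = c by omega,
          mul_smul_comm, ← mul_assoc, ← mul_assoc, h.E_mul_dpow_F hv0 hv, add_mul, add_mul, smul_add]
        congr 1
        · rw [mul_assoc _ E, h.bracketProd_E hv0, mul_assoc, mul_assoc, mul_dpow v hv,
            show a + 1 - t = a - t + 1 by omega, mul_smul_comm, mul_smul_comm, smul_smul, mul_assoc]
        · rw [mul_assoc (dpow v F c)]
          congr 6
          push_cast; ring
      rw [Finset.sum_congr rfl e1, Finset.sum_add_distrib, Finset.smul_sum]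
      have e2 : ∑ t ∈ Finset.range (a + 1), ((qFact v t)⁻¹ * qInt v (a + 1 - t)) •
          (dpow v F (b - t) * bracketProd v K Kinv (2 * t - a - b - 2) t * dpow v E (a + 1 - t)) =
          ∑ t ∈ Finset.range (a + 2), ((qFact v t)⁻¹ * qInt v (a + 1 - t)) •
          (dpow v F (b - t) * bracketProd v K Kinv (2 * t - a - b - 2) t *
            dpow v E (a + 1 - t)) := by
        rw [Finset.sum_range_succ _ (a + 1), Nat.sub_self, qInt_zero]; simp
      rw [e2, Finset.sum_range_succ' _ (a + 1), Finset.sum_range_succ' _ (a + 1), add_right_comm,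
        ← Finset.sum_add_distrib]
      congr 1
      · refine Finset.sum_congr rfl fun t ht => ?_
        have ht' : t ≤ a := by simpa [Nat.lt_succ_iff] using ht
        -- This relation merges the two contributions to the term of index `t + 1` into one bracket
        -- with coefficient `[a + 1]`.
        have e3 := qZ_smul_bracketK (K := K) (Kinv := Kinv) hv0 (a - t) (t + 1) (2 * t + 1 - a - b)
        have e4 := bracketProd_succ' (v := v) (K := K) (Kinv := Kinv) (2 * t - a - b : ℤ) t
        rw [show a + 1 - (t + 1) = a - t by omega, smul_smul,
          show (2 * ((t + 1 : ℕ) : ℤ) - (a : ℤ) - b - 2) = 2 * t - a - b by push_cast; ring,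
          show (2 * ((t + 1 : ℕ) : ℤ) - ((a + 1 : ℕ) : ℤ) - b) = 2 * t - a - b + 1 by
            push_cast; ring, e4, bracketProd]
        suffices hs : ((qFact v (t + 1))⁻¹ * qInt v (a - t)) • (bracketProd v K Kinv (2 * t - a - b) t *
            bracketK v K Kinv (2 * t - a - b - t)) + (qFact v t)⁻¹ • (bracketK v K Kinv (t + 1 - b) *
            bracketProd v K Kinv (2 * t - a - b) t) = (qInt v (a + 1) * (qFact v (t + 1))⁻¹) •
            (bracketK v K Kinv (2 * t - a - b + 1) * bracketProd v K Kinv (2 * t - a - b) t) by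
          have := congrArg (fun z => dpow v F (b - (t + 1)) * z * dpow v E (a - t)) hs
          simpa only [mul_add, add_mul, mul_smul_comm, smul_mul_assoc] using this
        rw [(h.commute_bracketProd (2 * t - a - b - t) _ t).eq.symm, ← smul_mul_assoc,
          ← smul_mul_assoc, ← smul_mul_assoc, ← add_mul]
        congr 1
        have e5 : qInt v (a + 1) = qZ v (a - t + (t + 1)) := by
          rw [← qZ_natCast]; congr 1; push_cast; ring
        have e6 : qInt v (a - t) = qZ v (a - t) := by
          rw [← qZ_natCast]; congr 1; push_cast [ht']; ring
        have e7 : qZ v (t + 1) = qInt v (t + 1) := by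
          rw [← qZ_natCast]; congr 1
        rw [e5, e6, mul_comm (qZ v _), mul_smul, mul_smul,
          show (2 * t - a - b + 1 : ℤ) = 2 * t + 1 - a - b by ring, ← e3, smul_add, e7,
          smul_smul _ (qInt v (t + 1)), qFact_succ, mul_inv, mul_assoc _ _ (qInt v (t + 1)),
          inv_mul_cancel₀ (hv t), mul_one]
        congr 4 <;> ring
      · simp [qFact_zero, bracketProd]
    have := congrArg (fun z => (qInt v (a + 1))⁻¹ • z) key
    simpa only [smul_smul, inv_mul_cancel₀ (hv a), one_smul] using this

end

end IsQuantum

/-! ### The quantum group `U_v` as a Hopf algebra -/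

lemma ringQuot_adjoin_range {k X : Type*} [CommRing k] (r : FreeAlgebra k X → FreeAlgebra k X → Prop) :
    Algebra.adjoin k (Set.range fun x => RingQuot.mkAlgHom k r (FreeAlgebra.ι k x)) = ⊤ := by
  rw [show (Set.range fun x => RingQuot.mkAlgHom k r (FreeAlgebra.ι k x)) =
    RingQuot.mkAlgHom k r '' Set.range (FreeAlgebra.ι k) from Set.range_comp _ _,
    ← AlgHom.map_adjoin, FreeAlgebra.adjoin_range_ι, Algebra.map_top, AlgHom.range_eq_top]
  exact RingQuot.mkAlgHom_surjective k r

namespace IsQuantum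
variable {k A B : Type*} [Field k] [Ring A] [Algebra k A] [Ring B] [Algebra k B] {v : k}
  {E F K Kinv : A}

lemma map (h : IsQuantum v E F K Kinv) (φ : A →ₐ[k] B) :
    IsQuantum v (φ E) (φ F) (φ K) (φ Kinv) where
  K_mul_Kinv := by rw [← map_mul, h.K_mul_Kinv, map_one]
  Kinv_mul_K := by rw [← map_mul, h.Kinv_mul_K, map_one]
  K_E := by rw [← map_mul, h.K_E, map_smul, map_mul]
  K_F := by rw [← map_mul, h.K_F, map_smul, map_mul]
  E_F := by rw [← map_mul, ← map_mul, ← map_sub, h.E_F, map_smul, map_sub]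

lemma tensor (h : IsQuantum v E F K Kinv) (hv : v ≠ 0) :
    IsQuantum v ((1 : A) ⊗ₜ[k] E + E ⊗ₜ[k] K) (Kinv ⊗ₜ[k] F + F ⊗ₜ[k] (1 : A)) (K ⊗ₜ[k] K)
      (Kinv ⊗ₜ[k] Kinv) where
  K_mul_Kinv := by
    rw [Algebra.TensorProduct.tmul_mul_tmul, h.K_mul_Kinv, Algebra.TensorProduct.one_def]
  Kinv_mul_K := by
    rw [Algebra.TensorProduct.tmul_mul_tmul, h.Kinv_mul_K, Algebra.TensorProduct.one_def]
  K_E := by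
    simp only [mul_add, add_mul, Algebra.TensorProduct.tmul_mul_tmul, h.K_E, mul_one, one_mul,
      TensorProduct.smul_tmul, TensorProduct.tmul_smul, smul_add]
  K_F := by
    simp only [mul_add, add_mul, Algebra.TensorProduct.tmul_mul_tmul, h.K_F, mul_one, one_mul,
      TensorProduct.smul_tmul, TensorProduct.tmul_smul, smul_add, h.K_mul_Kinv, h.Kinv_mul_K]
  E_F := by
    have e1 : E * F = F * E + (v - v⁻¹)⁻¹ • (K - Kinv) := by rw [← h.E_F]; abel
    have e2 : v⁻¹ ^ 2 * v⁻¹⁻¹ ^ 2 = (1 : k) := by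
      rw [← mul_pow, mul_inv_cancel₀ (inv_ne_zero hv), one_pow]
    simp only [mul_add, add_mul, Algebra.TensorProduct.tmul_mul_tmul, h.K_F, mul_one, one_mul,
      h.Kinv_E hv, e1, TensorProduct.tmul_add, TensorProduct.add_tmul, TensorProduct.tmul_sub,
      TensorProduct.sub_tmul, TensorProduct.smul_tmul, TensorProduct.tmul_smul, smul_sub]
    abel

lemma antipodeOp (h : IsQuantum v E F K Kinv) (hv : v ≠ 0) :
    IsQuantum v (MulOpposite.op (-(E * Kinv))) (MulOpposite.op (-(K * F))) (MulOpposite.op Kinv)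
      (MulOpposite.op K) where
  K_mul_Kinv := by rw [← MulOpposite.op_mul, h.K_mul_Kinv, MulOpposite.op_one]
  Kinv_mul_K := by rw [← MulOpposite.op_mul, h.Kinv_mul_K, MulOpposite.op_one]
  K_E := by
    have e : v ^ 2 * v⁻¹ ^ 2 = (1 : k) := by
      rw [← mul_pow, mul_inv_cancel₀ hv, one_pow]
    rw [← MulOpposite.op_mul, ← MulOpposite.op_mul, ← MulOpposite.op_smul, mul_neg, ← mul_assoc,
      h.Kinv_E hv, smul_mul_assoc, smul_neg, smul_smul, e, one_smul, neg_mul]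
  K_F := by
    have e : v⁻¹ ^ 2 * v ^ 2 = (1 : k) := by
      rw [← mul_pow, inv_mul_cancel₀ hv, one_pow]
    have e2 : Kinv * (K * F) = v ^ 2 • (K * F * Kinv) := by
      rw [mul_assoc K, ← mul_smul_comm, ← h.Kinv_F hv, ← mul_assoc, ← mul_assoc, h.K_mul_Kinv,
        h.Kinv_mul_K]
    rw [← MulOpposite.op_mul, ← MulOpposite.op_mul, ← MulOpposite.op_smul, mul_neg, e2,
      smul_neg, smul_smul, e, one_smul, neg_mul]
  E_F := by
    have e1 : K * F * (E * Kinv) = F * E := by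
      rw [h.K_F, smul_mul_assoc, mul_assoc, ← mul_assoc K, h.K_E, smul_mul_assoc, mul_smul_comm,
        smul_smul, ← mul_pow, inv_mul_cancel₀ hv, one_pow, one_smul, mul_assoc E, h.K_mul_Kinv,
        mul_one]
    have e2 : E * Kinv * (K * F) = E * F := by
      rw [mul_assoc, ← mul_assoc Kinv, h.Kinv_mul_K, one_mul]
    rw [← MulOpposite.op_mul, ← MulOpposite.op_mul, ← MulOpposite.op_sub, ← MulOpposite.op_sub,
      ← MulOpposite.op_smul, neg_mul_neg, neg_mul_neg, e1, e2]
    congr 1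
    rw [← neg_sub, h.E_F, ← smul_neg, neg_sub]

end IsQuantum

lemma isQuantum_counit {k : Type*} [Field k] (v : k) : IsQuantum v (0 : k) 0 1 1 :=
  ⟨by simp, by simp, by simp, by simp, by simp⟩

namespace Uq
variable {k A : Type*} [Field k] [Ring A] [Algebra k A] (v : k)

lemma adjoin_gen : Algebra.adjoin k (Set.range (Uq.gen v)) = ⊤ :=
  ringQuot_adjoin_range (UqRel v)

lemma isQuantum : IsQuantum v (gen v .E) (gen v .F) (gen v .K) (gen v .Kinv) := by
  have h1 : gen v .K * gen v .Kinv = 1 := by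
    have := RingQuot.mkAlgHom_rel k (UqRel.K_mul_Kinv (v := v))
    rw [map_mul, map_one] at this
    exact this
  have h2 : gen v .Kinv * gen v .K = 1 := by
    have := RingQuot.mkAlgHom_rel k (UqRel.Kinv_mul_K (v := v))
    rw [map_mul, map_one] at this
    exact this
  have h3 : gen v .K * gen v .E * gen v .Kinv = v ^ 2 • gen v .E := by
    have := RingQuot.mkAlgHom_rel k (UqRel.K_E (v := v))
    rw [map_mul, map_mul, map_smul] at this
    exact this
  have h4 : gen v .K * gen v .F * gen v .Kinv = v⁻¹ ^ 2 • gen v .F := by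
    have := RingQuot.mkAlgHom_rel k (UqRel.K_F (v := v))
    rw [map_mul, map_mul, map_smul] at this
    exact this
  refine ⟨h1, h2, ?_, ?_, ?_⟩
  · rw [← smul_mul_assoc, ← h3, mul_assoc _ (gen v .Kinv), h2, mul_one]
  · rw [← smul_mul_assoc, ← h4, mul_assoc _ (gen v .Kinv), h2, mul_one]
  · have := RingQuot.mkAlgHom_rel k (UqRel.E_F (v := v))
    rw [map_sub, map_mul, map_mul, map_smul, map_sub] at this
    exact this

variable {v} {E F K Kinv : A}

/-- The values of a map on the generators. -/
def genValue (E F K Kinv : A) : QGen → A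
  | .E => E
  | .F => F
  | .K => K
  | .Kinv => Kinv

lemma lift_rel (h : IsQuantum v E F K Kinv) ⦃x y : FreeAlgebra k QGen⦄ (hxy : UqRel v x y) :
    FreeAlgebra.lift k (genValue E F K Kinv) x = FreeAlgebra.lift k (genValue E F K Kinv) y := by
  induction hxy with
  | K_mul_Kinv => simp [genValue, h.K_mul_Kinv]
  | Kinv_mul_K => simp [genValue, h.Kinv_mul_K]
  | K_E =>
    simp only [map_mul, map_smul, FreeAlgebra.lift_ι_apply, genValue]
    rw [h.K_E, smul_mul_assoc, mul_assoc, h.K_mul_Kinv, mul_one]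
  | K_F =>
    simp only [map_mul, map_smul, FreeAlgebra.lift_ι_apply, genValue]
    rw [h.K_F, smul_mul_assoc, mul_assoc, h.K_mul_Kinv, mul_one]
  | E_F => simp [genValue, h.E_F]

/-- The map from `U_v` given by elements that satisfy the relations. -/
def lift (h : IsQuantum v E F K Kinv) : Uq v →ₐ[k] A :=
  RingQuot.liftAlgHom k ⟨FreeAlgebra.lift k (genValue E F K Kinv), lift_rel h⟩

lemma lift_gen (h : IsQuantum v E F K Kinv) (g : QGen) :
    lift h (gen v g) = genValue E F K Kinv g := by
  rw [lift, gen]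
  refine (RingQuot.liftAlgHom_mkAlgHom_apply _ _ _ _).trans ?_
  rw [FreeAlgebra.lift_ι_apply]

variable (v) in
/-- The standard Hopf algebra structure. -/
def hopf (hv : v ≠ 0) : HopfStructure k (Uq v) := by
  have hq := isQuantum v
  refine HopfStructure.ofGenerators _ (adjoin_gen v) (lift (hq.tensor hv)) (lift (isQuantum_counit v))
    (lift (hq.antipodeOp hv)) ?_ ?_ ?_ ?_ ?_
  · rintro _ ⟨g, rfl⟩
    cases g <;> simp [lift_gen, genValue, TensorProduct.tmul_add, TensorProduct.add_tmul,
      Algebra.TensorProduct.one_def, add_assoc]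
  · rintro _ ⟨g, rfl⟩
    cases g <;> simp [lift_gen, genValue]
  · rintro _ ⟨g, rfl⟩
    cases g <;> simp [lift_gen, genValue]
  · rintro _ ⟨g, rfl⟩
    cases g <;> simp [lift_gen, genValue, hq.K_mul_Kinv, hq.Kinv_mul_K, mul_assoc]
  · rintro _ ⟨g, rfl⟩
    cases g <;> simp [lift_gen, genValue, hq.K_mul_Kinv, hq.Kinv_mul_K, ← mul_assoc]

lemma hopf_comul_gen (hv : v ≠ 0) (g : QGen) : (hopf v hv).comul (gen v g) =
    genValue (1 ⊗ₜ[k] gen v .E + gen v .E ⊗ₜ[k] gen v .K)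
      (gen v .Kinv ⊗ₜ[k] gen v .F + gen v .F ⊗ₜ[k] 1) (gen v .K ⊗ₜ[k] gen v .K)
      (gen v .Kinv ⊗ₜ[k] gen v .Kinv) g :=
  lift_gen ((isQuantum v).tensor hv) g

lemma hopf_counit_gen (hv : v ≠ 0) (g : QGen) :
    (hopf v hv).counit (gen v g) = genValue 0 0 1 1 g :=
  lift_gen (isQuantum_counit v) g

lemma hopf_antipode_gen (hv : v ≠ 0) (g : QGen) : (hopf v hv).antipode (gen v g) =
    genValue (-(gen v .E * gen v .Kinv)) (-(gen v .K * gen v .F)) (gen v .Kinv) (gen v .K) g := by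
  have := lift_gen ((isQuantum v).antipodeOp hv) g
  change (lift ((isQuantum v).antipodeOp hv) (gen v g)).unop = _
  rw [this]
  cases g <;> rfl

lemma hopf_hasQuantumValues (hv : v ≠ 0) :
    HasQuantumValues (hopf v hv) (gen v .E) (gen v .F) (gen v .K) (gen v .Kinv) where
  comul_E := hopf_comul_gen hv .E
  comul_F := hopf_comul_gen hv .F
  comul_K := hopf_comul_gen hv .K
  antipode_E := hopf_antipode_gen hv .E
  antipode_F := hopf_antipode_gen hv .F
  antipode_K := hopf_antipode_gen hv .K
  counit_E := hopf_counit_gen hv .E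
  counit_F := hopf_counit_gen hv .F
  counit_K := hopf_counit_gen hv .K

end Uq

/-! ### The form with divided powers as a Hopf algebra over the local ring -/

local instance (a : ℂ) : CommRing (regularAt a) := inferInstance
local instance (a : ℂ) : CommSemiring (regularAt a) := inferInstance
local instance (a : ℂ) : Algebra (regularAt a) (RatFunc ℂ) := inferInstance
local instance (a : ℂ) : Algebra (regularAt a) Ugen := inferInstance
local instance (a : ℂ) : IsScalarTower (regularAt a) (RatFunc ℂ) Ugen := inferInstance
local instance (p : ℕ) : Ring (DividedForm p) := inferInstance
local instance (p : ℕ) : Semiring (DividedForm p) := inferInstance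
local instance (p : ℕ) : AddCommMonoid (DividedForm p) := inferInstance
local instance (p : ℕ) : Algebra (regularAt (qRoot p)) (DividedForm p) := inferInstance
local instance (p : ℕ) : Module (regularAt (qRoot p)) (DividedForm p) := inferInstance
local instance (p : ℕ) : Ring (DividedForm p ⊗[regularAt (qRoot p)] DividedForm p) := inferInstance
local instance : Ring (Ugen ⊗[RatFunc ℂ] Ugen) := inferInstance
local instance : Algebra (RatFunc ℂ) (Ugen ⊗[RatFunc ℂ] Ugen) := inferInstance

open Classical in
/-- A rational function regular at `qRoot p` as an element of the local ring. -/
def reg (p : ℕ) (x : RatFunc ℂ) : regularAt (qRoot p) :=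
  if h : x ∈ regularAt (qRoot p) then ⟨x, h⟩ else 0

lemma Specializes.coe_reg {p : ℕ} {x : RatFunc ℂ} {c : ℂ} (h : Specializes (qRoot p) x c) :
    (reg p x : RatFunc ℂ) = x := by
  rw [reg, dif_pos h.mem]

lemma Specializes.algebraMap_reg {p : ℕ} {x : RatFunc ℂ} {c : ℂ}
    (h : Specializes (qRoot p) x c) : algebraMap (regularAt (qRoot p)) ℂ (reg p x) = c := by
  rw [reg, dif_pos h.mem, h.algebraMap_eq]

namespace DividedForm
variable (p : ℕ)

def E : DividedForm p := ⟨Ugen.E, Algebra.subset_adjoin (by simp)⟩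
def F : DividedForm p := ⟨Ugen.F, Algebra.subset_adjoin (by simp)⟩
def K : DividedForm p := ⟨Ugen.K, Algebra.subset_adjoin (by simp)⟩
def Kinv : DividedForm p := ⟨Ugen.Kinv, Algebra.subset_adjoin (by simp)⟩
def e : DividedForm p := ⟨Ugen.e p, Algebra.subset_adjoin (by simp)⟩
def f : DividedForm p := ⟨Ugen.f p, Algebra.subset_adjoin (by simp)⟩
def h : DividedForm p := ⟨Ugen.h p, Algebra.subset_adjoin (by simp)⟩

@[simp] lemma coe_E : (E p : Ugen) = Ugen.E := rfl
@[simp] lemma coe_F : (F p : Ugen) = Ugen.F := rfl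
@[simp] lemma coe_K : (K p : Ugen) = Ugen.K := rfl
@[simp] lemma coe_Kinv : (Kinv p : Ugen) = Ugen.Kinv := rfl
@[simp] lemma coe_e : (e p : Ugen) = Ugen.e p := rfl
@[simp] lemma coe_f : (f p : Ugen) = Ugen.f p := rfl
@[simp] lemma coe_h : (h p : Ugen) = Ugen.h p := rfl

variable {p}

lemma coe_smul (c : regularAt (qRoot p)) (x : DividedForm p) :
    ((c • x : DividedForm p) : Ugen) = (c : RatFunc ℂ) • (x : Ugen) := rfl

lemma coe_reg_smul {c : RatFunc ℂ} {d : ℂ} (hc : Specializes (qRoot p) c d) (x : DividedForm p) :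
    ((reg p c • x : DividedForm p) : Ugen) = c • (x : Ugen) := by
  rw [coe_smul, hc.coe_reg]

lemma adjoin_eq_top : Algebra.adjoin (regularAt (qRoot p))
    ({E p, F p, K p, Kinv p, e p, f p, h p} : Set (DividedForm p)) = ⊤ := by
  have := Algebra.adjoin_adjoin_coe_preimage (R := regularAt (qRoot p))
    (s := ({Ugen.E, Ugen.F, Ugen.K, Ugen.Kinv, Ugen.e p, Ugen.f p, Ugen.h p} : Set Ugen))
  refine Eq.trans ?_ this
  congr 1
  ext x
  simp only [Set.mem_insert_iff, Set.mem_singleton_iff, Subtype.ext_iff]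
  rfl

lemma induction {P : DividedForm p → Prop} (hE : P (E p)) (hF : P (F p)) (hK : P (K p))
    (hKinv : P (Kinv p)) (he : P (e p)) (hf : P (f p)) (hh : P (h p))
    (hr : ∀ r, P (algebraMap (regularAt (qRoot p)) _ r)) (hadd : ∀ x y, P x → P y → P (x + y))
    (hmul : ∀ x y, P x → P y → P (x * y)) (x : DividedForm p) : P x := by
  have hx : x ∈ Algebra.adjoin (regularAt (qRoot p))
    ({E p, F p, K p, Kinv p, e p, f p, h p} : Set (DividedForm p)) :=
      adjoin_eq_top (p := p) ▸ Algebra.mem_top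
  induction hx using Algebra.adjoin_induction with
  | mem x hx =>
    rcases hx with rfl | rfl | rfl | rfl | rfl | rfl | rfl
    exacts [hE, hF, hK, hKinv, he, hf, hh]
  | algebraMap r => exact hr r
  | add x y _ _ hx hy => exact hadd x y hx hy
  | mul x y _ _ hx hy => exact hmul x y hx hy

variable (p) in
/-- The divided power of `E`. -/
def dE (r : ℕ) : DividedForm p :=
  -- Below `p` the quantum factorial is a unit at `q`. For `r = p` it is not, and the generator `e`
  -- is used instead. The values for `r > p` have no meaning.
  if r < p then reg p (qFact RatFunc.X r)⁻¹ • E p ^ r else Kinv p ^ p * e p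

variable (p) in
/-- The divided power of `F`. -/
def dF (r : ℕ) : DividedForm p :=
  if r < p then reg p (qFact RatFunc.X r)⁻¹ • F p ^ r else (-1) ^ p * f p

lemma specializes_qFact_inv (hp : 2 ≤ p) {r : ℕ} (hr : r < p) :
    Specializes (qRoot p) (qFact RatFunc.X r)⁻¹ (qFact (qRoot p) r)⁻¹ :=
  (specializes_qFact hp r).inv (qFact_qRoot_ne_zero hp hr)

lemma Kinv_pow_mul_K_pow (n : ℕ) : (Ugen.Kinv : Ugen) ^ n * Ugen.K ^ n = 1 := by
  have hq := Uq.isQuantum (RatFunc.X : RatFunc ℂ)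
  rw [← hq.commute_K_Kinv.symm.mul_pow, hq.Kinv_mul_K, one_pow]

lemma coe_dE (hp : 2 ≤ p) {r : ℕ} (hr : r ≤ p) :
    (dE p r : Ugen) = dpow (RatFunc.X : RatFunc ℂ) Ugen.E r := by
  rw [dE]
  split_ifs with h
  · rw [coe_reg_smul (specializes_qFact_inv hp h), dpow]
    rfl
  · obtain rfl : r = p := by omega
    change Ugen.Kinv ^ r * Ugen.e r = _
    rw [Ugen.e, mul_smul_comm, ← mul_assoc, Kinv_pow_mul_K_pow, one_mul, dpow]

lemma coe_dF (hp : 2 ≤ p) {r : ℕ} (hr : r ≤ p) :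
    (dF p r : Ugen) = dpow (RatFunc.X : RatFunc ℂ) Ugen.F r := by
  rw [dF]
  split_ifs with h
  · rw [coe_reg_smul (specializes_qFact_inv hp h), dpow]
    rfl
  · obtain rfl : r = p := by omega
    change (-1) ^ r * Ugen.f r = _
    have h2 : ∀ x : Ugen, (-1 : Ugen) ^ r * x = (-1 : RatFunc ℂ) ^ r • x := by
      intro x
      rcases Nat.even_or_odd r with h3 | h3 <;> simp [h3.neg_one_pow]
    rw [Ugen.f, h2, smul_smul, ← mul_div_assoc, ← mul_pow, neg_mul_neg, one_mul, one_pow, one_div,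
      dpow]

/-- The comultiplication of the divided power `e`. -/
def comulE (p : ℕ) : DividedForm p ⊗[regularAt (qRoot p)] DividedForm p :=
  ∑ r ∈ Finset.range (p + 1), reg p (RatFunc.X ^ (r * (p - r))) •
    ((K p ^ p * dE p (p - r)) ⊗ₜ (K p ^ p * (dE p r * K p ^ (p - r))))

/-- The comultiplication of the divided power `f`. -/
def comulF (p : ℕ) : DividedForm p ⊗[regularAt (qRoot p)] DividedForm p :=
  ∑ r ∈ Finset.range (p + 1), reg p ((-1) ^ p * RatFunc.X ^ (r * (p - r))) •
    ((dF p r * Kinv p ^ (p - r)) ⊗ₜ dF p (p - r))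

lemma coe_neg_one_pow_ratFunc (p : ℕ) :
    Specializes (qRoot p) ((-1 : RatFunc ℂ) ^ p) ((-1) ^ p) := by
  simpa using (Specializes.C (a := qRoot p) (-1 : ℂ)).pow p

variable (p) in
/-- The inclusion of the form with divided powers. -/
abbrev incl : DividedForm p →ₐ[regularAt (qRoot p)] Ugen := (DividedForm p).val

lemma dpow_tmul_left (x y : Ugen) (r : ℕ) :
    dpow (RatFunc.X : RatFunc ℂ) (x ⊗ₜ[RatFunc ℂ] y) r = (dpow (RatFunc.X : RatFunc ℂ) x r) ⊗ₜ (y ^ r) := by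
  simp only [dpow, Algebra.TensorProduct.tmul_pow, TensorProduct.smul_tmul']

lemma dpow_tmul_right (x y : Ugen) (r : ℕ) :
    dpow (RatFunc.X : RatFunc ℂ) (x ⊗ₜ[RatFunc ℂ] y) r = (x ^ r) ⊗ₜ (dpow (RatFunc.X : RatFunc ℂ) y r) := by
  simp only [dpow, Algebra.TensorProduct.tmul_pow, TensorProduct.tmul_smul]

/-- The standard Hopf structure on the generic quantum group. -/
abbrev genHopf : HopfStructure (RatFunc ℂ) Ugen := Uq.hopf RatFunc.X RatFunc.X_ne_zero

lemma tensorMap_incl_smul (c : regularAt (qRoot p)) (x y : DividedForm p) :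
    tensorMap (RatFunc ℂ) (incl p) (incl p) (c • (x ⊗ₜ y)) =
      (c : RatFunc ℂ) • ((x : Ugen) ⊗ₜ[RatFunc ℂ] (y : Ugen)) := by
  rw [tensorMap_smul_tmul]
  rfl

/-- The elements `1 ⊗ E` and `E ⊗ K` commute up to `v²`, so the quantum binomial theorem expands the
divided power of their sum. It involves only divided powers of order at most `p`, all of which lie
in the form. -/
lemma tensorMap_comulE (hp : 2 ≤ p) :
    tensorMap (RatFunc ℂ) (incl p) (incl p) (comulE p) = genHopf.comul (Ugen.e p) := by
  have hq := Uq.isQuantum (RatFunc.X : RatFunc ℂ)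
  have h1 : genHopf.comul (Ugen.e p) = (Ugen.K ⊗ₜ Ugen.K) ^ p *
      dpow (RatFunc.X : RatFunc ℂ) (1 ⊗ₜ[RatFunc ℂ] Ugen.E + Ugen.E ⊗ₜ[RatFunc ℂ] Ugen.K) p := by
    rw [Ugen.e, map_smul, map_mul, map_pow, map_pow, Uq.hopf_comul_gen, Uq.hopf_comul_gen, dpow,
      mul_smul_comm]
    rfl
  rw [h1, dpow_add _ RatFunc.X_ne_zero (fun n => qInt_X_ne_zero (by omega)), comulE, tensorMap_sum,
    Finset.mul_sum]
  · refine Finset.sum_congr rfl fun r hr => ?_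
    have hr' : r ≤ p := by simpa [Nat.lt_succ_iff] using hr
    rw [tensorMap_incl_smul, (Specializes.X.pow _).coe_reg, mul_smul_comm, dpow_tmul_right,
      dpow_tmul_left, one_pow, Algebra.TensorProduct.tmul_mul_tmul, one_mul,
      Algebra.TensorProduct.tmul_pow, Algebra.TensorProduct.tmul_mul_tmul,
      ← coe_dE hp hr', ← coe_dE hp (Nat.sub_le p r)]
    rfl
  · simp only [Algebra.TensorProduct.tmul_mul_tmul, one_mul, mul_one, hq.K_E,
      TensorProduct.tmul_smul]

lemma tensorMap_comulF (hp : 2 ≤ p) :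
    tensorMap (RatFunc ℂ) (incl p) (incl p) (comulF p) = genHopf.comul (Ugen.f p) := by
  have hq := Uq.isQuantum (RatFunc.X : RatFunc ℂ)
  have h1 : genHopf.comul (Ugen.f p) = (-1 : RatFunc ℂ) ^ p •
      dpow (RatFunc.X : RatFunc ℂ) (Ugen.F ⊗ₜ[RatFunc ℂ] 1 + Ugen.Kinv ⊗ₜ[RatFunc ℂ] Ugen.F) p := by
    rw [Ugen.f, map_smul, map_pow, Uq.hopf_comul_gen, dpow, smul_smul, div_eq_mul_inv,
      add_comm (Ugen.F ⊗ₜ[RatFunc ℂ] (1 : Ugen))]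
    rfl
  rw [h1, dpow_add _ RatFunc.X_ne_zero (fun n => qInt_X_ne_zero (by omega)), comulF, tensorMap_sum,
    Finset.smul_sum]
  · refine Finset.sum_congr rfl fun r hr => ?_
    have hr' : r ≤ p := by simpa [Nat.lt_succ_iff] using hr
    rw [tensorMap_incl_smul, ((coe_neg_one_pow_ratFunc p).mul (Specializes.X.pow _)).coe_reg,
      mul_smul, dpow_tmul_left Ugen.F,
      dpow_tmul_right Ugen.Kinv, one_pow, Algebra.TensorProduct.tmul_mul_tmul, one_mul,
      ← coe_dF hp hr', ← coe_dF hp (Nat.sub_le p r)]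
    rfl
  · simp only [Algebra.TensorProduct.tmul_mul_tmul, one_mul, mul_one,
      hq.Kinv_F RatFunc.X_ne_zero, TensorProduct.smul_tmul']

lemma E_mul_Kinv_pow (n : ℕ) : ((Ugen.E : Ugen) * Ugen.Kinv) ^ n =
    (RatFunc.X⁻¹ : RatFunc ℂ) ^ (n * (n - 1)) • (Ugen.E ^ n * Ugen.Kinv ^ n) := by
  have hq := (Uq.isQuantum (RatFunc.X : RatFunc ℂ)).Kinv_E RatFunc.X_ne_zero
  have h1 : ∀ n : ℕ, (Ugen.Kinv : Ugen) * Ugen.E ^ n =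
      (RatFunc.X⁻¹ : RatFunc ℂ) ^ (2 * n) • (Ugen.E ^ n * Ugen.Kinv) := by
    intro n
    induction n with
    | zero => simp
    | succ n ih =>
      rw [pow_succ, ← mul_assoc, ih, smul_mul_assoc, mul_assoc, hq, mul_smul_comm, smul_smul,
        ← pow_add, ← mul_assoc, mul_add, mul_one]
  induction n with
  | zero => simp
  | succ n ih =>
    rw [pow_succ', ih, mul_smul_comm, mul_assoc, ← mul_assoc Ugen.Kinv, h1, smul_mul_assoc,
      mul_smul_comm, smul_smul, ← pow_add, mul_assoc (Ugen.E ^ n), ← pow_succ', ← mul_assoc,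
      ← pow_succ']
    congr 2
    rcases n with _ | n
    · rfl
    · simp only [Nat.add_sub_cancel]; ring

lemma K_mul_F_pow (n : ℕ) : ((Ugen.K : Ugen) * Ugen.F) ^ n =
    (RatFunc.X : RatFunc ℂ) ^ (n * (n - 1)) • (Ugen.K ^ n * Ugen.F ^ n) := by
  have hq := (Uq.isQuantum (RatFunc.X : RatFunc ℂ)).K_F
  have h0 : (Ugen.F : Ugen) * Ugen.K = (RatFunc.X : RatFunc ℂ) ^ 2 • (Ugen.K * Ugen.F) := by
    rw [hq, smul_smul, ← mul_pow, mul_inv_cancel₀ RatFunc.X_ne_zero, one_pow, one_smul]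
  have h1 : ∀ n : ℕ, (Ugen.F : Ugen) * Ugen.K ^ n =
      (RatFunc.X : RatFunc ℂ) ^ (2 * n) • (Ugen.K ^ n * Ugen.F) := by
    intro n
    induction n with
    | zero => simp
    | succ n ih =>
      rw [pow_succ, ← mul_assoc, ih, smul_mul_assoc, mul_assoc, h0, mul_smul_comm, smul_smul,
        ← pow_add, ← mul_assoc, mul_add, mul_one]
  induction n with
  | zero => simp
  | succ n ih =>
    rw [pow_succ', ih, mul_smul_comm, mul_assoc, ← mul_assoc Ugen.F, h1, smul_mul_assoc,
      mul_smul_comm, smul_smul, ← pow_add, mul_assoc (Ugen.K ^ n), ← pow_succ', ← mul_assoc,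
      ← pow_succ']
    congr 2
    rcases n with _ | n
    · rfl
    · simp only [Nat.add_sub_cancel]; ring

lemma specializes_antipodeE (p : ℕ) : Specializes (qRoot p)
    ((-1) ^ p * RatFunc.X⁻¹ ^ (p * (p - 1))) ((-1) ^ p * (qRoot p)⁻¹ ^ (p * (p - 1))) :=
  (coe_neg_one_pow_ratFunc p).mul (specializes_X_inv.pow _)

lemma specializes_antipodeF (p : ℕ) : Specializes (qRoot p)
    ((-1) ^ p * RatFunc.X ^ (p * (p - 1))) ((-1) ^ p * qRoot p ^ (p * (p - 1))) :=
  (coe_neg_one_pow_ratFunc p).mul (Specializes.X.pow _)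

/-- The antipode of the divided power `e`. -/
def antipodeE (p : ℕ) : DividedForm p :=
  reg p ((-1) ^ p * RatFunc.X⁻¹ ^ (p * (p - 1))) •
    (Kinv p ^ p * e p * Kinv p ^ p * Kinv p ^ p)

/-- The antipode of the divided power `f`. -/
def antipodeF (p : ℕ) : DividedForm p :=
  reg p ((-1) ^ p * RatFunc.X ^ (p * (p - 1))) • (K p ^ p * f p)

lemma neg_pow_ugen (x : Ugen) (n : ℕ) : (-x) ^ n = (-1 : RatFunc ℂ) ^ n • x ^ n := by
  rw [← neg_one_smul (RatFunc ℂ) x, smul_pow]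

lemma coe_antipodeE : (antipodeE p : Ugen) = genHopf.antipode (Ugen.e p) := by
  rw [antipodeE, coe_reg_smul (specializes_antipodeE p), Ugen.e, map_smul, genHopf.antipode_mul,
    genHopf.antipode_pow, genHopf.antipode_pow, Uq.hopf_antipode_gen, Uq.hopf_antipode_gen]
  change (_ : RatFunc ℂ) • (Ugen.Kinv ^ p * Ugen.e p * Ugen.Kinv ^ p * Ugen.Kinv ^ p : Ugen) =
    (_ : RatFunc ℂ) • ((-(Ugen.E * Ugen.Kinv)) ^ p * Ugen.Kinv ^ p)
  rw [neg_pow_ugen, E_mul_Kinv_pow, Ugen.e, mul_smul_comm, ← mul_assoc, Kinv_pow_mul_K_pow,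
    one_mul]
  simp only [smul_mul_assoc, smul_smul, mul_assoc]
  congr 1
  ring

lemma coe_antipodeF : (antipodeF p : Ugen) = genHopf.antipode (Ugen.f p) := by
  rw [antipodeF, coe_reg_smul (specializes_antipodeF p), Ugen.f, map_smul,
    genHopf.antipode_pow, Uq.hopf_antipode_gen]
  change (_ : RatFunc ℂ) • (Ugen.K ^ p * Ugen.f p : Ugen) = (_ : RatFunc ℂ) • (-(Ugen.K * Ugen.F)) ^ p
  rw [neg_pow_ugen, K_mul_F_pow, Ugen.f]
  simp only [mul_smul_comm, smul_smul, mul_assoc]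
  congr 1
  ring

lemma specializes_half (p : ℕ) : Specializes (qRoot p) (1 / 2) (1 / 2) := by
  simpa using (Specializes.natCast (a := qRoot p) 2).inv (by norm_num)

lemma h_eq : h p = reg p (1 / 2) • (e p * f p - f p * e p) := by
  apply Subtype.ext
  rw [coe_reg_smul (specializes_half p)]
  rfl

lemma incl_injective : Function.Injective (incl p) := Subtype.val_injective

/-- The form is stable under comultiplication, counit and antipode because its generators are: `e`
and `f` by the binomial expansions and the explicit antipodes, `h` as half a commutator. Flatness
gives the injectivity of tensor square and cube needed to restrict the structure. -/
theorem exists_hopf (hp : 2 ≤ p) :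
    ∃ HD : HopfStructure (regularAt (qRoot p)) (DividedForm p), HD.IsSemiHom genHopf (incl p) := by
  have h1 : ∀ {x y : Ugen}, (∃ t, tensorMap (RatFunc ℂ) (incl p) (incl p) t = genHopf.comul x) →
      (∃ t, tensorMap (RatFunc ℂ) (incl p) (incl p) t = genHopf.comul y) →
      ∃ t, tensorMap (RatFunc ℂ) (incl p) (incl p) t =
        genHopf.comul ((1 / 2 : RatFunc ℂ) • (x * y - y * x)) := by
    rintro x y ⟨s, hs⟩ ⟨t, ht⟩
    refine ⟨reg p (1 / 2) • (s * t - t * s), ?_⟩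
    rw [tensorMap_smul_commutator, hs, ht, map_smul, map_sub, map_mul, map_mul]
    congr 1
    exact (specializes_half p).coe_reg
  have hε : ∀ x : Ugen, genHopf.counit x = 0 →
      ∃ c, algebraMap (regularAt (qRoot p)) (RatFunc ℂ) c = genHopf.counit x :=
    fun x hx => ⟨0, by rw [hx, map_zero]⟩
  have hp0 : p ≠ 0 := by omega
  have hεe : genHopf.counit (Ugen.e p) = 0 := by
    rw [Ugen.e, map_smul, map_mul, map_pow _ Ugen.E, Uq.hopf_counit_gen _ .E]
    simp [Uq.genValue, hp0]
  have hεf : genHopf.counit (Ugen.f p) = 0 := by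
    rw [Ugen.f, map_smul, map_pow, Uq.hopf_counit_gen]
    simp [Uq.genValue, hp0]
  refine HopfStructure.exists_restrict (incl p) genHopf incl_injective
    (IsFractionRing.injective _ _) (tensorMap_injective _ _ incl_injective incl_injective)
    (tensorMap_injective _ _ incl_injective
      (tensorMap_injective _ _ incl_injective incl_injective)) _ adjoin_eq_top ?_ ?_ ?_
  · rintro x (rfl | rfl | rfl | rfl | rfl | rfl | rfl)
    · exact ⟨1 ⊗ₜ E p + E p ⊗ₜ K p, by
        rw [tensorMap_add, tensorMap_tmul, tensorMap_tmul]
        exact (Uq.hopf_comul_gen RatFunc.X_ne_zero .E).symm⟩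
    · exact ⟨Kinv p ⊗ₜ F p + F p ⊗ₜ 1, by
        rw [tensorMap_add, tensorMap_tmul, tensorMap_tmul]
        exact (Uq.hopf_comul_gen RatFunc.X_ne_zero .F).symm⟩
    · exact ⟨K p ⊗ₜ K p, by
        rw [tensorMap_tmul]
        exact (Uq.hopf_comul_gen RatFunc.X_ne_zero .K).symm⟩
    · exact ⟨Kinv p ⊗ₜ Kinv p, by
        rw [tensorMap_tmul]
        exact (Uq.hopf_comul_gen RatFunc.X_ne_zero .Kinv).symm⟩
    · exact ⟨_, tensorMap_comulE hp⟩
    · exact ⟨_, tensorMap_comulF hp⟩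
    · exact h1 ⟨_, tensorMap_comulE hp⟩ ⟨_, tensorMap_comulF hp⟩
  · rintro x (rfl | rfl | rfl | rfl | rfl | rfl | rfl)
    · exact hε _ (Uq.hopf_counit_gen RatFunc.X_ne_zero .E)
    · exact hε _ (Uq.hopf_counit_gen RatFunc.X_ne_zero .F)
    · exact ⟨1, by rw [map_one]; exact (Uq.hopf_counit_gen RatFunc.X_ne_zero .K).symm⟩
    · exact ⟨1, by rw [map_one]; exact (Uq.hopf_counit_gen RatFunc.X_ne_zero .Kinv).symm⟩
    · exact hε _ hεe
    · exact hε _ hεf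
    · refine hε _ ?_
      change genHopf.counit (Ugen.h p) = 0
      rw [Ugen.h, map_smul, map_sub, map_mul, map_mul, hεe, hεf]
      simp
  · rintro x (rfl | rfl | rfl | rfl | rfl | rfl | rfl)
    · exact ⟨-(E p * Kinv p), (Uq.hopf_antipode_gen RatFunc.X_ne_zero .E).symm⟩
    · exact ⟨-(K p * F p), (Uq.hopf_antipode_gen RatFunc.X_ne_zero .F).symm⟩
    · exact ⟨Kinv p, (Uq.hopf_antipode_gen RatFunc.X_ne_zero .K).symm⟩
    · exact ⟨K p, (Uq.hopf_antipode_gen RatFunc.X_ne_zero .Kinv).symm⟩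
    · exact ⟨antipodeE p, coe_antipodeE⟩
    · exact ⟨antipodeF p, coe_antipodeF⟩
    · refine ⟨reg p (1 / 2) • (antipodeF p * antipodeE p - antipodeE p * antipodeF p), ?_⟩
      change ((reg p (1 / 2) • (antipodeF p * antipodeE p - antipodeE p * antipodeF p) :
        DividedForm p) : Ugen) = genHopf.antipode (Ugen.h p)
      rw [coe_reg_smul (specializes_half p), Ugen.h, map_smul, map_sub, genHopf.antipode_mul,
        genHopf.antipode_mul, ← coe_antipodeE, ← coe_antipodeF]
      rfl

end DividedForm

/-! ### Weight vectors in the restricted quantum group -/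

/-- The elements satisfy the relations of the restricted quantum group. -/
structure IsRestricted {A : Type*} [Ring A] [Algebra ℂ A] (p : ℕ) (E F K Kinv : A) : Prop where
  quantum : IsQuantum (qRoot p) E F K Kinv
  E_pow : E ^ p = 0
  F_pow : F ^ p = 0
  K_pow : K ^ (2 * p) = 1

/-- `q ^ n + q ^ (-n)`. -/
def betaZ (p : ℕ) (n : ℤ) : ℂ := qRoot p ^ n + qRoot p ^ (-n)

lemma betaZ_neg (p : ℕ) (n : ℤ) : betaZ p (-n) = betaZ p n := by
  rw [betaZ, betaZ, neg_neg, add_comm]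

lemma betaZ_natCast (p n : ℕ) : betaZ p n = qRoot p ^ n + (qRoot p)⁻¹ ^ n := by
  simp [betaZ]

lemma betaZ_eq_of_dvd {p : ℕ} (hp : 2 ≤ p) {m n : ℤ} (h : (2 * p : ℤ) ∣ m - n) :
    betaZ p m = betaZ p n := by
  have h2 : (2 * p : ℤ) ∣ -m - -n := by
    obtain ⟨c, hc⟩ := h
    exact ⟨-c, by linear_combination -hc⟩
  rw [betaZ, betaZ, (qRoot_zpow_eq_iff hp m n).2 h, (qRoot_zpow_eq_iff hp _ _).2 h2]

lemma betaZ_sub {p : ℕ} (hp : 2 ≤ p) (a r : ℤ) : betaZ p a - betaZ p (a + 2 * r) =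
    -((qRoot p - (qRoot p)⁻¹) ^ 2) * (qZ (qRoot p) r * qZ (qRoot p) (a + r)) := by
  have hd := qRoot_sub_inv_ne_zero hp
  have hq := qRoot_ne_zero p
  rw [qZ, qZ, div_mul_div_comm, ← sq, neg_mul, mul_div_cancel₀ _ (pow_ne_zero 2 hd), betaZ, betaZ]
  have e : qRoot p ^ (a + 2 * r) = qRoot p ^ a * (qRoot p ^ r * qRoot p ^ r) := by
    rw [← zpow_add₀ hq, ← zpow_add₀ hq]; congr 1; ring
  have e2 : qRoot p ^ (-(a + 2 * r)) = (qRoot p ^ a)⁻¹ * ((qRoot p ^ r)⁻¹ * (qRoot p ^ r)⁻¹) := by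
    rw [zpow_neg, e, mul_inv, mul_inv]
  rw [e, e2, neg_add, zpow_add₀ hq, zpow_add₀ hq, zpow_neg, zpow_neg]
  have h1 := zpow_ne_zero a hq
  have h2 := zpow_ne_zero r hq
  field_simp
  ring

namespace IsRestricted
variable {A : Type*} [Ring A] [Algebra ℂ A] {p : ℕ} {E F K Kinv : A}

section
variable (h : IsRestricted p E F K Kinv)
include h

lemma commute_casimir_E (hp : 2 ≤ p) : Commute (casimir p E F K Kinv) E := by
  have hq := h.quantum
  have e1 : F * E = E * F - (qRoot p - (qRoot p)⁻¹)⁻¹ • (K - Kinv) := by rw [← hq.E_F]; abel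
  have hd := qRoot_sub_inv_ne_zero hp
  rw [commute_iff_eq]
  simp only [casimir, add_mul, mul_add, smul_mul_assoc, mul_smul_comm, mul_assoc, hq.K_E,
    hq.Kinv_E (qRoot_ne_zero p), e1, mul_sub, smul_sub, smul_smul]
  have e2 : (qRoot p - (qRoot p)⁻¹) ^ 2 * (qRoot p - (qRoot p)⁻¹)⁻¹ = qRoot p - (qRoot p)⁻¹ := by
    rw [sq, mul_assoc, mul_inv_cancel₀ hd, mul_one]
  have hq0 := qRoot_ne_zero p
  have e3 : (qRoot p)⁻¹ * qRoot p ^ 2 = qRoot p := by field_simp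
  have e4 : qRoot p * (qRoot p)⁻¹ ^ 2 = (qRoot p)⁻¹ := by field_simp
  rw [e2, e3, e4, sub_smul, sub_smul]
  abel

lemma commute_casimir_F (hp : 2 ≤ p) : Commute (casimir p E F K Kinv) F := by
  have hq := h.quantum
  have e1 : F * E = E * F - (qRoot p - (qRoot p)⁻¹)⁻¹ • (K - Kinv) := by rw [← hq.E_F]; abel
  have hd := qRoot_sub_inv_ne_zero hp
  rw [commute_iff_eq]
  have e2 : (qRoot p - (qRoot p)⁻¹) ^ 2 * (qRoot p - (qRoot p)⁻¹)⁻¹ = qRoot p - (qRoot p)⁻¹ := by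
    rw [sq, mul_assoc, mul_inv_cancel₀ hd, mul_one]
  have e5 : F * (E * F) = E * (F * F) - (qRoot p - (qRoot p)⁻¹)⁻¹ • (K * F - Kinv * F) := by
    rw [← mul_assoc, e1, sub_mul, smul_mul_assoc, sub_mul, mul_assoc]
  have hq0 := qRoot_ne_zero p
  simp only [casimir, add_mul, mul_add, smul_mul_assoc, mul_smul_comm, mul_assoc, e5, hq.K_F,
    hq.Kinv_F (qRoot_ne_zero p), smul_sub, smul_smul]
  have e3 : (qRoot p)⁻¹ * (qRoot p)⁻¹ ^ 2 = (qRoot p)⁻¹ ^ 3 := by ring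
  have e4 : qRoot p * qRoot p ^ 2 = qRoot p ^ 3 := by ring
  have e6 : (qRoot p - (qRoot p)⁻¹) * (qRoot p)⁻¹ ^ 2 = (qRoot p)⁻¹ - (qRoot p)⁻¹ ^ 3 := by
    field_simp
  have e7 : (qRoot p - (qRoot p)⁻¹) * qRoot p ^ 2 = qRoot p ^ 3 - qRoot p := by
    field_simp
  rw [← mul_assoc (_ ^ 2), ← mul_assoc (_ ^ 2), e2, e3, e4, e6, e7, sub_smul, sub_smul]
  abel

lemma commute_casimir_K : Commute (casimir p E F K Kinv) K := by
  have hq := h.quantum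
  have hq0 := qRoot_ne_zero p
  have e1 : K * (E * F) = E * F * K := by
    rw [← mul_assoc, hq.K_E, smul_mul_assoc, mul_assoc, hq.K_F, mul_smul_comm, smul_smul,
      ← mul_pow, mul_inv_cancel₀ hq0, one_pow, one_smul, mul_assoc]
  rw [commute_iff_eq]
  simp only [casimir, add_mul, mul_add, smul_mul_assoc, mul_smul_comm, e1, hq.K_mul_Kinv,
    hq.Kinv_mul_K]

lemma Kinv_mul_weight {k : ℤ} {z : A} (hz : K * z = qRoot p ^ k • z) :
    Kinv * z = qRoot p ^ (-k) • z := by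
  have : Kinv * (K * z) = qRoot p ^ k • (Kinv * z) := by rw [hz, mul_smul_comm]
  rw [← mul_assoc, h.quantum.Kinv_mul_K, one_mul] at this
  conv_rhs => rw [this]
  rw [smul_smul, zpow_neg, inv_mul_cancel₀ (zpow_ne_zero k (qRoot_ne_zero p)), one_smul]

lemma E_weight {k : ℤ} {z : A} (hz : K * z = qRoot p ^ k • z) :
    K * (E * z) = qRoot p ^ (k + 2) • (E * z) := by
  rw [← mul_assoc, h.quantum.K_E, smul_mul_assoc, mul_assoc, hz, mul_smul_comm, smul_smul,
    ← zpow_natCast, ← zpow_add₀ (qRoot_ne_zero p), add_comm]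
  rfl

lemma F_weight {k : ℤ} {z : A} (hz : K * z = qRoot p ^ k • z) :
    K * (F * z) = qRoot p ^ (k - 2) • (F * z) := by
  rw [← mul_assoc, h.quantum.K_F, smul_mul_assoc, mul_assoc, hz, mul_smul_comm, smul_smul,
    inv_pow, ← zpow_natCast, ← zpow_neg, ← zpow_add₀ (qRoot_ne_zero p), add_comm]
  rfl

lemma E_pow_weight {k : ℤ} {z : A} (hz : K * z = qRoot p ^ k • z) (n : ℕ) :
    K * (E ^ n * z) = qRoot p ^ (k + 2 * n) • (E ^ n * z) := by
  induction n with
  | zero => simpa using hz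
  | succ n ih =>
    rw [pow_succ', mul_assoc, h.E_weight ih]
    congr 2; push_cast; ring

lemma F_pow_weight {k : ℤ} {z : A} (hz : K * z = qRoot p ^ k • z) (n : ℕ) :
    K * (F ^ n * z) = qRoot p ^ (k - 2 * n) • (F ^ n * z) := by
  induction n with
  | zero => simpa using hz
  | succ n ih =>
    rw [pow_succ', mul_assoc, h.F_weight ih]
    congr 2; push_cast; ring

omit h in
lemma K_pow_weight {k : ℤ} {z : A} (hz : K * z = qRoot p ^ k • z) (n : ℕ) :
    K ^ n * z = qRoot p ^ (k * n) • z := by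
  induction n with
  | zero => simp
  | succ n ih =>
    rw [pow_succ', mul_assoc, ih, mul_smul_comm, hz, smul_smul, ← zpow_add₀ (qRoot_ne_zero p)]
    congr 2; push_cast; ring

omit h in
lemma aeval_K_weight {k : ℤ} {z : A} (hz : K * z = qRoot p ^ k • z) (P : Polynomial ℂ) :
    Polynomial.aeval K P * z = P.eval (qRoot p ^ k) • z := by
  induction P using Polynomial.induction_on' with
  | add P Q hP hQ => rw [map_add, add_mul, hP, hQ, Polynomial.eval_add, add_smul]
  | monomial n c =>
    rw [Polynomial.aeval_monomial, Polynomial.eval_monomial, mul_assoc, K_pow_weight hz,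
      ← Algebra.smul_def, smul_smul, zpow_mul, zpow_natCast]

lemma qBracketK_weight {k : ℤ} {z : A} (hz : K * z = qRoot p ^ k • z) :
    qBracketK p K Kinv * z = qZ (qRoot p) (k + 1) • z := by
  rw [qBracketK, smul_mul_assoc, sub_mul, smul_mul_assoc, smul_mul_assoc, hz,
    h.Kinv_mul_weight hz, smul_smul, smul_smul, ← sub_smul, smul_smul, qZ, div_eq_inv_mul,
    neg_add, zpow_add₀ (qRoot_ne_zero p), zpow_add₀ (qRoot_ne_zero p), zpow_one, zpow_neg_one,
    mul_comm (qRoot p) (_ ^ k), mul_comm (qRoot p)⁻¹ (_ ^ (-k))]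

/-- On a vector of weight `q^k` the part of the Casimir element in `K` and `K⁻¹` is the scalar
`β_(k-1)`, so the Casimir element determines `E F`. -/
lemma E_F_weight (hp : 2 ≤ p) {k : ℤ} {z : A} (hz : K * z = qRoot p ^ k • z) :
    E * (F * z) = ((qRoot p - (qRoot p)⁻¹) ^ 2)⁻¹ • (Polynomial.aeval (casimir p E F K Kinv)
      (Polynomial.X - Polynomial.C (betaZ p (k - 1))) * z) := by
  have hd := pow_ne_zero 2 (qRoot_sub_inv_ne_zero hp)
  have e : casimir p E F K Kinv * z = (qRoot p - (qRoot p)⁻¹) ^ 2 • (E * (F * z)) +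
      betaZ p (k - 1) • z := by
    rw [casimir, add_mul, add_mul, smul_mul_assoc, smul_mul_assoc, smul_mul_assoc, hz,
      h.Kinv_mul_weight hz, smul_smul, smul_smul, add_assoc, ← add_smul, mul_assoc, betaZ, neg_sub,
      zpow_sub₀ (qRoot_ne_zero p), sub_eq_add_neg (1 : ℤ), zpow_add₀ (qRoot_ne_zero p), zpow_one,
      div_eq_inv_mul]
  rw [map_sub, Polynomial.aeval_X, Polynomial.aeval_C, sub_mul, e, ← Algebra.smul_def,
    add_sub_cancel_right, smul_smul, inv_mul_cancel₀ hd, one_smul]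

lemma F_E_weight (hp : 2 ≤ p) {k : ℤ} {z : A} (hz : K * z = qRoot p ^ k • z) :
    F * (E * z) = ((qRoot p - (qRoot p)⁻¹) ^ 2)⁻¹ • (Polynomial.aeval (casimir p E F K Kinv)
      (Polynomial.X - Polynomial.C (betaZ p (k + 1))) * z) := by
  have hd1 := qRoot_sub_inv_ne_zero hp
  have hd := pow_ne_zero 2 hd1
  have e1 : F * (E * z) = E * (F * z) - ((qRoot p - (qRoot p)⁻¹)⁻¹ *
      (qRoot p ^ k - qRoot p ^ (-k))) • z := by
    have : F * E = E * F - (qRoot p - (qRoot p)⁻¹)⁻¹ • (K - Kinv) := by rw [← h.quantum.E_F]; abel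
    rw [← mul_assoc, this, sub_mul, smul_mul_assoc, sub_mul, hz, h.Kinv_mul_weight hz, ← sub_smul,
      smul_smul, mul_assoc]
  have hq := qRoot_ne_zero p
  have hk := zpow_ne_zero k hq
  have e2 : betaZ p (k + 1) - betaZ p (k - 1) =
      (qRoot p - (qRoot p)⁻¹) * (qRoot p ^ k - qRoot p ^ (-k)) := by
    simp only [betaZ, neg_add, neg_sub, zpow_add₀ hq, zpow_sub₀ hq, zpow_neg, zpow_one]
    field_simp
    ring
  have e3 : (qRoot p - (qRoot p)⁻¹)⁻¹ * (qRoot p ^ k - qRoot p ^ (-k)) =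
      ((qRoot p - (qRoot p)⁻¹) ^ 2)⁻¹ * (betaZ p (k + 1) - betaZ p (k - 1)) := by
    rw [e2]; field_simp
  rw [e1, e3, h.E_F_weight hp hz, mul_smul, ← smul_sub, map_sub, map_sub, Polynomial.aeval_X,
    Polynomial.aeval_C, Polynomial.aeval_C, sub_mul, sub_mul, ← Algebra.smul_def,
    ← Algebra.smul_def, sub_smul]
  congr 1
  abel

lemma commute_aeval_E (hp : 2 ≤ p) (P : Polynomial ℂ) :
    Commute (Polynomial.aeval (casimir p E F K Kinv) P) E := by
  induction P using Polynomial.induction_on' with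
  | add P Q hP hQ => rw [map_add]; exact hP.add_left hQ
  | monomial n c =>
    rw [Polynomial.aeval_monomial, ← Algebra.smul_def]
    exact ((h.commute_casimir_E hp).pow_left n).smul_left c

lemma commute_aeval_F (hp : 2 ≤ p) (P : Polynomial ℂ) :
    Commute (Polynomial.aeval (casimir p E F K Kinv) P) F := by
  induction P using Polynomial.induction_on' with
  | add P Q hP hQ => rw [map_add]; exact hP.add_left hQ
  | monomial n c =>
    rw [Polynomial.aeval_monomial, ← Algebra.smul_def]
    exact ((h.commute_casimir_F hp).pow_left n).smul_left c

lemma commute_aeval_K (P : Polynomial ℂ) :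
    Commute (Polynomial.aeval (casimir p E F K Kinv) P) K := by
  induction P using Polynomial.induction_on' with
  | add P Q hP hQ => rw [map_add]; exact hP.add_left hQ
  | monomial n c =>
    rw [Polynomial.aeval_monomial, ← Algebra.smul_def]
    exact (h.commute_casimir_K.pow_left n).smul_left c

lemma E_pow_F_pow_weight (hp : 2 ≤ p) {k : ℤ} {z : A} (hz : K * z = qRoot p ^ k • z) (m : ℕ) :
    E ^ m * (F ^ m * z) = ((qRoot p - (qRoot p)⁻¹) ^ 2)⁻¹ ^ m •
      (Polynomial.aeval (casimir p E F K Kinv) (∏ r ∈ Finset.range m,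
        (Polynomial.X - Polynomial.C (betaZ p (k - 1 - 2 * r)))) * z) := by
  induction m with
  | zero => simp
  | succ m ih =>
    have e1 : (k - 2 * m - 1 : ℤ) = k - 1 - 2 * m := by ring
    rw [pow_succ E, pow_succ' F, mul_assoc, mul_assoc, h.E_F_weight hp (h.F_pow_weight hz m),
      mul_smul_comm, ← mul_assoc, ((h.commute_aeval_E hp _).pow_right m).eq.symm, mul_assoc, ih,
      mul_smul_comm, smul_smul, Finset.prod_range_succ, ← mul_assoc, ← map_mul, e1,
      mul_comm (∏ _ ∈ _, _), pow_succ' _⁻¹]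

lemma F_pow_E_pow_weight (hp : 2 ≤ p) {k : ℤ} {z : A} (hz : K * z = qRoot p ^ k • z) (m : ℕ) :
    F ^ m * (E ^ m * z) = ((qRoot p - (qRoot p)⁻¹) ^ 2)⁻¹ ^ m •
      (Polynomial.aeval (casimir p E F K Kinv) (∏ r ∈ Finset.range m,
        (Polynomial.X - Polynomial.C (betaZ p (k + 1 + 2 * r)))) * z) := by
  induction m with
  | zero => simp
  | succ m ih =>
    have e1 : (k + 2 * m + 1 : ℤ) = k + 1 + 2 * m := by ring
    rw [pow_succ F, pow_succ' E, mul_assoc, mul_assoc, h.F_E_weight hp (h.E_pow_weight hz m),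
      mul_smul_comm, ← mul_assoc, ((h.commute_aeval_F hp _).pow_right m).eq.symm, mul_assoc, ih,
      mul_smul_comm, smul_smul, Finset.prod_range_succ, ← mul_assoc, ← map_mul, e1,
      mul_comm (∏ _ ∈ _, _), pow_succ' _⁻¹]

/-- The Casimir element satisfies a polynomial equation of degree `p - 1` on `E z`. -/
lemma aeval_casimir_mul_E (hp : 2 ≤ p) {k : ℤ} {z : A} (hz : K * z = qRoot p ^ k • z) :
    Polynomial.aeval (casimir p E F K Kinv) (∏ r ∈ Finset.Icc 1 (p - 1),
        (Polynomial.X - Polynomial.C (betaZ p (k + 1 + 2 * r)))) * (E * z) = 0 := by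
  -- The vector `E z` is killed by `E^(p-1)`, hence by `F^(p-1) E^(p-1)`, which is a polynomial in
  -- the Casimir element. Since `E z` has weight `k + 2`, a product over `0 ≤ r < p - 1` becomes one
  -- over `1 ≤ r ≤ p - 1`.
  have h1 := h.F_pow_E_pow_weight hp (h.E_weight hz) (p - 1)
  have h2 : E ^ (p - 1) * (E * z) = 0 := by
    rw [← mul_assoc, ← pow_succ, Nat.sub_add_cancel (by omega), h.E_pow, zero_mul]
  rw [h2, mul_zero] at h1
  have hd := pow_ne_zero (p - 1) (inv_ne_zero (pow_ne_zero 2 (qRoot_sub_inv_ne_zero hp)))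
  have h3 := (smul_eq_zero_iff_right hd).1 h1.symm
  rw [← h3]
  congr 2
  rw [Finset.range_eq_Ico, ← Finset.Ico_add_one_right_eq_Icc, Nat.sub_add_cancel (by omega),
    Finset.prod_Ico_eq_prod_range, Finset.range_eq_Ico]
  refine Finset.prod_congr (by simp) fun r _ => ?_
  congr 3
  push_cast
  ring

/-- As `K^(2p) = 1` and the powers `q^k` are distinct, the Lagrange basis polynomials evaluated at
`K` are weight vectors, and their sum is `1`. -/
lemma eq_of_weight (hp : 2 ≤ p) (X Y : A)
    (hXY : ∀ (k : ℤ) (z : A), K * z = qRoot p ^ k • z → X * z = Y * z) : X = Y := by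
  have hinj : Set.InjOn (fun k : ℕ => qRoot p ^ k) (Finset.range (2 * p)) := by
    intro i hi j hj hij
    simp only [Finset.coe_range, Set.mem_Iio] at hi hj
    exact (qRoot_isPrimitiveRoot hp).pow_inj hi hj hij
  have h1 := Lagrange.sum_basis hinj ⟨0, by simp; omega⟩
  have h2 := congrArg (Polynomial.aeval K) h1
  rw [map_sum, map_one] at h2
  have h3 : ∀ k ∈ Finset.range (2 * p), K * Polynomial.aeval K
      (Lagrange.basis (Finset.range (2 * p)) (fun k : ℕ => qRoot p ^ k) k) =
      qRoot p ^ (k : ℤ) • Polynomial.aeval K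
      (Lagrange.basis (Finset.range (2 * p)) (fun k : ℕ => qRoot p ^ k) k) := by
    intro k hk
    have h4 : (Polynomial.X - Polynomial.C (qRoot p ^ k)) *
        Lagrange.basis (Finset.range (2 * p)) (fun k : ℕ => qRoot p ^ k) k =
        Polynomial.C (Lagrange.nodalWeight (Finset.range (2 * p)) (fun k : ℕ => qRoot p ^ k) k) *
          Lagrange.nodal (Finset.range (2 * p)) (fun k : ℕ => qRoot p ^ k) := by
      rw [Lagrange.basis_eq_prod_sub_inv_mul_nodal_div hk, ← Lagrange.nodal_erase_eq_nodal_div hk,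
        mul_left_comm, ← Lagrange.nodal_eq_mul_nodal_erase hk]
    have h5 : Lagrange.nodal (Finset.range (2 * p)) (fun k : ℕ => qRoot p ^ k) =
        Polynomial.X ^ (2 * p) - 1 := by
      rw [Lagrange.nodal, Polynomial.X_pow_sub_one_eq_prod (by omega) (qRoot_isPrimitiveRoot hp)]
      refine Finset.prod_bij (fun i _ => qRoot p ^ i) ?_ ?_ ?_ ?_
      · intro i _
        rw [Polynomial.mem_nthRootsFinset (by omega), ← pow_mul, mul_comm, pow_mul,
          (qRoot_isPrimitiveRoot hp).pow_eq_one, one_pow]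
      · intro i hi j hj hij
        exact hinj (by simpa using hi) (by simpa using hj) hij
      · intro x hx
        rw [Polynomial.mem_nthRootsFinset (by omega)] at hx
        have : NeZero (2 * p) := ⟨by omega⟩
        obtain ⟨i, hi, rfl⟩ := (qRoot_isPrimitiveRoot hp).eq_pow_of_pow_eq_one hx
        exact ⟨i, by simpa using hi, rfl⟩
      · intro i _; rfl
    have h6 := congrArg (Polynomial.aeval K) h4
    rw [h5, map_mul, map_mul, map_sub, map_sub (_ : _ →ₐ[ℂ] _) (_ ^ (2 * p)),
      map_pow (_ : _ →ₐ[ℂ] _) Polynomial.X, Polynomial.aeval_X, map_one, h.K_pow,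
      sub_self, mul_zero, sub_mul, sub_eq_zero, Polynomial.aeval_C, ← Algebra.smul_def] at h6
    rw [h6, zpow_natCast]
  rw [← mul_one X, ← mul_one Y, ← h2, Finset.mul_sum, Finset.mul_sum]
  exact Finset.sum_congr rfl fun k hk => hXY k _ (h3 k hk)

end

end IsRestricted

/-! ### Divisors of `ψ_s` -/

/-- The numbers `0, …, p` represent the integers modulo `2p` and up to sign, and `betaZ` depends
only on this class. -/
lemma exists_le_dvd {p : ℕ} (hp : 2 ≤ p) (n : ℤ) :
    ∃ j : ℕ, j ≤ p ∧ ((2 * p : ℤ) ∣ n - j ∨ (2 * p : ℤ) ∣ n + j) := by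
  have h0 : (0 : ℤ) < 2 * p := by omega
  have h1 := Int.emod_nonneg n h0.ne'
  have h2 := Int.emod_lt_of_pos n h0
  have h3 := Int.emod_add_mul_ediv n (2 * p)
  by_cases h : n % (2 * p) ≤ p
  · refine ⟨(n % (2 * p)).toNat, by omega, Or.inl ⟨n / (2 * p), ?_⟩⟩
    rw [Int.toNat_of_nonneg h1]; linarith
  · refine ⟨(2 * p - n % (2 * p)).toNat, by omega, Or.inr ⟨n / (2 * p) + 1, ?_⟩⟩
    rw [Int.toNat_of_nonneg (by omega)]; linarith

lemma betaZ_eq_of_dvd_or {p : ℕ} (hp : 2 ≤ p) {m n : ℤ}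
    (h : (2 * p : ℤ) ∣ m - n ∨ (2 * p : ℤ) ∣ m + n) : betaZ p m = betaZ p n := by
  rcases h with h | h
  · exact betaZ_eq_of_dvd hp h
  · rw [← betaZ_neg p n]; exact betaZ_eq_of_dvd hp (by rwa [sub_neg_eq_add])

lemma betaZ_injOn {p : ℕ} (hp : 2 ≤ p) {i j : ℕ} (hi : i ≤ p) (hj : j ≤ p)
    (h : betaZ p i = betaZ p j) : i = j := by
  have hq := qRoot_ne_zero p
  -- The difference `β_i - β_j` factors in this way.
  have h1 : (qRoot p ^ (i : ℤ) - qRoot p ^ (j : ℤ)) * (1 - qRoot p ^ (-(i + j : ℤ))) = 0 := by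
    have e1 : qRoot p ^ (i : ℤ) * qRoot p ^ (-(i + j : ℤ)) = qRoot p ^ (-(j : ℤ)) := by
      rw [← zpow_add₀ hq]; congr 1; ring
    have e2 : qRoot p ^ (j : ℤ) * qRoot p ^ (-(i + j : ℤ)) = qRoot p ^ (-(i : ℤ)) := by
      rw [← zpow_add₀ hq]; congr 1; ring
    rw [betaZ, betaZ] at h
    linear_combination h - e1 + e2
  rcases mul_eq_zero.1 h1 with h2 | h2
  · obtain ⟨c, hc⟩ := (qRoot_zpow_eq_iff hp _ _).1 (sub_eq_zero.1 h2)
    have : c = 0 := by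
      have hc1 : c < 1 := by by_contra hh; nlinarith [not_lt.1 hh]
      have hc2 : -1 < c := by by_contra hh; nlinarith [not_lt.1 hh]
      omega
    subst this
    omega
  · rw [sub_eq_zero, ← zpow_zero (qRoot p)] at h2
    obtain ⟨c, hc⟩ := (qRoot_zpow_eq_iff hp _ _).1 h2
    have hc1 : c ≤ 1 := by by_contra hh; nlinarith [not_le.1 hh]
    have hc2 : 0 ≤ c := by by_contra hh; nlinarith [not_le.1 hh]
    interval_cases c <;> omega

lemma psi_eq_prod {p s : ℕ} (hp : 2 ≤ p) (hs : s ∈ Finset.Icc 1 (p - 1)) :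
    psi p s = ∏ j ∈ (Finset.range (p + 1)).erase s,
      (Polynomial.X - Polynomial.C (betaZ p j)) ^ (if j = 0 ∨ j = p then 1 else 2) := by
  rw [Finset.mem_Icc] at hs
  have h1 : (Finset.range (p + 1)).erase s =
      insert 0 (insert p ((Finset.Icc 1 (p - 1)).erase s)) := by
    ext j; simp only [Finset.mem_erase, Finset.mem_range, Finset.mem_insert, Finset.mem_Icc]; omega
  rw [h1, Finset.prod_insert (by simp; omega), Finset.prod_insert (by simp; omega), psi,
    if_pos (Or.inl rfl), if_pos (Or.inr rfl), pow_one, pow_one, ← mul_assoc, betaZ_natCast,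
    betaZ_natCast]
  congr 1
  refine Finset.prod_congr rfl fun j hj => ?_
  simp only [Finset.mem_erase, Finset.mem_Icc] at hj
  rw [if_neg (by omega), betaZ_natCast]

lemma psi_eval_ne_zero {p s : ℕ} (hp : 2 ≤ p) (hs : s ∈ Finset.Icc 1 (p - 1)) :
    (psi p s).eval (betaZ p s) ≠ 0 := by
  rw [psi_eq_prod hp hs, Polynomial.eval_prod, Finset.prod_ne_zero_iff]
  intro j hj
  simp only [Finset.mem_erase, Finset.mem_range, Finset.mem_Icc] at hj hs
  rw [Polynomial.eval_pow, Polynomial.eval_sub, Polynomial.eval_X, Polynomial.eval_C]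
  exact pow_ne_zero _ (sub_ne_zero.2 fun h =>
    hj.1 (betaZ_injOn hp (by omega) (by omega) h).symm)

/-- For distinct `r` between `1` and `p - 1` the numbers `a + 2r` are distinct modulo `2p`. So `β_j`
occurs at most twice, once for `a + 2r ≡ j` and once for `a + 2r ≡ -j`; when `j` is `0` or `p` these
congruences coincide and it occurs at most once. These bounds are the multiplicities in `ψ_s`, and
the hypothesis excludes the missing root `β_s`. -/
lemma prod_betaZ_dvd_psi {p s : ℕ} (hp : 2 ≤ p) (hs : s ∈ Finset.Icc 1 (p - 1)) (a : ℤ)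
    {T : Finset ℕ} (hT : T ⊆ Finset.Icc 1 (p - 1))
    (h : ∀ r ∈ T, ¬ ((2 * p : ℤ) ∣ a + 2 * r - s ∨ (2 * p : ℤ) ∣ a + 2 * r + s)) :
    (∏ r ∈ T, (Polynomial.X - Polynomial.C (betaZ p (a + 2 * r)))) ∣ psi p s := by
  choose cl hcl1 hcl2 using exists_le_dvd hp
  have hunique : ∀ (b : ℤ) (r r' : ℕ), r ∈ T → r' ∈ T → (2 * p : ℤ) ∣ a + 2 * r - b →
      (2 * p : ℤ) ∣ a + 2 * r' - b → r = r' := by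
    rintro b r r' hr hr' ⟨c, hc⟩ ⟨c', hc'⟩
    have h1 := Finset.mem_Icc.1 (hT hr)
    have h2 := Finset.mem_Icc.1 (hT hr')
    have h3 : (r : ℤ) - r' = p * (c - c') := by linarith
    have h4 : r < p := by omega
    have h5 : r' < p := by omega
    have hc1 : c - c' < 1 := by by_contra hh; nlinarith [not_lt.1 hh]
    have hc2 : -1 < c - c' := by by_contra hh; nlinarith [not_lt.1 hh]
    have : c - c' = 0 := by omega
    rw [this] at h3
    omega
  rw [Finset.prod_congr rfl fun r _ => by rw [betaZ_eq_of_dvd_or hp (hcl2 (a + 2 * r))],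
    Finset.prod_comp (fun j : ℕ => Polynomial.X - Polynomial.C (betaZ p j))
      (fun r : ℕ => cl (a + 2 * r)), psi_eq_prod hp hs]
  have hsub : T.image (fun r : ℕ => cl (a + 2 * r)) ⊆ (Finset.range (p + 1)).erase s := by
    intro j hj
    obtain ⟨r, hr, rfl⟩ := Finset.mem_image.1 hj
    rw [Finset.mem_erase, Finset.mem_range]
    refine ⟨fun hh => h r hr ?_, by have := hcl1 (a + 2 * r); omega⟩
    have := hcl2 (a + 2 * r)
    rwa [hh] at this
  refine (Finset.prod_dvd_prod_of_dvd _ _ fun j hj => pow_dvd_pow _ ?_).trans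
    (Finset.prod_dvd_prod_of_subset _ _ _ hsub)
  split_ifs with hj0
  · rw [Finset.card_le_one]
    intro r hr r' hr'
    rw [Finset.mem_filter] at hr hr'
    have hdvd : ∀ r : ℕ, cl (a + 2 * r) = j → (2 * p : ℤ) ∣ a + 2 * r - j := by
      intro r hr
      have := hcl2 (a + 2 * r)
      rw [hr] at this
      rcases this with h1 | h1
      · exact h1
      · obtain ⟨c, hc⟩ := h1
        rcases hj0 with rfl | rfl
        · exact ⟨c, by rw [← hc]; simp⟩
        · exact ⟨c - 1, by linear_combination hc⟩
    exact hunique j r r' hr.1 hr'.1 (hdvd r hr.2) (hdvd r' hr'.2)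
  · have h2 : T.filter (fun r : ℕ => cl (a + 2 * r) = j) ⊆
        T.filter (fun r : ℕ => (2 * p : ℤ) ∣ a + 2 * r - j) ∪
        T.filter (fun r : ℕ => (2 * p : ℤ) ∣ a + 2 * r - -j) := by
      intro r hr
      rw [Finset.mem_filter] at hr
      rw [Finset.mem_union, Finset.mem_filter, Finset.mem_filter, sub_neg_eq_add]
      have := hcl2 (a + 2 * r)
      rw [hr.2] at this
      exact this.imp (⟨hr.1, ·⟩) (⟨hr.1, ·⟩)
    have hc : ∀ b : ℤ, (T.filter (fun r : ℕ => (2 * p : ℤ) ∣ a + 2 * r - b)).card ≤ 1 := by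
      intro b
      rw [Finset.card_le_one]
      intro r hr r' hr'
      rw [Finset.mem_filter] at hr hr'
      exact hunique b r r' hr.1 hr'.1 hr.2 hr'.2
    exact (Finset.card_le_card h2).trans
      ((Finset.card_union_le _ _).trans (add_le_add (hc j) (hc (-j))))

/-- The polynomial in the Casimir element that defines `idem`. -/
def idemPoly (p s : ℕ) : Polynomial ℂ :=
  Polynomial.C ((psi p s).eval (betaZ p s))⁻¹ * (psi p s - Polynomial.C
    ((psi p s).derivative.eval (betaZ p s) / (psi p s).eval (betaZ p s)) *
      ((Polynomial.X - Polynomial.C (betaZ p s)) * psi p s))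

lemma idem_eq_aeval (p s : ℕ) {A : Type*} [Ring A] [Algebra ℂ A] (E F K Kinv : A) :
    idem p E F K Kinv s = Polynomial.aeval (casimir p E F K Kinv) (idemPoly p s) := by
  simp only [idem, idemPoly, map_mul, map_sub, Polynomial.aeval_C, Polynomial.aeval_X,
    ← Algebra.smul_def, betaZ_natCast]

lemma psi_dvd_idemPoly (p s : ℕ) : psi p s ∣ idemPoly p s :=
  Dvd.dvd.mul_left (dvd_sub dvd_rfl (Dvd.dvd.mul_left (Dvd.intro_left _ rfl) _)) _

/-- Modulo `(X - β_s) P`, where `P` divides `ψ_s`, the polynomial `idemPoly` is `P / P(β_s)`. -/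
lemma dvd_idemPoly_sub {p s : ℕ} (hp : 2 ≤ p) (hs : s ∈ Finset.Icc 1 (p - 1))
    {P : Polynomial ℂ} (hP : P ∣ psi p s) {c : ℂ} (hc : c * P.eval (betaZ p s) = 1) :
    (Polynomial.X - Polynomial.C (betaZ p s)) * P ∣ idemPoly p s - Polynomial.C c * P := by
  obtain ⟨Q, hQ⟩ := hP
  have h0 := psi_eval_ne_zero hp hs
  have hP0 : P.eval (betaZ p s) ≠ 0 := right_ne_zero_of_mul (hc.trans_ne one_ne_zero)
  -- With `ψ_s = P Q`, the leading part of `idemPoly` minus `c P` is `P` times a polynomial that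
  -- vanishes at `β_s`. The correction term with the derivative is itself a multiple of `(X - β_s)
  -- P`.
  obtain ⟨Q', hQ'⟩ : Polynomial.X - Polynomial.C (betaZ p s) ∣
      Polynomial.C ((psi p s).eval (betaZ p s))⁻¹ * Q - Polynomial.C c := by
    rw [Polynomial.dvd_iff_isRoot, Polynomial.IsRoot, Polynomial.eval_sub, Polynomial.eval_mul,
      Polynomial.eval_C, Polynomial.eval_C, sub_eq_zero, inv_mul_eq_iff_eq_mul₀ h0, hQ,
      Polynomial.eval_mul, mul_right_comm, mul_comm _ c, hc, one_mul]
  refine ⟨Q' - Polynomial.C ((psi p s).eval (betaZ p s))⁻¹ * Polynomial.C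
    ((psi p s).derivative.eval (betaZ p s) / (psi p s).eval (betaZ p s)) * Q, ?_⟩
  rw [idemPoly]
  generalize ((psi p s).eval (betaZ p s))⁻¹ = c1 at *
  generalize ((psi p s).derivative.eval (betaZ p s) / (psi p s).eval (betaZ p s)) = c2 at *
  rw [hQ]
  linear_combination P * hQ'

/-! ### The products that occur in the commutator of `h` and `E` -/

/-- The sum over `r` of `[a + 2 r] ∏_{r' ≠ r} (X - β_{a + 2 r'})` has one surviving term. -/
lemma sum_qZ_prod_betaZ {p : ℕ} (hp : 2 ≤ p) {a m : ℤ} {r₀ : ℕ} (hr₀ : r₀ ∈ Finset.Icc 1 (p - 1))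
    (ha : a + r₀ = p * m) :
    ∑ r ∈ Finset.Icc 1 (p - 1), Polynomial.C (qZ (qRoot p) (a + 2 * r)) *
      ∏ r' ∈ (Finset.Icc 1 (p - 1)).erase r,
        (Polynomial.X - Polynomial.C (betaZ p (a + 2 * r'))) =
    Polynomial.C (qZ (qRoot p) (a + 2 * r₀)) * ∏ r' ∈ (Finset.Icc 1 (p - 1)).erase r₀,
        (Polynomial.X - Polynomial.C (betaZ p (a + 2 * r'))) := by
  rw [← Finset.add_sum_erase _ _ hr₀, add_eq_left]
  rw [Finset.mem_Icc] at hr₀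
  -- The involution sends `r` to the residue `g r` of `-(a + r)` modulo `p`. Then `a + 2 (g r) ≡ -(a
  -- + 2r)` modulo `2p`, so `β` is preserved and the quantum integer changes sign; at a fixed point
  -- it is zero. The index `r₀` has no partner, because `g r₀ = 0` lies outside the range.
  have hex : ∀ r : ℕ, ∃ r' : ℕ, r' < p ∧ (p : ℤ) ∣ a + r + r' := by
    intro r
    have h0 : (0 : ℤ) < p := by omega
    refine ⟨((-(a + r)) % p).toNat, ?_, ?_⟩
    · have := Int.emod_lt_of_pos (-(a + r)) h0
      omega
    · rw [Int.toNat_of_nonneg (Int.emod_nonneg _ h0.ne')]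
      refine ⟨-((-(a + r)) / p), ?_⟩
      have := Int.emod_add_mul_ediv (-(a + r)) p
      linarith
  choose g hg1 hg2 using hex
  have huniq : ∀ (b : ℤ) (r r' : ℕ), r < p → r' < p → (p : ℤ) ∣ b + r → (p : ℤ) ∣ b + r' →
      r = r' := by
    rintro b r r' h1 h2 ⟨c, hc⟩ ⟨c', hc'⟩
    have h3 : (r : ℤ) - r' = p * (c - c') := by linarith
    have hc1 : c - c' < 1 := by by_contra hh; nlinarith [not_lt.1 hh]
    have hc2 : -1 < c - c' := by by_contra hh; nlinarith [not_lt.1 hh]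
    have : c - c' = 0 := by omega
    rw [this] at h3
    omega
  have hmem : ∀ r ∈ (Finset.Icc 1 (p - 1)).erase r₀, g r ∈ (Finset.Icc 1 (p - 1)).erase r₀ := by
    intro r hr
    simp only [Finset.mem_erase, Finset.mem_Icc] at hr ⊢
    have hg := hg1 r
    refine ⟨fun hh => ?_, ?_, by omega⟩
    · have h1 := hg2 r
      rw [hh] at h1
      have h2 : (p : ℤ) ∣ r := by
        obtain ⟨c, hc⟩ := h1
        exact ⟨c - m, by linear_combination hc - ha⟩
      have := Int.le_of_dvd (by omega) h2
      omega
    · by_contra hh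
      have h0 : g r = 0 := by omega
      have h1 := hg2 r
      rw [h0] at h1
      exact hr.1 (huniq a r r₀ (by omega) (by omega) (by simpa using h1) ⟨m, ha⟩)
  have hodd : ∀ r, qZ (qRoot p) (a + 2 * (g r : ℕ)) = -qZ (qRoot p) (a + 2 * r) := by
    intro r
    obtain ⟨c, hc⟩ := hg2 r
    rw [← qZ_neg, show a + 2 * (g r : ℤ) = -(a + 2 * r) + p * (2 * c) by linear_combination 2 * hc,
      qZ_qRoot_add_mul hp]
    simp [zpow_mul]
  have hbeta : ∀ r, betaZ p (a + 2 * (g r : ℕ)) = betaZ p (a + 2 * r) := by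
    intro r
    obtain ⟨c, hc⟩ := hg2 r
    exact betaZ_eq_of_dvd_or hp (Or.inr ⟨c, by linear_combination 2 * hc⟩)
  refine Finset.sum_involution (fun r _ => g r) (fun r hr => ?_) (fun r hr h0 hh => h0 ?_)
    (fun r hr => hmem r hr) (fun r hr => ?_)
  · have h1 := Finset.mem_of_mem_erase hr
    have h2 := Finset.mem_of_mem_erase (hmem r hr)
    have h3 : ∏ r' ∈ (Finset.Icc 1 (p - 1)).erase r,
        (Polynomial.X - Polynomial.C (betaZ p (a + 2 * r'))) =
        ∏ r' ∈ (Finset.Icc 1 (p - 1)).erase (g r),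
        (Polynomial.X - Polynomial.C (betaZ p (a + 2 * r'))) := by
      refine mul_left_cancel₀ (Polynomial.X_sub_C_ne_zero (betaZ p (a + 2 * r))) ?_
      rw [Finset.mul_prod_erase _ (fun r' : ℕ => Polynomial.X -
        Polynomial.C (betaZ p (a + 2 * r'))) h1, ← hbeta r, Finset.mul_prod_erase _
        (fun r' : ℕ => Polynomial.X - Polynomial.C (betaZ p (a + 2 * r'))) h2]
    rw [hodd, h3, Polynomial.C_neg]
    ring
  · have h1 := hodd r
    rw [hh] at h1
    have h2 : qZ (qRoot p) (a + 2 * r) = 0 := by linear_combination h1 / 2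
    rw [h2, Polynomial.C_0, zero_mul]
  · have h1 := hg2 r
    have h2 := hg2 (g r)
    refine huniq (a + g r) _ _ (hg1 _) ?_ h2 (by rwa [add_right_comm])
    simp only [Finset.mem_erase, Finset.mem_Icc] at hr
    omega

/-- The indices below `r₀` contribute `[r₀ - 1]!` and a sign, those above contribute `[p - 1 -
r₀]!`; `qFact_qRoot_mul` recombines the factorials. -/
lemma prod_qZ_sub {p : ℕ} (hp : 2 ≤ p) {r₀ : ℕ} (hr₀ : r₀ ∈ Finset.Icc 1 (p - 1)) :
    qInt (qRoot p) r₀ * ∏ r ∈ (Finset.Icc 1 (p - 1)).erase r₀, qZ (qRoot p) (r - r₀) =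
      (-1) ^ (r₀ + 1) * qFact (qRoot p) (p - 1) := by
  rw [Finset.mem_Icc] at hr₀
  have h1 : (Finset.Icc 1 (p - 1)).erase r₀ = Finset.Icc 1 (r₀ - 1) ∪ Finset.Icc (r₀ + 1) (p - 1) := by
    ext r; simp only [Finset.mem_erase, Finset.mem_union, Finset.mem_Icc]; omega
  have hd : Disjoint (Finset.Icc 1 (r₀ - 1)) (Finset.Icc (r₀ + 1) (p - 1)) := by
    rw [Finset.disjoint_left]; intro r; simp only [Finset.mem_Icc]; omega
  have h2 : ∏ r ∈ Finset.Icc 1 (r₀ - 1), qZ (qRoot p) (r - r₀) =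
      (-1) ^ (r₀ - 1) * qFact (qRoot p) (r₀ - 1) := by
    have : (r₀ - 1) = (Finset.Icc 1 (r₀ - 1)).card := by simp
    rw [qFact]
    conv_rhs => rw [this, ← Finset.prod_const, ← this, ← Finset.prod_mul_distrib]
    refine Finset.prod_bij' (fun r _ => r₀ - r) (fun r _ => r₀ - r) ?_ ?_ ?_ ?_ ?_ <;>
      intro r hr <;> rw [Finset.mem_Icc] at hr <;> try (rw [Finset.mem_Icc]; omega)
    · omega
    · omega
    · rw [← qZ_natCast, ← neg_sub (r₀ : ℤ), qZ_neg, Nat.cast_sub (by omega)]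
      ring
  have h3 : ∏ r ∈ Finset.Icc (r₀ + 1) (p - 1), qZ (qRoot p) (r - r₀) =
      qFact (qRoot p) (p - 1 - r₀) := by
    rw [qFact]
    refine Finset.prod_bij' (fun r _ => r - r₀) (fun r _ => r + r₀) ?_ ?_ ?_ ?_ ?_ <;>
      intro r hr <;> rw [Finset.mem_Icc] at hr <;> try (rw [Finset.mem_Icc]; omega)
    · omega
    · omega
    · rw [← qZ_natCast, Nat.cast_sub (by omega)]
  rw [h1, Finset.prod_union hd, h2, h3, ← qFact_qRoot_mul hp (r := r₀) (by omega)]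
  obtain ⟨r, rfl⟩ : ∃ r, r₀ = r + 1 := ⟨r₀ - 1, by omega⟩
  rw [qFact_succ, Nat.add_sub_cancel]
  ring

/-- The value at `β_a` of the surviving product. -/
lemma prod_betaZ_eval {p : ℕ} (hp : 2 ≤ p) {a m : ℤ} {r₀ : ℕ} (hr₀ : r₀ ∈ Finset.Icc 1 (p - 1))
    (ha : a + r₀ = p * m) :
    qInt (qRoot p) r₀ ^ 2 * (∏ r' ∈ (Finset.Icc 1 (p - 1)).erase r₀,
        (Polynomial.X - Polynomial.C (betaZ p (a + 2 * r')))).eval (betaZ p a) =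
      (-((qRoot p - (qRoot p)⁻¹) ^ 2)) ^ (p - 2) * (((-1 : ℂ) ^ m) ^ (p - 2) * ((-1) ^ (r₀ + 1) *
        qFact (qRoot p) (p - 1) ^ 2)) := by
  have hcard : ((Finset.Icc 1 (p - 1)).erase r₀).card = p - 2 := by
    rw [Finset.card_erase_of_mem hr₀, Nat.card_Icc]; omega
  have h1 : ∀ r : ℕ, (Polynomial.X - Polynomial.C (betaZ p (a + 2 * r))).eval (betaZ p a) =
      -((qRoot p - (qRoot p)⁻¹) ^ 2) *
        (qInt (qRoot p) r * ((-1 : ℂ) ^ m * qZ (qRoot p) (r - r₀))) := by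
    intro r
    rw [Polynomial.eval_sub, Polynomial.eval_X, Polynomial.eval_C, betaZ_sub hp, qZ_natCast,
      show a + (r : ℤ) = (r - r₀) + p * m by linear_combination ha, qZ_qRoot_add_mul hp]
  rw [Polynomial.eval_prod, Finset.prod_congr rfl fun r _ => h1 r, Finset.prod_mul_distrib,
    Finset.prod_mul_distrib, Finset.prod_mul_distrib, Finset.prod_const, Finset.prod_const, hcard]
  have h2 := prod_qZ_sub hp hr₀
  have h3 := Finset.mul_prod_erase _ (fun r => qInt (qRoot p) r) hr₀
  rw [← qFact] at h3
  generalize (∏ r ∈ (Finset.Icc 1 (p - 1)).erase r₀, qZ (qRoot p) (r - r₀)) = P1 at *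
  generalize (∏ r ∈ (Finset.Icc 1 (p - 1)).erase r₀, qInt (qRoot p) r) = P2 at *
  generalize (-((qRoot p - (qRoot p)⁻¹) ^ 2)) ^ (p - 2) = c at *
  generalize ((-1 : ℂ) ^ m) ^ (p - 2) = c' at *
  rw [← h3]
  rw [← h3] at h2
  linear_combination c * c' * qInt (qRoot p) r₀ * P2 * h2

/-! ### The commutators of `h` with `E` and `F` -/

lemma aeval_C_mul_mul {A : Type*} [Ring A] [Algebra ℂ A] (x w : A) (c : ℂ) (P : Polynomial ℂ) :
    Polynomial.aeval x (Polynomial.C c * P) * w = c • (Polynomial.aeval x P * w) := by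
  rw [map_mul, Polynomial.aeval_C, ← Algebra.smul_def, smul_mul_assoc]

namespace IsRestricted
variable {A : Type*} [Ring A] [Algebra ℂ A] {p : ℕ} {E F K Kinv : A}

lemma aeval_mul_E_eq_zero (h : IsRestricted p E F K Kinv) (hp : 2 ≤ p) {k : ℤ} {z : A}
    (hz : K * z = qRoot p ^ k • z) {P : Polynomial ℂ}
    (hP : (∏ r ∈ Finset.Icc 1 (p - 1),
        (Polynomial.X - Polynomial.C (betaZ p (k + 1 + 2 * r)))) ∣ P) :
    Polynomial.aeval (casimir p E F K Kinv) P * (E * z) = 0 := by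
  obtain ⟨Q, rfl⟩ := hP
  rw [mul_comm, map_mul, mul_assoc, h.aeval_casimir_mul_E hp hz, mul_zero]

/-- When `k` has the parity of `s - 1`, it is congruent to `s - 1 - 2n` modulo `2p` for some `0 ≤ n
< p`. The excluded classes are `n = 0` and `n = s`; every other `n` gives a root of `u_s`. -/
lemma uPoly_eval_eq_zero {p : ℕ} (hp : 2 ≤ p) {s : ℕ} {k : ℤ}
    (h0 : ¬ ((2 * p : ℤ) ∣ k + 1 - s ∨ (2 * p : ℤ) ∣ k + 1 + s)) {c : ℤ} (hc : k + 1 - s = 2 * c) :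
    (uPoly p s).eval (qRoot p ^ k) = 0 := by
  have hp0 : (0 : ℤ) < p := by omega
  have h1 := Int.emod_nonneg (-c) hp0.ne'
  have h2 := Int.emod_lt_of_pos (-c) hp0
  have h3 := Int.emod_add_mul_ediv (-c) p
  obtain ⟨n, hn⟩ := Int.eq_ofNat_of_zero_le h1
  rw [hn] at h2 h3
  rw [uPoly, Polynomial.eval_prod]
  refine Finset.prod_eq_zero (i := n) ?_ ?_
  · rw [Finset.mem_erase, Finset.mem_Icc]
    refine ⟨?_, ?_, by omega⟩
    · rintro rfl
      exact h0 (Or.inr ⟨-(-c / p), by linear_combination hc + 2 * h3⟩)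
    · by_contra hh
      have : n = 0 := by omega
      subst this
      exact h0 (Or.inl ⟨-(-c / p), by push_cast at h3; linear_combination hc + 2 * h3⟩)
  · rw [Polynomial.eval_sub, Polynomial.eval_X, Polynomial.eval_C, sub_eq_zero,
      qRoot_zpow_eq_iff hp]
    exact ⟨-(-c / p), by linear_combination hc + 2 * h3⟩

lemma uPoly_eval_ne_zero {p : ℕ} (hp : 2 ≤ p) {s : ℕ} (hs : s ∈ Finset.Icc 1 (p - 1)) :
    (uPoly p s).eval (qRoot p ^ ((s : ℤ) - 1)) ≠ 0 ∧
      (uPoly p s).eval (qRoot p ^ (-(s : ℤ) - 1)) ≠ 0 := by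
  rw [Finset.mem_Icc] at hs
  constructor <;>
  · rw [uPoly, Polynomial.eval_prod, Finset.prod_ne_zero_iff]
    intro n hn
    rw [Finset.mem_erase, Finset.mem_Icc] at hn
    rw [Polynomial.eval_sub, Polynomial.eval_X, Polynomial.eval_C, sub_ne_zero, Ne,
      qRoot_zpow_eq_iff hp]
    rintro ⟨c, hc⟩
    have h1 : n < p := by omega
    have h2 : s < p := by omega
    have hc1 : c < 1 := by by_contra hh; nlinarith [not_lt.1 hh]
    have hc2 : -1 < c := by by_contra hh; nlinarith [not_lt.1 hh]
    have : c = 0 := by omega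
    subst this
    omega

/-- The linear factor interpolates: it is `(a - b) u_s(b)` at `a` and `(a - b) u_s(a)` at `b`. So
apart from the idempotent the summand acts as `1` on the weights `s - 1` and `-s - 1`. Other weights
of the same parity are roots of `u_s`. On weights of the opposite parity the idempotent itself
annihilates `E z`, because there `ψ_s` is divisible by the polynomial that annihilates `E z`. -/
lemma E_mul_elemA_term (h : IsRestricted p E F K Kinv) (hp : 2 ≤ p) {k : ℤ} {z : A}
    (hz : K * z = qRoot p ^ k • z) {s : ℕ} (hs : s ∈ Finset.Icc 1 (p - 1)) {a b ua ub : ℂ}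
    (ha : a = qRoot p ^ ((s : ℤ) - 1)) (hb : b = qRoot p ^ (-(s : ℤ) - 1))
    (hua : ua = (uPoly p s).eval a) (hub : ub = (uPoly p s).eval b) :
    E * (((a - b) * ub * ua)⁻¹ • (((ub - ua) • K + algebraMap ℂ A (a * ua - b * ub)) *
        Polynomial.aeval K (uPoly p s) * idem p E F K Kinv s) * z) =
      if ((2 * p : ℤ) ∣ k + 1 - s ∨ (2 * p : ℤ) ∣ k + 1 + s) then
        Polynomial.aeval (casimir p E F K Kinv) (idemPoly p s) * (E * z) else 0 := by
  set y := Polynomial.aeval (casimir p E F K Kinv) (idemPoly p s) * z with hy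
  have hKy : K * y = qRoot p ^ k • y := by
    rw [hy, ← mul_assoc, ← (h.commute_aeval_K _).eq, mul_assoc, hz, mul_smul_comm]
  have hEy : E * y = Polynomial.aeval (casimir p E F K Kinv) (idemPoly p s) * (E * z) := by
    rw [hy, ← mul_assoc, ← (h.commute_aeval_E hp _).eq, mul_assoc]
  have e1 : ((a - b) * ub * ua)⁻¹ • (((ub - ua) • K + algebraMap ℂ A (a * ua - b * ub)) *
        Polynomial.aeval K (uPoly p s) * idem p E F K Kinv s) * z =
      (((a - b) * ub * ua)⁻¹ * ((uPoly p s).eval (qRoot p ^ k) *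
        ((ub - ua) * qRoot p ^ k + (a * ua - b * ub)))) • y := by
    rw [smul_mul_assoc, mul_assoc _ (idem p E F K Kinv s) z, idem_eq_aeval, ← hy,
      mul_assoc _ (Polynomial.aeval K _) y, aeval_K_weight hKy,
      mul_smul_comm, add_mul, smul_mul_assoc, hKy, ← Algebra.smul_def, smul_smul _ _ y, ← add_smul,
      smul_smul, smul_smul, mul_assoc _⁻¹]
  rw [e1, mul_smul_comm, hEy]
  obtain ⟨hua0, hub0⟩ := uPoly_eval_ne_zero hp hs
  rw [← ha, ← hua] at hua0
  rw [← hb, ← hub] at hub0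
  have hab : a - b ≠ 0 := by
    rw [ha, hb, sub_ne_zero, Ne, qRoot_zpow_eq_iff hp]
    rw [Finset.mem_Icc] at hs
    rintro ⟨c, hc⟩
    have h2 : s < p := by omega
    have hc1 : c < 1 := by by_contra hh; nlinarith [not_lt.1 hh]
    have hc2 : 0 < c := by by_contra hh; nlinarith [not_lt.1 hh]
    omega
  split_ifs with hdvd
  · have : ((a - b) * ub * ua)⁻¹ * ((uPoly p s).eval (qRoot p ^ k) *
        ((ub - ua) * qRoot p ^ k + (a * ua - b * ub))) = 1 := by
      rcases hdvd with hd | hd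
      · have : qRoot p ^ k = a := by
          rw [ha, qRoot_zpow_eq_iff hp]; convert hd using 1; ring
        rw [this, ← hua]
        field_simp
        ring
      · have : qRoot p ^ k = b := by
          rw [hb, qRoot_zpow_eq_iff hp]; convert hd using 1; ring
        rw [this, ← hub]
        field_simp
        ring
    rw [this, one_smul]
  · by_cases hpar : ∃ c, k + 1 - s = 2 * c
    · obtain ⟨c, hc⟩ := hpar
      rw [uPoly_eval_eq_zero hp hdvd hc, zero_mul, mul_zero, zero_smul]
    · rw [h.aeval_mul_E_eq_zero hp hz ((prod_betaZ_dvd_psi hp hs (k + 1) subset_rfl ?_).trans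
        (psi_dvd_idemPoly p s)), smul_zero]
      rintro r - (⟨c, hc⟩ | ⟨c, hc⟩)
      · exact hpar ⟨p * c - r, by linear_combination hc⟩
      · exact hpar ⟨p * c - r - s, by linear_combination hc⟩

/-- The action of `E A` on weight vectors. -/
lemma E_mul_elemA (h : IsRestricted p E F K Kinv) (hp : 2 ≤ p) {k : ℤ} {z : A}
    (hz : K * z = qRoot p ^ k • z) :
    E * elemA p E F K Kinv * z = ∑ s ∈ Finset.Icc 1 (p - 1),
      if ((2 * p : ℤ) ∣ k + 1 - s ∨ (2 * p : ℤ) ∣ k + 1 + s) then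
        Polynomial.aeval (casimir p E F K Kinv) (idemPoly p s) * (E * z) else 0 := by
  rw [elemA, mul_assoc, Finset.sum_mul, Finset.mul_sum]
  exact Finset.sum_congr rfl fun s hs => h.E_mul_elemA_term hp hz hs rfl rfl rfl rfl

end IsRestricted

/-- The relations of the Lusztig limit that involve neither `h` nor scalars depending on it. -/
structure IsPreLimit {A : Type*} [Ring A] [Algebra ℂ A] (p : ℕ) (E F K Kinv e f : A) : Prop where
  restricted : IsRestricted p E F K Kinv
  E_e : E * e = e * E
  K_e : K * e = e * K
  F_f : F * f = f * F
  K_f : K * f = f * K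
  F_e : F * e - e * F = (qFact (qRoot p) (p - 1))⁻¹ • (K ^ p * qBracketK p K Kinv * E ^ (p - 1))
  E_f : E * f - f * E =
    ((-1) ^ (p + 1) / qFact (qRoot p) (p - 1)) • (F ^ (p - 1) * qBracketK p K Kinv)

namespace IsPreLimit
variable {A : Type*} [Ring A] [Algebra ℂ A] {p : ℕ} {E F K Kinv e f : A}

lemma Kinv_e (H : IsPreLimit p E F K Kinv e f) : Kinv * e = e * Kinv := by
  have h1 := H.restricted.quantum
  calc Kinv * e = Kinv * (e * K) * Kinv := by
        rw [mul_assoc, mul_assoc, h1.K_mul_Kinv, mul_one]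
    _ = e * Kinv := by rw [← H.K_e, ← mul_assoc, h1.Kinv_mul_K, one_mul]

lemma qBracketK_e (H : IsPreLimit p E F K Kinv e f) :
    qBracketK p K Kinv * e = e * qBracketK p K Kinv := by
  simp only [qBracketK, smul_mul_assoc, mul_smul_comm, sub_mul, mul_sub, H.K_e, H.Kinv_e]

omit [Algebra ℂ A] in
lemma pow_mul_sub_mul_pow (x y : A) (n : ℕ) :
    x ^ n * y - y * x ^ n =
      ∑ j ∈ Finset.range n, x ^ j * (x * y - y * x) * x ^ (n - 1 - j) := by
  induction n with
  | zero => simp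
  | succ n ih =>
    rw [Finset.sum_range_succ, pow_succ]
    have : ∑ j ∈ Finset.range n, x ^ j * (x * y - y * x) * x ^ (n + 1 - 1 - j) =
        (∑ j ∈ Finset.range n, x ^ j * (x * y - y * x) * x ^ (n - 1 - j)) * x := by
      rw [Finset.sum_mul]
      refine Finset.sum_congr rfl fun j hj => ?_
      rw [Finset.mem_range] at hj
      rw [mul_assoc _ _ x, ← pow_succ]
      congr 2
      omega
    rw [this, ← ih]
    simp only [Nat.add_sub_cancel, Nat.sub_self, pow_zero, mul_one]
    noncomm_ring

/-- One summand of the commutator of `F ^ (p - 1)` and `e` on a weight vector. -/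
lemma F_pow_K_pow_term (H : IsPreLimit p E F K Kinv e f) (hp : 2 ≤ p) {k : ℤ} {z : A}
    (hz : K * z = qRoot p ^ k • z) {j : ℕ} (hj : j < p - 1) :
    F ^ j * (K ^ p * qBracketK p K Kinv * E ^ (p - 1)) * F ^ (p - 1 - 1 - j) * z =
      (((qRoot p - (qRoot p)⁻¹) ^ 2)⁻¹ ^ (p - 2) * (-1) ^ k) • (Polynomial.aeval
        (casimir p E F K Kinv) (Polynomial.C (qZ (qRoot p) (k + 1 + 2 * (j + 1 : ℕ))) *
          ∏ r ∈ (Finset.Icc 1 (p - 1)).erase (j + 1),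
          (Polynomial.X - Polynomial.C (betaZ p (k + 1 + 2 * r)))) * (E * z)) := by
  have hR := H.restricted
  obtain ⟨m, hm⟩ : ∃ m, p - 1 - 1 - j = m := ⟨_, rfl⟩
  -- Write `p - 1 = (j + 1) + m`. On weight vectors `E^m F^m` contributes the product `P1`, and `F^j
  -- E^j`, applied to `E z`, contributes `P2`. Together these are all factors of the annihilating
  -- polynomial except the one of index `j + 1`.
  set P1 : Polynomial ℂ := ∏ r ∈ Finset.range m,
    (Polynomial.X - Polynomial.C (betaZ p (k - 1 - 2 * r))) with hP1
  set P2 : Polynomial ℂ := ∏ r ∈ Finset.range j,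
    (Polynomial.X - Polynomial.C (betaZ p (k + 2 + 1 + 2 * r))) with hP2
  have hprod : ∏ r ∈ (Finset.Icc 1 (p - 1)).erase (j + 1),
      (Polynomial.X - Polynomial.C (betaZ p (k + 1 + 2 * r))) = P2 * P1 := by
    have hu : (Finset.Icc 1 (p - 1)).erase (j + 1) =
        Finset.Icc 1 j ∪ Finset.Icc (j + 2) (p - 1) := by
      ext r; simp only [Finset.mem_erase, Finset.mem_union, Finset.mem_Icc]; omega
    have hd : Disjoint (Finset.Icc 1 j) (Finset.Icc (j + 2) (p - 1)) := by
      rw [Finset.disjoint_left]; intro r; simp only [Finset.mem_Icc]; omega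
    rw [hu, Finset.prod_union hd]
    congr 1
    · refine Finset.prod_bij' (fun r _ => r - 1) (fun r _ => r + 1) ?_ ?_ ?_ ?_ ?_ <;>
        intro r hr <;> simp only [Finset.mem_Icc, Finset.mem_range] at * <;> try omega
      rw [Nat.cast_sub hr.1]
      congr 3
      push_cast
      ring
    · refine Finset.prod_bij' (fun r _ => p - 1 - r) (fun r _ => p - 1 - r) ?_ ?_ ?_ ?_ ?_ <;>
        intro r hr <;> simp only [Finset.mem_Icc, Finset.mem_range] at * <;> try omega
      congr 2
      refine betaZ_eq_of_dvd hp ⟨1, ?_⟩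
      rw [Nat.cast_sub hr.2, Nat.cast_sub (by omega : 1 ≤ p)]
      push_cast
      ring
  have hEz := hR.E_weight hz
  have hy : K * (Polynomial.aeval (casimir p E F K Kinv) P1 * (E ^ (j + 1) * z)) =
      qRoot p ^ (k + 2 * (j + 1 : ℕ)) •
        (Polynomial.aeval (casimir p E F K Kinv) P1 * (E ^ (j + 1) * z)) := by
    rw [← mul_assoc, ← (hR.commute_aeval_K _).eq, mul_assoc, hR.E_pow_weight hz, mul_smul_comm]
  have e1 : E ^ (p - 1) * (F ^ m * z) = ((qRoot p - (qRoot p)⁻¹) ^ 2)⁻¹ ^ m •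
      (Polynomial.aeval (casimir p E F K Kinv) P1 * (E ^ (j + 1) * z)) := by
    rw [show p - 1 = (j + 1) + m by omega, pow_add, mul_assoc, hR.E_pow_F_pow_weight hp hz,
      mul_smul_comm, ← mul_assoc, ((hR.commute_aeval_E hp _).pow_right (j + 1)).eq.symm, mul_assoc]
  have e2 : (-1 : ℂ) ^ (k + 2 * (j + 1 : ℕ)) = (-1) ^ k := by
    rw [zpow_add₀ (by norm_num), zpow_mul]; norm_num
  have e3 := IsRestricted.K_pow_weight hy p
  rw [mul_comm, qRoot_zpow_mul hp, e2] at e3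
  have e4 : F ^ j * (Polynomial.aeval (casimir p E F K Kinv) P1 * (E ^ (j + 1) * z)) =
      ((qRoot p - (qRoot p)⁻¹) ^ 2)⁻¹ ^ j •
        (Polynomial.aeval (casimir p E F K Kinv) (P2 * P1) * (E * z)) := by
    rw [← mul_assoc (F ^ j), ((hR.commute_aeval_F hp _).pow_right j).eq.symm, mul_assoc,
      pow_succ E, mul_assoc, hR.F_pow_E_pow_weight hp hEz, mul_smul_comm, ← mul_assoc, ← map_mul,
      mul_comm P1]
  rw [hm, mul_assoc, mul_assoc, mul_assoc, mul_assoc, e1, mul_smul_comm, mul_smul_comm,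
    mul_smul_comm, hR.qBracketK_weight hy, mul_smul_comm, e3, mul_smul_comm, mul_smul_comm, e4,
    hprod, aeval_C_mul_mul, smul_smul, smul_smul, smul_smul, smul_smul, show p - 2 = m + j by omega, pow_add,
    show k + 2 * ((j + 1 : ℕ) : ℤ) + 1 = k + 1 + 2 * (j + 1 : ℕ) by ring]
  congr 1
  ring

/-- As `E` commutes with `e`, the Jacobi identity turns the commutator of `[e, f]` and `E` into that
of `[E, f]` and `e`. The bracket in `K` commutes with `e`, so only the commutator of `F^(p-1)` and
`e` is left. -/
lemma commutator_smul (H : IsPreLimit p E F K Kinv e f) :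
    (e * f - f * e) * E - E * (e * f - f * e) =
      ((-1) ^ (p + 1) / qFact (qRoot p) (p - 1)) •
        ((F ^ (p - 1) * e - e * F ^ (p - 1)) * qBracketK p K Kinv) := by
  have e1 : (e * f - f * e) * E - E * (e * f - f * e) =
      (E * f - f * E) * e - e * (E * f - f * E) := by
    simp only [sub_mul, mul_sub]
    have h1 : e * f * E = e * (f * E) := mul_assoc _ _ _
    have h2 : f * e * E = f * E * e := by rw [mul_assoc, ← H.E_e, ← mul_assoc]
    have h3 : E * (e * f) = e * (E * f) := by rw [← mul_assoc, H.E_e, mul_assoc]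
    have h4 : E * (f * e) = E * f * e := (mul_assoc _ _ _).symm
    rw [h1, h2, h3, h4]
    abel
  rw [e1, H.E_f, smul_mul_assoc, mul_smul_comm, ← smul_sub, mul_assoc, H.qBracketK_e, sub_mul,
    mul_assoc, mul_assoc]

lemma commutator_weight (H : IsPreLimit p E F K Kinv e f) (hp : 2 ≤ p) {k : ℤ} {z : A}
    (hz : K * z = qRoot p ^ k • z) :
    ((e * f - f * e) * E - E * (e * f - f * e)) * z =
      ((-1) ^ (p + 1) / qFact (qRoot p) (p - 1) * qZ (qRoot p) (k + 1) *
        (qFact (qRoot p) (p - 1))⁻¹ * (((qRoot p - (qRoot p)⁻¹) ^ 2)⁻¹ ^ (p - 2) * (-1) ^ k)) •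
      (Polynomial.aeval (casimir p E F K Kinv)
        (∑ r ∈ Finset.Icc 1 (p - 1), Polynomial.C (qZ (qRoot p) (k + 1 + 2 * r)) *
        ∏ r' ∈ (Finset.Icc 1 (p - 1)).erase r,
        (Polynomial.X - Polynomial.C (betaZ p (k + 1 + 2 * r')))) * (E * z)) := by
  rw [H.commutator_smul, smul_mul_assoc, mul_assoc, H.restricted.qBracketK_weight hz,
    mul_smul_comm, pow_mul_sub_mul_pow, H.F_e, Finset.sum_mul, map_sum, Finset.sum_mul]
  have : ∑ j ∈ Finset.range (p - 1), F ^ j * ((qFact (qRoot p) (p - 1))⁻¹ •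
        (K ^ p * qBracketK p K Kinv * E ^ (p - 1))) * F ^ (p - 1 - 1 - j) * z =
      ((qFact (qRoot p) (p - 1))⁻¹ * (((qRoot p - (qRoot p)⁻¹) ^ 2)⁻¹ ^ (p - 2) * (-1) ^ k)) •
      ∑ r ∈ Finset.Icc 1 (p - 1), Polynomial.aeval (casimir p E F K Kinv)
        (Polynomial.C (qZ (qRoot p) (k + 1 + 2 * r)) *
        ∏ r' ∈ (Finset.Icc 1 (p - 1)).erase r,
        (Polynomial.X - Polynomial.C (betaZ p (k + 1 + 2 * r')))) * (E * z) := by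
    rw [← Finset.Ico_add_one_right_eq_Icc, Finset.sum_Ico_eq_sum_range, Finset.smul_sum,
      Nat.add_sub_cancel]
    refine Finset.sum_congr rfl fun j hj => ?_
    rw [Finset.mem_range] at hj
    rw [mul_smul_comm, smul_mul_assoc, smul_mul_assoc, H.F_pow_K_pow_term hp hz hj, smul_smul,
      add_comm 1 j]
    have : Finset.Ico 1 (p - 1 + 1) = Finset.Icc 1 (p - 1) := Finset.Ico_add_one_right_eq_Icc _ _
    rw [this]
  rw [this, smul_smul, smul_smul]
  congr 1
  ring

/-- The commutator of `h = [e, f] / 2` and `E`. -/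
theorem commutator_E (H : IsPreLimit p E F K Kinv e f) (hp : 2 ≤ p) :
    (e * f - f * e) * E - E * (e * f - f * e) = E * elemA p E F K Kinv := by
  refine H.restricted.eq_of_weight hp _ _ fun k z hz => ?_
  rw [H.commutator_weight hp hz, H.restricted.E_mul_elemA hp hz]
  -- If `p` divides `k + 1`, both sides vanish: `[k + 1] = 0`, and no `s` between `1` and `p - 1` is
  -- congruent to `k + 1` up to sign.
  by_cases hdiv : (p : ℤ) ∣ k + 1
  · rw [(qZ_qRoot_eq_zero_iff hp _).2 hdiv, mul_zero, zero_mul, zero_mul, zero_smul,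
      Finset.sum_eq_zero]
    intro s hs
    rw [Finset.mem_Icc] at hs
    obtain ⟨c, hc⟩ := hdiv
    refine if_neg ?_
    rintro (⟨c', hc'⟩ | ⟨c', hc'⟩)
    · have h1 : (p : ℤ) ∣ s := ⟨c - 2 * c', by linear_combination hc - hc'⟩
      have := Int.le_of_dvd (by omega) h1
      omega
    · have h1 : (p : ℤ) ∣ s := ⟨2 * c' - c, by linear_combination hc' - hc⟩
      have := Int.le_of_dvd (by omega) h1
      omega
  · obtain ⟨s, hsp, hs⟩ := exists_le_dvd hp (k + 1)
    have hs0 : s ≠ 0 := by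
      rintro rfl
      refine hdiv ?_
      rcases hs with ⟨c, hc⟩ | ⟨c, hc⟩ <;> exact ⟨2 * c, by push_cast at hc; linear_combination hc⟩
    have hsp' : s ≠ p := by
      rintro rfl
      refine hdiv ?_
      rcases hs with ⟨c, hc⟩ | ⟨c, hc⟩
      · exact ⟨2 * c + 1, by linear_combination hc⟩
      · exact ⟨2 * c - 1, by linear_combination hc⟩
    have hsI : s ∈ Finset.Icc 1 (p - 1) := by rw [Finset.mem_Icc]; omega
    have hbeta := betaZ_eq_of_dvd_or hp hs
    -- The index `r₀ ≡ -(k + 1)` modulo `p` is the one that survives the cancellation; it is `p - s`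
    -- or `s` according to the sign in `k + 1 ≡ ±s`.
    obtain ⟨r₀, m, hr₀, hm⟩ : ∃ (r₀ : ℕ) (m : ℤ), r₀ ∈ Finset.Icc 1 (p - 1) ∧ k + 1 + r₀ = p * m := by
      rcases hs with ⟨c, hc⟩ | ⟨c, hc⟩
      · refine ⟨p - s, 2 * c + 1, by rw [Finset.mem_Icc]; omega, ?_⟩
        rw [Nat.cast_sub hsp]
        linear_combination hc
      · exact ⟨s, 2 * c, hsI, by linear_combination hc⟩
    rw [Finset.sum_eq_single_of_mem (s := Finset.Icc 1 (p - 1)) (f := fun s : ℕ => ite _ _ _) s hsI,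
      if_pos hs]
    · set P : Polynomial ℂ := ∏ r' ∈ (Finset.Icc 1 (p - 1)).erase r₀,
        (Polynomial.X - Polynomial.C (betaZ p (k + 1 + 2 * r'))) with hP
      rw [sum_qZ_prod_betaZ hp hr₀ hm, ← hP, aeval_C_mul_mul, smul_smul]
      have hPdvd : P ∣ psi p s := by
        refine prod_betaZ_dvd_psi hp hsI (k + 1) (Finset.erase_subset _ _) fun r hr hdvd => ?_
        rw [Finset.mem_erase, Finset.mem_Icc] at hr
        have h1 : (2 * p : ℤ) ∣ 2 * r ∨ (2 * p : ℤ) ∣ 2 * (r - r₀) := by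
          rcases hs with ⟨c, hc⟩ | ⟨c, hc⟩ <;> rcases hdvd with ⟨c', hc'⟩ | ⟨c', hc'⟩
          · exact Or.inl ⟨c' - c, by linear_combination hc' - hc⟩
          · exact Or.inr ⟨c' + c - m, by linear_combination hc' + hc - 2 * hm⟩
          · exact Or.inr ⟨c' + c - m, by linear_combination hc' + hc - 2 * hm⟩
          · exact Or.inl ⟨c' - c, by linear_combination hc' - hc⟩
        rw [mul_dvd_mul_iff_left (by norm_num), mul_dvd_mul_iff_left (by norm_num)] at h1
        rcases h1 with h1 | ⟨c, hc⟩
        · have := Int.le_of_dvd (by omega) h1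
          omega
        · rw [Finset.mem_Icc] at hr₀
          have h4 : r < p := by omega
          have h5 : r₀ < p := by omega
          have hc1 : c < 1 := by by_contra hh; nlinarith [not_lt.1 hh]
          have hc2 : -1 < c := by by_contra hh; nlinarith [not_lt.1 hh]
          have : c = 0 := by omega
          subst this
          omega
      have hβ : betaZ p (k + 1 + 2 * r₀) = betaZ p s := by
        rw [← hbeta]
        exact betaZ_eq_of_dvd_or hp (Or.inr ⟨m, by linear_combination 2 * hm⟩)
      -- The omitted factor has root `β_s`; restoring it to `P` gives the polynomial that
      -- annihilates `E z`.
      have hprod : (Polynomial.X - Polynomial.C (betaZ p s)) * P = ∏ r ∈ Finset.Icc 1 (p - 1),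
          (Polynomial.X - Polynomial.C (betaZ p (k + 1 + 2 * r))) := by
        rw [← hβ, hP, Finset.mul_prod_erase _ (fun r' : ℕ => Polynomial.X -
          Polynomial.C (betaZ p (k + 1 + 2 * r'))) hr₀]
      have hval := prod_betaZ_eval hp hr₀ hm
      rw [← hP, hbeta] at hval
      have hk1 : qZ (qRoot p) (k + 1) = -((-1) ^ m * qInt (qRoot p) r₀) := by
        rw [show k + 1 = -r₀ + p * m by linear_combination hm, qZ_qRoot_add_mul hp, qZ_neg,
          qZ_natCast]
        ring
      have hk2 : qZ (qRoot p) (k + 1 + 2 * r₀) = (-1) ^ m * qInt (qRoot p) r₀ := by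
        rw [show k + 1 + 2 * r₀ = r₀ + p * m by linear_combination hm, qZ_qRoot_add_mul hp,
          qZ_natCast]
      have hk3 : (-1 : ℂ) ^ k = ((-1) ^ m) ^ p * (-1) ^ (r₀ + 1) := by
        rw [show k = m * p - ((r₀ + 1 : ℕ) : ℤ) by push_cast; linear_combination hm,
          zpow_sub₀ (by norm_num), zpow_mul, zpow_natCast, zpow_natCast, div_eq_mul_inv, ← inv_pow]
        norm_num
      have hc0 := qFact_qRoot_ne_zero hp (n := p - 1) (by omega)
      have hd := pow_ne_zero 2 (qRoot_sub_inv_ne_zero hp)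
      have hε : ((-1 : ℂ) ^ m) ^ 2 = 1 := by
        rw [← zpow_natCast, ← zpow_mul, mul_comm, zpow_mul]; norm_num
      have hδ : ((-1 : ℂ) ^ (r₀ + 1)) ^ 2 = 1 := by
        rw [← pow_mul, mul_comm, pow_mul]; norm_num
      -- The coefficient of the surviving product is exactly the inverse of `P(β_s)`, so that
      -- `dvd_idemPoly_sub` identifies this product with the idempotent on `E z`.
      have hscalar : ((-1) ^ (p + 1) / qFact (qRoot p) (p - 1) * qZ (qRoot p) (k + 1) *
          (qFact (qRoot p) (p - 1))⁻¹ * (((qRoot p - (qRoot p)⁻¹) ^ 2)⁻¹ ^ (p - 2) * (-1) ^ k) *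
          qZ (qRoot p) (k + 1 + 2 * r₀)) * P.eval (betaZ p s) = 1 := by
        rw [hk1, hk2, hk3]
        obtain ⟨n, rfl⟩ : ∃ n, p = n + 2 := ⟨p - 2, by omega⟩
        rw [Nat.add_sub_cancel] at *
        generalize (-1 : ℂ) ^ m = ε at *
        generalize (-1 : ℂ) ^ (r₀ + 1) = δ at *
        generalize (qRoot (n + 2) - (qRoot (n + 2))⁻¹) ^ 2 = d at *
        generalize qFact (qRoot (n + 2)) (n + 2 - 1) = c0 at *
        generalize qInt (qRoot (n + 2)) r₀ = x at *
        generalize P.eval (betaZ (n + 2) s) = y at *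
        have e1 : (-1 : ℂ) ^ (n + 2 + 1) / c0 * -(ε * x) * c0⁻¹ * (d⁻¹ ^ n * (ε ^ (n + 2) * δ)) *
            (ε * x) * y = (-1) ^ n * (c0⁻¹ ^ 2 * d⁻¹ ^ n * ε ^ n * δ) * (ε ^ 2) ^ 2 * (x ^ 2 * y) := by
          rw [div_eq_mul_inv]; ring
        have e2 : d⁻¹ ^ n * (-d) ^ n = (-1) ^ n := by
          rw [← mul_pow, mul_neg, inv_mul_cancel₀ hd]
        have e3 : c0⁻¹ ^ 2 * c0 ^ 2 = 1 := by rw [← mul_pow, inv_mul_cancel₀ hc0, one_pow]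
        have e4 : (-1 : ℂ) ^ n * (-1) ^ n = 1 := by rw [← mul_pow]; norm_num
        have e5 : ε ^ n * ε ^ n = 1 := by rw [← mul_pow, ← sq, hε, one_pow]
        rw [e1, hval, hε]
        calc _ = (c0⁻¹ ^ 2 * c0 ^ 2) * ((-1) ^ n * (d⁻¹ ^ n * (-d) ^ n)) * (ε ^ n * ε ^ n) *
              δ ^ 2 := by ring
          _ = 1 := by rw [e2, e3, e4, e5, hδ]; norm_num
      have hfin := H.restricted.aeval_mul_E_eq_zero hp hz
        (hprod ▸ dvd_idemPoly_sub hp hsI hPdvd hscalar)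
      rw [map_sub, sub_mul, sub_eq_zero, aeval_C_mul_mul] at hfin
      exact hfin.symm
    · intro s' hs' hne
      refine if_neg fun hs'd => hne ?_
      rw [Finset.mem_Icc] at hs'
      refine betaZ_injOn hp (by omega) hsp ?_
      rw [← hbeta, betaZ_eq_of_dvd_or hp hs'd]

end IsPreLimit

/-! ### The opposite algebra -/

section Opposite
open MulOpposite
variable {A : Type*} [Ring A] [Algebra ℂ A] {p : ℕ} {E F K Kinv e f : A}

lemma aeval_op (x : A) (P : Polynomial ℂ) :
    Polynomial.aeval (op x) P = op (Polynomial.aeval x P) := by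
  induction P using Polynomial.induction_on' with
  | add P Q hP hQ => rw [map_add, map_add, hP, hQ, op_add]
  | monomial n c =>
    rw [Polynomial.aeval_monomial, Polynomial.aeval_monomial, ← Algebra.smul_def,
      ← Algebra.smul_def, op_smul, op_pow]

lemma casimir_op (p : ℕ) (E F K Kinv : A) :
    casimir p (op F) (op E) (op K) (op Kinv) = op (casimir p E F K Kinv) := rfl

lemma qBracketK_op (p : ℕ) (K Kinv : A) :
    qBracketK p (op K) (op Kinv) = op (qBracketK p K Kinv) := rfl

lemma idem_op (p s : ℕ) (E F K Kinv : A) :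
    idem p (op F) (op E) (op K) (op Kinv) s = op (idem p E F K Kinv s) := by
  rw [idem_eq_aeval, idem_eq_aeval, casimir_op, aeval_op]

lemma IsQuantum.op {v : ℂ} (hv : v ≠ 0) (h : IsQuantum v E F K Kinv) :
    IsQuantum v (op F) (op E) (op K) (op Kinv) where
  K_mul_Kinv := by rw [← op_mul, h.Kinv_mul_K, op_one]
  Kinv_mul_K := by rw [← op_mul, h.K_mul_Kinv, op_one]
  K_E := by
    rw [← op_mul, ← op_mul, h.K_F, ← op_smul, smul_smul, ← mul_pow, mul_inv_cancel₀ hv, one_pow,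
      one_smul]
  K_F := by
    rw [← op_mul, ← op_mul, h.K_E, ← op_smul, smul_smul, ← mul_pow, inv_mul_cancel₀ hv, one_pow,
      one_smul]
  E_F := by rw [← op_mul, ← op_mul, ← op_sub, h.E_F]; rfl

lemma IsRestricted.op (h : IsRestricted p E F K Kinv) :
    IsRestricted p (op F) (op E) (op K) (op Kinv) where
  quantum := h.quantum.op (qRoot_ne_zero p)
  E_pow := by rw [← op_pow, h.F_pow, op_zero]
  F_pow := by rw [← op_pow, h.E_pow, op_zero]
  K_pow := by rw [← op_pow, h.K_pow, op_one]

lemma IsRestricted.elemA_op (h : IsRestricted p E F K Kinv) :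
    elemA p (MulOpposite.op F) (MulOpposite.op E) (MulOpposite.op K) (MulOpposite.op Kinv) =
      MulOpposite.op (elemA p E F K Kinv) := by
  simp only [elemA]
  rw [← MulOpposite.opAddEquiv_apply, map_sum]
  simp only [MulOpposite.opAddEquiv_apply]
  refine Finset.sum_congr rfl fun s _ => ?_
  rw [idem_op, aeval_op, op_smul, idem_eq_aeval]
  congr 1
  have e1 : Commute (Polynomial.aeval (casimir p E F K Kinv) (idemPoly p s))
      (Polynomial.aeval K (uPoly p s)) := by
    generalize uPoly p s = P
    induction P using Polynomial.induction_on' with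
    | add P Q hP hQ => rw [map_add]; exact hP.add_right hQ
    | monomial n c =>
      rw [Polynomial.aeval_monomial, ← Algebra.smul_def]
      exact ((h.commute_aeval_K _).pow_right n).smul_right c
  have e2 : Commute K (Polynomial.aeval K (uPoly p s)) := by
    have := (Polynomial.commute_X (uPoly p s)).map (Polynomial.aeval K)
    rwa [Polynomial.aeval_X] at this
  have e3 : ∀ a b : ℂ, a • MulOpposite.op K + algebraMap ℂ Aᵐᵒᵖ b =
      MulOpposite.op (a • K + algebraMap ℂ A b) := fun _ _ => rfl
  have e4 : ∀ a b : ℂ, Commute (a • K + algebraMap ℂ A b) (Polynomial.aeval K (uPoly p s)) :=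
    fun a b => (e2.smul_left a).add_left (Algebra.commutes b _)
  have e5 : ∀ a b : ℂ, Commute (Polynomial.aeval (casimir p E F K Kinv) (idemPoly p s))
      (a • K + algebraMap ℂ A b) :=
    fun a b => ((h.commute_aeval_K _).smul_right a).add_right (Algebra.commutes b _).symm
  rw [e3, ← op_mul, ← op_mul, (e4 _ _).eq, (e1.mul_right (e5 _ _)).eq]

namespace IsRestricted

lemma K_pow_mul_E (h : IsRestricted p E F K Kinv) (hp : 2 ≤ p) : K ^ p * E = E * K ^ p := by
  have h1 : ∀ n, K ^ n * E = qRoot p ^ (2 * n) • (E * K ^ n) := by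
    intro n
    induction n with
    | zero => simp
    | succ n ih =>
      rw [pow_succ, mul_assoc, h.quantum.K_E, mul_smul_comm, ← mul_assoc, ih, smul_mul_assoc,
        smul_smul, mul_assoc, ← pow_add]
      congr 2; ring
  rw [h1, mul_comm, pow_mul, qRoot_pow hp, neg_one_sq, one_smul]

lemma K_pow_mul_F (h : IsRestricted p E F K Kinv) (hp : 2 ≤ p) : K ^ p * F = F * K ^ p := by
  have h1 := h.op.K_pow_mul_E hp
  rw [← op_pow, ← op_mul, ← op_mul] at h1
  exact (op_injective h1).symm

lemma K_pow_mul_K_pow (h : IsRestricted p E F K Kinv) : K ^ p * K ^ p = 1 := by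
  rw [← pow_add, ← two_mul, h.K_pow]

lemma K_pow_mul_qBracketK (h : IsRestricted p E F K Kinv) :
    K ^ p * qBracketK p K Kinv = qBracketK p K Kinv * K ^ p := by
  have h1 : Commute K (qBracketK p K Kinv) := by
    rw [commute_iff_eq]
    simp only [qBracketK, mul_smul_comm, smul_mul_assoc, mul_sub, sub_mul, h.quantum.K_mul_Kinv,
      h.quantum.Kinv_mul_K]
  exact (h1.pow_left p).eq

end IsRestricted

namespace IsPreLimit

/-- The relations have a symmetry that reverses products, exchanges `E` and `F`, and exchanges `e`
and `f` up to `(-1)^p K^p`. The factor `K^p`, which has square `1` and commutes with all other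
generators, accounts for the `K^p` that stands in only one of the relations for `[F, e]` and `[E,
f]`. Statements about `F` and `f` thereby follow from those about `E` and `e`. -/
lemma op (H : IsPreLimit p E F K Kinv e f) (hp : 2 ≤ p) :
    IsPreLimit p (op F) (op E) (op K) (op Kinv) (op ((-1 : ℂ) ^ p • (f * K ^ p)))
      (MulOpposite.op ((-1 : ℂ) ^ p • (e * K ^ p))) := by
  have hR := H.restricted
  have hKE := hR.K_pow_mul_E hp
  have hKF := hR.K_pow_mul_F hp
  have hsq : (-1 : ℂ) ^ p * (-1) ^ p = 1 := by rw [← mul_pow]; norm_num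
  refine ⟨hR.op, ?_, ?_, ?_, ?_, ?_, ?_⟩
  · rw [← op_mul, ← op_mul, smul_mul_assoc, mul_smul_comm, mul_assoc, hKF, ← mul_assoc, ← H.F_f,
      mul_assoc]
  · rw [← op_mul, ← op_mul, smul_mul_assoc, mul_smul_comm, mul_assoc, ← pow_succ, pow_succ',
      ← mul_assoc, ← H.K_f, mul_assoc]
  · rw [← op_mul, ← op_mul, smul_mul_assoc, mul_smul_comm, mul_assoc, hKE, ← mul_assoc, ← H.E_e,
      mul_assoc]
  · rw [← op_mul, ← op_mul, smul_mul_assoc, mul_smul_comm, mul_assoc, ← pow_succ, pow_succ',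
      ← mul_assoc, ← H.K_e, mul_assoc]
  · rw [qBracketK_op, ← op_mul, ← op_mul, ← op_pow, ← op_pow, ← op_mul, ← op_mul, ← op_sub,
      ← op_smul]
    congr 1
    have : f * K ^ p * E - E * (f * K ^ p) = -((E * f - f * E) * K ^ p) := by
      rw [mul_assoc, hKE]; noncomm_ring
    rw [smul_mul_assoc, mul_smul_comm, ← smul_sub, this, H.E_f, smul_mul_assoc, smul_neg,
      ← neg_smul, smul_smul, mul_assoc]
    congr 1
    rw [div_eq_mul_inv, pow_succ]
    linear_combination (qFact (qRoot p) (p - 1))⁻¹ * hsq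
  · rw [qBracketK_op, ← op_mul, ← op_mul, ← op_pow, ← op_mul, ← op_sub, ← op_smul]
    congr 1
    have h1 : e * K ^ p * F - F * (e * K ^ p) = -((F * e - e * F) * K ^ p) := by
      rw [mul_assoc, hKF]; noncomm_ring
    have h2 : K ^ p * qBracketK p K Kinv * E ^ (p - 1) * K ^ p =
        qBracketK p K Kinv * E ^ (p - 1) := by
      have h3 : Commute (K ^ p) (E ^ (p - 1)) := Commute.pow_right hKE _
      rw [hR.K_pow_mul_qBracketK, mul_assoc, mul_assoc, ← h3.eq, ← mul_assoc (K ^ p),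
        hR.K_pow_mul_K_pow, one_mul]
    rw [smul_mul_assoc, mul_smul_comm, ← smul_sub, h1, H.F_e, smul_mul_assoc, h2, smul_neg,
      ← neg_smul, smul_smul]
    congr 1
    rw [div_eq_mul_inv, pow_succ]
    ring

lemma K_pow_e (H : IsPreLimit p E F K Kinv e f) : K ^ p * e = e * K ^ p :=
  (Commute.pow_left H.K_e p)

lemma K_pow_f (H : IsPreLimit p E F K Kinv e f) : K ^ p * f = f * K ^ p :=
  (Commute.pow_left H.K_f p)

/-- The two factors `K^p` cancel, and so do the signs: the symmetry fixes `[e, f]`. -/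
lemma op_commutator (H : IsPreLimit p E F K Kinv e f) :
    MulOpposite.op ((-1 : ℂ) ^ p • (f * K ^ p)) * MulOpposite.op ((-1 : ℂ) ^ p • (e * K ^ p)) -
      MulOpposite.op ((-1 : ℂ) ^ p • (e * K ^ p)) * MulOpposite.op ((-1 : ℂ) ^ p • (f * K ^ p)) =
      MulOpposite.op (e * f - f * e) := by
  have hsq : (-1 : ℂ) ^ p * (-1) ^ p = 1 := by rw [← mul_pow]; norm_num
  have h1 : e * K ^ p * (f * K ^ p) = e * f := by
    rw [mul_assoc, ← mul_assoc (K ^ p), H.K_pow_f, mul_assoc, H.restricted.K_pow_mul_K_pow, mul_one]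
  have h2 : f * K ^ p * (e * K ^ p) = f * e := by
    rw [mul_assoc, ← mul_assoc (K ^ p), H.K_pow_e, mul_assoc, H.restricted.K_pow_mul_K_pow, mul_one]
  rw [← op_mul, ← op_mul, ← op_sub]
  simp only [smul_mul_assoc, mul_smul_comm, smul_smul, hsq, one_smul, h1, h2]

/-- The commutator of `h = [e, f] / 2` and `F`. -/
theorem commutator_F (H : IsPreLimit p E F K Kinv e f) (hp : 2 ≤ p) :
    (e * f - f * e) * F - F * (e * f - f * e) = -(elemA p E F K Kinv * F) := by
  have h1 := (H.op hp).commutator_E hp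
  rw [H.op_commutator, H.restricted.elemA_op, ← op_mul, ← op_mul, ← op_mul, ← op_sub] at h1
  rw [← op_injective h1, neg_sub]

end IsPreLimit

end Opposite

/-! ### The special fiber of the form with divided powers -/

namespace IsQuantum
variable {k A : Type*} [Field k] [Ring A] [Algebra k A] {v : k} {E F K Kinv : A}

lemma K_pow_E_pow (h : IsQuantum v E F K Kinv) (n m : ℕ) :
    K ^ n * E ^ m = v ^ (2 * n * m) • (E ^ m * K ^ n) := by
  have h1 : ∀ n, K ^ n * E = v ^ (2 * n) • (E * K ^ n) := by
    intro n
    induction n with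
    | zero => simp
    | succ n ih =>
      rw [pow_succ, mul_assoc, h.K_E, mul_smul_comm, ← mul_assoc, ih, smul_mul_assoc,
        smul_smul, mul_assoc, ← pow_add]
      congr 2; ring
  induction m with
  | zero => simp
  | succ m ih =>
    rw [pow_succ, ← mul_assoc, ih, smul_mul_assoc, mul_assoc (E ^ m), h1, mul_smul_comm, smul_smul,
      ← pow_add, mul_assoc (E ^ m)]
    congr 2

lemma K_pow_F_pow (h : IsQuantum v E F K Kinv) (n m : ℕ) :
    K ^ n * F ^ m = v⁻¹ ^ (2 * n * m) • (F ^ m * K ^ n) := by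
  have h1 : ∀ n, K ^ n * F = v⁻¹ ^ (2 * n) • (F * K ^ n) := by
    intro n
    induction n with
    | zero => simp
    | succ n ih =>
      rw [pow_succ, mul_assoc, h.K_F, mul_smul_comm, ← mul_assoc, ih, smul_mul_assoc,
        smul_smul, mul_assoc, ← pow_add]
      congr 2; ring
  induction m with
  | zero => simp
  | succ m ih =>
    rw [pow_succ, ← mul_assoc, ih, smul_mul_assoc, mul_assoc (F ^ m), h1, mul_smul_comm, smul_smul,
      ← pow_add, mul_assoc (F ^ m)]
    congr 2

end IsQuantum

instance (p : ℕ) : SMul (regularAt (qRoot p)) (DividedForm p) := Algebra.toSMul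

/-- The multiples of `v - q` in the form with divided powers. -/
def specialIdeal (p : ℕ) : Ideal (DividedForm p) where
  carrier := {x | ∃ y : DividedForm p, x = reg p (RatFunc.X - RatFunc.C (qRoot p)) • y}
  zero_mem' := ⟨0, (smul_zero _).symm⟩
  add_mem' := by
    rintro _ _ ⟨x, rfl⟩ ⟨y, rfl⟩
    exact ⟨x + y, (smul_add _ _ _).symm⟩
  smul_mem' := by
    rintro c _ ⟨x, rfl⟩
    exact ⟨c * x, mul_smul_comm _ _ _⟩

instance (p : ℕ) : (specialIdeal p).IsTwoSided where
  mul_mem_of_left := by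
    rintro _ c ⟨x, rfl⟩
    exact ⟨x * c, smul_mul_assoc _ _ _⟩

/-- The quotient of the form with divided powers by `v - q`. -/
def SpecialFiber (p : ℕ) := DividedForm p ⧸ specialIdeal p

namespace SpecialFiber
variable (p : ℕ)

instance : Ring (SpecialFiber p) := inferInstanceAs (Ring (DividedForm p ⧸ specialIdeal p))

instance : Algebra (regularAt (qRoot p)) (SpecialFiber p) :=
  inferInstanceAs (Algebra (regularAt (qRoot p)) (DividedForm p ⧸ specialIdeal p))

/-- The quotient map. -/
def mk : DividedForm p →ₐ[regularAt (qRoot p)] SpecialFiber p :=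
  Ideal.Quotient.mkₐ _ (specialIdeal p)

lemma mk_surjective : Function.Surjective (mk p) := Ideal.Quotient.mk_surjective

instance : Algebra ℂ (SpecialFiber p) :=
  Algebra.compHom _ (algebraMap ℂ (regularAt (qRoot p)))

variable {p}

lemma specializes_X_sub_C : Specializes (qRoot p) (RatFunc.X - RatFunc.C (qRoot p)) 0 := by
  simpa using (Specializes.X (a := qRoot p)).sub (Specializes.C (qRoot p))

lemma mk_eq_zero_iff {x : DividedForm p} : mk p x = 0 ↔
    ∃ y : DividedForm p, (x : Ugen) = (RatFunc.X - RatFunc.C (qRoot p)) • (y : Ugen) := by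
  refine Ideal.Quotient.eq_zero_iff_mem.trans ?_
  refine exists_congr fun y => ?_
  rw [Subtype.ext_iff, DividedForm.coe_reg_smul specializes_X_sub_C]

lemma mk_smul (c : regularAt (qRoot p)) (x : DividedForm p) :
    mk p (c • x) = algebraMap (regularAt (qRoot p)) ℂ c • mk p x := by
  set d := algebraMap (regularAt (qRoot p)) ℂ c with hd
  have h1 : Specializes (qRoot p) (c : RatFunc ℂ) d := specializes_eval c.2
  have h2 : Specializes (qRoot p) ((c : RatFunc ℂ) - RatFunc.C d) 0 := by
    simpa using h1.sub (Specializes.C d)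
  obtain ⟨y, hy, hxy⟩ := h2.exists_eq_mul
  have h3 : mk p (c • x - algebraMap ℂ (regularAt (qRoot p)) d • x) = 0 := by
    refine mk_eq_zero_iff.2 ⟨(⟨y, hy⟩ : regularAt (qRoot p)) • x, ?_⟩
    change (c : RatFunc ℂ) • (x : Ugen) - (algebraMap ℂ (RatFunc ℂ) d) • (x : Ugen) =
      _ • (y • (x : Ugen))
    rw [smul_smul, ← hxy, ← sub_smul]
    rfl
  rw [map_sub, sub_eq_zero] at h3
  rw [h3, map_smul]
  rfl

lemma mk_eq_smul {x y : DividedForm p} {c : RatFunc ℂ} {d : ℂ} (hc : Specializes (qRoot p) c d)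
    (h : (x : Ugen) = c • (y : Ugen)) : mk p x = d • mk p y := by
  have : x = reg p c • y := Subtype.ext (by rw [DividedForm.coe_reg_smul hc, h])
  rw [this, mk_smul, hc.algebraMap_reg]

lemma mk_reg_smul {c : RatFunc ℂ} {d : ℂ} (hc : Specializes (qRoot p) c d) (x : DividedForm p) :
    mk p (reg p c • x) = d • mk p x := by
  rw [mk_smul, hc.algebraMap_reg]

variable (p) in
abbrev E : SpecialFiber p := mk p (DividedForm.E p)
variable (p) in
abbrev F : SpecialFiber p := mk p (DividedForm.F p)
variable (p) in
abbrev K : SpecialFiber p := mk p (DividedForm.K p)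
variable (p) in
abbrev Kinv : SpecialFiber p := mk p (DividedForm.Kinv p)
variable (p) in
abbrev e : SpecialFiber p := mk p (DividedForm.e p)
variable (p) in
abbrev f : SpecialFiber p := mk p (DividedForm.f p)
variable (p) in
abbrev h : SpecialFiber p := mk p (DividedForm.h p)

lemma specializes_X_sub_inv_inv (hp : 2 ≤ p) :
    Specializes (qRoot p) (RatFunc.X - RatFunc.X⁻¹)⁻¹ (qRoot p - (qRoot p)⁻¹)⁻¹ :=
  (Specializes.X.sub specializes_X_inv).inv (qRoot_sub_inv_ne_zero hp)

lemma isQuantum (hp : 2 ≤ p) : IsQuantum (qRoot p) (E p) (F p) (K p) (Kinv p) where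
  K_mul_Kinv := by
    rw [← map_mul, ← map_one (mk p)]
    exact congrArg _ (Subtype.ext (Uq.isQuantum RatFunc.X).K_mul_Kinv)
  Kinv_mul_K := by
    rw [← map_mul, ← map_one (mk p)]
    exact congrArg _ (Subtype.ext (Uq.isQuantum RatFunc.X).Kinv_mul_K)
  K_E := by
    rw [← map_mul, ← map_mul]
    exact mk_eq_smul (Specializes.X.pow 2) (Uq.isQuantum RatFunc.X).K_E
  K_F := by
    rw [← map_mul, ← map_mul]
    exact mk_eq_smul (specializes_X_inv.pow 2) (Uq.isQuantum RatFunc.X).K_F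
  E_F := by
    rw [← map_mul, ← map_mul, ← map_sub, ← map_sub]
    exact mk_eq_smul (specializes_X_sub_inv_inv hp) (Uq.isQuantum RatFunc.X).E_F

end SpecialFiber

namespace DividedForm
variable (p : ℕ)

/-- `[K; c]` in the form with divided powers. -/
def bracket (c : ℤ) : DividedForm p :=
  reg p (RatFunc.X - RatFunc.X⁻¹)⁻¹ •
    (reg p (RatFunc.X ^ c) • K p - reg p (RatFunc.X ^ (-c)) • Kinv p)

/-- `[K; c] [K; c - 1] ⋯ [K; c - t + 1]` in the form with divided powers. -/
def bracketsProd (c : ℤ) : ℕ → DividedForm p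
  | 0 => 1
  | t + 1 => bracketsProd c t * bracket p (c - t)

variable {p}

lemma coe_bracket (hp : 2 ≤ p) (c : ℤ) :
    (bracket p c : Ugen) = bracketK (RatFunc.X : RatFunc ℂ) Ugen.K Ugen.Kinv c := by
  rw [bracket, coe_reg_smul (SpecialFiber.specializes_X_sub_inv_inv hp)]
  change _ • (((reg p (RatFunc.X ^ c) • K p : DividedForm p) : Ugen) -
    ((reg p (RatFunc.X ^ (-c)) • Kinv p : DividedForm p) : Ugen)) = _
  rw [coe_reg_smul (specializes_X_zpow c), coe_reg_smul (specializes_X_zpow (-c))]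
  rfl

lemma mk_bracket (hp : 2 ≤ p) (c : ℤ) : SpecialFiber.mk p (bracket p c) =
    bracketK (qRoot p) (SpecialFiber.K p) (SpecialFiber.Kinv p) c := by
  rw [bracket, SpecialFiber.mk_reg_smul (SpecialFiber.specializes_X_sub_inv_inv hp), map_sub,
    SpecialFiber.mk_reg_smul (specializes_X_zpow c),
    SpecialFiber.mk_reg_smul (specializes_X_zpow (-c))]
  rfl

lemma coe_bracketsProd (hp : 2 ≤ p) (c : ℤ) (t : ℕ) :
    (bracketsProd p c t : Ugen) = bracketProd (RatFunc.X : RatFunc ℂ) Ugen.K Ugen.Kinv c t := by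
  induction t with
  | zero => rfl
  | succ t ih =>
    change (bracketsProd p c t : Ugen) * (bracket p (c - t) : Ugen) = _
    rw [ih, coe_bracket hp]
    rfl

lemma mk_bracketsProd (hp : 2 ≤ p) (c : ℤ) (t : ℕ) : SpecialFiber.mk p (bracketsProd p c t) =
    bracketProd (qRoot p) (SpecialFiber.K p) (SpecialFiber.Kinv p) c t := by
  induction t with
  | zero => exact map_one _
  | succ t ih => rw [bracketsProd, map_mul, ih, mk_bracket hp]; rfl

end DividedForm

lemma bracketK_one_sub {p : ℕ} (hp : 2 ≤ p) {A : Type*} [Ring A] [Algebra ℂ A] (K Kinv : A) :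
    bracketK (qRoot p) K Kinv (-((p - 1 : ℕ) : ℤ)) = -qBracketK p K Kinv := by
  have h1 : qRoot p ^ (-((p - 1 : ℕ) : ℤ)) = -qRoot p := by
    rw [Nat.cast_sub (by omega), neg_sub, Nat.cast_one,
      zpow_sub₀ (qRoot_ne_zero p), zpow_natCast, qRoot_pow hp, zpow_one, div_neg, div_one]
  have h2 : qRoot p ^ (-(-((p - 1 : ℕ) : ℤ))) = -(qRoot p)⁻¹ := by
    rw [zpow_neg, h1, inv_neg]
  rw [bracketK, qBracketK, h1, h2, ← smul_neg, neg_smul, neg_smul]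
  congr 1
  abel

namespace SpecialFiber
variable {p : ℕ}

lemma dpow_mul_qFact (x : Ugen) (n : ℕ) : x ^ n = qFact (RatFunc.X : RatFunc ℂ) n •
    dpow (RatFunc.X : RatFunc ℂ) x n := by
  rw [dpow, smul_smul, mul_inv_cancel₀ (qFact_X_ne_zero n), one_smul]

lemma qFact_qRoot_self (hp : 2 ≤ p) : qFact (qRoot p) p = 0 := by
  obtain ⟨n, rfl⟩ : ∃ n, p = n + 1 := ⟨p - 1, by omega⟩
  rw [qFact_succ, qInt_qRoot_self hp, mul_zero]

/-- `E^p = [p]! E^(p)`, where `E^(p)` lies in the form and `[p]!` vanishes at `q`. -/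
lemma E_pow (hp : 2 ≤ p) : E p ^ p = 0 := by
  rw [← map_pow, mk_eq_smul (specializes_qFact hp p) (y := DividedForm.dE p p), qFact_qRoot_self hp,
    zero_smul]
  rw [DividedForm.coe_dE hp le_rfl]
  exact dpow_mul_qFact _ _

lemma F_pow (hp : 2 ≤ p) : F p ^ p = 0 := by
  rw [← map_pow, mk_eq_smul (specializes_qFact hp p) (y := DividedForm.dF p p), qFact_qRoot_self hp,
    zero_smul]
  rw [DividedForm.coe_dF hp le_rfl]
  exact dpow_mul_qFact _ _

lemma E_e (hp : 2 ≤ p) : E p * e p = e p * E p := by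
  have hq := Uq.isQuantum (RatFunc.X : RatFunc ℂ)
  rw [← map_mul, ← map_mul, ← one_smul ℂ (mk p (DividedForm.e p * _)), eq_comm]
  rw [one_smul, ← one_smul ℂ (mk p (DividedForm.E p * _))]
  refine mk_eq_smul (specializes_X_pow_two_mul hp) ?_
  change Ugen.e p * Ugen.E = _ • (Ugen.E * Ugen.e p)
  have h1 := hq.K_pow_E_pow p 1
  rw [pow_one, mul_one] at h1
  rw [Ugen.e, smul_mul_assoc, mul_assoc, ← pow_succ, pow_succ', ← mul_assoc, h1, mul_smul_comm,
    smul_mul_assoc, smul_comm, mul_assoc]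

lemma F_f : F p * f p = f p * F p := by
  rw [← map_mul, ← map_mul]
  congr 1
  refine Subtype.ext ?_
  change Ugen.F * Ugen.f p = Ugen.f p * Ugen.F
  rw [Ugen.f, mul_smul_comm, smul_mul_assoc, ← pow_succ, ← pow_succ']

lemma K_pow_e (n : ℕ) : (Ugen.K : Ugen) ^ n * Ugen.e p =
    ((RatFunc.X : RatFunc ℂ) ^ (2 * p)) ^ n • (Ugen.e p * Ugen.K ^ n) := by
  have hq := Uq.isQuantum (RatFunc.X : RatFunc ℂ)
  rw [Ugen.e, mul_smul_comm, smul_mul_assoc, ← mul_assoc, ← pow_add, add_comm, pow_add, mul_assoc,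
    hq.K_pow_E_pow, mul_smul_comm, smul_comm, ← mul_assoc, ← pow_mul]
  congr 2; ring

lemma K_pow_f (n : ℕ) : (Ugen.K : Ugen) ^ n * Ugen.f p =
    (((RatFunc.X : RatFunc ℂ) ^ (2 * p))⁻¹) ^ n • (Ugen.f p * Ugen.K ^ n) := by
  have hq := Uq.isQuantum (RatFunc.X : RatFunc ℂ)
  rw [Ugen.f, mul_smul_comm, smul_mul_assoc, hq.K_pow_F_pow, smul_comm, inv_pow, inv_pow, ← pow_mul]
  congr 3; ring

lemma K_e (hp : 2 ≤ p) : K p * e p = e p * K p := by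
  rw [← map_mul, ← map_mul, ← one_smul ℂ (mk p (DividedForm.e p * _))]
  refine mk_eq_smul (specializes_X_pow_two_mul hp) ?_
  simpa using K_pow_e (p := p) 1

lemma K_f (hp : 2 ≤ p) : K p * f p = f p * K p := by
  rw [← map_mul, ← map_mul, ← one_smul ℂ (mk p (DividedForm.f p * _))]
  refine mk_eq_smul (by simpa using (specializes_X_pow_two_mul hp).inv one_ne_zero) ?_
  simpa using K_pow_f (p := p) 1

/-- Generically `E^p F = F E^p + [p] [K; 1 - p] E^(p-1)`. Division by `[p]!` cancels the vanishing
factor `[p]`, and the factor `v^(2p)` from moving `F` past `K^p` specializes to `1`. -/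
lemma F_e (hp : 2 ≤ p) : F p * e p - e p * F p = (qFact (qRoot p) (p - 1))⁻¹ •
    (K p ^ p * qBracketK p (K p) (Kinv p) * E p ^ (p - 1)) := by
  have hq := Uq.isQuantum (RatFunc.X : RatFunc ℂ)
  have hX : (RatFunc.X : RatFunc ℂ) ≠ 0 := RatFunc.X_ne_zero
  have h1 : mk p (DividedForm.F p * DividedForm.e p) = (1 : ℂ) • mk p (DividedForm.e p *
      DividedForm.F p - reg p (qFact RatFunc.X (p - 1))⁻¹ • (DividedForm.K p ^ p *
        DividedForm.bracket p (-((p - 1 : ℕ) : ℤ)) * DividedForm.E p ^ (p - 1))) := by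
    refine mk_eq_smul (specializes_X_pow_two_mul hp) ?_
    change Ugen.F * Ugen.e p = _ • (Ugen.e p * Ugen.F - ((reg p (qFact RatFunc.X (p - 1))⁻¹ •
      (DividedForm.K p ^ p * DividedForm.bracket p (-((p - 1 : ℕ) : ℤ)) * DividedForm.E p ^ (p - 1)) :
      DividedForm p) : Ugen))
    rw [DividedForm.coe_reg_smul (DividedForm.specializes_qFact_inv hp (by omega))]
    change _ = _ • (_ - _ • (Ugen.K ^ p * (DividedForm.bracket p (-((p - 1 : ℕ) : ℤ)) : Ugen) *
      Ugen.E ^ (p - 1)))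
    have h2 := hq.K_pow_F_pow p 1
    rw [pow_one, mul_one] at h2
    have h3 : Ugen.F * Ugen.K ^ p = (RatFunc.X : RatFunc ℂ) ^ (2 * p) • (Ugen.K ^ p * Ugen.F) := by
      rw [h2, smul_smul, ← mul_pow, mul_inv_cancel₀ hX, one_pow, one_smul]
    have h4 := hq.E_pow_mul_F hX (p - 1)
    rw [Nat.sub_add_cancel (by omega)] at h4
    have h5 : qFact (RatFunc.X : RatFunc ℂ) p = qFact RatFunc.X (p - 1) * qInt RatFunc.X p := by
      conv_lhs => rw [← Nat.sub_add_cancel (by omega : 1 ≤ p), qFact_succ,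
        Nat.sub_add_cancel (by omega : 1 ≤ p)]
    rw [DividedForm.coe_bracket hp, Ugen.e, mul_smul_comm, smul_mul_assoc, ← mul_assoc, h3,
      smul_mul_assoc, smul_comm]
    congr 1
    rw [mul_assoc, mul_assoc, h4, mul_add, smul_add, mul_smul_comm, smul_smul, h5, mul_inv,
      mul_assoc (qFact _ (p - 1))⁻¹, inv_mul_cancel₀ (qInt_X_ne_zero (by omega)), mul_one,
      mul_assoc (Ugen.K ^ p) (bracketK _ _ _ _), add_sub_cancel_right]
  rw [one_smul, map_sub, mk_reg_smul (DividedForm.specializes_qFact_inv hp (by omega)), map_mul,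
    map_mul, map_mul, map_mul, DividedForm.mk_bracket hp, bracketK_one_sub hp, map_pow, map_pow] at h1
  rw [h1, mul_neg, neg_mul, smul_neg, sub_neg_eq_add, add_sub_cancel_left]

lemma E_f (hp : 2 ≤ p) : E p * f p - f p * E p = ((-1) ^ (p + 1) / qFact (qRoot p) (p - 1)) •
    (F p ^ (p - 1) * qBracketK p (K p) (Kinv p)) := by
  have hq := Uq.isQuantum (RatFunc.X : RatFunc ℂ)
  have hX : (RatFunc.X : RatFunc ℂ) ≠ 0 := RatFunc.X_ne_zero
  have h1 : mk p (DividedForm.E p * DividedForm.f p - DividedForm.f p * DividedForm.E p) =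
      ((-1) ^ p * (qFact (qRoot p) (p - 1))⁻¹) • mk p (DividedForm.F p ^ (p - 1) *
        DividedForm.bracket p (-((p - 1 : ℕ) : ℤ))) := by
    refine mk_eq_smul (c := (-1) ^ p * (qFact RatFunc.X (p - 1))⁻¹)
      ((Specializes.one.neg.pow p).mul (DividedForm.specializes_qFact_inv hp (by omega))) ?_
    change Ugen.E * Ugen.f p - Ugen.f p * Ugen.E = _ • (Ugen.F ^ (p - 1) *
      (DividedForm.bracket p (-((p - 1 : ℕ) : ℤ)) : Ugen))
    have h4 := hq.E_mul_F_pow hX (p - 1)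
    rw [Nat.sub_add_cancel (by omega)] at h4
    have h5 : qFact (RatFunc.X : RatFunc ℂ) p = qFact RatFunc.X (p - 1) * qInt RatFunc.X p := by
      conv_lhs => rw [← Nat.sub_add_cancel (by omega : 1 ≤ p), qFact_succ,
        Nat.sub_add_cancel (by omega : 1 ≤ p)]
    rw [DividedForm.coe_bracket hp, Ugen.f, mul_smul_comm, smul_mul_assoc, h4, smul_add,
      add_sub_cancel_left, smul_smul, h5, div_eq_mul_inv, mul_inv, mul_assoc, mul_assoc,
      inv_mul_cancel₀ (qInt_X_ne_zero (by omega)), mul_one]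
  rw [map_sub, map_mul, map_mul, map_mul, DividedForm.mk_bracket hp, bracketK_one_sub hp,
    map_pow] at h1
  rw [h1, mul_neg, smul_neg, ← neg_smul]
  congr 1
  rw [div_eq_mul_inv, pow_succ]
  ring

end SpecialFiber

/-! ### Elements of degree zero commuting with `e` and `f` -/

lemma commute_aeval_of_commute {R A : Type*} [CommRing R] [Ring A] [Algebra R A] {a x : A}
    (h : Commute a x) (P : Polynomial R) : Commute a (Polynomial.aeval x P) := by
  induction P using Polynomial.induction_on' with
  | add P Q hP hQ => rw [map_add]; exact hP.add_right hQ
  | monomial n c =>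
    rw [Polynomial.aeval_monomial, ← Algebra.smul_def]
    exact (h.pow_right n).smul_right c

section
variable {A : Type*} [Ring A] [Algebra ℂ A] {p : ℕ} {E F K Kinv e f : A}

lemma IsRestricted.Kinv_eq (h : IsRestricted p E F K Kinv) (hp : 2 ≤ p) :
    Kinv = K ^ (2 * p - 1) := by
  have h1 := h.K_pow
  rw [← Nat.sub_add_cancel (by omega : 1 ≤ 2 * p), pow_succ'] at h1
  rw [← one_mul (K ^ (2 * p - 1)), ← h.quantum.Kinv_mul_K, mul_assoc, h1, mul_one]

lemma IsRestricted.bracketProd_eq_aeval (h : IsRestricted p E F K Kinv) (hp : 2 ≤ p) (c : ℤ)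
    (t : ℕ) : ∃ P : Polynomial ℂ, bracketProd (qRoot p) K Kinv c t = Polynomial.aeval K P := by
  induction t with
  | zero => exact ⟨1, by rw [map_one]; rfl⟩
  | succ t ih =>
    obtain ⟨P, hP⟩ := ih
    refine ⟨P * (Polynomial.C (qRoot p - (qRoot p)⁻¹)⁻¹ * (Polynomial.C (qRoot p ^ (c - t)) *
      Polynomial.X - Polynomial.C (qRoot p ^ (-(c - t : ℤ))) * Polynomial.X ^ (2 * p - 1))), ?_⟩
    rw [bracketProd, hP, bracketK]
    simp only [map_mul, map_sub, Polynomial.aeval_C, Polynomial.aeval_X, map_pow,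
      ← Algebra.smul_def, ← h.Kinv_eq hp]

/-- The commutator of `F^m` and `e` is a sum of terms ending in `E^(p-1) F^i` with `i < m`. Followed
by `P(K) E^m`, such a term vanishes: on weight vectors `F^i E^i` is a polynomial in the Casimir
element, which leaves `E^(p-1+m-i) = 0`. -/
lemma IsPreLimit.commute_e_term (H : IsPreLimit p E F K Kinv e f) (hp : 2 ≤ p) {m : ℕ}
    (P : Polynomial ℂ) : Commute e (F ^ m * Polynomial.aeval K P * E ^ m) := by
  have hR := H.restricted
  have hB : Commute e (Polynomial.aeval K P) := commute_aeval_of_commute H.K_e.symm P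
  have hE : Commute e (E ^ m) := Commute.pow_right H.E_e.symm m
  have h0 : ∀ i < m, E ^ (p - 1) * (F ^ i * (Polynomial.aeval K P * E ^ m)) = 0 := by
    intro i hi
    refine hR.eq_of_weight hp _ _ fun k z hz => ?_
    have h1 := hR.E_pow_weight hz (m - i)
    have h2 : Polynomial.aeval K P * (E ^ m * z) = _ :=
      IsRestricted.aeval_K_weight (hR.E_pow_weight hz m) P
    rw [zero_mul, mul_assoc, mul_assoc, mul_assoc, h2, show m = i + (m - i) by omega, pow_add,
      mul_assoc, mul_smul_comm, hR.F_pow_E_pow_weight hp h1, mul_smul_comm, mul_smul_comm,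
      ← mul_assoc (E ^ (p - 1)), ((hR.commute_aeval_E hp _).pow_right (p - 1)).eq.symm, mul_assoc,
      ← mul_assoc (E ^ (p - 1)), ← pow_add, show p - 1 + (m - i) = p + (m - i - 1) by omega,
      pow_add, hR.E_pow, zero_mul, zero_mul, mul_zero, smul_zero, smul_zero]
  have h1 : (F ^ m * e - e * F ^ m) * (Polynomial.aeval K P * E ^ m) = 0 := by
    rw [IsPreLimit.pow_mul_sub_mul_pow, Finset.sum_mul]
    refine Finset.sum_eq_zero fun j hj => ?_
    rw [Finset.mem_range] at hj
    rw [H.F_e, mul_smul_comm, smul_mul_assoc, smul_mul_assoc, mul_assoc, mul_assoc,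
      mul_assoc _ (E ^ (p - 1)), h0 _ (by omega), mul_zero, mul_zero, smul_zero]
  rw [sub_mul, sub_eq_zero] at h1
  rw [commute_iff_eq, mul_assoc, mul_assoc, ← mul_assoc e, ← h1, mul_assoc, ← mul_assoc e, hB.eq,
    mul_assoc, hE.eq, mul_assoc (Polynomial.aeval K P)]

open MulOpposite in
-- The symmetry of the opposite algebra maps this to the statement for `e`; the factors `K^p` it
-- introduces are removed afterwards.
lemma IsPreLimit.commute_f_term (H : IsPreLimit p E F K Kinv e f) (hp : 2 ≤ p) {m : ℕ}
    (P : Polynomial ℂ) : Commute f (F ^ m * Polynomial.aeval K P * E ^ m) := by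
  have hR := H.restricted
  have h1 := ((H.op hp).commute_e_term hp (m := m) P).eq
  rw [aeval_op, ← op_pow, ← op_pow, ← op_mul, ← op_mul, ← op_mul, ← op_mul, ← mul_assoc] at h1
  have h2 := op_injective h1
  set T := F ^ m * Polynomial.aeval K P * E ^ m with hT
  have h3 : Commute (K ^ p) T :=
    ((Commute.pow_right (hR.K_pow_mul_F hp) m).mul_right
      (commute_aeval_of_commute (Commute.pow_self K p) P)).mul_right
      (Commute.pow_right (hR.K_pow_mul_E hp) m)
  rw [mul_smul_comm, smul_mul_assoc] at h2
  have h4 := smul_right_injective A (pow_ne_zero p (neg_ne_zero.2 one_ne_zero) : (-1 : ℂ) ^ p ≠ 0) h2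
  have h5 := congrArg (· * K ^ p) h4
  beta_reduce at h5
  rw [mul_assoc T, mul_assoc f, hR.K_pow_mul_K_pow, mul_one, mul_assoc _ T, ← h3.eq, mul_assoc f,
    ← mul_assoc (K ^ p), hR.K_pow_mul_K_pow, one_mul] at h5
  exact h5.symm

end

lemma IsQuantum.commute_K_bracketProd {k A : Type*} [Field k] [Ring A] [Algebra k A] {v : k}
    {E F K Kinv : A} (h : IsQuantum v E F K Kinv) (c : ℤ) (t : ℕ) :
    Commute K (bracketProd v K Kinv c t) := by
  induction t with
  | zero => exact Commute.one_right _
  | succ t ih =>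
    exact ih.mul_right ((((Commute.refl K).smul_right _).sub_right
      (h.commute_K_Kinv.smul_right _)).smul_right _)

/-! ### The relations involving `h` in the special fiber -/

/-- `∏_j (v ^ (-j) x - v ^ j)` for `0 ≤ j < n`. -/
def cartanPoly (p n : ℕ) : Polynomial (regularAt (qRoot p)) :=
  ∏ j ∈ Finset.range n, (Polynomial.C (reg p (RatFunc.X ^ (-(j : ℤ)))) * Polynomial.X -
    Polynomial.C (reg p (RatFunc.X ^ (j : ℤ))))

/-- At `v = q` the factors become `q^(-j) (x - q^(2j))`, and `q²` is a primitive `p`-th root of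
unity. -/
lemma cartanPoly_map {p : ℕ} (hp : 2 ≤ p) :
    (cartanPoly p p).map (algebraMap (regularAt (qRoot p)) ℂ) =
      Polynomial.C (∏ j ∈ Finset.range p, qRoot p ^ (-(j : ℤ))) * (Polynomial.X ^ p - 1) := by
  have hprim : IsPrimitiveRoot (qRoot p ^ 2) p :=
    (qRoot_isPrimitiveRoot hp).pow (by omega) rfl
  have h1 := X_pow_sub_C_eq_prod hprim (by omega) (one_pow p)
  rw [Polynomial.C_1] at h1
  rw [h1, map_prod, ← Finset.prod_mul_distrib, cartanPoly, Polynomial.map_prod]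
  refine Finset.prod_congr rfl fun j _ => ?_
  rw [Polynomial.map_sub, Polynomial.map_mul, Polynomial.map_X, Polynomial.map_C, Polynomial.map_C,
    (specializes_X_zpow _).algebraMap_reg, (specializes_X_zpow _).algebraMap_reg, mul_sub, mul_one,
    ← Polynomial.C_mul, ← pow_mul, ← zpow_natCast (qRoot p) (2 * j), ← zpow_add₀ (qRoot_ne_zero p)]
  congr 3
  push_cast
  ring

/-- This is the evaluation `∏ (1 - ζ^j) = p` over `0 < j < p` for `ζ = q²`. It fixes the
normalization of `h`. -/
lemma prod_qRoot_identity {p : ℕ} (hp : 2 ≤ p) :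
    (qRoot p - (qRoot p)⁻¹) ^ (p - 1) * qFact (qRoot p) (p - 1) =
      (-1) ^ (p - 1) * p * ∏ j ∈ Finset.range p, qRoot p ^ (-(j : ℤ)) := by
  obtain ⟨n, rfl⟩ : ∃ n, p = n + 1 := ⟨p - 1, by omega⟩
  have hd := qRoot_sub_inv_ne_zero hp
  have hprim : IsPrimitiveRoot (qRoot (n + 1) ^ 2) (n + 1) :=
    (qRoot_isPrimitiveRoot hp).pow (by omega) rfl
  have h1 := hprim.prod_one_sub_pow_eq_order
  rw [Nat.add_sub_cancel, qFact, Finset.prod_range_succ', ← Finset.Ico_add_one_right_eq_Icc,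
    Finset.prod_Ico_eq_prod_range, Nat.add_sub_cancel]
  have h2 : ∀ j, qInt (qRoot (n + 1)) (1 + j) * (qRoot (n + 1) - (qRoot (n + 1))⁻¹) =
      (-1) * qRoot (n + 1) ^ (-((j + 1 : ℕ) : ℤ)) * (1 - (qRoot (n + 1) ^ 2) ^ (j + 1)) := by
    intro j
    have hq := pow_ne_zero (j + 1) (qRoot_ne_zero (n + 1))
    rw [qInt, div_mul_cancel₀ _ hd, zpow_neg, zpow_natCast, inv_pow, add_comm 1 j, ← pow_mul,
      mul_comm 2, pow_mul]
    field_simp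
    ring
  have h3 := Finset.prod_congr rfl fun j (_ : j ∈ Finset.range n) => h2 j
  rw [Finset.prod_mul_distrib, Finset.prod_mul_distrib, Finset.prod_mul_distrib, Finset.prod_const,
    Finset.prod_const, Finset.card_range, h1] at h3
  rw [mul_comm, h3]
  push_cast
  simp
  ring

/-- Two polynomials over the local ring with the same reduction at `q` differ, coefficient by
coefficient, by multiples of `v - q`. -/
lemma exists_cartanPoly_eq {p : ℕ} (hp : 2 ≤ p) : ∃ N : Polynomial (regularAt (qRoot p)),
    cartanPoly p p = Polynomial.C (algebraMap ℂ (regularAt (qRoot p))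
      (∏ j ∈ Finset.range p, qRoot p ^ (-(j : ℤ)))) * (Polynomial.X ^ p - 1) +
      Polynomial.C (reg p (RatFunc.X - RatFunc.C (qRoot p))) * N := by
  set u := ∏ j ∈ Finset.range p, qRoot p ^ (-(j : ℤ)) with hu
  have h1 : (cartanPoly p p - Polynomial.C (algebraMap ℂ (regularAt (qRoot p)) u) *
      (Polynomial.X ^ p - 1)).map (algebraMap (regularAt (qRoot p)) ℂ) = 0 := by
    have h2 : algebraMap (regularAt (qRoot p)) ℂ (algebraMap ℂ (regularAt (qRoot p)) u) = u :=
      (Specializes.C u).eval_eq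
    rw [Polynomial.map_sub, cartanPoly_map hp, Polynomial.map_mul, Polynomial.map_C, h2,
      Polynomial.map_sub, Polynomial.map_pow, Polynomial.map_X, Polynomial.map_one, sub_self]
  have h2 : Polynomial.C (reg p (RatFunc.X - RatFunc.C (qRoot p))) ∣ cartanPoly p p -
      Polynomial.C (algebraMap ℂ (regularAt (qRoot p)) u) * (Polynomial.X ^ p - 1) := by
    rw [Polynomial.C_dvd_iff_dvd_coeff]
    intro i
    have h3 := congrArg (fun Q => Polynomial.coeff Q i) h1
    simp only [Polynomial.coeff_map, Polynomial.coeff_zero] at h3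
    set c := (cartanPoly p p - Polynomial.C (algebraMap ℂ (regularAt (qRoot p)) u) *
      (Polynomial.X ^ p - 1)).coeff i
    have h4 : Specializes (qRoot p) (c : RatFunc ℂ) 0 := h3 ▸ specializes_eval c.2
    obtain ⟨y, hy, hxy⟩ := h4.exists_eq_mul
    refine ⟨⟨y, hy⟩, Subtype.ext ?_⟩
    rw [hxy]
    change _ = (reg p (RatFunc.X - RatFunc.C (qRoot p)) : RatFunc ℂ) * y
    rw [SpecialFiber.specializes_X_sub_C.coe_reg]
  obtain ⟨N, hN⟩ := h2
  exact ⟨N, by rw [← hN]; ring⟩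

/-! ### The Cartan element of the divided-power form -/

namespace DividedForm
variable {p : ℕ}

/-- The summands of `E ^ (p) F ^ (p)`. -/
def cartanTerm (p t : ℕ) : DividedForm p :=
  reg p (qFact RatFunc.X t)⁻¹ •
    (dF p (p - t) * bracketsProd p (2 * t - p - p) t * dE p (p - t))

/-- The element `[K; 0] [K; -1] ⋯ [K; 1 - p] / [p]!`. -/
def cartan (p : ℕ) : DividedForm p :=
  -- The element is isolated as the last term of the expansion of `E^(p) F^(p)`. All earlier terms
  -- lie in the form, so this one does too, although `[p]!` is not invertible.
  dE p p * dF p p - ∑ t ∈ Finset.range p, cartanTerm p t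

lemma coe_cartanTerm (hp : 2 ≤ p) {t : ℕ} (ht : t < p) :
    (cartanTerm p t : Ugen) = (qFact (RatFunc.X : RatFunc ℂ) t)⁻¹ • (dpow (RatFunc.X : RatFunc ℂ) Ugen.F (p - t) *
      bracketProd (RatFunc.X : RatFunc ℂ) Ugen.K Ugen.Kinv (2 * t - p - p) t *
        dpow (RatFunc.X : RatFunc ℂ) Ugen.E (p - t)) := by
  rw [cartanTerm, coe_reg_smul (specializes_qFact_inv hp ht)]
  change _ • ((dF p (p - t) : Ugen) * (bracketsProd p (2 * t - p - p) t : Ugen) *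
    (dE p (p - t) : Ugen)) = _
  rw [coe_dF hp (Nat.sub_le _ _), coe_dE hp (Nat.sub_le _ _), coe_bracketsProd hp]

lemma coe_cartan (hp : 2 ≤ p) : (cartan p : Ugen) = (qFact (RatFunc.X : RatFunc ℂ) p)⁻¹ •
    bracketProd (RatFunc.X : RatFunc ℂ) Ugen.K Ugen.Kinv 0 p := by
  have h1 := (Uq.isQuantum (RatFunc.X : RatFunc ℂ)).dpow_E_mul_dpow_F RatFunc.X_ne_zero
    (fun n => qInt_X_ne_zero (Nat.succ_ne_zero n)) p p le_rfl
  rw [Finset.sum_range_succ, Nat.sub_self, dpow_zero, dpow_zero, one_mul, mul_one,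
    show (2 * (p : ℤ) - p - p) = 0 by ring] at h1
  have h2 : ((∑ t ∈ Finset.range p, cartanTerm p t : DividedForm p) : Ugen) =
      ∑ t ∈ Finset.range p, (cartanTerm p t : Ugen) := map_sum (incl p) _ _
  change (dE p p : Ugen) * (dF p p : Ugen) - _ = _
  rw [h2, coe_dE hp le_rfl, coe_dF hp le_rfl, h1,
    Finset.sum_congr rfl fun t ht => coe_cartanTerm hp (Finset.mem_range.1 ht),
    add_sub_cancel_left]

/-- Each factor `v^(-j) K² - v^j` equals `(v - v⁻¹) K [K; -j]`. -/
lemma coe_aeval_cartanPoly (n : ℕ) :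
    ((Polynomial.aeval (K p ^ 2) (cartanPoly p n) : DividedForm p) : Ugen) =
      (RatFunc.X - RatFunc.X⁻¹ : RatFunc ℂ) ^ n •
        ((Ugen.K : Ugen) ^ n * bracketProd (RatFunc.X : RatFunc ℂ) Ugen.K Ugen.Kinv 0 n) := by
  have hq := Uq.isQuantum (RatFunc.X : RatFunc ℂ)
  induction n with
  | zero => simp [cartanPoly, bracketProd]
  | succ n ih =>
    have h1 : ((Polynomial.aeval (K p ^ 2) (Polynomial.C (reg p (RatFunc.X ^ (-(n : ℤ)))) *
        Polynomial.X - Polynomial.C (reg p (RatFunc.X ^ (n : ℤ)))) : DividedForm p) : Ugen) =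
        (RatFunc.X : RatFunc ℂ) ^ (-(n : ℤ)) • (Ugen.K : Ugen) ^ 2 -
          (RatFunc.X : RatFunc ℂ) ^ (n : ℤ) • (1 : Ugen) := by
      rw [map_sub, map_mul, Polynomial.aeval_C, Polynomial.aeval_C, Polynomial.aeval_X,
        ← Algebra.smul_def, Algebra.algebraMap_eq_smul_one]
      exact congrArg₂ (· - ·) (coe_reg_smul (specializes_X_zpow _) _)
        (coe_reg_smul (specializes_X_zpow _) _)
    have h2 : (RatFunc.X : RatFunc ℂ) ^ (-(n : ℤ)) • (Ugen.K : Ugen) ^ 2 -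
          (RatFunc.X : RatFunc ℂ) ^ (n : ℤ) • (1 : Ugen) = (RatFunc.X - RatFunc.X⁻¹ : RatFunc ℂ) •
          ((Ugen.K : Ugen) * bracketK (RatFunc.X : RatFunc ℂ) Ugen.K Ugen.Kinv (0 - n)) := by
      rw [bracketK, mul_smul_comm, smul_smul, mul_inv_cancel₀ ratFunc_X_sub_inv_ne_zero, one_smul,
        mul_sub, mul_smul_comm, mul_smul_comm, hq.K_mul_Kinv, sq, zero_sub, neg_neg]
    have h3 : Commute (Ugen.K : Ugen) (bracketProd (RatFunc.X : RatFunc ℂ) Ugen.K Ugen.Kinv 0 n) :=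
      hq.commute_K_bracketProd 0 n
    rw [cartanPoly, Finset.prod_range_succ, ← cartanPoly, map_mul]
    change (Polynomial.aeval (K p ^ 2) (cartanPoly p n) : Ugen) * ((Polynomial.aeval (K p ^ 2)
      (Polynomial.C (reg p (RatFunc.X ^ (-(n : ℤ)))) * Polynomial.X -
        Polynomial.C (reg p (RatFunc.X ^ (n : ℤ)))) : DividedForm p) : Ugen) = _
    rw [ih, h1, h2, smul_mul_assoc, mul_smul_comm, smul_smul, ← pow_succ, bracketProd, pow_succ Ugen.K,
      mul_assoc, mul_assoc, ← mul_assoc _ Ugen.K, ← h3.eq, mul_assoc]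

/-- The unit `([p] / (v - q)) [p - 1]! (v - v⁻¹) ^ p`. -/
def cartanUnit (p : ℕ) : RatFunc ℂ :=
  qInt RatFunc.X p / (RatFunc.X - RatFunc.C (qRoot p)) *
    (qFact RatFunc.X (p - 1) * (RatFunc.X - RatFunc.X⁻¹) ^ p)

lemma specializes_cartanUnit (hp : 2 ≤ p) : Specializes (qRoot p) (cartanUnit p)
    (-(2 * p * (qRoot p)⁻¹) / (qRoot p - (qRoot p)⁻¹) *
      (qFact (qRoot p) (p - 1) * (qRoot p - (qRoot p)⁻¹) ^ p)) :=
  (specializes_qInt_self_div hp).mul ((specializes_qFact hp _).mul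
    ((Specializes.X.sub specializes_X_inv).pow p))

/-- The denominator `[p]!` has a simple zero at `q`, which supplies the factor `v - q`; the rest is
`cartanUnit`. -/
lemma coe_aeval_cartanPoly_self (hp : 2 ≤ p) :
    Polynomial.aeval (K p ^ 2) (cartanPoly p p) = reg p (RatFunc.X - RatFunc.C (qRoot p)) •
      (reg p (cartanUnit p) • (K p ^ p * cartan p)) := by
  refine Subtype.ext ?_
  rw [coe_aeval_cartanPoly, coe_reg_smul SpecialFiber.specializes_X_sub_C,
    coe_reg_smul (specializes_cartanUnit hp)]
  change _ = _ • _ • (Ugen.K ^ p * (cartan p : Ugen))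
  rw [coe_cartan hp, mul_smul_comm, smul_smul, smul_smul]
  congr 1
  obtain ⟨n, rfl⟩ : ∃ n, p = n + 1 := ⟨p - 1, by omega⟩
  have h1 := ratFunc_X_sub_C_ne_zero (qRoot (n + 1))
  have h2 := qFact_X_ne_zero n
  have h3 := qInt_X_ne_zero (Nat.succ_ne_zero n)
  rw [cartanUnit, Nat.add_sub_cancel, qFact_succ]
  field_simp

end DividedForm

/-! ### The expansion of `h` and its brackets with `e` and `f` -/

namespace SpecialFiber
variable {p : ℕ}

/-- The element `(K ^ (2 p) - 1) / (v - q)` of the form with divided powers. -/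
lemma exists_K_pow_sub_one (hp : 2 ≤ p) : ∃ (Y : DividedForm p)
    (N : Polynomial (regularAt (qRoot p))),
    DividedForm.K p ^ (2 * p) - 1 = reg p (RatFunc.X - RatFunc.C (qRoot p)) • Y ∧
    algebraMap ℂ (regularAt (qRoot p)) (∏ j ∈ Finset.range p, qRoot p ^ (-(j : ℤ))) • Y =
      reg p (DividedForm.cartanUnit p) • (DividedForm.K p ^ p * DividedForm.cartan p) -
        Polynomial.aeval (DividedForm.K p ^ 2) N := by
  obtain ⟨N, hN⟩ := exists_cartanPoly_eq hp
  have h1 := DividedForm.coe_aeval_cartanPoly_self hp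
  set u := ∏ j ∈ Finset.range p, qRoot p ^ (-(j : ℤ)) with hu
  have hu0 : u ≠ 0 := Finset.prod_ne_zero_iff.2 fun j _ => zpow_ne_zero _ (qRoot_ne_zero p)
  have huu : ∀ y : DividedForm p, algebraMap ℂ (regularAt (qRoot p)) u •
      algebraMap ℂ (regularAt (qRoot p)) u⁻¹ • y = y := by
    intro y
    rw [smul_smul, ← map_mul, mul_inv_cancel₀ hu0, map_one, one_smul]
  have huu' : ∀ y : DividedForm p, algebraMap ℂ (regularAt (qRoot p)) u⁻¹ •
      algebraMap ℂ (regularAt (qRoot p)) u • y = y := by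
    intro y
    rw [smul_smul, ← map_mul, inv_mul_cancel₀ hu0, map_one, one_smul]
  -- The value of `cartanPoly` at `K²` is known in two ways: as a multiple of `v - q`, and as a unit
  -- times `K^(2p) - 1` up to a multiple of `v - q`. Comparison divides `K^(2p) - 1` by `v - q`
  -- within the form.
  rw [hN, map_add, map_mul, map_mul, Polynomial.aeval_C, Polynomial.aeval_C, ← Algebra.smul_def,
    ← Algebra.smul_def, map_sub, map_pow, Polynomial.aeval_X, map_one, ← pow_mul,
    ← eq_sub_iff_add_eq, ← smul_sub] at h1
  refine ⟨algebraMap ℂ (regularAt (qRoot p)) u⁻¹ • (reg p (DividedForm.cartanUnit p) •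
    (DividedForm.K p ^ p * DividedForm.cartan p) - Polynomial.aeval (DividedForm.K p ^ 2) N), N,
    ?_, huu _⟩
  rw [smul_comm, ← h1, huu']

lemma mk_reg_X_sub_C_smul (x : DividedForm p) :
    mk p (reg p (RatFunc.X - RatFunc.C (qRoot p)) • x) = 0 := by
  rw [mk_reg_smul specializes_X_sub_C, zero_smul]

lemma K_pow (hp : 2 ≤ p) : K p ^ (2 * p) = 1 := by
  obtain ⟨Y, -, hY, -⟩ := exists_K_pow_sub_one hp
  have := congrArg (mk p) hY
  rw [mk_reg_X_sub_C_smul, map_sub, map_pow, map_one, sub_eq_zero] at this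
  exact this

lemma isPreLimit (hp : 2 ≤ p) : IsPreLimit p (E p) (F p) (K p) (Kinv p) (e p) (f p) where
  restricted := ⟨isQuantum hp, E_pow hp, F_pow hp, K_pow hp⟩
  E_e := E_e hp
  K_e := K_e hp
  F_f := F_f
  K_f := K_f hp
  F_e := F_e hp
  E_f := E_f hp

/-- Cancellation of `v - q`. -/
lemma eq_of_smul_eq {x y : DividedForm p} {c : RatFunc ℂ}
    (h : reg p (RatFunc.X - RatFunc.C (qRoot p)) • x = y) {d : ℂ}
    {z : DividedForm p} (hy : (y : Ugen) = c • (z : Ugen))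
    (hc : Specializes (qRoot p) (c / (RatFunc.X - RatFunc.C (qRoot p))) d) :
    mk p x = d • mk p z := by
  refine mk_eq_smul hc ?_
  have h1 := congrArg (Subtype.val) h
  have h0 := ratFunc_X_sub_C_ne_zero (qRoot p)
  rw [DividedForm.coe_reg_smul specializes_X_sub_C] at h1
  rw [div_eq_inv_mul, ← smul_smul, ← hy, ← h1, smul_smul, inv_mul_cancel₀ h0, one_smul]

lemma specializes_slope_X_pow (hp : 2 ≤ p) : Specializes (qRoot p)
    ((((RatFunc.X : RatFunc ℂ) ^ (2 * p)) ^ (2 * p) - 1) / (RatFunc.X - RatFunc.C (qRoot p)))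
    (4 * p ^ 2 * (qRoot p)⁻¹) := by
  have h1 := Specializes.slope (a := qRoot p) (Polynomial.X ^ (2 * p * (2 * p)))
  have h2 : qRoot p ^ (2 * p * (2 * p)) = 1 := by
    rw [pow_mul, (qRoot_isPrimitiveRoot hp).pow_eq_one, one_pow]
  have h3 : qRoot p ^ (2 * p * (2 * p) - 1) = (qRoot p)⁻¹ := by
    rw [← mul_eq_one_iff_eq_inv₀ (qRoot_ne_zero p), ← pow_succ, Nat.sub_add_cancel ?_, h2]
    nlinarith
  simp only [map_pow, RatFunc.algebraMap_X, Polynomial.eval_pow, Polynomial.eval_X, h2, map_one,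
    Polynomial.derivative_X_pow, Polynomial.eval_mul, Polynomial.eval_C, h3] at h1
  rw [← pow_mul]
  convert h1 using 1
  push_cast
  ring

/-- Generically `K^(2p) e = v^(4p²) e K^(2p)`. Dividing the commutator by `v - q` leaves the
derivative `4p² q⁻¹` of `v^(4p²)` at `q`. -/
lemma e_Y (hp : 2 ≤ p) {Y : DividedForm p} (hY : DividedForm.K p ^ (2 * p) - 1 =
    reg p (RatFunc.X - RatFunc.C (qRoot p)) • Y) :
    mk p Y * e p - e p * mk p Y = (4 * p ^ 2 * (qRoot p)⁻¹ : ℂ) • e p := by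
  have h1 : reg p (RatFunc.X - RatFunc.C (qRoot p)) •
      (Y * DividedForm.e p - DividedForm.e p * Y) = DividedForm.K p ^ (2 * p) * DividedForm.e p -
        DividedForm.e p * DividedForm.K p ^ (2 * p) := by
    rw [smul_sub, ← smul_mul_assoc, ← mul_smul_comm, ← hY]
    noncomm_ring
  rw [← map_mul, ← map_mul, ← map_sub, eq_of_smul_eq h1 (z := DividedForm.e p *
    DividedForm.K p ^ (2 * p)) ?_ (specializes_slope_X_pow hp), map_mul, map_pow, K_pow hp, mul_one]
  change Ugen.K ^ (2 * p) * Ugen.e p - Ugen.e p * Ugen.K ^ (2 * p) =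
    _ • (Ugen.e p * Ugen.K ^ (2 * p))
  rw [K_pow_e, sub_smul, one_smul]

lemma f_Y (hp : 2 ≤ p) {Y : DividedForm p} (hY : DividedForm.K p ^ (2 * p) - 1 =
    reg p (RatFunc.X - RatFunc.C (qRoot p)) • Y) :
    mk p Y * f p - f p * mk p Y = -((4 * p ^ 2 * (qRoot p)⁻¹ : ℂ) • f p) := by
  have h1 : reg p (RatFunc.X - RatFunc.C (qRoot p)) •
      (DividedForm.f p * Y - Y * DividedForm.f p) = DividedForm.f p * DividedForm.K p ^ (2 * p) -
        DividedForm.K p ^ (2 * p) * DividedForm.f p := by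
    rw [smul_sub, ← mul_smul_comm, ← smul_mul_assoc, ← hY]
    noncomm_ring
  rw [← neg_sub, neg_inj, ← map_mul, ← map_mul, ← map_sub, eq_of_smul_eq h1 (z :=
    DividedForm.K p ^ (2 * p) * DividedForm.f p) ?_ (specializes_slope_X_pow hp), map_mul, map_pow,
    K_pow hp, one_mul]
  change Ugen.f p * Ugen.K ^ (2 * p) - Ugen.K ^ (2 * p) * Ugen.f p =
    _ • (Ugen.K ^ (2 * p) * Ugen.f p)
  have h0 : ((RatFunc.X : RatFunc ℂ) ^ (2 * p)) ^ (2 * p) ≠ 0 :=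
    pow_ne_zero _ (pow_ne_zero _ RatFunc.X_ne_zero)
  rw [K_pow_f, sub_smul, one_smul, smul_smul, inv_pow, mul_inv_cancel₀ h0, one_smul]

/-- The terms other than `Y` in the expansion of `h` commute with `e` and `f`. -/
lemma commute_cartanTerm (hp : 2 ≤ p) {t : ℕ} (ht : t ∈ Finset.Ico 1 p) :
    Commute (e p) (mk p (DividedForm.cartanTerm p t)) ∧
      Commute (f p) (mk p (DividedForm.cartanTerm p t)) := by
  rw [Finset.mem_Ico] at ht
  have H := isPreLimit hp
  have h1 := (DividedForm.specializes_qFact_inv hp (r := p - t) (by omega))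
  obtain ⟨P, hP⟩ := H.restricted.bracketProd_eq_aeval hp (2 * t - p - p) t
  have h2 : mk p (DividedForm.cartanTerm p t) = ((qFact (qRoot p) t)⁻¹ *
      ((qFact (qRoot p) (p - t))⁻¹ * (qFact (qRoot p) (p - t))⁻¹)) •
      (F p ^ (p - t) * Polynomial.aeval (K p) P * E p ^ (p - t)) := by
    rw [DividedForm.cartanTerm, mk_reg_smul (DividedForm.specializes_qFact_inv hp ht.2), map_mul,
      map_mul, DividedForm.mk_bracketsProd hp, hP, DividedForm.dF, if_pos (by omega),
      DividedForm.dE, if_pos (by omega), mk_reg_smul h1, mk_reg_smul h1, map_pow, map_pow,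
      smul_mul_assoc, smul_mul_assoc, mul_smul_comm, smul_smul, smul_smul, mul_assoc]
  rw [h2]
  exact ⟨(H.commute_e_term hp P).smul_right _, (H.commute_f_term hp P).smul_right _⟩

/-- This is the expansion of `E^(p) F^(p)` in the fiber. Its term of index `0` is `F^(p) E^(p)`,
which becomes the product `f e`, and its term of index `p` is the Cartan element. -/
lemma e_f_eq (hp : 2 ≤ p) : e p * f p - f p * e p = (-1 : ℂ) ^ p •
    ((∑ t ∈ Finset.Ico 1 p, K p ^ p * mk p (DividedForm.cartanTerm p t)) +
      mk p (DividedForm.K p ^ p * DividedForm.cartan p)) := by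
  have H := isPreLimit hp
  have hR := H.restricted
  have hdF : mk p (DividedForm.dF p p) = (-1 : ℂ) ^ p • f p := by
    refine mk_eq_smul (c := (-1) ^ p) (Specializes.one.neg.pow p) ?_
    rw [DividedForm.coe_dF hp le_rfl]
    change _ = _ • Ugen.f p
    rw [Ugen.f, smul_smul, ← mul_div_assoc, ← mul_pow, neg_mul_neg, one_mul, one_pow, one_div, dpow]
  have hdE : mk p (DividedForm.dE p p) = K p ^ p * e p := by
    rw [DividedForm.dE, if_neg (lt_irrefl p), map_mul, map_pow]
    congr 1
    rw [← one_mul (Kinv p ^ p), ← hR.K_pow_mul_K_pow, mul_assoc,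
      ← hR.quantum.commute_K_Kinv.mul_pow, hR.quantum.K_mul_Kinv, one_pow, mul_one]
  have h0 : mk p (DividedForm.cartanTerm p 0) = (-1 : ℂ) ^ p • (f p * (K p ^ p * e p)) := by
    rw [DividedForm.cartanTerm, Nat.sub_zero, DividedForm.bracketsProd, mul_one, qFact_zero, inv_one,
      mk_reg_smul Specializes.one, one_smul, map_mul, hdF, hdE, smul_mul_assoc]
  have hsum : mk p (∑ t ∈ Finset.range p, DividedForm.cartanTerm p t) =
      mk p (DividedForm.cartanTerm p 0) + ∑ t ∈ Finset.Ico 1 p, mk p (DividedForm.cartanTerm p t) := by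
    rw [map_sum, Finset.range_eq_Ico, Finset.sum_eq_sum_Ico_succ_bot (by omega)]
  have hsq : (-1 : ℂ) ^ p * (-1) ^ p = 1 := by rw [← mul_pow]; norm_num
  have h3 : K p ^ p * (f p * (K p ^ p * e p)) = f p * e p := by
    rw [← mul_assoc, H.K_pow_f, mul_assoc, ← mul_assoc (K p ^ p), hR.K_pow_mul_K_pow, one_mul]
  have h4 : K p ^ p * (K p ^ p * e p * f p) = e p * f p := by
    rw [← mul_assoc, ← mul_assoc, hR.K_pow_mul_K_pow, one_mul]
  rw [map_mul, DividedForm.cartan, map_sub, map_mul, hsum, hdF, hdE, h0, map_pow, ← Finset.mul_sum,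
    ← mul_add]
  generalize ∑ t ∈ Finset.Ico 1 p, mk p (DividedForm.cartanTerm p t) = S
  rw [mul_smul_comm, sub_add_eq_sub_sub, add_sub_cancel, ← smul_sub, mul_smul_comm, smul_smul, hsq,
    one_smul, mul_sub, h3, h4]

lemma h_eq : h p = (1 / 2 : ℂ) • (e p * f p - f p * e p) := by
  rw [← map_mul, ← map_mul, ← map_sub, ← mk_reg_smul (DividedForm.specializes_half p),
    ← DividedForm.h_eq]

/-- The coefficient of `Y` in the expansion of `h` is inverse to the factor `4p² q⁻¹` by which the
commutator with `Y` scales `e`. -/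
lemma h_scalar (hp : 2 ≤ p) : (1 / 2 : ℂ) * ((-1) ^ p * ((-(2 * p * (qRoot p)⁻¹) /
    (qRoot p - (qRoot p)⁻¹) * (qFact (qRoot p) (p - 1) * (qRoot p - (qRoot p)⁻¹) ^ p))⁻¹ *
      ((∏ j ∈ Finset.range p, qRoot p ^ (-(j : ℤ))) * (4 * p ^ 2 * (qRoot p)⁻¹)))) = 1 := by
  have h1 := prod_qRoot_identity hp
  have hd := qRoot_sub_inv_ne_zero hp
  have hq := qRoot_ne_zero p
  have hc := qFact_qRoot_ne_zero hp (n := p - 1) (by omega)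
  have hp0 : (p : ℂ) ≠ 0 := by exact_mod_cast (by omega : p ≠ 0)
  have hu : ∏ j ∈ Finset.range p, qRoot p ^ (-(j : ℤ)) =
      (-1) ^ (p - 1) * (p : ℂ)⁻¹ * ((qRoot p - (qRoot p)⁻¹) ^ (p - 1) * qFact (qRoot p) (p - 1)) := by
    have h2 : (-1 : ℂ) ^ (p - 1) * (-1) ^ (p - 1) = 1 := by rw [← mul_pow]; norm_num
    rw [h1]
    field_simp
    linear_combination -(∏ j ∈ Finset.range p, qRoot p ^ (-(j : ℤ))) * h2
  rw [hu]
  have h3 : (qRoot p - (qRoot p)⁻¹) ^ p = (qRoot p - (qRoot p)⁻¹) ^ (p - 1) *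
      (qRoot p - (qRoot p)⁻¹) := by rw [← pow_succ, Nat.sub_add_cancel (by omega)]
  have h4 : (-1 : ℂ) ^ p * (-1) ^ (p - 1) = -1 := by
    rw [← pow_add, show p + (p - 1) = 2 * (p - 1) + 1 by omega, pow_succ, pow_mul]; norm_num
  rw [h3]
  generalize qRoot p - (qRoot p)⁻¹ = d at *
  have hdp := pow_ne_zero (p - 1) hd
  generalize d ^ (p - 1) = d' at *
  generalize (-1 : ℂ) ^ (p - 1) = a at *
  generalize (-1 : ℂ) ^ p = b at *
  field_simp
  linear_combination -4 * h4

/-- The Cartan element is a multiple of `Y` plus a polynomial in `K²`, and the remaining terms of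
`[e, f]` have the shape `F^m P(K) E^m` up to `K^p`. Everything except `Y` thus commutes with `e` and
`f`, and both brackets with `h` reduce to those with `Y`. -/
lemma exists_h_eq (hp : 2 ≤ p) : ∃ (Y : DividedForm p) (G : SpecialFiber p),
    DividedForm.K p ^ (2 * p) - 1 = reg p (RatFunc.X - RatFunc.C (qRoot p)) • Y ∧
    h p = (4 * p ^ 2 * (qRoot p)⁻¹ : ℂ)⁻¹ • mk p Y + G ∧ Commute (e p) G ∧ Commute (f p) G := by
  obtain ⟨Y, N, hY, hN⟩ := exists_K_pow_sub_one hp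
  have H := isPreLimit hp
  set u := ∏ j ∈ Finset.range p, qRoot p ^ (-(j : ℤ)) with hu
  set w := -(2 * p * (qRoot p)⁻¹) / (qRoot p - (qRoot p)⁻¹) *
      (qFact (qRoot p) (p - 1) * (qRoot p - (qRoot p)⁻¹) ^ p) with hw
  have hw0 : w ≠ 0 := by
    intro h0
    have := h_scalar hp
    rw [← hw, h0] at this
    simp at this
  have h1 := congrArg (mk p) hN
  have h2 : algebraMap (regularAt (qRoot p)) ℂ (algebraMap ℂ (regularAt (qRoot p)) u) = u :=
    (Specializes.C u).eval_eq
  rw [mk_smul, h2, map_sub, mk_reg_smul (DividedForm.specializes_cartanUnit hp), ← hw] at h1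
  have h3 : mk p (DividedForm.K p ^ p * DividedForm.cartan p) = w⁻¹ • (u • mk p Y +
      mk p (Polynomial.aeval (DividedForm.K p ^ 2) N)) := by
    rw [h1, sub_add_cancel, smul_smul, inv_mul_cancel₀ hw0, one_smul]
  have h4 : mk p (Polynomial.aeval (DividedForm.K p ^ 2) N) =
      Polynomial.aeval (K p ^ 2) N := by
    rw [← map_pow, ← Polynomial.aeval_algHom_apply]
  refine ⟨Y, (1 / 2 : ℂ) • ((-1 : ℂ) ^ p • ((∑ t ∈ Finset.Ico 1 p, K p ^ p *
    mk p (DividedForm.cartanTerm p t)) + w⁻¹ • Polynomial.aeval (K p ^ 2) N)), hY, ?_, ?_, ?_⟩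
  · have h5 := h_scalar hp
    rw [← hw, ← hu] at h5
    have h6 : (4 * p ^ 2 * (qRoot p)⁻¹ : ℂ)⁻¹ = 1 / 2 * ((-1) ^ p * (w⁻¹ * u)) := by
      exact inv_eq_of_mul_eq_one_left (by linear_combination h5)
    rw [h_eq, e_f_eq hp, h3, h4, h6]
    simp only [smul_add, smul_smul]
    abel
  · refine ((Commute.add_right (Commute.sum_right _ _ _ fun t ht => ?_)
      ((commute_aeval_of_commute ?_ N).smul_right _)).smul_right _).smul_right _
    · exact Commute.mul_right (Commute.pow_right H.K_e.symm p) (commute_cartanTerm hp ht).1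
    · exact Commute.pow_right H.K_e.symm 2
  · refine ((Commute.add_right (Commute.sum_right _ _ _ fun t ht => ?_)
      ((commute_aeval_of_commute ?_ N).smul_right _)).smul_right _).smul_right _
    · exact Commute.mul_right (Commute.pow_right H.K_f.symm p) (commute_cartanTerm hp ht).2
    · exact Commute.pow_right H.K_f.symm 2

lemma h_e (hp : 2 ≤ p) : h p * e p - e p * h p = e p := by
  obtain ⟨Y, G, hY, hh, hG, -⟩ := exists_h_eq hp
  have h1 := e_Y hp hY
  have h0 : (4 * p ^ 2 * (qRoot p)⁻¹ : ℂ) ≠ 0 := by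
    have hp0 : (p : ℂ) ≠ 0 := by exact_mod_cast (by omega : p ≠ 0)
    exact mul_ne_zero (mul_ne_zero (by norm_num) (pow_ne_zero 2 hp0)) (inv_ne_zero (qRoot_ne_zero p))
  rw [hh, add_mul, mul_add, hG.eq, add_sub_add_right_eq_sub, smul_mul_assoc, mul_smul_comm,
    ← smul_sub, h1, smul_smul, inv_mul_cancel₀ h0, one_smul]

lemma h_f (hp : 2 ≤ p) : h p * f p - f p * h p = -f p := by
  obtain ⟨Y, G, hY, hh, -, hG⟩ := exists_h_eq hp
  have h1 := f_Y hp hY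
  have h0 : (4 * p ^ 2 * (qRoot p)⁻¹ : ℂ) ≠ 0 := by
    have hp0 : (p : ℂ) ≠ 0 := by exact_mod_cast (by omega : p ≠ 0)
    exact mul_ne_zero (mul_ne_zero (by norm_num) (pow_ne_zero 2 hp0)) (inv_ne_zero (qRoot_ne_zero p))
  rw [hh, add_mul, mul_add, hG.eq, add_sub_add_right_eq_sub, smul_mul_assoc, mul_smul_comm,
    ← smul_sub, h1, smul_neg, smul_smul, inv_mul_cancel₀ h0, one_smul]

end SpecialFiber

/-! ### The universal property of the Lusztig limit -/

/-- The elements satisfy the relations of the Lusztig limit. -/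
structure IsLusztig {A : Type*} [Ring A] [Algebra ℂ A] (p : ℕ) (E F K Kinv e f h : A) : Prop
    extends IsPreLimit p E F K Kinv e f where
  h_e : h * e - e * h = e
  h_f : h * f - f * h = -f
  e_f : e * f - f * e = (2 : ℂ) • h
  h_K : h * K = K * h
  h_E : h * E - E * h = (1 / 2 : ℂ) • (E * elemA p E F K Kinv)
  h_F : h * F - F * h = -((1 / 2 : ℂ) • (elemA p E F K Kinv * F))

lemma SpecialFiber.isLusztig {p : ℕ} (hp : 2 ≤ p) :
    IsLusztig p (E p) (F p) (K p) (Kinv p) (e p) (f p) (h p) where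
  toIsPreLimit := isPreLimit hp
  h_e := h_e hp
  h_f := h_f hp
  e_f := by rw [h_eq, smul_smul]; norm_num
  h_K := by
    have H := isPreLimit hp
    have h1 : Commute (K p) (e p) := H.K_e
    have h2 : Commute (K p) (f p) := H.K_f
    rw [h_eq]
    exact (((h1.mul_right h2).sub_right (h2.mul_right h1)).smul_right _).symm.eq
  h_E := by
    rw [← (isPreLimit hp).commutator_E hp, h_eq, smul_mul_assoc, mul_smul_comm, smul_sub]
  h_F := by
    rw [← smul_neg, ← (isPreLimit hp).commutator_F hp, h_eq, smul_mul_assoc, mul_smul_comm, smul_sub]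

section Maps
variable {A B : Type*} [Ring A] [Algebra ℂ A] [Ring B] [Algebra ℂ B] (φ : A →ₐ[ℂ] B) (p : ℕ)
  (E F K Kinv : A)

lemma map_casimir : φ (casimir p E F K Kinv) = casimir p (φ E) (φ F) (φ K) (φ Kinv) := by
  simp only [casimir, map_add, map_smul, map_mul]

lemma map_qBracketK : φ (qBracketK p K Kinv) = qBracketK p (φ K) (φ Kinv) := by
  simp only [qBracketK, map_sub, map_smul]

lemma map_idem (s : ℕ) : φ (idem p E F K Kinv s) = idem p (φ E) (φ F) (φ K) (φ Kinv) s := by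
  rw [idem_eq_aeval, idem_eq_aeval, ← Polynomial.aeval_algHom_apply, map_casimir]

lemma map_elemA : φ (elemA p E F K Kinv) = elemA p (φ E) (φ F) (φ K) (φ Kinv) := by
  simp only [elemA, map_sum, map_smul, map_mul, map_add, map_idem, AlgHom.commutes,
    ← Polynomial.aeval_algHom_apply]

end Maps

namespace Ures
variable {p : ℕ}

/-- The algebra homomorphism from the quantum group at a root of unity. -/
def ofUq (p : ℕ) : Uq (qRoot p) →ₐ[ℂ] Ures p :=
  RingQuot.liftAlgHom ℂ ⟨RingQuot.mkAlgHom ℂ (ResRel p), fun _ _ h =>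
    RingQuot.mkAlgHom_rel ℂ (ResRel.quantum h)⟩

lemma ofUq_gen (g : QGen) : ofUq p (Uq.gen (qRoot p) g) = gen p g :=
  RingQuot.liftAlgHom_mkAlgHom_apply ..

lemma isRestricted : IsRestricted p (gen p .E) (gen p .F) (gen p .K) (gen p .Kinv) where
  quantum := by
    have := (Uq.isQuantum (v := qRoot p)).map (ofUq p)
    simpa only [ofUq_gen] using this
  E_pow := by
    have := RingQuot.mkAlgHom_rel ℂ (ResRel.E_pow (p := p))
    rwa [map_pow, map_zero] at this
  F_pow := by
    have := RingQuot.mkAlgHom_rel ℂ (ResRel.F_pow (p := p))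
    rwa [map_pow, map_zero] at this
  K_pow := by
    have := RingQuot.mkAlgHom_rel ℂ (ResRel.K_pow (p := p))
    rwa [map_pow, map_one] at this

lemma adjoin_gen : Algebra.adjoin ℂ (Set.range (gen p)) = ⊤ :=
  ringQuot_adjoin_range (ResRel p)

end Ures

namespace LU
variable {p : ℕ}

/-- The inclusion of the restricted quantum group. -/
def ofUres (p : ℕ) : Ures p →ₐ[ℂ] LU p :=
  RingQuot.liftAlgHom ℂ ⟨(RingQuot.mkAlgHom ℂ (LRel p)).comp LGen.incl, fun _ _ h =>
    RingQuot.mkAlgHom_rel ℂ (LRel.restricted h)⟩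

lemma ofUres_gen (g : QGen) : ofUres p (Ures.gen p g) = gen p (.q g) := by
  exact (RingQuot.liftAlgHom_mkAlgHom_apply ..).trans
    (congrArg (RingQuot.mkAlgHom ℂ (LRel p)) (FreeAlgebra.lift_ι_apply _ _))

lemma isRestricted : IsRestricted p (E p) (F p) (K p) (Kinv p) where
  quantum := by
    have := Ures.isRestricted.quantum.map (ofUres p)
    simpa only [ofUres_gen] using this
  E_pow := by
    have := congrArg (ofUres p) Ures.isRestricted.E_pow
    simpa only [map_pow, ofUres_gen, map_zero] using this
  F_pow := by
    have := congrArg (ofUres p) Ures.isRestricted.F_pow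
    simpa only [map_pow, ofUres_gen, map_zero] using this
  K_pow := by
    have := congrArg (ofUres p) Ures.isRestricted.K_pow
    simpa only [map_pow, ofUres_gen, map_one] using this

/-- The quotient map from words in the generators. -/
def ofWord (p : ℕ) : FreeAlgebra ℂ LGen →ₐ[ℂ] LU p := RingQuot.mkAlgHom ℂ (LRel p)

lemma ofWord_rel {x y : FreeAlgebra ℂ LGen} (h : LRel p x y) : ofWord p x = ofWord p y :=
  RingQuot.mkAlgHom_rel ℂ h

lemma ofWord_ι (g : LGen) : ofWord p (FreeAlgebra.ι ℂ g) = gen p g := rfl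

lemma isLusztig : IsLusztig p (E p) (F p) (K p) (Kinv p) (e p) (f p) (h p) where
  restricted := isRestricted
  h_e := by
    have := ofWord_rel (LRel.h_e (p := p))
    simpa only [map_sub, map_mul, ofWord_ι] using this
  h_f := by
    have := ofWord_rel (LRel.h_f (p := p))
    simpa only [map_sub, map_mul, map_neg, ofWord_ι] using this
  e_f := by
    have := ofWord_rel (LRel.e_f (p := p))
    rw [map_sub, map_mul, map_mul, map_nsmul] at this
    simp only [ofWord_ι] at this
    rw [this, two_smul, two_smul]
  h_K := by
    have := ofWord_rel (LRel.h_K (p := p))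
    simpa only [map_sub, map_mul, ofWord_ι, map_zero, sub_eq_zero] using this
  E_e := by
    have := ofWord_rel (LRel.E_e (p := p))
    simpa only [map_sub, map_mul, ofWord_ι, map_zero, sub_eq_zero] using this
  K_e := by
    have := ofWord_rel (LRel.K_e (p := p))
    simpa only [map_sub, map_mul, ofWord_ι, map_zero, sub_eq_zero] using this
  F_f := by
    have := ofWord_rel (LRel.F_f (p := p))
    simpa only [map_sub, map_mul, ofWord_ι, map_zero, sub_eq_zero] using this
  K_f := by
    have := ofWord_rel (LRel.K_f (p := p))
    simpa only [map_sub, map_mul, ofWord_ι, map_zero, sub_eq_zero] using this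
  F_e := by
    have := ofWord_rel (LRel.F_e (p := p))
    simpa only [map_sub, map_mul, map_smul, map_pow, map_qBracketK, ofWord_ι] using this
  E_f := by
    have := ofWord_rel (LRel.E_f (p := p))
    simpa only [map_sub, map_mul, map_smul, map_pow, map_qBracketK, ofWord_ι] using this
  h_E := by
    have := ofWord_rel (LRel.h_E (p := p))
    simpa only [map_sub, map_mul, map_smul, map_elemA, ofWord_ι] using this
  h_F := by
    have := ofWord_rel (LRel.h_F (p := p))
    simpa only [map_sub, map_mul, map_neg, map_smul, map_elemA, ofWord_ι] using this

lemma adjoin_gen : Algebra.adjoin ℂ (Set.range (gen p)) = ⊤ :=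
  ringQuot_adjoin_range (LRel p)

/-- The values of the generators. -/
def genValue {A : Type*} (E F K Kinv e f h : A) : LGen → A
  | .q g => Uq.genValue E F K Kinv g
  | .e => e
  | .f => f
  | .h => h

section Lift
variable {A : Type*} [Ring A] [Algebra ℂ A] {E F K Kinv e f h : A}

lemma lift_rel (H : IsLusztig p E F K Kinv e f h) ⦃x y : FreeAlgebra ℂ LGen⦄ (hxy : LRel p x y) :
    FreeAlgebra.lift ℂ (genValue E F K Kinv e f h) x =
      FreeAlgebra.lift ℂ (genValue E F K Kinv e f h) y := by
  have hι : ∀ g, FreeAlgebra.lift ℂ (genValue E F K Kinv e f h) (FreeAlgebra.ι ℂ g) =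
      genValue E F K Kinv e f h g := fun g => FreeAlgebra.lift_ι_apply _ _
  have hincl : ∀ z, FreeAlgebra.lift ℂ (genValue E F K Kinv e f h) (LGen.incl z) =
      FreeAlgebra.lift ℂ (Uq.genValue E F K Kinv) z := by
    intro z
    rw [← AlgHom.comp_apply]
    congr 1
    ext g
    simp [LGen.incl, genValue]
  cases hxy with
  | restricted r =>
    rw [hincl, hincl]
    cases r with
    | quantum r => exact Uq.lift_rel H.restricted.quantum r
    | E_pow =>
      rw [map_pow, FreeAlgebra.lift_ι_apply, map_zero]
      exact H.restricted.E_pow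
    | F_pow =>
      rw [map_pow, FreeAlgebra.lift_ι_apply, map_zero]
      exact H.restricted.F_pow
    | K_pow =>
      rw [map_pow, FreeAlgebra.lift_ι_apply, map_one]
      exact H.restricted.K_pow
  | h_e => simpa only [map_sub, map_mul, hι, genValue, Uq.genValue] using H.h_e
  | h_f => simpa only [map_sub, map_mul, map_neg, hι, genValue, Uq.genValue] using H.h_f
  | e_f =>
    have := H.e_f
    rw [two_smul] at this
    simpa only [map_sub, map_mul, map_add, two_smul, hι, genValue, Uq.genValue] using this
  | h_K => simpa only [map_sub, map_mul, map_zero, sub_eq_zero, hι, genValue, Uq.genValue] using H.h_K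
  | E_e => simpa only [map_sub, map_mul, map_zero, sub_eq_zero, hι, genValue, Uq.genValue] using H.E_e
  | K_e => simpa only [map_sub, map_mul, map_zero, sub_eq_zero, hι, genValue, Uq.genValue] using H.K_e
  | F_f => simpa only [map_sub, map_mul, map_zero, sub_eq_zero, hι, genValue, Uq.genValue] using H.F_f
  | K_f => simpa only [map_sub, map_mul, map_zero, sub_eq_zero, hι, genValue, Uq.genValue] using H.K_f
  | F_e => simpa only [map_sub, map_mul, map_smul, map_pow, map_qBracketK, hι, genValue, Uq.genValue] using H.F_e
  | E_f => simpa only [map_sub, map_mul, map_smul, map_pow, map_qBracketK, hι, genValue, Uq.genValue] using H.E_f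
  | h_E => simpa only [map_sub, map_mul, map_smul, map_elemA, hι, genValue, Uq.genValue] using H.h_E
  | h_F => simpa only [map_sub, map_mul, map_neg, map_smul, map_elemA, hι, genValue, Uq.genValue] using H.h_F

/-- The homomorphism given by elements that satisfy the relations. -/
def lift (H : IsLusztig p E F K Kinv e f h) : LU p →ₐ[ℂ] A :=
  RingQuot.liftAlgHom ℂ ⟨FreeAlgebra.lift ℂ (genValue E F K Kinv e f h), lift_rel H⟩

lemma lift_gen (H : IsLusztig p E F K Kinv e f h) (g : LGen) :
    lift H (gen p g) = genValue E F K Kinv e f h g :=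
  (RingQuot.liftAlgHom_mkAlgHom_apply ..).trans (FreeAlgebra.lift_ι_apply _ _)

end Lift

/-- The homomorphism from the Lusztig limit to the special fiber of the form with divided
powers. -/
def toSpecialFiber (hp : 2 ≤ p) : LU p →ₐ[ℂ] SpecialFiber p := lift (SpecialFiber.isLusztig hp)

lemma toSpecialFiber_surjective (hp : 2 ≤ p) : Function.Surjective (toSpecialFiber hp) := by
  have hgen : ∀ g, genValue (SpecialFiber.E p) (SpecialFiber.F p) (SpecialFiber.K p)
      (SpecialFiber.Kinv p) (SpecialFiber.e p) (SpecialFiber.f p) (SpecialFiber.h p) g ∈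
      (toSpecialFiber hp).range := fun g => ⟨gen p g, lift_gen _ g⟩
  intro y
  obtain ⟨x, rfl⟩ := SpecialFiber.mk_surjective p y
  change SpecialFiber.mk p x ∈ (toSpecialFiber hp).range
  induction x using DividedForm.induction with
  | hE => exact hgen (.q .E)
  | hF => exact hgen (.q .F)
  | hK => exact hgen (.q .K)
  | hKinv => exact hgen (.q .Kinv)
  | he => exact hgen .e
  | hf => exact hgen .f
  | hh => exact hgen .h
  | hr c =>
    rw [Algebra.algebraMap_eq_smul_one, SpecialFiber.mk_smul, map_one]
    exact Subalgebra.smul_mem _ (one_mem _) _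
  | hadd x y hx hy =>
    rw [map_add]; exact add_mem hx hy
  | hmul x y hx hy =>
    rw [map_mul]; exact mul_mem hx hy

end LU

/-! ### Quantum binomial coefficients -/

/-- The quantum binomial coefficient `[m] [m - 1] ⋯ [m - t + 1] / [t]!`. -/
def qBinom {k : Type*} [Field k] (v : k) (m : ℤ) (t : ℕ) : k :=
  (∏ i ∈ Finset.range t, qZ v (m - i)) / qFact v t

section qBinom
variable {k : Type*} [Field k] {v : k}

lemma qBinom_zero (m : ℤ) : qBinom v m 0 = 1 := by simp [qBinom, qFact_zero]

lemma qBinom_eq_zero {b t : ℕ} (h : b < t) : qBinom v b t = 0 := by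
  rw [qBinom, Finset.prod_eq_zero (Finset.mem_range.2 h) (by simp), zero_div]

lemma qBinom_mul_sub (hv : ∀ n : ℕ, qInt v (n + 1) ≠ 0) (m : ℤ) (t : ℕ) :
    qBinom v m t * qZ v (m - t) = qInt v (t + 1) * qBinom v m (t + 1) := by
  have h1 := hv t
  have h2 : qFact v t ≠ 0 := qFact_ne_zero _ _ fun m hm _ => by
    obtain ⟨m, rfl⟩ := Nat.exists_eq_add_of_le' hm
    exact hv m
  rw [qBinom, qBinom, Finset.prod_range_succ, qFact_succ]
  field_simp

lemma mul_qBinom_sub_one (hv : ∀ n : ℕ, qInt v (n + 1) ≠ 0) (m : ℤ) (t : ℕ) :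
    qZ v m * qBinom v (m - 1) t = qInt v (t + 1) * qBinom v m (t + 1) := by
  have h1 := hv t
  have h2 : qFact v t ≠ 0 := qFact_ne_zero _ _ fun m hm _ => by
    obtain ⟨m, rfl⟩ := Nat.exists_eq_add_of_le' hm
    exact hv m
  rw [qBinom, qBinom, Finset.prod_range_succ', qFact_succ]
  simp only [Nat.cast_zero, sub_zero, Nat.cast_add, Nat.cast_one, sub_add_eq_sub_sub_swap]
  field_simp

lemma natCast_mul_qBinom (hv : ∀ n : ℕ, qInt v (n + 1) ≠ 0) (b t : ℕ) :
    qInt v b * qBinom v (b - 1 : ℕ) t = qInt v (t + 1) * qBinom v b (t + 1) := by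
  rcases b with _ | b
  · rw [qInt_zero, zero_mul, qBinom_eq_zero (by omega), mul_zero]
  · rw [← qZ_natCast, ← mul_qBinom_sub_one hv]
    simp

/-- The recursion behind the action of divided powers. -/
lemma qBinom_recursion (hv0 : v ≠ 0) (hv : ∀ n : ℕ, qInt v (n + 1) ≠ 0) (m : ℤ) (s t : ℕ) :
    qInt v s * qBinom v m (t + 1) + qZ v (m + 1 + s) * qBinom v m t =
      qInt v (s + (t + 1)) * qBinom v (m + 1) (t + 1) := by
  have h1 := hv t
  have e1 := qBinom_mul_sub hv m t
  have e2 := mul_qBinom_sub_one hv (m + 1) t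
  rw [add_sub_cancel_right] at e2
  have key : qZ v s * qZ v (m - t) + qZ v (m + 1 + s) * qZ v (t + 1) =
      qZ v (s + (t + 1)) * qZ v (m + 1) := by
    have := qZ_three_term v hv0 (m + 1) (t + 1) s
    rw [show m + 1 - ((t : ℤ) + 1) = m - t by ring, add_comm ((t : ℤ) + 1)] at this
    linear_combination -this
  apply mul_left_cancel₀ h1
  have h3 : qInt v (t + 1) = qZ v (t + 1) := by rw [← qZ_natCast]; push_cast; rfl
  have h4 : qInt v (s + (t + 1)) = qZ v (s + (t + 1)) := by rw [← qZ_natCast]; push_cast; rfl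
  have h5 : qInt v s = qZ v s := by rw [← qZ_natCast]
  rw [h4, h5]
  rw [h3] at e1 e2 ⊢
  linear_combination -qZ v s * e1 + qZ v (s + (t + 1)) * e2 + qBinom v m t * key

end qBinom

section Values
variable {p : ℕ}

/-- The part of the quantum binomial coefficient of `m` and `p` that is a unit at `q`. -/
def binomUnit (p : ℕ) (m : ℤ) : ℂ :=
  (∏ i ∈ (Finset.range p).erase (m % p).toNat, qZ (qRoot p) (m - i)) / qFact (qRoot p) (p - 1)

lemma emod_toNat_mem (hp : 2 ≤ p) (m : ℤ) : (m % p).toNat ∈ Finset.range p := by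
  have h1 := Int.emod_lt_of_pos m (b := (p : ℤ)) (by omega)
  have h2 := Int.emod_nonneg m (b := (p : ℤ)) (by omega)
  rw [Finset.mem_range]
  omega

lemma binomUnit_ne_zero (hp : 2 ≤ p) (m : ℤ) : binomUnit p m ≠ 0 := by
  refine div_ne_zero (Finset.prod_ne_zero_iff.2 fun i hi => ?_) (qFact_qRoot_ne_zero hp (by omega))
  rw [Finset.mem_erase, Finset.mem_range] at hi
  rw [Ne, qZ_qRoot_eq_zero_iff hp]
  intro h
  apply hi.1
  rw [Int.emod_eq_emod_iff_emod_sub_eq_zero.2 (Int.emod_eq_zero_of_dvd h),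
    Int.emod_eq_of_lt (by omega) (by omega)]
  simp

/-- Among the `p` consecutive integers `m - i` exactly one is divisible by `p`, the one with `i` the
residue of `m`. Its quantum integer divided by `[p]` has the limit given by
`specializes_qZ_mul_div`; all other factors are units at `q`. -/
lemma specializes_qBinom_self (hp : 2 ≤ p) (m : ℤ) : Specializes (qRoot p)
    (qBinom RatFunc.X m p) (binomUnit p m * ((-1) ^ (m / p - 1) * (m / p : ℤ))) := by
  have h2 := Int.emod_nonneg m (b := (p : ℤ)) (by omega)
  have h3 : m - ((m % p).toNat : ℤ) = p * (m / p) := by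
    rw [Int.toNat_of_nonneg h2]
    have := Int.emod_add_mul_ediv m p
    linarith
  have h1 : qBinom (RatFunc.X : RatFunc ℂ) m p =
      (∏ i ∈ (Finset.range p).erase (m % p).toNat, qZ RatFunc.X (m - i)) /
        qFact RatFunc.X (p - 1) * (qZ RatFunc.X (p * (m / p)) / qInt RatFunc.X p) := by
    obtain ⟨n, rfl⟩ : ∃ n, p = n + 1 := ⟨p - 1, by omega⟩
    rw [qBinom, ← Finset.prod_erase_mul _ _ (emod_toNat_mem hp m), h3, qFact_succ, div_mul_div_comm]
    rfl
  rw [h1]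
  exact ((Specializes.prod _ fun i _ => specializes_qZ hp _).div (specializes_qFact hp _)
    (qFact_qRoot_ne_zero hp (by omega))).mul (specializes_qZ_mul_div hp _)

lemma exists_specializes_qBinom (hp : 2 ≤ p) (m : ℤ) {t : ℕ} (ht : t ≤ p) :
    qBinom (RatFunc.X : RatFunc ℂ) m t ∈ regularAt (qRoot p) := by
  rcases ht.lt_or_eq with h | rfl
  · exact ((Specializes.prod _ fun i _ => specializes_qZ hp _).div (specializes_qFact hp _)
      (qFact_qRoot_ne_zero hp h)).mem
  · exact (specializes_qBinom_self hp m).mem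

lemma binomUnit_add_mul (hp : 2 ≤ p) (m s : ℤ) :
    binomUnit p (m + p * (2 * s)) = binomUnit p m := by
  have h1 : (m + p * (2 * s)) % p = m % p := by simp
  rw [binomUnit, binomUnit, h1]
  congr 1
  refine Finset.prod_congr rfl fun i _ => ?_
  rw [show m + p * (2 * s) - (i : ℤ) = m - i + p * (2 * s) by ring, qZ_qRoot_add_mul hp, zpow_mul]
  norm_num

end Values

/-! ### A module of functions over quantum `sl(2)` -/

/-- Functions of two natural numbers and an integer weight. -/
abbrev Coefs := ℕ → ℤ → ℕ → RatFunc ℂ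

namespace Coefs

/-- The action of `E`. -/
def opE : Module.End (RatFunc ℂ) Coefs where
  -- A function `φ` stands for the formal sum of `φ a n b` times `F^(a) 1_n E^(b)`, with `1_n` the
  -- idempotent of weight `n`, and the operators are left multiplications. Here `E` either passes to
  -- the right and joins `E^(b-1)`, or removes one factor `F`. The truncated `b - 1` is harmless
  -- since `[0] = 0`. The unit is the sum of all `1_n`, which is `delta` below.
  toFun φ a n b := qInt RatFunc.X b * φ a (n - 2) (b - 1) + qZ RatFunc.X (n - a) * φ (a + 1) n b
  map_add' φ ψ := by ext a n b; simp only [Pi.add_apply]; ring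
  map_smul' c φ := by ext a n b; simp only [Pi.smul_apply, smul_eq_mul, RingHom.id_apply]; ring

/-- The action of `F`. -/
def opF : Module.End (RatFunc ℂ) Coefs where
  toFun φ a n b := qInt RatFunc.X a * φ (a - 1) n b
  map_add' φ ψ := by ext a n b; simp only [Pi.add_apply]; ring
  map_smul' c φ := by ext a n b; simp only [Pi.smul_apply, smul_eq_mul, RingHom.id_apply]; ring

/-- The action of `K ^ c`. -/
def opK (c : ℤ) : Module.End (RatFunc ℂ) Coefs where
  toFun φ a n b := RatFunc.X ^ (c * (n - 2 * a)) * φ a n b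
  map_add' φ ψ := by ext a n b; simp only [Pi.add_apply]; ring
  map_smul' c φ := by ext a n b; simp only [Pi.smul_apply, smul_eq_mul, RingHom.id_apply]; ring

lemma opE_apply (φ : Coefs) (a : ℕ) (n : ℤ) (b : ℕ) : opE φ a n b =
    qInt RatFunc.X b * φ a (n - 2) (b - 1) + qZ RatFunc.X (n - a) * φ (a + 1) n b := rfl

lemma opF_apply (φ : Coefs) (a : ℕ) (n : ℤ) (b : ℕ) :
    opF φ a n b = qInt RatFunc.X a * φ (a - 1) n b := rfl

lemma opK_apply (c : ℤ) (φ : Coefs) (a : ℕ) (n : ℤ) (b : ℕ) :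
    opK c φ a n b = RatFunc.X ^ (c * (n - 2 * a)) * φ a n b := rfl

lemma opK_mul_opK (c d : ℤ) : opK c * opK d = opK (c + d) := by
  ext φ a n b
  rw [Module.End.mul_apply, opK_apply, opK_apply, opK_apply, ← mul_assoc,
    ← zpow_add₀ RatFunc.X_ne_zero, add_mul]

lemma opK_zero : opK 0 = 1 := by
  ext φ a n b
  rw [opK_apply]
  simp

lemma isQuantum : IsQuantum (RatFunc.X : RatFunc ℂ) opE opF (opK 1) (opK (-1)) where
  K_mul_Kinv := by rw [opK_mul_opK, add_neg_cancel, opK_zero]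
  Kinv_mul_K := by rw [opK_mul_opK, neg_add_cancel, opK_zero]
  K_E := by
    ext φ a n b
    have hX : (RatFunc.X : RatFunc ℂ) ≠ 0 := RatFunc.X_ne_zero
    simp only [Module.End.mul_apply, LinearMap.smul_apply, Pi.smul_apply, smul_eq_mul, opK_apply,
      opE_apply]
    have h1 : (RatFunc.X : RatFunc ℂ) ^ (1 * (n - 2 * a)) =
        RatFunc.X ^ 2 * RatFunc.X ^ (1 * (n - 2 - 2 * a : ℤ)) := by
      rw [← zpow_natCast, ← zpow_add₀ hX]; congr 1; push_cast; ring
    have h2 : (1 * (n - 2 * ((a + 1 : ℕ) : ℤ))) = 1 * (n - 2 - 2 * a : ℤ) := by push_cast; ring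
    rw [h1, h2]
    ring
  K_F := by
    ext φ a n b
    have hX : (RatFunc.X : RatFunc ℂ) ≠ 0 := RatFunc.X_ne_zero
    simp only [Module.End.mul_apply, LinearMap.smul_apply, Pi.smul_apply, smul_eq_mul, opK_apply,
      opF_apply]
    rcases a with _ | a
    · simp [qInt_zero]
    have h1 : (RatFunc.X : RatFunc ℂ) ^ (1 * (n - 2 * ((a + 1 : ℕ) : ℤ))) =
        RatFunc.X⁻¹ ^ 2 * RatFunc.X ^ (1 * (n - 2 * a : ℤ)) := by
      rw [inv_pow, ← zpow_natCast, ← zpow_neg, ← zpow_add₀ hX]; congr 1; push_cast; ring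
    rw [h1, Nat.add_sub_cancel]
    ring
  E_F := by
    ext φ a n b
    simp only [Module.End.mul_apply, LinearMap.smul_apply, Pi.smul_apply, smul_eq_mul, opK_apply,
      opF_apply, opE_apply, LinearMap.sub_apply, Pi.sub_apply, Nat.add_sub_cancel]
    have h1 : (RatFunc.X - RatFunc.X⁻¹ : RatFunc ℂ)⁻¹ * (RatFunc.X ^ (1 * (n - 2 * a)) * φ a n b -
        RatFunc.X ^ (-1 * (n - 2 * a)) * φ a n b) = qZ RatFunc.X (n - 2 * a) * φ a n b := by
      rw [qZ, one_mul, neg_one_mul]; ring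
    rw [h1]
    have h2 := qZ_three_term (RatFunc.X : RatFunc ℂ) RatFunc.X_ne_zero (n - a) a 1
    rw [show n - (a : ℤ) - a = n - 2 * a by ring, qZ_one _ ratFunc_X_sub_inv_ne_zero] at h2
    rcases a with _ | a
    · simp only [← qZ_natCast]
      simp [qZ_one _ ratFunc_X_sub_inv_ne_zero]
    · simp only [← qZ_natCast, Nat.add_sub_cancel] at h2 ⊢
      push_cast at h2 ⊢
      rw [show n - ((a : ℤ) + 1) + 1 = n - a by ring] at h2
      linear_combination φ (a + 1) n b * h2

lemma opF_pow_apply (r : ℕ) (φ : Coefs) (a : ℕ) (n : ℤ) (b : ℕ) : (opF ^ r) φ a n b =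
    qFact RatFunc.X r * (qBinom RatFunc.X a r * φ (a - r) n b) := by
  induction r generalizing a with
  | zero => simp [qFact_zero, qBinom_zero]
  | succ r ih =>
    rw [pow_succ', Module.End.mul_apply, opF_apply, ih, qFact_succ, Nat.sub_sub, add_comm 1 r]
    have := natCast_mul_qBinom (v := (RatFunc.X : RatFunc ℂ))
      (fun n => qInt_X_ne_zero n.succ_ne_zero) a r
    linear_combination qFact RatFunc.X r * φ (a - (r + 1)) n b * this

/-- Of the `r` factors `E`, a number `x.1` moves to the right into `E^(b)`, while `x.2` of them
consume factors `F`. The induction step is `qBinom_recursion`. -/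
lemma opE_pow_apply (r : ℕ) (φ : Coefs) (a : ℕ) (n : ℤ) (b : ℕ) : (opE ^ r) φ a n b =
    qFact RatFunc.X r * ∑ x ∈ Finset.HasAntidiagonal.antidiagonal r, qBinom RatFunc.X b x.1 *
      qBinom RatFunc.X (n - a - x.1) x.2 * φ (a + x.2) (n - 2 * x.1) (b - x.1) := by
  have hv := fun n : ℕ => qInt_X_ne_zero n.succ_ne_zero
  induction r generalizing a n b with
  | zero => simp [qFact_zero, qBinom_zero]
  | succ r ih =>
    rw [pow_succ', Module.End.mul_apply, opE_apply, ih, ih, qFact_succ]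
    have h1 : qInt RatFunc.X b * ∑ x ∈ Finset.HasAntidiagonal.antidiagonal r, qBinom RatFunc.X (b - 1 : ℕ) x.1 *
        qBinom RatFunc.X (n - 2 - a - x.1) x.2 *
          φ (a + x.2) (n - 2 - 2 * x.1) (b - 1 - x.1) =
        ∑ x ∈ Finset.HasAntidiagonal.antidiagonal (r + 1), qInt RatFunc.X x.1 * qBinom RatFunc.X b x.1 *
          qBinom RatFunc.X (n - a - x.1 - 1) x.2 * φ (a + x.2) (n - 2 * x.1) (b - x.1) := by
      rw [Finset.Nat.sum_antidiagonal_succ, qInt_zero, zero_mul, zero_mul, zero_mul, zero_add,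
        Finset.mul_sum]
      refine Finset.sum_congr rfl fun x _ => ?_
      rw [← natCast_mul_qBinom hv, Nat.sub_sub, add_comm 1 x.1]
      push_cast
      rw [show n - 2 - (a : ℤ) - x.1 = n - a - (x.1 + 1) - 1 by ring,
        show n - 2 - 2 * (x.1 : ℤ) = n - 2 * (x.1 + 1) by ring]
      ring
    have h2 : qZ RatFunc.X (n - a) * ∑ x ∈ Finset.HasAntidiagonal.antidiagonal r, qBinom RatFunc.X b x.1 *
        qBinom RatFunc.X (n - (a + 1 : ℕ) - x.1) x.2 *
          φ (a + 1 + x.2) (n - 2 * x.1) (b - x.1) =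
        ∑ x ∈ Finset.HasAntidiagonal.antidiagonal (r + 1), qBinom RatFunc.X b x.1 * (if x.2 = 0 then 0 else
          qZ RatFunc.X (n - a) * qBinom RatFunc.X (n - a - x.1 - 1) (x.2 - 1)) *
            φ (a + x.2) (n - 2 * x.1) (b - x.1) := by
      rw [Finset.Nat.sum_antidiagonal_succ', if_pos rfl, mul_zero, zero_mul, zero_add,
        Finset.mul_sum]
      refine Finset.sum_congr rfl fun x _ => ?_
      rw [if_neg (by omega), Nat.add_sub_cancel, add_right_comm a 1, add_assoc a]
      push_cast
      rw [show n - ((a : ℤ) + 1) - x.1 = n - a - x.1 - 1 by ring]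
      ring
    rw [mul_left_comm, h1, mul_left_comm (qZ RatFunc.X _), h2, ← mul_add, mul_assoc,
      ← Finset.sum_add_distrib, Finset.mul_sum (a := qInt RatFunc.X (r + 1))]
    congr 1
    refine Finset.sum_congr rfl fun x hx => ?_
    rw [Finset.HasAntidiagonal.mem_antidiagonal] at hx
    obtain ⟨s, t⟩ := x
    dsimp only at hx ⊢
    rcases t with _ | t
    · rw [if_pos rfl, qBinom_zero, qBinom_zero, ← hx]
      simp [mul_assoc]
    · rw [if_neg (by omega), Nat.add_sub_cancel, ← hx]
      have := qBinom_recursion (v := (RatFunc.X : RatFunc ℂ)) RatFunc.X_ne_zero hv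
        (n - a - s - 1) s t
      rw [show n - (a : ℤ) - s - 1 + 1 + s = n - a by ring, sub_add_cancel] at this
      linear_combination qBinom RatFunc.X b s * φ (a + (t + 1)) (n - 2 * s) (b - s) * this

end Coefs

/-! ### Regularity at `q` and leading terms -/

namespace Coefs

/-- The representation of generic quantum `sl(2)` on functions. -/
def rep : Ugen →ₐ[RatFunc ℂ] Module.End (RatFunc ℂ) Coefs := Uq.lift isQuantum

lemma rep_E : rep Ugen.E = opE := Uq.lift_gen isQuantum .E
lemma rep_F : rep Ugen.F = opF := Uq.lift_gen isQuantum .F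
lemma rep_K : rep Ugen.K = opK 1 := Uq.lift_gen isQuantum .K
lemma rep_Kinv : rep Ugen.Kinv = opK (-1) := Uq.lift_gen isQuantum .Kinv

lemma opK_pow (c : ℤ) (n : ℕ) : opK c ^ n = opK (n * c) := by
  induction n with
  | zero => rw [pow_zero, Nat.cast_zero, zero_mul, opK_zero]
  | succ n ih => rw [pow_succ, ih, opK_mul_opK]; congr 1; push_cast; ring

variable {p : ℕ}

lemma rep_f_apply (φ : Coefs) (a : ℕ) (n : ℤ) (b : ℕ) : rep (Ugen.f p) φ a n b =
    (-1) ^ p * (qBinom RatFunc.X a p * φ (a - p) n b) := by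
  rw [Ugen.f, map_smul, map_pow, rep_F, LinearMap.smul_apply, Pi.smul_apply, Pi.smul_apply,
    Pi.smul_apply, opF_pow_apply, smul_eq_mul]
  field_simp [qFact_X_ne_zero p]

lemma rep_e_apply (φ : Coefs) (a : ℕ) (n : ℤ) (b : ℕ) : rep (Ugen.e p) φ a n b =
    RatFunc.X ^ (p * (n - 2 * a)) * ∑ x ∈ Finset.HasAntidiagonal.antidiagonal p,
      qBinom RatFunc.X b x.1 * qBinom RatFunc.X (n - a - x.1) x.2 *
        φ (a + x.2) (n - 2 * x.1) (b - x.1) := by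
  rw [Ugen.e, map_smul, map_mul, map_pow, map_pow, rep_E, rep_K, opK_pow, LinearMap.smul_apply,
    Pi.smul_apply, Pi.smul_apply, Pi.smul_apply, Module.End.mul_apply, opK_apply, opE_pow_apply,
    smul_eq_mul, mul_one]
  field_simp [qFact_X_ne_zero p]

lemma rep_h_apply (φ : Coefs) (a : ℕ) (n : ℤ) (b : ℕ) : rep (Ugen.h p) φ a n b =
    1 / 2 * (rep (Ugen.e p) (rep (Ugen.f p) φ) a n b -
      rep (Ugen.f p) (rep (Ugen.e p) φ) a n b) := by
  rw [Ugen.h, map_smul, map_sub, map_mul, map_mul]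
  rfl

variable (p) in
/-- The values are regular at `q`. -/
def IsRegular (φ : Coefs) : Prop := ∀ a n b, φ a n b ∈ regularAt (qRoot p)

lemma isRegular_rep_e (hp : 2 ≤ p) {φ : Coefs} (h : IsRegular p φ) :
    IsRegular p (rep (Ugen.e p) φ) := by
  intro a n b
  rw [rep_e_apply]
  refine mul_mem (specializes_X_zpow _).mem (sum_mem fun x hx => ?_)
  rw [Finset.HasAntidiagonal.mem_antidiagonal] at hx
  exact mul_mem (mul_mem (exists_specializes_qBinom hp _ (by omega))
    (exists_specializes_qBinom hp _ (by omega))) (h _ _ _)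

lemma isRegular_rep_f (hp : 2 ≤ p) {φ : Coefs} (h : IsRegular p φ) :
    IsRegular p (rep (Ugen.f p) φ) := by
  intro a n b
  rw [rep_f_apply]
  exact mul_mem (pow_mem (neg_mem (one_mem _)) _)
    (mul_mem (exists_specializes_qBinom hp _ le_rfl) (h _ _ _))

/-- The generators act through quantum integers, powers of `v` and quantum binomial coefficients of
lower index at most `p`, all regular at `q`. The action on `delta` can therefore be specialized. -/
lemma isRegular_rep (hp : 2 ≤ p) (x : DividedForm p) :
    ∀ {φ : Coefs}, IsRegular p φ → IsRegular p (rep (x : Ugen) φ) := by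
  induction x using DividedForm.induction with
  | hE =>
    intro φ h a n b
    rw [DividedForm.coe_E, rep_E]
    exact add_mem (mul_mem (specializes_qInt hp _).mem (h _ _ _))
      (mul_mem (specializes_qZ hp _).mem (h _ _ _))
  | hF =>
    intro φ h a n b
    rw [DividedForm.coe_F, rep_F]
    exact mul_mem (specializes_qInt hp _).mem (h _ _ _)
  | hK =>
    intro φ h a n b
    rw [DividedForm.coe_K, rep_K]
    exact mul_mem (specializes_X_zpow _).mem (h _ _ _)
  | hKinv =>
    intro φ h a n b
    rw [DividedForm.coe_Kinv, rep_Kinv]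
    exact mul_mem (specializes_X_zpow _).mem (h _ _ _)
  | he => exact isRegular_rep_e hp
  | hf => exact isRegular_rep_f hp
  | hh =>
    intro φ h a n b
    rw [DividedForm.coe_h, rep_h_apply]
    exact mul_mem (DividedForm.specializes_half p).mem (sub_mem
      (isRegular_rep_e hp (isRegular_rep_f hp h) _ _ _)
      (isRegular_rep_f hp (isRegular_rep_e hp h) _ _ _))
  | hr c =>
    intro φ h a n b
    rw [Algebra.algebraMap_eq_smul_one, DividedForm.coe_smul, map_smul]
    have h1 : rep ((1 : DividedForm p) : Ugen) φ = φ := by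
      rw [OneMemClass.coe_one, map_one, Module.End.one_apply]
    rw [LinearMap.smul_apply, h1]
    exact mul_mem c.2 (h _ _ _)
  | hadd x y hx hy =>
    intro φ h a n b
    rw [AddMemClass.coe_add, map_add]
    exact add_mem (hx h _ _ _) (hy h _ _ _)
  | hmul x y hx hy =>
    intro φ h a n b
    rw [MulMemClass.coe_mul, map_mul]
    exact hx (hy h) _ _ _

/-- The indicator function of `a = b = 0`. -/
def delta : Coefs := fun a _ b => if a = 0 ∧ b = 0 then 1 else 0

lemma isRegular_delta : IsRegular p delta := by
  intro a n b
  rw [delta]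
  split_ifs
  exacts [one_mem _, zero_mem _]

/-- A relation in the special fiber gives a relation between specialized coefficients. -/
lemma sum_mul_eq_zero (hp : 2 ≤ p) {ι : Type*} {M : ι → DividedForm p} {l : ι →₀ ℂ}
    (hl : ∑ i ∈ l.support, l i • SpecialFiber.mk p (M i) = 0) (a : ℕ) (n : ℤ) (b : ℕ) {w : ι → ℂ}
    (hw : ∀ i, Specializes (qRoot p) (rep (M i : Ugen) delta a n b) (w i)) :
    ∑ i ∈ l.support, l i * w i = 0 := by
  -- The complex coefficients are lifted as constants. The lifted combination is `v - q` times an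
  -- element of the form, and the coefficients of that element are regular, so those of the
  -- combination vanish at `q`.
  have h1 : SpecialFiber.mk p (∑ i ∈ l.support, reg p (RatFunc.C (l i)) • M i) = 0 := by
    rw [map_sum, ← hl]
    exact Finset.sum_congr rfl fun i _ => SpecialFiber.mk_reg_smul (Specializes.C _) _
  obtain ⟨y, hy⟩ := SpecialFiber.mk_eq_zero_iff.1 h1
  have h2 : rep ((∑ i ∈ l.support, reg p (RatFunc.C (l i)) • M i : DividedForm p) : Ugen)
      delta a n b = ∑ i ∈ l.support, RatFunc.C (l i) * rep (M i : Ugen) delta a n b := by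
    rw [AddSubmonoidClass.coe_finsetSum, map_sum, LinearMap.sum_apply, Finset.sum_apply,
      Finset.sum_apply, Finset.sum_apply]
    refine Finset.sum_congr rfl fun i _ => ?_
    rw [DividedForm.coe_reg_smul (Specializes.C _), map_smul]
    rfl
  obtain ⟨c, hc⟩ := exists_specializes (isRegular_rep hp y (isRegular_delta (p := p)) a n b)
  have h3 := SpecialFiber.specializes_X_sub_C.mul hc
  rw [zero_mul] at h3
  have h4 : (RatFunc.X - RatFunc.C (qRoot p)) * rep (y : Ugen) delta a n b =
      ∑ i ∈ l.support, RatFunc.C (l i) * rep (M i : Ugen) delta a n b := by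
    rw [← h2, hy, map_smul]
    rfl
  rw [h4] at h3
  exact (Specializes.sum _ fun i _ => (Specializes.C (l i)).mul (hw i)).unique h3

/-- `φ` vanishes below `a = A` and has there the specialized values `w`, all at `b = B`. -/
structure IsLead (p : ℕ) (φ : Coefs) (A B : ℕ) (w : ℤ → ℂ) : Prop where
  below : ∀ a < A, ∀ n b, φ a n b = 0
  off : ∀ n b, b ≠ B → φ A n b = 0
  value : ∀ n, Specializes (qRoot p) (φ A n B) (w n)

/-- The specialization of the quantum binomial coefficient of `m` and `p`. -/
def binomValue (p : ℕ) (m : ℤ) : ℂ := binomUnit p m * ((-1) ^ (m / p - 1) * (m / p : ℤ))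

lemma binomValue_ne_zero (hp : 2 ≤ p) {m : ℤ} (hm : p ≤ m) : binomValue p m ≠ 0 := by
  refine mul_ne_zero (binomUnit_ne_zero hp m) (mul_ne_zero (zpow_ne_zero _ (by norm_num)) ?_)
  have := Int.ediv_pos_of_pos_of_dvd (a := (p : ℤ)) (b := p) (by omega) (by omega) dvd_rfl
  have h2 := Int.ediv_le_ediv (c := (p : ℤ)) (by omega) hm
  exact_mod_cast (by omega : m / p ≠ 0)

/-- The leading coefficient of `h`. -/
def hValue (p A : ℕ) (n : ℤ) : ℂ :=
  1 / 2 * ((-1) ^ p * (qRoot p ^ (p * (n - 2 * A)) * (binomValue p (n - A) *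
    binomValue p ((A + p : ℕ) : ℤ))))

namespace IsLead
variable {φ : Coefs} {A B : ℕ} {w : ℤ → ℂ}

lemma rep_f (hp : 2 ≤ p) (H : IsLead p φ A B w) : IsLead p (rep (Ugen.f p) φ) (A + p) B
    (fun n => (-1) ^ p * (binomValue p ((A + p : ℕ) : ℤ) * w n)) where
  below a ha n b := by
    rw [rep_f_apply]
    by_cases h : a < p
    · rw [qBinom_eq_zero h, zero_mul, mul_zero]
    · rw [H.below _ (by omega), mul_zero, mul_zero]
  off n b hb := by
    rw [rep_f_apply, Nat.add_sub_cancel, H.off _ _ hb, mul_zero, mul_zero]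
  value n := by
    rw [rep_f_apply, Nat.add_sub_cancel]
    exact (Specializes.one.neg.pow p).mul ((specializes_qBinom_self hp _).mul (H.value n))

/-- For `a < p` the operator `f` gives zero at `a`, so only `e f` matters. A summand of `e`
evaluates `f φ` at `a + t` with `t ≤ p`, hence involves `φ` at `a + t - p` or a zero binomial
coefficient. As `φ` vanishes below `A`, only `t = p` survives, and `h` acts on the lowest layer by a
scalar for each `n`. -/
lemma rep_h_eq (hA : A < p) (h : ∀ a < A, ∀ n b, φ a n b = 0) {a : ℕ} (ha : a ≤ A) (n : ℤ)
    (b : ℕ) : rep (Ugen.h p) φ a n b = 1 / 2 * ((-1) ^ p * (RatFunc.X ^ (p * (n - 2 * a)) *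
      (qBinom RatFunc.X (n - a) p * qBinom RatFunc.X ((a + p : ℕ) : ℤ) p)) * φ a n b) := by
  rw [rep_h_apply, rep_f_apply (rep (Ugen.e p) φ), qBinom_eq_zero (by omega), zero_mul, mul_zero,
    sub_zero, rep_e_apply, Finset.sum_eq_single (0, p)]
  · rw [rep_f_apply, Nat.add_sub_cancel, qBinom_zero]
    simp only [Nat.cast_zero, mul_zero, sub_zero, Nat.sub_zero]
    ring
  · rintro ⟨s, t⟩ hx hne
    rw [Finset.HasAntidiagonal.mem_antidiagonal] at hx
    dsimp only at hx ⊢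
    have ht : t < p := by
      rcases Nat.eq_zero_or_pos s with rfl | hs
      · exact absurd (by rw [← hx, zero_add]) hne
      · omega
    rw [rep_f_apply]
    by_cases h1 : a + t < p
    · rw [qBinom_eq_zero h1, zero_mul, mul_zero, mul_zero]
    · rw [h _ (by omega), mul_zero, mul_zero, mul_zero]
  · intro h
    exact absurd (Finset.HasAntidiagonal.mem_antidiagonal.2 (zero_add p)) h

lemma rep_h (hp : 2 ≤ p) (hA : A < p) (H : IsLead p φ A B w) :
    IsLead p (rep (Ugen.h p) φ) A B (fun n => hValue p A n * w n) where
  below a ha n b := by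
    rw [rep_h_eq hA H.below ha.le, H.below a ha, mul_zero, mul_zero]
  off n b hb := by
    rw [rep_h_eq hA H.below le_rfl, H.off n b hb, mul_zero, mul_zero]
  value n := by
    rw [rep_h_eq hA H.below le_rfl, ← mul_assoc]
    exact ((DividedForm.specializes_half p).mul ((Specializes.one.neg.pow p).mul
      ((specializes_X_zpow _).mul ((specializes_qBinom_self hp _).mul
        (specializes_qBinom_self hp _))))).mul (H.value n)

lemma rep_h_pow (hp : 2 ≤ p) (hA : A < p) (H : IsLead p φ A B w) (j : ℕ) :
    IsLead p (rep (Ugen.h p ^ j) φ) A B (fun n => hValue p A n ^ j * w n) := by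
  induction j with
  | zero => simpa using H
  | succ j ih =>
    rw [pow_succ', map_mul, Module.End.mul_apply]
    convert ih.rep_h hp hA using 2
    ring

lemma rep_F_pow (hp : 2 ≤ p) (H : IsLead p φ 0 B w) {a : ℕ} (ha : a < p) :
    IsLead p (rep (Ugen.F ^ a) φ) a B
      (fun n => qFact (qRoot p) a * (qBinom (qRoot p) a a * w n)) where
  below a' ha' n b := by
    rw [map_pow, rep_F, opF_pow_apply, qBinom_eq_zero ha', zero_mul, mul_zero]
  off n b hb := by
    rw [map_pow, rep_F, opF_pow_apply, Nat.sub_self, H.off _ _ hb, mul_zero, mul_zero]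
  value n := by
    rw [map_pow, rep_F, opF_pow_apply, Nat.sub_self]
    exact (specializes_qFact hp _).mul (((Specializes.prod _ fun i _ => specializes_qZ hp _).div
      (specializes_qFact hp _) (qFact_qRoot_ne_zero hp ha)).mul (H.value n))

lemma rep_K_pow (H : IsLead p φ 0 B w) (c : ℕ) :
    IsLead p (rep (Ugen.K ^ c) φ) 0 B (fun n => qRoot p ^ (c * n) * w n) where
  below a ha := absurd ha (Nat.not_lt_zero a)
  off n b hb := by
    rw [map_pow, rep_K, opK_pow, opK_apply, H.off _ _ hb, mul_zero]
  value n := by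
    rw [map_pow, rep_K, opK_pow, opK_apply, Nat.cast_zero, mul_zero, sub_zero, mul_one]
    exact (specializes_X_zpow _).mul (H.value n)

end IsLead

/-- `φ` is supported on `a = 0`. -/
def IsFlat (φ : Coefs) : Prop := ∀ a, a ≠ 0 → ∀ n b, φ a n b = 0

namespace IsFlat
variable {φ : Coefs}

lemma sum_eq (h : IsFlat φ) (r a : ℕ) (n : ℤ) (b : ℕ) :
    ∑ x ∈ Finset.HasAntidiagonal.antidiagonal r, qBinom RatFunc.X b x.1 *
      qBinom RatFunc.X (n - a - x.1) x.2 * φ (a + x.2) (n - 2 * x.1) (b - x.1) =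
    qBinom RatFunc.X b r * φ a (n - 2 * r) (b - r) := by
  rw [Finset.sum_eq_single (r, 0)]
  · rw [qBinom_zero, mul_one, add_zero]
  · rintro ⟨s, t⟩ hx hne
    rw [Finset.HasAntidiagonal.mem_antidiagonal] at hx
    dsimp only at hx ⊢
    have ht : t ≠ 0 := by
      rintro rfl
      exact hne (by rw [← hx, add_zero])
    rw [h _ (by omega), mul_zero]
  · intro h
    exact absurd (Finset.HasAntidiagonal.mem_antidiagonal.2 (add_zero r)) h

lemma rep_E_pow_apply (h : IsFlat φ) (r a : ℕ) (n : ℤ) (b : ℕ) : rep (Ugen.E ^ r) φ a n b =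
    qFact RatFunc.X r * (qBinom RatFunc.X b r * φ a (n - 2 * r) (b - r)) := by
  rw [map_pow, rep_E, opE_pow_apply, h.sum_eq]

lemma rep_e_apply (h : IsFlat φ) (a : ℕ) (n : ℤ) (b : ℕ) : rep (Ugen.e p) φ a n b =
    RatFunc.X ^ (p * (n - 2 * a)) * (qBinom RatFunc.X b p * φ a (n - 2 * p) (b - p)) := by
  rw [Coefs.rep_e_apply, h.sum_eq]

end IsFlat

/-- The lowest terms of `e ^ l`. -/
lemma exists_isLead_e_pow (hp : 2 ≤ p) (l : ℕ) : IsFlat (rep (Ugen.e p ^ l) delta) ∧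
    ∃ w : ℤ → ℂ, (∀ n, w n ≠ 0) ∧ IsLead p (rep (Ugen.e p ^ l) delta) 0 (p * l) w := by
  induction l with
  | zero =>
    rw [pow_zero, map_one, Module.End.one_apply, mul_zero]
    refine ⟨fun a ha n b => if_neg (by simp [ha]), fun _ => 1, fun _ => one_ne_zero, ?_, ?_, ?_⟩
    · intro a ha
      exact absurd ha (Nat.not_lt_zero a)
    · exact fun n b hb => if_neg (by simp [hb])
    · intro n
      rw [delta, if_pos ⟨rfl, rfl⟩]
      exact Specializes.one
  | succ l ih =>
    obtain ⟨h1, w, hw, H⟩ := ih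
    rw [pow_succ', map_mul, Module.End.mul_apply]
    refine ⟨?_, fun n => qRoot p ^ (p * n) * (binomValue p ((p * (l + 1) : ℕ) : ℤ) *
      w (n - 2 * p)), ?_, ?_, ?_, ?_⟩
    · intro a ha n b
      rw [h1.rep_e_apply, h1 a ha, mul_zero, mul_zero]
    · intro n
      refine mul_ne_zero (zpow_ne_zero _ (qRoot_ne_zero p)) (mul_ne_zero (binomValue_ne_zero hp ?_)
        (hw _))
      push_cast
      nlinarith
    · intro a ha
      exact absurd ha (Nat.not_lt_zero a)
    · intro n b hb
      rw [h1.rep_e_apply]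
      by_cases h : b < p
      · rw [qBinom_eq_zero h, zero_mul, mul_zero]
      · rw [H.off _ _ (by rw [mul_add, mul_one] at hb; omega), mul_zero, mul_zero]
    · intro n
      rw [h1.rep_e_apply, show p * (l + 1) - p = p * l by rw [mul_add, mul_one, Nat.add_sub_cancel],
        Nat.cast_zero, mul_zero, sub_zero]
      exact (specializes_X_zpow _).mul ((specializes_qBinom_self hp _).mul (H.value _))

lemma exists_isLead_E_pow_e_pow (hp : 2 ≤ p) {b : ℕ} (hb : b < p) (l : ℕ) :
    ∃ w : ℤ → ℂ, (∀ n, w n ≠ 0) ∧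
      IsLead p (rep (Ugen.E ^ b * Ugen.e p ^ l) delta) 0 (p * l + b) w := by
  obtain ⟨h1, w, hw, H⟩ := exists_isLead_e_pow hp l
  rw [map_mul, Module.End.mul_apply]
  refine ⟨fun n => qFact (qRoot p) b * (qBinom (qRoot p) ((p * l + b : ℕ) : ℤ) b *
    w (n - 2 * b)), ?_, ?_, ?_, ?_⟩
  · intro n
    refine mul_ne_zero (qFact_qRoot_ne_zero hp hb) (mul_ne_zero (div_ne_zero
      (Finset.prod_ne_zero_iff.2 fun i hi => ?_) (qFact_qRoot_ne_zero hp hb)) (hw _))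
    rw [Finset.mem_range] at hi
    rw [Ne, qZ_qRoot_eq_zero_iff hp]
    intro h
    push_cast at h
    rw [add_sub_assoc, dvd_add_right (dvd_mul_right _ _)] at h
    have := Int.le_of_dvd (by omega) h
    omega
  · intro a ha
    exact absurd ha (Nat.not_lt_zero a)
  · intro n b' hb'
    rw [h1.rep_E_pow_apply]
    by_cases h : b' < b
    · rw [qBinom_eq_zero h, zero_mul, mul_zero]
    · rw [H.off _ _ (by omega), mul_zero, mul_zero]
  · intro n
    rw [h1.rep_E_pow_apply, Nat.add_sub_cancel]
    exact (specializes_qFact hp _).mul (((Specializes.prod _ fun i _ => specializes_qZ hp _).div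
      (specializes_qFact hp _) (qFact_qRoot_ne_zero hp hb)).mul (H.value _))

end Coefs

/-- The monomial `f ^ (A / p) h ^ j F ^ (A % p) K ^ c E ^ (B % p) e ^ (B / p)`. -/
def monomial {M : Type*} [Monoid M] (E F K e f h : M) (p : ℕ) (A B j c : ℕ) : M :=
  f ^ (A / p) * (h ^ j * (F ^ (A % p) * (K ^ c * (E ^ (B % p) * e ^ (B / p)))))

namespace Coefs
variable {p : ℕ}

/-- Read the monomial from right to left. The factors `e` and `E` bring `b` up to `B` at `a = 0`,
powers of `K` multiply by `q^(cn)`, those of `F` raise `a` to the residue of `A`, those of `h`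
multiply by `hValue` since this residue is below `p`, and each `f` adds `p` to `a`. The binomial
coefficients from `e`, `E`, `F` and `f` do not vanish at `q`, and they do not depend on `j` and `c`.
-/
lemma exists_isLead_monomial (hp : 2 ≤ p) (A B : ℕ) : ∃ w : ℤ → ℂ, (∀ n, w n ≠ 0) ∧ ∀ j c : ℕ,
    IsLead p (rep (monomial Ugen.E Ugen.F Ugen.K (Ugen.e p) (Ugen.f p) (Ugen.h p) p A B j c) delta)
      A B (fun n => w n * (hValue p (A % p) n ^ j * qRoot p ^ (c * n))) := by
  have hA := Nat.mod_lt A (show 0 < p by omega)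
  obtain ⟨w, hw, H⟩ := exists_isLead_E_pow_e_pow hp (Nat.mod_lt B (show 0 < p by omega)) (B / p)
  rw [Nat.div_add_mod] at H
  have key : ∀ i : ℕ, ∃ w : ℤ → ℂ, (∀ n, w n ≠ 0) ∧ ∀ j c : ℕ,
      IsLead p (rep (Ugen.f p ^ i * (Ugen.h p ^ j * (Ugen.F ^ (A % p) * (Ugen.K ^ c *
        (Ugen.E ^ (B % p) * Ugen.e p ^ (B / p)))))) delta) (p * i + A % p) B
          (fun n => w n * (hValue p (A % p) n ^ j * qRoot p ^ (c * n))) := by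
    intro i
    induction i with
    | zero =>
      refine ⟨fun n => qFact (qRoot p) (A % p) * (qBinom (qRoot p) (A % p : ℕ) (A % p) * w n),
        fun n => ?_, fun j c => ?_⟩
      · refine mul_ne_zero (qFact_qRoot_ne_zero hp hA) (mul_ne_zero (div_ne_zero
          (Finset.prod_ne_zero_iff.2 fun i hi => ?_) (qFact_qRoot_ne_zero hp hA)) (hw _))
        rw [Finset.mem_range] at hi
        rw [Ne, qZ_qRoot_eq_zero_iff hp]
        intro h
        have := Int.le_of_dvd (by omega) h
        omega
      · rw [pow_zero, one_mul, mul_zero, zero_add]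
        have := ((H.rep_K_pow c).rep_F_pow hp hA).rep_h_pow hp hA j
        rw [← Module.End.mul_apply, ← Module.End.mul_apply, ← Module.End.mul_apply, ← map_mul,
          ← map_mul, ← map_mul, mul_assoc, mul_assoc] at this
        convert this using 2
        ring
    | succ i ih =>
      obtain ⟨w, hw, H⟩ := ih
      refine ⟨fun n => (-1) ^ p * (binomValue p ((p * i + A % p + p : ℕ) : ℤ) * w n),
        fun n => ?_, fun j c => ?_⟩
      · refine mul_ne_zero (pow_ne_zero _ (by norm_num)) (mul_ne_zero (binomValue_ne_zero hp ?_)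
          (hw n))
        push_cast
        have : (0 : ℤ) ≤ p * i := by positivity
        omega
      · have := (H j c).rep_f hp
        rw [pow_succ', mul_assoc, map_mul, Module.End.mul_apply,
          show p * (i + 1) + A % p = p * i + A % p + p by ring]
        convert this using 2
        ring
  have := key (A / p)
  rw [Nat.div_add_mod] at this
  exact this

/-- Along a residue class modulo `2p` all factors of `hValue` are constant except the integer part
of `(n - a) / p`, which grows linearly. -/
lemma infinite_hValue (hp : 2 ≤ p) (a : ℕ) (n : ℤ) :
    Set.Infinite (Set.range fun m : ℤ => hValue p a (n + p * (2 * m))) := by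
  apply Set.infinite_range_of_injective
  intro m m' h
  have hq : ∀ m : ℤ, qRoot p ^ (p * (n + p * (2 * m) - 2 * a)) = (-1) ^ (n - 2 * a) := by
    intro m
    rw [show (p : ℤ) * (n + p * (2 * m) - 2 * a) = p * (n - 2 * a + 2 * (p * m)) by ring,
      qRoot_zpow_mul hp, zpow_add₀ (by norm_num), zpow_mul]
    norm_num
  have hb : ∀ m : ℤ, binomValue p (n + p * (2 * m) - a) = binomUnit p (n - a) *
      ((-1) ^ ((n - a) / p - 1) * ((n - a) / p + 2 * m : ℤ)) := by
    intro m
    rw [show n + p * (2 * m) - (a : ℤ) = n - a + p * (2 * m) by ring, binomValue,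
      binomUnit_add_mul hp, Int.add_mul_ediv_left _ _ (by omega),
      show (n - (a : ℤ)) / p + 2 * m - 1 = ((n - a) / p - 1) + 2 * m by ring,
      zpow_add₀ (by norm_num), zpow_mul]
    norm_num
  simp only [hValue, hq, hb] at h
  have h1 : ((-1 : ℂ) ^ p) ≠ 0 := pow_ne_zero _ (by norm_num)
  have h2 : ((-1 : ℂ) ^ (n - 2 * a : ℤ)) ≠ 0 := zpow_ne_zero _ (by norm_num)
  have h3 := binomValue_ne_zero hp (m := ((a + p : ℕ) : ℤ)) (by push_cast; omega)
  have h4 := binomUnit_ne_zero hp (n - a)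
  have h5 : ((-1 : ℂ) ^ ((n - a) / p - 1 : ℤ)) ≠ 0 := zpow_ne_zero _ (by norm_num)
  have h6 := mul_right_cancel₀ h3 (mul_left_cancel₀ h2 (mul_left_cancel₀ h1 (mul_left_cancel₀
    (by norm_num) h)))
  have h7 := mul_left_cancel₀ h5 (mul_left_cancel₀ h4 h6)
  have h8 : (n - (a : ℤ)) / p + 2 * m = (n - (a : ℤ)) / p + 2 * m' := by exact_mod_cast h7
  omega

/-- Independence of the functions `h ^ j q ^ (c n)` of `n`. -/
lemma eq_zero_of_forall_sum_eq_zero (hp : 2 ≤ p) (a N : ℕ) (l : ℕ → Fin (2 * p) → ℂ)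
    (h : ∀ n : ℤ, ∑ j ∈ Finset.range N, ∑ c, l j c * (hValue p a n ^ j * qRoot p ^ ((c : ℕ) * n)) = 0)
    {j : ℕ} (hj : j < N) (c : Fin (2 * p)) : l j c = 0 := by
  have hprim := qRoot_isPrimitiveRoot hp
  have h1 : ∀ n : ℤ, ∑ c, l j c * qRoot p ^ ((c : ℕ) * n) = 0 := by
    intro n
    -- On the residue class of `n` modulo `2p` the powers of `q` are constant, and the relation
    -- becomes a polynomial in `hValue` with infinitely many roots.
    set P : Polynomial ℂ := ∑ j ∈ Finset.range N,
      Polynomial.monomial j (∑ c, l j c * qRoot p ^ ((c : ℕ) * n)) with hP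
    have hP0 : P = 0 := by
      refine Polynomial.eq_zero_of_infinite_isRoot P ((infinite_hValue hp a n).mono ?_)
      rintro _ ⟨m, rfl⟩
      have := h (n + p * (2 * m))
      rw [Set.mem_ofPred_eq, Polynomial.IsRoot, hP, Polynomial.eval_finsetSum, ← this]
      refine Finset.sum_congr rfl fun j _ => ?_
      rw [Polynomial.eval_monomial, Finset.sum_mul]
      refine Finset.sum_congr rfl fun c _ => ?_
      have h2 : qRoot p ^ (((c : ℕ) : ℤ) * (n + p * (2 * m))) = qRoot p ^ (((c : ℕ) : ℤ) * n) := by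
        rw [show (((c : ℕ) : ℤ) * (n + p * (2 * m))) = (c : ℕ) * n + p * (2 * ((c : ℕ) * m)) by ring,
          zpow_add₀ (qRoot_ne_zero p), qRoot_zpow_mul hp, zpow_mul (-1 : ℂ)]
        norm_num
      rw [h2]
      ring
    have := congrArg (fun Q => Polynomial.coeff Q j) hP0
    simpa [hP, Polynomial.finsetSum_coeff, Polynomial.coeff_monomial, hj] using this
  -- Now `Q` has degree below `2p` and vanishes at the `2p` distinct powers of `q`.
  set Q : Polynomial ℂ := ∑ c : Fin (2 * p), Polynomial.monomial (c : ℕ) (l j c) with hQ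
  have hQ0 : Q = 0 := by
    refine Polynomial.eq_zero_of_degree_lt_of_eval_finset_eq_zero
      ((Finset.range (2 * p)).image fun n => qRoot p ^ n) ?_ ?_
    · rw [Finset.card_image_of_injOn]
      · rw [Finset.card_range]
        refine lt_of_le_of_lt (Polynomial.degree_sum_le _ _) ?_
        rw [Finset.sup_lt_iff (WithBot.bot_lt_coe _)]
        intro c _
        exact lt_of_le_of_lt (Polynomial.degree_monomial_le _ _) (by exact_mod_cast c.2)
      · intro n hn m hm hnm
        rw [Finset.mem_coe, Finset.mem_range] at hn hm
        exact hprim.pow_inj hn hm hnm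
    · intro x hx
      obtain ⟨n, -, rfl⟩ := Finset.mem_image.1 hx
      rw [hQ, Polynomial.eval_finsetSum, ← h1 n]
      refine Finset.sum_congr rfl fun c _ => ?_
      rw [Polynomial.eval_monomial, ← pow_mul, ← zpow_natCast]
      push_cast
      rw [mul_comm (n : ℤ)]
  have := congrArg (fun Q => Polynomial.coeff Q (c : ℕ)) hQ0
  simpa [hQ, Polynomial.finsetSum_coeff, Polynomial.coeff_monomial, Fin.val_inj] using this

end Coefs

namespace SpecialFiber
variable {p : ℕ}

/-- The monomials are independent in the special fiber. -/
theorem linearIndependent_monomial (hp : 2 ≤ p) :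
    LinearIndependent ℂ fun m : ℕ × ℕ × ℕ × Fin (2 * p) =>
      monomial (E p) (F p) (K p) (e p) (f p) (h p) p m.1 m.2.1 m.2.2.1 m.2.2.2 := by
  rw [linearIndependent_iff]
  intro l hl
  set M := fun m : ℕ × ℕ × ℕ × Fin (2 * p) => monomial (DividedForm.E p) (DividedForm.F p)
    (DividedForm.K p) (DividedForm.e p) (DividedForm.f p) (DividedForm.h p) p
      m.1 m.2.1 m.2.2.1 m.2.2.2 with hM
  have hl' : ∑ m ∈ l.support, l m • mk p (M m) = 0 := by
    rw [← hl, Finsupp.linearCombination_apply, Finsupp.sum]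
    refine Finset.sum_congr rfl fun m _ => ?_
    simp only [hM, monomial, map_mul, map_pow]
  have hcoe : ∀ m, (M m : Ugen) = monomial Ugen.E Ugen.F Ugen.K (Ugen.e p) (Ugen.f p) (Ugen.h p) p
      m.1 m.2.1 m.2.2.1 m.2.2.2 := fun m => rfl
  choose w hw H using fun A B => Coefs.exists_isLead_monomial hp A B
  suffices key : ∀ A B j c, l (A, B, j, c) = 0 by
    ext ⟨A, B, j, c⟩
    exact key A B j c
  intro A
  -- At the place `(A, n, B)`, monomials with a larger first index, or with the same one and another
  -- `B`, contribute zero, and those with a smaller first index have coefficient zero by induction.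
  -- What is left is a relation in which only `j` and `c` vary.
  induction A using Nat.strong_induction_on with
  | _ A ih =>
  intro B j c
  -- `N` exceeds every exponent of `h` in the support and the exponent `j` under consideration.
  set N := l.support.sup (fun m => m.2.2.1 + 1) + (j + 1) with hN
  have hjN : j < N := by omega
  refine Coefs.eq_zero_of_forall_sum_eq_zero hp (A % p) N (fun j c => l (A, B, j, c)) ?_ hjN c
  intro n
  apply mul_left_cancel₀ (hw A B n)
  rw [mul_zero]
  have hex : ∀ m, ∃ z, Specializes (qRoot p) (Coefs.rep (M m : Ugen) Coefs.delta A n B) z ∧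
      (A ≤ m.1 → z = if m.1 = A ∧ m.2.1 = B then w A B n *
        (Coefs.hValue p (A % p) n ^ m.2.2.1 * qRoot p ^ ((m.2.2.2 : ℕ) * n)) else 0) := by
    rintro ⟨A', B', j', c'⟩
    have H' := H A' B' j' c'
    rw [hcoe]
    dsimp only
    rcases lt_trichotomy A A' with hlt | rfl | hlt
    · rw [H'.below _ hlt]
      exact ⟨0, Specializes.zero, fun _ => by rw [if_neg (by omega)]⟩
    · by_cases hB : B' = B
      · subst hB
        exact ⟨_, H'.value n, fun _ => by rw [if_pos ⟨rfl, rfl⟩]⟩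
      · rw [H'.off _ _ (Ne.symm hB)]
        exact ⟨0, Specializes.zero, fun _ => by rw [if_neg (fun h => hB h.2)]⟩
    · obtain ⟨z, hz⟩ := exists_specializes (Coefs.isRegular_rep hp (M (A', B', j', c'))
        (Coefs.isRegular_delta (p := p)) A n B)
      exact ⟨z, hz, fun h => absurd h (by omega)⟩
  choose z hz hz' using hex
  have hsum := Coefs.sum_mul_eq_zero hp hl' A n B hz
  have hzero : ∀ m : ℕ × ℕ × ℕ × Fin (2 * p), ¬(m.1 = A ∧ m.2.1 = B) → l m * z m = 0 := by
    rintro ⟨A', B', j', c'⟩ hne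
    by_cases h : A ≤ A'
    · rw [hz' _ h, if_neg hne, mul_zero]
    · rw [ih A' (by omega), zero_mul]
  set T := (Finset.range N ×ˢ (Finset.univ : Finset (Fin (2 * p)))).image
    (fun x => ((A, B, x) : ℕ × ℕ × ℕ × Fin (2 * p))) with hT
  have h1 : ∑ m ∈ T, l m * z m = ∑ m ∈ l.support, l m * z m := by
    rw [Finset.sum_subset (Finset.subset_union_left (s₁ := T) (s₂ := l.support)),
      Finset.sum_subset (Finset.subset_union_right (s₁ := T) (s₂ := l.support))]
    · intro m _ hm
      rw [Finsupp.notMem_support_iff.1 hm, zero_mul]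
    · rintro ⟨A', B', j', c'⟩ hm hmT
      by_cases h : A' = A ∧ B' = B
      · obtain ⟨rfl, rfl⟩ := h
        exfalso
        apply hmT
        have hm' : (A', B', j', c') ∈ l.support :=
          (Finset.mem_union.1 hm).resolve_left hmT
        have hle := Finset.le_sup (f := fun m : ℕ × ℕ × ℕ × Fin (2 * p) => m.2.2.1 + 1) hm'
        dsimp only at hle
        exact Finset.mem_image.2 ⟨(j', c'), Finset.mem_product.2 ⟨Finset.mem_range.2 (by omega),
          Finset.mem_univ _⟩, rfl⟩
      · exact hzero _ h
  rw [← hsum, ← h1, hT, Finset.sum_image (fun x _ y _ h => by simpa using h), Finset.sum_product,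
    Finset.mul_sum]
  refine Finset.sum_congr rfl fun j _ => ?_
  rw [Finset.mul_sum]
  refine Finset.sum_congr rfl fun c _ => ?_
  rw [hz' _ le_rfl, if_pos ⟨rfl, rfl⟩]
  ring

end SpecialFiber

/-! ### Spanning sets -/

/-- A subspace that contains `1` and is stable under left multiplication by generators. -/
lemma eq_top_of_mul_mem {k A : Type*} [CommRing k] [Ring A] [Algebra k A] {s : Set A}
    (hs : Algebra.adjoin k s = ⊤) (M : Submodule k A) (h1 : (1 : A) ∈ M)
    (hM : ∀ g ∈ s, ∀ x ∈ M, g * x ∈ M) : M = ⊤ := by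
  rw [eq_top_iff]
  rintro y -
  have hy : y ∈ Algebra.adjoin k s := hs ▸ Algebra.mem_top
  suffices ∀ x ∈ M, y * x ∈ M by simpa using this 1 h1
  induction hy using Algebra.adjoin_induction with
  | mem g hg => exact hM g hg
  | algebraMap r =>
    intro x hx
    rw [← Algebra.smul_def]
    exact M.smul_mem r hx
  | add y z _ _ hy hz =>
    intro x hx
    rw [add_mul]
    exact M.add_mem (hy x hx) (hz x hx)
  | mul y z _ _ hy hz =>
    intro x hx
    rw [mul_assoc]
    exact hy _ (hz x hx)

/-- A linear map is injective if it maps a spanning family to an independent family. -/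
lemma injective_of_span_of_linearIndependent {k V W ι : Type*} [CommRing k] [AddCommGroup V]
    [Module k V] [AddCommGroup W] [Module k W] (φ : V →ₗ[k] W) (v : ι → V)
    (hv : Submodule.span k (Set.range v) = ⊤) (h : LinearIndependent k (φ ∘ v)) :
    Function.Injective φ := by
  rw [← LinearMap.ker_eq_bot, LinearMap.ker_eq_bot']
  intro x hx
  have hx' : x ∈ Submodule.span k (Set.range v) := hv ▸ Submodule.mem_top
  rw [← Finsupp.range_linearCombination] at hx'
  obtain ⟨l, rfl⟩ := hx'
  rw [linearIndependent_iff] at h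
  rw [h l, map_zero]
  rw [← hx, Finsupp.linearCombination_apply, Finsupp.linearCombination_apply, Finsupp.sum,
    Finsupp.sum, map_sum]
  simp

/-- Stability of a span under an endomorphism. -/
lemma span_stable {k V : Type*} [CommRing k] [AddCommGroup V] [Module k V] {s : Set V}
    (T : V →ₗ[k] V) (h : ∀ x ∈ s, T x ∈ Submodule.span k s) :
    ∀ x ∈ Submodule.span k s, T x ∈ Submodule.span k s :=
  fun _ hx => (Submodule.span_le (p := (Submodule.span k s).comap T)).2 h hx

lemma linearIndependent_congr_fun {k V ι : Type*} [Semiring k] [AddCommMonoid V] [Module k V]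
    {v w : ι → V} (h : LinearIndependent k v) (hvw : ∀ i, v i = w i) : LinearIndependent k w :=
  (funext hvw : v = w) ▸ h

namespace Ures
variable {p : ℕ}

lemma span_eq_top (hp : 2 ≤ p) : Submodule.span ℂ (Set.range fun x : ℕ × ℕ × ℕ =>
    gen p .F ^ x.1 * (gen p .K ^ x.2.1 * gen p .E ^ x.2.2)) = ⊤ := by
  have H := isRestricted (p := p)
  have Q := H.quantum
  have hq := qRoot_ne_zero p
  set M := Submodule.span ℂ (Set.range fun x : ℕ × ℕ × ℕ =>
    gen p .F ^ x.1 * (gen p .K ^ x.2.1 * gen p .E ^ x.2.2)) with hM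
  have hmem : ∀ a c b, gen p .F ^ a * (gen p .K ^ c * gen p .E ^ b) ∈ M :=
    fun a c b => Submodule.subset_span ⟨(a, c, b), rfl⟩
  have hF : ∀ x ∈ M, gen p .F * x ∈ M := by
    refine span_stable (LinearMap.mulLeft ℂ (gen p .F)) ?_
    rintro _ ⟨⟨a, c, b⟩, rfl⟩
    rw [LinearMap.mulLeft_apply, ← mul_assoc, ← pow_succ']
    exact hmem _ _ _
  have hK : ∀ x ∈ M, gen p .K * x ∈ M := by
    refine span_stable (LinearMap.mulLeft ℂ (gen p .K)) ?_
    rintro _ ⟨⟨a, c, b⟩, rfl⟩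
    rw [LinearMap.mulLeft_apply]
    dsimp only
    induction a with
    | zero =>
      rw [pow_zero, one_mul, ← mul_assoc, ← pow_succ']
      simpa using hmem 0 (c + 1) b
    | succ a ih =>
      rw [pow_succ', mul_assoc, ← mul_assoc, Q.K_F, smul_mul_assoc, mul_assoc]
      exact M.smul_mem _ (hF _ ih)
  have hKinv : ∀ x ∈ M, gen p .Kinv * x ∈ M := by
    rw [H.Kinv_eq hp]
    generalize 2 * p - 1 = n
    intro x hx
    induction n with
    | zero => simpa using hx
    | succ n ih => rw [pow_succ', mul_assoc]; exact hK _ ih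
  have hE : ∀ x ∈ M, gen p .E * x ∈ M := by
    refine span_stable (LinearMap.mulLeft ℂ (gen p .E)) ?_
    rintro _ ⟨⟨a, c, b⟩, rfl⟩
    rw [LinearMap.mulLeft_apply]
    dsimp only
    induction a with
    | zero =>
      rw [pow_zero, one_mul]
      induction c with
      | zero =>
        rw [pow_zero, one_mul, ← pow_succ']
        simpa using hmem 0 0 (b + 1)
      | succ c ih =>
        have h1 : gen p .E * gen p .K = (qRoot p ^ 2)⁻¹ • (gen p .K * gen p .E) := by
          rw [Q.K_E, smul_smul, inv_mul_cancel₀ (pow_ne_zero 2 hq), one_smul]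
        rw [pow_succ', mul_assoc, ← mul_assoc, h1, smul_mul_assoc, mul_assoc]
        exact M.smul_mem _ (hK _ ih)
    | succ a ih =>
      rw [pow_succ', mul_assoc, ← mul_assoc, ← sub_add_cancel (gen p .E * gen p .F)
        (gen p .F * gen p .E), Q.E_F, add_mul, smul_mul_assoc, sub_mul, mul_assoc (gen p .F)]
      exact M.add_mem (M.smul_mem _ (M.sub_mem (hK _ (hmem _ _ _)) (hKinv _ (hmem _ _ _))))
        (hF _ ih)
  refine eq_top_of_mul_mem adjoin_gen M (by simpa using hmem 0 0 0) ?_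
  rintro _ ⟨_ | _ | _ | _, rfl⟩
  exacts [hE, hF, hK, hKinv]

lemma span_fin_eq_top (hp : 2 ≤ p) : Submodule.span ℂ (Set.range fun x : Fin p × Fin (2 * p) × Fin p =>
    gen p .F ^ (x.1 : ℕ) * (gen p .K ^ (x.2.1 : ℕ) * gen p .E ^ (x.2.2 : ℕ))) = ⊤ := by
  have H := isRestricted (p := p)
  rw [eq_top_iff, ← span_eq_top hp, Submodule.span_le]
  rintro _ ⟨⟨a, c, b⟩, rfl⟩
  dsimp only
  by_cases ha : a < p
  · by_cases hb : b < p
    · refine Submodule.subset_span ⟨(⟨a, ha⟩, ⟨c % (2 * p), Nat.mod_lt _ (by omega)⟩, ⟨b, hb⟩), ?_⟩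
      dsimp only
      rw [← pow_eq_pow_mod c H.K_pow]
    · rw [pow_eq_zero_of_le (not_lt.1 hb) H.E_pow, mul_zero, mul_zero]
      exact zero_mem _
  · rw [pow_eq_zero_of_le (not_lt.1 ha) H.F_pow, zero_mul]
    exact zero_mem _

end Ures

/-! ### Straightening in the presented algebra, and the comparison with the special fiber -/

namespace LU
variable {p : ℕ}

/-- The commutator with `g` is a derivation, so it maps a subalgebra into itself once it does so on
generators. -/
lemma commutator_mem (g : LU p) (hE : E p * g - g * E p ∈ (ofUres p).range)
    (hF : F p * g - g * F p ∈ (ofUres p).range) (hK : K p * g - g * K p ∈ (ofUres p).range)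
    (hKinv : Kinv p * g - g * Kinv p ∈ (ofUres p).range) {x : LU p} (hx : x ∈ (ofUres p).range) :
    x * g - g * x ∈ (ofUres p).range := by
  obtain ⟨y, rfl⟩ := hx
  have hy : y ∈ Algebra.adjoin ℂ (Set.range (Ures.gen p)) := Ures.adjoin_gen (p := p) ▸ Algebra.mem_top
  change ofUres p y * g - g * ofUres p y ∈ _
  induction hy using Algebra.adjoin_induction with
  | mem y hy =>
    obtain ⟨_ | _ | _ | _, rfl⟩ := hy <;> rw [ofUres_gen]
    exacts [hE, hF, hK, hKinv]
  | algebraMap r =>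
    rw [AlgHom.commutes, Algebra.commutes, sub_self]
    exact zero_mem _
  | add y z _ _ hy hz =>
    rw [map_add, add_mul, mul_add, add_sub_add_comm]
    exact add_mem hy hz
  | mul y z _ _ hy hz =>
    have : ofUres p (y * z) * g - g * ofUres p (y * z) =
        ofUres p y * (ofUres p z * g - g * ofUres p z) +
          (ofUres p y * g - g * ofUres p y) * ofUres p z := by
      rw [map_mul]; noncomm_ring
    rw [this]
    exact add_mem (mul_mem ⟨y, rfl⟩ hz) (mul_mem hy ⟨z, rfl⟩)

lemma gen_mem (g : QGen) : gen p (.q g) ∈ (ofUres p).range := ⟨Ures.gen p g, ofUres_gen g⟩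

lemma elemA_mem : elemA p (E p) (F p) (K p) (Kinv p) ∈ (ofUres p).range := by
  refine ⟨elemA p (Ures.gen p .E) (Ures.gen p .F) (Ures.gen p .K) (Ures.gen p .Kinv), ?_⟩
  change ofUres p _ = _
  rw [map_elemA, ofUres_gen, ofUres_gen, ofUres_gen, ofUres_gen]

lemma qBracketK_mem : qBracketK p (K p) (Kinv p) ∈ (ofUres p).range :=
  Subalgebra.smul_mem _ (sub_mem (Subalgebra.smul_mem _ (gen_mem .K) _)
    (Subalgebra.smul_mem _ (gen_mem .Kinv) _)) _

lemma commute_Kinv (hp : 2 ≤ p) {g : LU p} (h : Commute (K p) g) : Commute (Kinv p) g := by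
  rw [isRestricted.Kinv_eq hp]
  exact h.pow_left _

lemma commutator_e_mem (hp : 2 ≤ p) {x : LU p} (hx : x ∈ (ofUres p).range) :
    x * e p - e p * x ∈ (ofUres p).range := by
  have H := isLusztig (p := p)
  have hK : Commute (K p) (e p) := H.K_e
  refine commutator_mem _ ?_ ?_ ?_ ?_ hx
  · rw [H.E_e, sub_self]; exact zero_mem _
  · rw [H.F_e]
    exact Subalgebra.smul_mem _ (mul_mem (mul_mem (pow_mem (gen_mem .K) _) qBracketK_mem)
      (pow_mem (gen_mem .E) _)) _
  · rw [hK.eq, sub_self]; exact zero_mem _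
  · rw [(commute_Kinv hp hK).eq, sub_self]; exact zero_mem _

lemma commutator_f_mem (hp : 2 ≤ p) {x : LU p} (hx : x ∈ (ofUres p).range) :
    x * f p - f p * x ∈ (ofUres p).range := by
  have H := isLusztig (p := p)
  have hK : Commute (K p) (f p) := H.K_f
  refine commutator_mem _ ?_ ?_ ?_ ?_ hx
  · rw [H.E_f]
    exact Subalgebra.smul_mem _ (mul_mem (pow_mem (gen_mem .F) _) qBracketK_mem) _
  · rw [H.F_f, sub_self]; exact zero_mem _
  · rw [hK.eq, sub_self]; exact zero_mem _
  · rw [(commute_Kinv hp hK).eq, sub_self]; exact zero_mem _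

lemma commutator_h_mem (hp : 2 ≤ p) {x : LU p} (hx : x ∈ (ofUres p).range) :
    x * h p - h p * x ∈ (ofUres p).range := by
  have H := isLusztig (p := p)
  have hK : Commute (K p) (h p) := H.h_K.symm
  refine commutator_mem _ ?_ ?_ ?_ ?_ hx
  · rw [← neg_sub, H.h_E]
    exact neg_mem (Subalgebra.smul_mem _ (mul_mem (gen_mem .E) elemA_mem) _)
  · rw [← neg_sub, H.h_F]
    exact neg_mem (neg_mem (Subalgebra.smul_mem _ (mul_mem elemA_mem (gen_mem .F)) _))
  · rw [hK.eq, sub_self]; exact zero_mem _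
  · rw [(commute_Kinv hp hK).eq, sub_self]; exact zero_mem _

/-- Products of powers of `f`, of `h`, elements of the restricted quantum group and powers of `e`
span the algebra. -/
lemma span_eq_top (hp : 2 ≤ p) : Submodule.span ℂ (Set.range fun x : ℕ × ℕ × Ures p × ℕ =>
    f p ^ x.1 * (h p ^ x.2.1 * (ofUres p x.2.2.1 * e p ^ x.2.2.2))) = ⊤ := by
  have H := isLusztig (p := p)
  set M := Submodule.span ℂ (Set.range fun x : ℕ × ℕ × Ures p × ℕ =>
    f p ^ x.1 * (h p ^ x.2.1 * (ofUres p x.2.2.1 * e p ^ x.2.2.2))) with hM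
  have hmem : ∀ i j, ∀ x ∈ (ofUres p).range, ∀ l, f p ^ i * (h p ^ j * (x * e p ^ l)) ∈ M := by
    rintro i j _ ⟨x, rfl⟩ l
    exact Submodule.subset_span ⟨(i, j, x, l), rfl⟩
  have hf : ∀ x ∈ M, f p * x ∈ M := by
    refine span_stable (LinearMap.mulLeft ℂ (f p)) ?_
    rintro _ ⟨⟨i, j, x, l⟩, rfl⟩
    rw [LinearMap.mulLeft_apply, ← mul_assoc, ← pow_succ']
    exact hmem _ _ _ ⟨x, rfl⟩ _
  have hh : ∀ x ∈ M, h p * x ∈ M := by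
    refine span_stable (LinearMap.mulLeft ℂ (h p)) ?_
    rintro _ ⟨⟨i, j, x, l⟩, rfl⟩
    rw [LinearMap.mulLeft_apply]
    dsimp only
    induction i with
    | zero =>
      rw [pow_zero, one_mul, ← mul_assoc, ← pow_succ']
      simpa using hmem 0 (j + 1) _ ⟨x, rfl⟩ l
    | succ i ih =>
      have h1 : h p * f p = f p * h p - f p := by
        rw [← sub_add_cancel (h p * f p) (f p * h p), H.h_f]; abel
      rw [pow_succ', mul_assoc, ← mul_assoc, h1, sub_mul, mul_assoc]
      exact M.sub_mem (hf _ ih) (hf _ (hmem _ _ _ ⟨x, rfl⟩ _))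
  -- Moving `y` past `f` or `h` costs a commutator that lies again in the restricted part. The
  -- inductions therefore run over all `y` at once.
  have hJ : ∀ y ∈ (ofUres p).range, ∀ x ∈ M, y * x ∈ M := by
    intro y hy
    refine span_stable (LinearMap.mulLeft ℂ y) ?_
    rintro _ ⟨⟨i, j, x, l⟩, rfl⟩
    rw [LinearMap.mulLeft_apply]
    dsimp only
    induction i generalizing y with
    | zero =>
      rw [pow_zero, one_mul]
      induction j generalizing y with
      | zero =>
        rw [pow_zero, one_mul, ← mul_assoc]
        simpa using hmem 0 0 _ (mul_mem hy ⟨x, rfl⟩) l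
      | succ j ih =>
        rw [pow_succ', mul_assoc, ← mul_assoc, ← sub_add_cancel (y * h p) (h p * y), add_mul,
          mul_assoc (h p)]
        exact M.add_mem (ih _ (commutator_h_mem hp hy)) (hh _ (ih _ hy))
    | succ i ih =>
      rw [pow_succ', mul_assoc, ← mul_assoc, ← sub_add_cancel (y * f p) (f p * y), add_mul,
        mul_assoc (f p)]
      exact M.add_mem (ih _ (commutator_f_mem hp hy)) (hf _ (ih _ hy))
  have he : ∀ x ∈ M, e p * x ∈ M := by
    refine span_stable (LinearMap.mulLeft ℂ (e p)) ?_
    rintro _ ⟨⟨i, j, x, l⟩, rfl⟩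
    rw [LinearMap.mulLeft_apply]
    dsimp only
    induction i with
    | zero =>
      rw [pow_zero, one_mul]
      induction j with
      | zero =>
        have hx : ofUres p x ∈ (ofUres p).range := ⟨x, rfl⟩
        rw [pow_zero, one_mul, ← mul_assoc, ← sub_sub_cancel (ofUres p x * e p) (e p * ofUres p x),
          sub_mul, mul_assoc (ofUres p x), ← pow_succ']
        exact M.sub_mem (by simpa using hmem 0 0 _ hx (l + 1))
          (by simpa using hmem 0 0 _ (commutator_e_mem hp hx) l)
      | succ j ih =>
        have h1 : e p * h p = h p * e p - e p := by
          rw [← sub_sub_cancel (h p * e p) (e p * h p), H.h_e]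
        rw [pow_succ', mul_assoc, ← mul_assoc, h1, sub_mul, mul_assoc (h p)]
        exact M.sub_mem (hh _ ih) ih
    | succ i ih =>
      rw [pow_succ', mul_assoc, ← mul_assoc, ← sub_add_cancel (e p * f p) (f p * e p), H.e_f,
        add_mul, smul_mul_assoc, mul_assoc (f p)]
      exact M.add_mem (M.smul_mem _ (hh _ (hmem _ _ _ ⟨x, rfl⟩ _))) (hf _ ih)
  refine eq_top_of_mul_mem adjoin_gen M (by simpa using hmem 0 0 1 (one_mem _) 0) ?_
  rintro _ ⟨g | _ | _ | _, rfl⟩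
  exacts [hJ _ (gen_mem g), he, hf, hh]

lemma span_monomial_eq_top (hp : 2 ≤ p) : Submodule.span ℂ (Set.range
    fun m : ℕ × ℕ × ℕ × Fin (2 * p) => monomial (E p) (F p) (K p) (e p) (f p) (h p) p
      m.1 m.2.1 m.2.2.1 m.2.2.2) = ⊤ := by
  rw [eq_top_iff, ← span_eq_top hp, Submodule.span_le]
  rintro _ ⟨⟨i, j, x, l⟩, rfl⟩
  dsimp only
  have hx : x ∈ Submodule.span ℂ (Set.range fun x : Fin p × Fin (2 * p) × Fin p =>
    Ures.gen p .F ^ (x.1 : ℕ) * (Ures.gen p .K ^ (x.2.1 : ℕ) * Ures.gen p .E ^ (x.2.2 : ℕ))) :=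
    Ures.span_fin_eq_top hp ▸ Submodule.mem_top
  induction hx using Submodule.span_induction with
  | mem x hx =>
    obtain ⟨⟨⟨a, ha⟩, c, ⟨b, hb⟩⟩, rfl⟩ := hx
    refine Submodule.subset_span ⟨(a + p * i, b + p * l, j, c), ?_⟩
    have hp0 : 0 < p := by omega
    simp only [monomial, map_mul, map_pow, ofUres_gen, Nat.add_mul_mod_self_left, Nat.mod_eq_of_lt ha,
      Nat.mod_eq_of_lt hb, Nat.add_mul_div_left _ _ hp0, Nat.div_eq_of_lt ha, Nat.div_eq_of_lt hb,
      zero_add, mul_assoc]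
  | zero => simp
  | add x y _ _ hx hy =>
    rw [map_add, add_mul, mul_add, mul_add]
    exact add_mem hx hy
  | smul c x _ hx =>
    rw [map_smul, smul_mul_assoc, mul_smul_comm, mul_smul_comm]
    exact Submodule.smul_mem _ _ hx

lemma toSpecialFiber_gen (hp : 2 ≤ p) (g : LGen) : toSpecialFiber hp (gen p g) =
    genValue (SpecialFiber.E p) (SpecialFiber.F p) (SpecialFiber.K p) (SpecialFiber.Kinv p)
      (SpecialFiber.e p) (SpecialFiber.f p) (SpecialFiber.h p) g := lift_gen _ g

/-- A spanning family with independent images is a basis, whence injectivity. -/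
lemma toSpecialFiber_bijective (hp : 2 ≤ p) : Function.Bijective (toSpecialFiber hp) := by
  refine ⟨?_, toSpecialFiber_surjective hp⟩
  refine injective_of_span_of_linearIndependent (toSpecialFiber hp).toLinearMap _
    (span_monomial_eq_top hp) (linearIndependent_congr_fun
      (SpecialFiber.linearIndependent_monomial hp) fun m => ?_)
  simp only [Function.comp_apply, AlgHom.toLinearMap_apply, monomial, map_mul, map_pow,
    toSpecialFiber_gen]
  rfl

/-- The composite with the map to the special fiber is already injective: the spanning monomials
`F^a K^c E^b` go to those independent monomials in which `e, f, h` do not occur. -/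
theorem ofUres_injective (hp : 2 ≤ p) : Function.Injective (ofUres p) := by
  have : Function.Injective ((toSpecialFiber hp).toLinearMap ∘ₗ (ofUres p).toLinearMap) := by
    have hinj : Function.Injective (fun x : Fin p × Fin (2 * p) × Fin p =>
        (((x.1 : ℕ), (x.2.2 : ℕ), 0, x.2.1) : ℕ × ℕ × ℕ × Fin (2 * p))) := by
      rintro ⟨a, c, b⟩ ⟨a', c', b'⟩ h
      simp only [Prod.mk.injEq, Fin.val_inj] at h
      obtain ⟨rfl, rfl, -, rfl⟩ := h
      rfl
    refine injective_of_span_of_linearIndependent _ _ (Ures.span_fin_eq_top hp)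
      (linearIndependent_congr_fun
        ((SpecialFiber.linearIndependent_monomial hp).comp _ hinj) ?_)
    rintro ⟨⟨a, ha⟩, c, ⟨b, hb⟩⟩
    simp only [Function.comp_apply, LinearMap.comp_apply, AlgHom.toLinearMap_apply, monomial,
      map_mul, map_pow, ofUres_gen, toSpecialFiber_gen, Nat.mod_eq_of_lt ha, Nat.mod_eq_of_lt hb,
      Nat.div_eq_of_lt ha, Nat.div_eq_of_lt hb, pow_zero, one_mul, mul_one]
    rfl
  exact fun x y h => this (congrArg (toSpecialFiber hp) h)

end LU

/-! ### The specialization map and the Hopf structure of the limit -/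

namespace DividedForm
variable {p : ℕ}

instance : Algebra (regularAt (qRoot p)) (LU p) :=
  Algebra.compHom _ (algebraMap (regularAt (qRoot p)) ℂ)

instance : IsScalarTower (regularAt (qRoot p)) ℂ (LU p) :=
  IsScalarTower.of_algebraMap_eq fun _ => rfl

/-- The specialization of the form with divided powers. -/
def toLU (hp : 2 ≤ p) : DividedForm p →ₐ[regularAt (qRoot p)] LU p :=
  { ((AlgEquiv.ofBijective (LU.toSpecialFiber hp) (LU.toSpecialFiber_bijective hp)).symm :
      SpecialFiber p →+* LU p).comp (SpecialFiber.mk p : DividedForm p →+* SpecialFiber p) with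
    commutes' := fun r => by
      change (AlgEquiv.ofBijective (LU.toSpecialFiber hp) (LU.toSpecialFiber_bijective hp)).symm
        (SpecialFiber.mk p (algebraMap _ _ r)) = algebraMap ℂ (LU p) (algebraMap _ ℂ r)
      rw [show algebraMap (regularAt (qRoot p)) (DividedForm p) r = r • 1 from
        Algebra.algebraMap_eq_smul_one r, SpecialFiber.mk_smul, map_one, map_smul, map_one]
      exact (Algebra.algebraMap_eq_smul_one _).symm }

lemma toSpecialFiber_toLU (hp : 2 ≤ p) (x : DividedForm p) :
    LU.toSpecialFiber hp (toLU hp x) = SpecialFiber.mk p x :=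
  (AlgEquiv.ofBijective (LU.toSpecialFiber hp) (LU.toSpecialFiber_bijective hp)).apply_symm_apply _

lemma toLU_eq (hp : 2 ≤ p) {x : DividedForm p} {y : LU p}
    (h : LU.toSpecialFiber hp y = SpecialFiber.mk p x) : toLU hp x = y :=
  (LU.toSpecialFiber_bijective hp).1 (by rw [h, toSpecialFiber_toLU])

lemma toLU_surjective (hp : 2 ≤ p) : Function.Surjective (toLU hp) := fun y => by
  obtain ⟨x, hx⟩ := SpecialFiber.mk_surjective p (LU.toSpecialFiber hp y)
  exact ⟨x, toLU_eq hp hx.symm⟩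

lemma toLU_eq_zero_iff (hp : 2 ≤ p) {x : DividedForm p} : toLU hp x = 0 ↔
    ∃ y : DividedForm p, (x : Ugen) = (RatFunc.X - RatFunc.C (qRoot p)) • (y : Ugen) := by
  rw [← SpecialFiber.mk_eq_zero_iff, ← toSpecialFiber_toLU hp,
    map_eq_zero_iff _ (LU.toSpecialFiber_bijective hp).1]

lemma toLU_E (hp : 2 ≤ p) : toLU hp (E p) = LU.E p := toLU_eq hp (LU.toSpecialFiber_gen hp _)
lemma toLU_F (hp : 2 ≤ p) : toLU hp (F p) = LU.F p := toLU_eq hp (LU.toSpecialFiber_gen hp _)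
lemma toLU_K (hp : 2 ≤ p) : toLU hp (K p) = LU.K p := toLU_eq hp (LU.toSpecialFiber_gen hp _)
lemma toLU_Kinv (hp : 2 ≤ p) : toLU hp (Kinv p) = LU.Kinv p :=
  toLU_eq hp (LU.toSpecialFiber_gen hp _)
lemma toLU_e (hp : 2 ≤ p) : toLU hp (e p) = LU.e p := toLU_eq hp (LU.toSpecialFiber_gen hp _)
lemma toLU_f (hp : 2 ≤ p) : toLU hp (f p) = LU.f p := toLU_eq hp (LU.toSpecialFiber_gen hp _)
lemma toLU_h (hp : 2 ≤ p) : toLU hp (h p) = LU.h p := toLU_eq hp (LU.toSpecialFiber_gen hp _)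

lemma toLU_smul (hp : 2 ≤ p) (c : regularAt (qRoot p)) (x : DividedForm p) :
    toLU hp (c • x) = algebraMap (regularAt (qRoot p)) ℂ c • toLU hp x := by
  rw [map_smul, algebraMap_smul]

lemma toLU_reg_smul (hp : 2 ≤ p) {c : RatFunc ℂ} {d : ℂ} (hc : Specializes (qRoot p) c d)
    (x : DividedForm p) : toLU hp (reg p c • x) = d • toLU hp x := by
  rw [toLU_smul, hc.algebraMap_reg]

lemma tensorMap_incl_injective : Function.Injective (tensorMap (RatFunc ℂ) (incl p) (incl p)) :=
  tensorMap_injective _ _ incl_injective incl_injective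

/-- The kernel of specialization consists of the multiples of `v - q`. Comultiplication, counit and
antipode are linear over the local ring, so they carry such multiples to elements that specialize to
zero. -/
theorem exists_hopf_LU (hp : 2 ≤ p) : ∃ (HD : HopfStructure (regularAt (qRoot p)) (DividedForm p))
    (H : HopfStructure ℂ (LU p)), HD.IsSemiHom genHopf (incl p) ∧ HD.IsSemiHom H (toLU hp) := by
  obtain ⟨HD, hD⟩ := exists_hopf hp
  have hker : ∀ x, toLU hp x = 0 → ∃ y, x = reg p (RatFunc.X - RatFunc.C (qRoot p)) • y := by
    intro x hx
    obtain ⟨y, hy⟩ := (toLU_eq_zero_iff hp).1 hx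
    exact ⟨y, Subtype.ext (by
      rw [hy, DividedForm.coe_reg_smul SpecialFiber.specializes_X_sub_C])⟩
  have hc : algebraMap (regularAt (qRoot p)) ℂ (reg p (RatFunc.X - RatFunc.C (qRoot p))) = 0 :=
    SpecialFiber.specializes_X_sub_C.algebraMap_reg
  obtain ⟨H, hH⟩ := HopfStructure.exists_descend (toLU hp) HD (toLU_surjective hp)
    (algebraMap_regularAt_surjective (qRoot p)) (fun x hx => by
      obtain ⟨y, rfl⟩ := hker x hx
      rw [show HD.comul _ = _ from HD.comul.toLinearMap.map_smul _ y]
      change tensorMap ℂ (toLU hp) (toLU hp) (_ • HD.comul y) = 0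
      rw [show tensorMap ℂ (toLU hp) (toLU hp) _ = _ from
        (tensorMap ℂ (toLU hp) (toLU hp)).toLinearMap.map_smul _ _, ← algebraMap_smul ℂ, hc,
        zero_smul])
    (fun x hx => by
      obtain ⟨y, rfl⟩ := hker x hx
      rw [map_smul, smul_eq_mul, map_mul, hc, zero_mul])
    (fun x hx => by
      obtain ⟨y, rfl⟩ := hker x hx
      rw [map_smul, map_smul, ← algebraMap_smul ℂ, hc, zero_smul])
  exact ⟨HD, H, hD, hH⟩

end DividedForm

/-- `H` is the specialization of the Hopf structure of generic quantum `sl(2)`. -/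
structure IsSpecialization {p : ℕ} (hp : 2 ≤ p)
    (HD : HopfStructure (regularAt (qRoot p)) (DividedForm p)) (H : HopfStructure ℂ (LU p)) :
    Prop where
  generic : HD.IsSemiHom DividedForm.genHopf (DividedForm.incl p)
  special : HD.IsSemiHom H (DividedForm.toLU hp)

namespace IsSpecialization
variable {p : ℕ} {hp : 2 ≤ p} {HD : HopfStructure (regularAt (qRoot p)) (DividedForm p)}
  {H : HopfStructure ℂ (LU p)}
open DividedForm

/-- The tensor `t` is determined by its image in the generic algebra, because the tensor square of
the inclusion is injective. So any generic formula written in the form may be specialized term by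
term. -/
lemma comul (h : IsSpecialization hp HD H) {x : DividedForm p}
    {t : DividedForm p ⊗[regularAt (qRoot p)] DividedForm p}
    (ht : tensorMap (RatFunc ℂ) (incl p) (incl p) t = genHopf.comul (x : Ugen)) :
    H.comul (toLU hp x) = tensorMap ℂ (toLU hp) (toLU hp) t := by
  rw [h.special.comul]
  congr 1
  apply tensorMap_incl_injective
  rw [ht, ← h.generic.comul]
  rfl

lemma counit (h : IsSpecialization hp HD H) {x : DividedForm p} {c : ℂ}
    (hc : Specializes (qRoot p) (genHopf.counit (x : Ugen)) c) : H.counit (toLU hp x) = c := by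
  rw [h.special.counit]
  have := h.generic.counit x
  change genHopf.counit (x : Ugen) = (HD.counit x : RatFunc ℂ) at this
  rw [this] at hc
  exact hc.eval_eq

lemma antipode (h : IsSpecialization hp HD H) {x y : DividedForm p}
    (hy : (y : Ugen) = genHopf.antipode (x : Ugen)) : H.antipode (toLU hp x) = toLU hp y := by
  rw [h.special.antipode]
  congr 1
  apply incl_injective
  rw [← h.generic.antipode]
  exact hy.symm

lemma comul_Kinv (h : IsSpecialization hp HD H) :
    H.comul (LU.Kinv p) = LU.Kinv p ⊗ₜ LU.Kinv p := by
  have := h.comul (x := Kinv p) (t := Kinv p ⊗ₜ Kinv p) (by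
    rw [tensorMap_tmul]; exact (Uq.hopf_comul_gen RatFunc.X_ne_zero .Kinv).symm)
  rwa [tensorMap_tmul, toLU_Kinv] at this

lemma hasQuantumValues (h : IsSpecialization hp HD H) :
    HasQuantumValues H (LU.E p) (LU.F p) (LU.K p) (LU.Kinv p) where
  comul_E := by
    have := h.comul (x := E p) (t := 1 ⊗ₜ E p + E p ⊗ₜ K p) (by
      rw [tensorMap_add, tensorMap_tmul, tensorMap_tmul]
      exact (Uq.hopf_comul_gen RatFunc.X_ne_zero .E).symm)
    rwa [tensorMap_add, tensorMap_tmul, tensorMap_tmul, map_one, toLU_E, toLU_K] at this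
  comul_F := by
    have := h.comul (x := F p) (t := Kinv p ⊗ₜ F p + F p ⊗ₜ 1) (by
      rw [tensorMap_add, tensorMap_tmul, tensorMap_tmul]
      exact (Uq.hopf_comul_gen RatFunc.X_ne_zero .F).symm)
    rwa [tensorMap_add, tensorMap_tmul, tensorMap_tmul, map_one, toLU_F, toLU_Kinv] at this
  comul_K := by
    have := h.comul (x := K p) (t := K p ⊗ₜ K p) (by
      rw [tensorMap_tmul]; exact (Uq.hopf_comul_gen RatFunc.X_ne_zero .K).symm)
    rwa [tensorMap_tmul, toLU_K] at this
  antipode_E := by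
    have := h.antipode (x := E p) (y := -(E p * Kinv p))
      (Uq.hopf_antipode_gen RatFunc.X_ne_zero .E).symm
    rwa [map_neg, map_mul, toLU_E, toLU_Kinv] at this
  antipode_F := by
    have := h.antipode (x := F p) (y := -(K p * F p))
      (Uq.hopf_antipode_gen RatFunc.X_ne_zero .F).symm
    rwa [map_neg, map_mul, toLU_F, toLU_K] at this
  antipode_K := by
    have := h.antipode (x := K p) (y := Kinv p)
      (Uq.hopf_antipode_gen RatFunc.X_ne_zero .K).symm
    rwa [toLU_K, toLU_Kinv] at this
  counit_E := by
    rw [← toLU_E hp]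
    refine h.counit ?_
    rw [show genHopf.counit ((E p : DividedForm p) : Ugen) = 0 from
      Uq.hopf_counit_gen RatFunc.X_ne_zero .E]
    exact Specializes.zero
  counit_F := by
    rw [← toLU_F hp]
    refine h.counit ?_
    rw [show genHopf.counit ((F p : DividedForm p) : Ugen) = 0 from
      Uq.hopf_counit_gen RatFunc.X_ne_zero .F]
    exact Specializes.zero
  counit_K := by
    rw [← toLU_K hp]
    refine h.counit ?_
    rw [show genHopf.counit ((K p : DividedForm p) : Ugen) = 1 from
      Uq.hopf_counit_gen RatFunc.X_ne_zero .K]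
    exact Specializes.one

end IsSpecialization

/-! ### The values on the divided powers -/

namespace IsRestricted
variable {A : Type*} [Ring A] [Algebra ℂ A] {p : ℕ} {E F K Kinv : A}

lemma K_pow_mul_Kinv_pow (H : IsRestricted p E F K Kinv) (n : ℕ) : K ^ n * Kinv ^ n = 1 := by
  rw [← H.quantum.commute_K_Kinv.mul_pow, H.quantum.K_mul_Kinv, one_pow]

lemma Kinv_pow_eq (H : IsRestricted p E F K Kinv) {m n : ℕ} (h : m + n = 2 * p) :
    Kinv ^ m = K ^ n := by
  rw [← one_mul (Kinv ^ m), ← H.K_pow, ← h, add_comm m, pow_add, mul_assoc, H.K_pow_mul_Kinv_pow,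
    mul_one]

end IsRestricted

lemma qFact_mul_qFact_sub {p : ℕ} (hp : 2 ≤ p) {r : ℕ} (h1 : 1 ≤ r) (h2 : r < p) :
    qFact (qRoot p) r * qFact (qRoot p) (p - r) = qFact (qRoot p) (p - 1) * qInt (qRoot p) r := by
  obtain ⟨r, rfl⟩ := Nat.exists_eq_add_of_le' h1
  rw [← qFact_qRoot_mul hp (r := r) (by omega), qFact_succ, show p - (r + 1) = p - 1 - r by omega]
  ring

/-- The first and the last term of a sum. -/
lemma sum_range_succ_eq_ends {M : Type*} [AddCommMonoid M] (g : ℕ → M) {p : ℕ} (hp : 2 ≤ p) :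
    ∑ r ∈ Finset.range (p + 1), g r = g 0 + g p + ∑ r ∈ Finset.Icc 1 (p - 1), g r := by
  obtain ⟨n, rfl⟩ : ∃ n, p = n + 1 := ⟨p - 1, by omega⟩
  rw [Finset.sum_range_succ, Finset.sum_range_succ', add_comm (∑ _ ∈ _, _), add_right_comm,
    Nat.add_sub_cancel]
  congr 1
  refine Finset.sum_nbij (· + 1) (fun x hx => ?_) (fun x _ y _ h => by simpa using h)
    (fun x hx => ?_) fun _ _ => rfl
  · rw [Finset.mem_range] at hx
    rw [Finset.mem_Icc]
    omega
  · rw [Finset.mem_coe, Finset.mem_Icc] at hx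
    exact ⟨x - 1, by rw [Finset.mem_coe, Finset.mem_range]; omega, by dsimp only; omega⟩

namespace IsSpecialization
variable {p : ℕ} {hp : 2 ≤ p} {HD : HopfStructure (regularAt (qRoot p)) (DividedForm p)}
  {H : HopfStructure ℂ (LU p)}
open DividedForm

lemma toLU_dE {p : ℕ} (hp : 2 ≤ p) {r : ℕ} (hr : r < p) :
    toLU hp (dE p r) = (qFact (qRoot p) r)⁻¹ • LU.E p ^ r := by
  rw [dE, if_pos hr, toLU_reg_smul hp (specializes_qFact_inv hp hr), map_pow, toLU_E]

lemma toLU_dF {p : ℕ} (hp : 2 ≤ p) {r : ℕ} (hr : r < p) :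
    toLU hp (dF p r) = (qFact (qRoot p) r)⁻¹ • LU.F p ^ r := by
  rw [dF, if_pos hr, toLU_reg_smul hp (specializes_qFact_inv hp hr), map_pow, toLU_F]

lemma toLU_dE_self {p : ℕ} (hp : 2 ≤ p) : toLU hp (dE p p) = LU.K p ^ p * LU.e p := by
  rw [dE, if_neg (lt_irrefl p), map_mul, map_pow, toLU_Kinv, toLU_e,
    LU.isRestricted.Kinv_pow_eq (by omega : p + p = 2 * p)]

lemma toLU_dF_self {p : ℕ} (hp : 2 ≤ p) : toLU hp (dF p p) = (-1 : ℂ) ^ p • LU.f p := by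
  rw [dF, if_neg (lt_irrefl p), map_mul, map_pow, map_neg, map_one, toLU_f]
  rcases Nat.even_or_odd p with h3 | h3 <;> simp [h3.neg_one_pow]

/-- The extreme terms of the binomial sum give `e ⊗ 1` and `K^p ⊗ e`. In the others `[r]! [p - r]! =
[p - 1]! [r]` at `q`, and the powers of `K` simplify by `K^(2p) = 1`. -/
lemma comul_e (h : IsSpecialization hp HD H) :
    H.comul (LU.e p) = LU.e p ⊗ₜ[ℂ] 1 + (LU.K p ^ p) ⊗ₜ[ℂ] LU.e p +
    (qFact (qRoot p) (p - 1))⁻¹ • ∑ r ∈ Finset.Icc 1 (p - 1),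
      (qRoot p ^ (r * (p - r)) / qInt (qRoot p) r) •
        ((LU.K p ^ p * LU.E p ^ (p - r)) ⊗ₜ[ℂ] (LU.E p ^ r * LU.Kinv p ^ r)) := by
  have R := LU.isRestricted (p := p)
  have hKK := R.K_pow_mul_K_pow
  have h0 : toLU hp (dE p 0) = 1 := by
    rw [toLU_dE hp (by omega), qFact_zero, inv_one, one_smul, pow_zero]
  rw [← toLU_e hp, h.comul (tensorMap_comulE hp), comulE, tensorMap_sum,
    sum_range_succ_eq_ends _ hp]
  have hterm : ∀ r, tensorMap ℂ (toLU hp) (toLU hp) (reg p (RatFunc.X ^ (r * (p - r))) •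
      ((K p ^ p * dE p (p - r)) ⊗ₜ (K p ^ p * (dE p r * K p ^ (p - r))))) =
      qRoot p ^ (r * (p - r)) • ((LU.K p ^ p * toLU hp (dE p (p - r))) ⊗ₜ
        (LU.K p ^ p * (toLU hp (dE p r) * LU.K p ^ (p - r)))) := by
    intro r
    rw [tensorMap_smul_tmul, (Specializes.X.pow _).algebraMap_reg]
    simp only [map_mul, map_pow, toLU_K]
  simp only [hterm]
  congr 1
  · rw [zero_mul, pow_zero, one_smul, Nat.sub_zero, Nat.sub_self, mul_zero, pow_zero, one_smul, h0,
      one_mul, pow_zero, mul_one, mul_one, hKK, toLU_dE_self hp, ← mul_assoc, hKK, one_mul, toLU_e]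
  · rw [Finset.smul_sum]
    refine Finset.sum_congr rfl fun r hr => ?_
    rw [Finset.mem_Icc] at hr
    have h1 : LU.K p ^ p * (LU.E p ^ r * LU.K p ^ (p - r)) = LU.E p ^ r * LU.Kinv p ^ r := by
      rw [← mul_assoc, R.quantum.K_pow_E_pow, pow_mul, (qRoot_isPrimitiveRoot hp).pow_eq_one, one_pow,
        one_smul, mul_assoc, ← pow_add, R.Kinv_pow_eq (by omega : r + (p + (p - r)) = 2 * p)]
    rw [toLU_dE hp (by omega), toLU_dE hp (by omega), smul_mul_assoc, mul_smul_comm, mul_smul_comm,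
      h1, TensorProduct.smul_tmul_smul, smul_smul, smul_smul]
    congr 1
    have := qFact_mul_qFact_sub hp hr.1 (by omega : r < p)
    rw [← mul_inv, mul_comm (qFact _ (p - r)), this, mul_inv]
    ring

lemma comul_f (h : IsSpecialization hp HD H) :
    H.comul (LU.f p) = LU.f p ⊗ₜ[ℂ] 1 + (LU.K p ^ p) ⊗ₜ[ℂ] LU.f p +
    ((-1) ^ p / qFact (qRoot p) (p - 1)) • ∑ s ∈ Finset.Icc 1 (p - 1),
      ((qRoot p)⁻¹ ^ (s * (p - s)) / qInt (qRoot p) s) •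
        ((LU.K p ^ (p + s) * LU.F p ^ s) ⊗ₜ[ℂ] (LU.F p ^ (p - s))) := by
  have R := LU.isRestricted (p := p)
  have hsq : (-1 : ℂ) ^ p * (-1) ^ p = 1 := by rw [← mul_pow]; norm_num
  have h0 : toLU hp (dF p 0) = 1 := by
    rw [toLU_dF hp (by omega), qFact_zero, inv_one, one_smul, pow_zero]
  rw [← toLU_f hp, h.comul (tensorMap_comulF hp), comulF, tensorMap_sum,
    sum_range_succ_eq_ends _ hp]
  have hterm : ∀ r, tensorMap ℂ (toLU hp) (toLU hp)
      (reg p ((-1) ^ p * RatFunc.X ^ (r * (p - r))) • ((dF p r * Kinv p ^ (p - r)) ⊗ₜ dF p (p - r))) =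
      ((-1) ^ p * qRoot p ^ (r * (p - r))) • ((toLU hp (dF p r) * LU.Kinv p ^ (p - r)) ⊗ₜ
        toLU hp (dF p (p - r))) := by
    intro r
    rw [tensorMap_smul_tmul, ((coe_neg_one_pow_ratFunc p).mul (Specializes.X.pow _)).algebraMap_reg]
    simp only [map_mul, map_pow, toLU_Kinv]
  simp only [hterm]
  congr 1
  · rw [zero_mul, pow_zero, mul_one, Nat.sub_zero, Nat.sub_self, mul_zero, pow_zero, mul_one, h0,
      one_mul, pow_zero, mul_one, toLU_dF_self hp, toLU_f, TensorProduct.tmul_smul, smul_smul,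
      ← TensorProduct.smul_tmul', smul_smul, hsq, one_smul, one_smul,
      R.Kinv_pow_eq (by omega : p + p = 2 * p), add_comm]
  · rw [Finset.smul_sum]
    refine Finset.sum_congr rfl fun s hs => ?_
    rw [Finset.mem_Icc] at hs
    -- Replacing `K^(-(p-s))` by `K^(p+s)` and moving it to the left inverts the power of `q`,
    -- because `q^(4ps) = 1`.
    have h1 : qRoot p ^ (s * (p - s)) • (LU.F p ^ s * LU.Kinv p ^ (p - s)) =
        (qRoot p)⁻¹ ^ (s * (p - s)) • (LU.K p ^ (p + s) * LU.F p ^ s) := by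
      rw [R.Kinv_pow_eq (by omega : p - s + (p + s) = 2 * p), R.quantum.K_pow_F_pow, smul_smul]
      congr 1
      obtain ⟨d, rfl⟩ := Nat.exists_eq_add_of_le (by omega : s ≤ p)
      rw [Nat.add_sub_cancel_left, ← pow_add, inv_pow]
      refine eq_inv_of_mul_eq_one_left ?_
      rw [← pow_add, show s * d + (s * d + 2 * (s + d + s) * s) =
          2 * (s + d) * (2 * s) by ring, pow_mul, (qRoot_isPrimitiveRoot hp).pow_eq_one, one_pow]
    rw [toLU_dF hp (by omega), toLU_dF hp (by omega), TensorProduct.tmul_smul, smul_mul_assoc,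
      ← TensorProduct.smul_tmul', smul_smul, smul_smul]
    have h2 : (LU.F p ^ s * LU.Kinv p ^ (p - s)) = ((qRoot p ^ (s * (p - s)))⁻¹ *
        (qRoot p)⁻¹ ^ (s * (p - s))) • (LU.K p ^ (p + s) * LU.F p ^ s) := by
      rw [← smul_smul, ← h1, smul_smul, inv_mul_cancel₀ (pow_ne_zero _ (qRoot_ne_zero p)), one_smul]
    rw [h2, ← TensorProduct.smul_tmul', smul_smul, smul_smul]
    congr 1
    have := qFact_mul_qFact_sub hp hs.1 (by omega : s < p)
    have h3 := pow_ne_zero (s * (p - s)) (qRoot_ne_zero p)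
    have h4 : (qFact (qRoot p) (p - s))⁻¹ * (qFact (qRoot p) s)⁻¹ =
        (qFact (qRoot p) (p - 1))⁻¹ * (qInt (qRoot p) s)⁻¹ := by
      rw [← mul_inv, ← mul_inv, mul_comm, this]
    have h5 := mul_inv_cancel₀ h3
    rw [div_eq_mul_inv, div_eq_mul_inv]
    linear_combination (-1) ^ p * (qRoot p)⁻¹ ^ (s * (p - s)) * (qFact (qRoot p) (p - s))⁻¹ *
      (qFact (qRoot p) s)⁻¹ * h5 + (-1) ^ p * (qRoot p)⁻¹ ^ (s * (p - s)) * h4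

lemma antipode_e (h : IsSpecialization hp HD H) :
    H.antipode (LU.e p) = -(LU.K p ^ p * LU.e p) := by
  have R := LU.isRestricted (p := p)
  have := h.antipode (x := e p) coe_antipodeE
  rw [toLU_e] at this
  rw [this, antipodeE, toLU_reg_smul hp (specializes_antipodeE p), map_mul, map_mul, map_mul,
    map_pow, toLU_Kinv, toLU_e, R.Kinv_pow_eq (by omega : p + p = 2 * p), mul_assoc,
    R.K_pow_mul_K_pow, mul_one, pow_mul, inv_pow, qRoot_pow hp, ← neg_one_smul ℂ (LU.K p ^ p * _)]
  congr 1
  rw [inv_neg, inv_one, ← pow_add, show p + (p - 1) = 2 * (p - 1) + 1 by omega, pow_succ, pow_mul]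
  norm_num

lemma antipode_f (h : IsSpecialization hp HD H) :
    H.antipode (LU.f p) = -(LU.K p ^ p * LU.f p) := by
  have := h.antipode (x := f p) coe_antipodeF
  rw [toLU_f] at this
  rw [this, antipodeF, toLU_reg_smul hp (specializes_antipodeF p), map_mul,
    map_pow, toLU_K, toLU_f, pow_mul, qRoot_pow hp, ← neg_one_smul ℂ (LU.K p ^ p * _)]
  congr 1
  rw [← pow_add, show p + (p - 1) = 2 * (p - 1) + 1 by omega, pow_succ, pow_mul]
  norm_num

lemma h_eq_LU : LU.h p = (1 / 2 : ℂ) • (LU.e p * LU.f p - LU.f p * LU.e p) := by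
  rw [LU.isLusztig.e_f, smul_smul]
  norm_num

lemma counit_e (h : IsSpecialization hp HD H) : H.counit (LU.e p) = 0 := by
  rw [← toLU_e hp]
  refine h.counit ?_
  rw [coe_e, Ugen.e, map_smul, map_mul, map_pow _ Ugen.E, Uq.hopf_counit_gen _ .E]
  simpa [Uq.genValue, show p ≠ 0 by omega] using Specializes.zero

lemma counit_f (h : IsSpecialization hp HD H) : H.counit (LU.f p) = 0 := by
  rw [← toLU_f hp]
  refine h.counit ?_
  rw [coe_f, Ugen.f, map_smul, map_pow, Uq.hopf_counit_gen]
  simpa [Uq.genValue, show p ≠ 0 by omega] using Specializes.zero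

lemma hasLusztigValues (h : IsSpecialization hp HD H) : HasLusztigValues p H where
  quantum := h.hasQuantumValues
  comul_e := h.comul_e
  comul_f := h.comul_f
  comul_h := by rw [h_eq_LU, map_smul, map_sub, map_mul, map_mul]
  antipode_e := h.antipode_e
  antipode_f := h.antipode_f
  antipode_h := by
    have L := LU.isLusztig (p := p)
    have R := L.restricted
    have h1 : LU.K p ^ p * LU.f p * (LU.K p ^ p * LU.e p) = LU.f p * LU.e p := by
      rw [L.K_pow_f, mul_assoc, ← mul_assoc (LU.K p ^ p), R.K_pow_mul_K_pow, one_mul]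
    have h2 : LU.K p ^ p * LU.e p * (LU.K p ^ p * LU.f p) = LU.e p * LU.f p := by
      rw [L.K_pow_e, mul_assoc, ← mul_assoc (LU.K p ^ p), R.K_pow_mul_K_pow, one_mul]
    rw [h_eq_LU, map_smul, map_sub, H.antipode_mul, H.antipode_mul, h.antipode_e, h.antipode_f,
      neg_mul_neg, neg_mul_neg, h1, h2, ← smul_neg, neg_sub]
  counit_e := h.counit_e
  counit_f := h.counit_f
  counit_h := by
    rw [h_eq_LU, map_smul, map_sub, map_mul, map_mul, mul_comm, sub_self, smul_zero]

/-- The specialization map has the properties of a limit. -/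
lemma isLimitMap (h : IsSpecialization hp HD H) :
    IsLimitMap p genHopf H (toLU hp : DividedForm p →+* LU p) where
  map_smul c x := by
    rw [← algebraMap_regularAt]
    exact toLU_smul hp c x
  surjective := toLU_surjective hp
  map_eq_zero_iff _ := toLU_eq_zero_iff hp
  map_E := ⟨E p, rfl, toLU_E hp⟩
  map_F := ⟨F p, rfl, toLU_F hp⟩
  map_K := ⟨K p, rfl, toLU_K hp⟩
  map_e := ⟨e p, rfl, toLU_e hp⟩
  map_f := ⟨f p, rfl, toLU_f hp⟩
  map_h := ⟨DividedForm.h p, rfl, toLU_h hp⟩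
  comul x := by
    obtain ⟨S, hS⟩ := TensorProduct.exists_finset (HD.comul x)
    refine ⟨S.card, fun i => (S.equivFin.symm i).1.1, fun i => (S.equivFin.symm i).1.2, ?_, ?_⟩
    · have := h.generic.comul x
      rw [hS, tensorMap_sum] at this
      simp only [tensorMap_tmul] at this
      refine this.trans ?_
      rw [← Finset.sum_coe_sort S, ← S.equivFin.symm.sum_comp]
      rfl
    · have := h.special.comul x
      rw [hS, tensorMap_sum] at this
      simp only [tensorMap_tmul] at this
      refine this.trans ?_
      rw [← Finset.sum_coe_sort S, ← S.equivFin.symm.sum_comp]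
      rfl
  counit x := by
    have h1 := h.generic.counit x
    change genHopf.counit (x : Ugen) = (HD.counit x : RatFunc ℂ) at h1
    rw [h1]
    exact ⟨(HD.counit x).2, h.special.counit x⟩
  antipode x := ⟨HD.antipode x, (h.generic.antipode x).symm, h.special.antipode x⟩

end IsSpecialization

/-! ### The restricted quantum group as a Hopf subalgebra -/

lemma tensorMap_eq_map {k A B A' B' : Type*} [Field k] [Ring A] [Algebra k A] [Ring B] [Algebra k B]
    [Ring A'] [Algebra k A'] [Ring B'] [Algebra k B'] (φ : A →ₐ[k] B) (ψ : A' →ₐ[k] B')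
    (t : A ⊗[k] A') : tensorMap k φ ψ t = Algebra.TensorProduct.map φ ψ t := by
  induction t using TensorProduct.induction_on with
  | zero => simp
  | add x y hx hy => rw [map_add, map_add, hx, hy]
  | tmul x y => simp

/-- The structure is restricted along the embedding. Over a field tensor products of injections are
injective, so it suffices that the images of the four generators behave well. -/
theorem IsSpecialization.exists_hopf_Ures {p : ℕ} {hp : 2 ≤ p}
    {HD : HopfStructure (regularAt (qRoot p)) (DividedForm p)} {H : HopfStructure ℂ (LU p)}
    (h : IsSpecialization hp HD H) : ∃ Hres : HopfStructure ℂ (Ures p),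
      HasQuantumValues Hres (Ures.gen p .E) (Ures.gen p .F) (Ures.gen p .K) (Ures.gen p .Kinv) ∧
        Hres.IsHom H (LU.ofUres p) := by
  have hj := LU.ofUres_injective hp
  have Q := h.hasQuantumValues
  have hjj : Function.Injective (tensorMap ℂ (LU.ofUres p) (LU.ofUres p)) :=
    tensorMap_injective _ _ hj hj
  have hcu : H.counit (LU.Kinv p) = 1 := by
    have h1 := congrArg H.counit (LU.isRestricted (p := p)).quantum.K_mul_Kinv
    rwa [map_mul, Q.counit_K, one_mul, map_one] at h1
  have han : H.antipode (LU.Kinv p) = LU.K p := by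
    rw [← DividedForm.toLU_Kinv hp, ← DividedForm.toLU_K hp]
    exact h.antipode (Uq.hopf_antipode_gen RatFunc.X_ne_zero .Kinv).symm
  obtain ⟨Hres, hres⟩ := HopfStructure.exists_restrict (LU.ofUres p) H hj
    (algebraMap ℂ ℂ).injective hjj (tensorMap_injective _ _ hj hjj) _ Ures.adjoin_gen
    (by
      rintro _ ⟨_ | _ | _ | _, rfl⟩ <;> rw [LU.ofUres_gen]
      · exact ⟨1 ⊗ₜ Ures.gen p .E + Ures.gen p .E ⊗ₜ Ures.gen p .K, by
          rw [tensorMap_add, tensorMap_tmul, tensorMap_tmul, map_one, LU.ofUres_gen, LU.ofUres_gen,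
            Q.comul_E]⟩
      · exact ⟨Ures.gen p .Kinv ⊗ₜ Ures.gen p .F + Ures.gen p .F ⊗ₜ 1, by
          rw [tensorMap_add, tensorMap_tmul, tensorMap_tmul, map_one, LU.ofUres_gen, LU.ofUres_gen,
            Q.comul_F]⟩
      · exact ⟨Ures.gen p .K ⊗ₜ Ures.gen p .K, by
          rw [tensorMap_tmul, LU.ofUres_gen, Q.comul_K]⟩
      · exact ⟨Ures.gen p .Kinv ⊗ₜ Ures.gen p .Kinv, by
          rw [tensorMap_tmul, LU.ofUres_gen, h.comul_Kinv]⟩)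
    (fun x _ => ⟨_, rfl⟩)
    (by
      rintro _ ⟨_ | _ | _ | _, rfl⟩ <;> rw [LU.ofUres_gen]
      · exact ⟨-(Ures.gen p .E * Ures.gen p .Kinv), by
          rw [map_neg, map_mul, LU.ofUres_gen, LU.ofUres_gen, Q.antipode_E]⟩
      · exact ⟨-(Ures.gen p .K * Ures.gen p .F), by
          rw [map_neg, map_mul, LU.ofUres_gen, LU.ofUres_gen, Q.antipode_F]⟩
      · exact ⟨Ures.gen p .Kinv, by rw [LU.ofUres_gen, Q.antipode_K]⟩
      · exact ⟨Ures.gen p .K, by rw [LU.ofUres_gen, han]⟩)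
  refine ⟨Hres, ?_, ?_⟩
  · have hc : ∀ x, Hres.counit x = H.counit (LU.ofUres p x) := fun x => (hres.counit x).symm
    constructor
    · apply hjj
      rw [← hres.comul, tensorMap_add, tensorMap_tmul, tensorMap_tmul, map_one, LU.ofUres_gen,
        LU.ofUres_gen, Q.comul_E]
    · apply hjj
      rw [← hres.comul, tensorMap_add, tensorMap_tmul, tensorMap_tmul, map_one, LU.ofUres_gen,
        LU.ofUres_gen, Q.comul_F]
    · apply hjj
      rw [← hres.comul, tensorMap_tmul, LU.ofUres_gen, Q.comul_K]
    · apply hj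
      rw [← hres.antipode, map_neg, map_mul, LU.ofUres_gen, LU.ofUres_gen, Q.antipode_E]
    · apply hj
      rw [← hres.antipode, map_neg, map_mul, LU.ofUres_gen, LU.ofUres_gen, Q.antipode_F]
    · apply hj
      rw [← hres.antipode, LU.ofUres_gen, LU.ofUres_gen, Q.antipode_K]
    · rw [hc, LU.ofUres_gen, Q.counit_E]
    · rw [hc, LU.ofUres_gen, Q.counit_F]
    · rw [hc, LU.ofUres_gen, Q.counit_K]
  · exact ⟨fun x => (hres.comul x).trans (tensorMap_eq_map _ _ _), hres.counit, hres.antipode⟩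

/-! ### Universal enveloping algebras -/

section Enveloping
attribute [local instance] LieRing.ofAssociativeRing

variable {L A : Type*} [LieRing L] [LieAlgebra ℂ L] [Ring A] [Algebra ℂ A]

/-- The algebra homomorphism on the enveloping algebra given by a linear map. -/
def envLift (f : L →ₗ[ℂ] A) (hf : ∀ x y, f ⁅x, y⁆ = f x * f y - f y * f x) :
    UniversalEnvelopingAlgebra ℂ L →ₐ[ℂ] A :=
  UniversalEnvelopingAlgebra.lift ℂ { f with map_lie' := fun {x y} => hf x y }

lemma envLift_ι (f : L →ₗ[ℂ] A) (hf : ∀ x y, f ⁅x, y⁆ = f x * f y - f y * f x) (x : L) :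
    envLift f hf (UniversalEnvelopingAlgebra.ι ℂ x) = f x :=
  UniversalEnvelopingAlgebra.lift_ι_apply ℂ _ x

lemma env_algHom_ext {φ ψ : UniversalEnvelopingAlgebra ℂ L →ₐ[ℂ] A}
    (h : ∀ x : L, φ (UniversalEnvelopingAlgebra.ι ℂ x) = ψ (UniversalEnvelopingAlgebra.ι ℂ x)) :
    φ = ψ :=
  UniversalEnvelopingAlgebra.hom_ext ℂ (LieHom.ext h)

lemma ι_lie (x y : L) : UniversalEnvelopingAlgebra.ι ℂ ⁅x, y⁆ =
    UniversalEnvelopingAlgebra.ι ℂ x * UniversalEnvelopingAlgebra.ι ℂ y -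
      UniversalEnvelopingAlgebra.ι ℂ y * UniversalEnvelopingAlgebra.ι ℂ x :=
  LieHom.map_lie _ x y

variable (L) in
/-- The canonical linear map to the enveloping algebra. -/
def envι : L →ₗ[ℂ] UniversalEnvelopingAlgebra ℂ L :=
  (UniversalEnvelopingAlgebra.ι ℂ : L →ₗ⁅ℂ⁆ UniversalEnvelopingAlgebra ℂ L)

lemma envι_apply (x : L) : envι L x = UniversalEnvelopingAlgebra.ι ℂ x := rfl

lemma envι_lie (x y : L) : envι L ⁅x, y⁆ = envι L x * envι L y - envι L y * envι L x := ι_lie x y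

/-- The universal property maps the enveloping algebra into the subalgebra generated by `L`.
Followed by the inclusion this is the identity on `L`, hence everywhere. -/
lemma env_adjoin_range : Algebra.adjoin ℂ (Set.range (envι L)) = ⊤ := by
  set S := Algebra.adjoin ℂ (Set.range (envι L)) with hS
  let f : L →ₗ[ℂ] S := (envι L).codRestrict S.toSubmodule
    fun x => Algebra.subset_adjoin ⟨x, rfl⟩
  have hf : ∀ x y, f ⁅x, y⁆ = f x * f y - f y * f x := fun x y => Subtype.ext (envι_lie x y)
  have h : S.val.comp (envLift f hf) = AlgHom.id ℂ _ := env_algHom_ext fun x => by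
    rw [AlgHom.comp_apply, envLift_ι]
    rfl
  rw [eq_top_iff]
  intro x _
  have := DFunLike.congr_fun h x
  rw [AlgHom.comp_apply, AlgHom.id_apply] at this
  rw [← this]
  exact (envLift f hf x).2

variable (L) in
/-- The Hopf structure in which the elements of the Lie algebra are primitive. -/
def envHopf : HopfStructure ℂ (UniversalEnvelopingAlgebra ℂ L) :=
  HopfStructure.ofGenerators (Set.range (envι L)) env_adjoin_range
    (envLift ((Algebra.TensorProduct.includeLeft (R := ℂ) (S := ℂ)
        (A := UniversalEnvelopingAlgebra ℂ L) (B := UniversalEnvelopingAlgebra ℂ L)).toLinearMap ∘ₗ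
          envι L + (Algebra.TensorProduct.includeRight (R := ℂ)
        (A := UniversalEnvelopingAlgebra ℂ L) (B := UniversalEnvelopingAlgebra ℂ L)).toLinearMap ∘ₗ
          envι L) (fun x y => by
      simp only [LinearMap.add_apply, LinearMap.comp_apply, AlgHom.toLinearMap_apply, envι_lie,
        Algebra.TensorProduct.includeLeft_apply, Algebra.TensorProduct.includeRight_apply, add_mul,
        mul_add, Algebra.TensorProduct.tmul_mul_tmul, one_mul, mul_one, TensorProduct.sub_tmul,
        TensorProduct.tmul_sub]
      abel))
    (envLift 0 (fun x y => by simp))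
    (envLift (-((MulOpposite.opLinearEquiv ℂ).toLinearMap ∘ₗ envι L)) (fun x y => by
      simp only [LinearMap.neg_apply, LinearMap.comp_apply, envι_lie, neg_mul_neg,
        LinearEquiv.coe_coe, MulOpposite.coe_opLinearEquiv, ← MulOpposite.op_mul,
        MulOpposite.op_sub, neg_sub]))
    (by
      rintro _ ⟨x, rfl⟩
      simp [envι_apply, envLift_ι, TensorProduct.add_tmul, TensorProduct.tmul_add,
        Algebra.TensorProduct.one_def, add_assoc, -UniversalEnvelopingAlgebra.ι_apply])
    (by
      rintro _ ⟨x, rfl⟩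
      simp [envι_apply, envLift_ι, -UniversalEnvelopingAlgebra.ι_apply])
    (by
      rintro _ ⟨x, rfl⟩
      simp [envι_apply, envLift_ι, -UniversalEnvelopingAlgebra.ι_apply])
    (by
      rintro _ ⟨x, rfl⟩
      simp [envι_apply, envLift_ι, -UniversalEnvelopingAlgebra.ι_apply])
    (by
      rintro _ ⟨x, rfl⟩
      simp [envι_apply, envLift_ι, -UniversalEnvelopingAlgebra.ι_apply])

lemma envHopf_comul_ι (x : L) : (envHopf L).comul (UniversalEnvelopingAlgebra.ι ℂ x) =
    UniversalEnvelopingAlgebra.ι ℂ x ⊗ₜ[ℂ] 1 + 1 ⊗ₜ[ℂ] UniversalEnvelopingAlgebra.ι ℂ x :=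
  envLift_ι _ _ x

lemma envHopf_counit_ι (x : L) : (envHopf L).counit (UniversalEnvelopingAlgebra.ι ℂ x) = 0 :=
  envLift_ι _ _ x

lemma envHopf_antipode_ι (x : L) : (envHopf L).antipode (UniversalEnvelopingAlgebra.ι ℂ x) =
    -UniversalEnvelopingAlgebra.ι ℂ x :=
  congrArg MulOpposite.unop (envLift_ι _ _ x)

end Enveloping

lemma envHopf_hasPrimitiveValues : HasPrimitiveValues (envHopf Sl2) :=
  ⟨envHopf_comul_ι, envHopf_counit_ι, envHopf_antipode_ι⟩

section Sl2

lemma sl2_val_one_one (x : Sl2) : x.1 1 1 = -x.1 0 0 := by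
  have h : Matrix.trace x.1 = 0 := x.2
  rw [Matrix.trace_fin_two] at h
  linear_combination h

lemma sl2_eq (x : Sl2) : x = x.1 0 1 • sl2e + x.1 1 0 • sl2f + (2 * x.1 0 0) • sl2h := by
  apply Subtype.ext
  have := sl2_val_one_one x
  ext i j
  fin_cases i <;> fin_cases j <;> simp [this] <;> ring

lemma sl2_lie_val (x y : Sl2) : (⁅x, y⁆ : Sl2).1 = x.1 * y.1 - y.1 * x.1 := rfl

lemma sl2h_lie_sl2e : ⁅sl2h, sl2e⁆ = sl2e := by
  apply Subtype.ext
  rw [sl2_lie_val]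
  ext i j
  fin_cases i <;> fin_cases j <;> norm_num [Matrix.mul_apply, Fin.sum_univ_two]

lemma sl2h_lie_sl2f : ⁅sl2h, sl2f⁆ = -sl2f := by
  apply Subtype.ext
  rw [sl2_lie_val]
  ext i j
  fin_cases i <;> fin_cases j <;> norm_num [Matrix.mul_apply, Fin.sum_univ_two]

lemma sl2e_lie_sl2f : ⁅sl2e, sl2f⁆ = (2 : ℂ) • sl2h := by
  apply Subtype.ext
  rw [sl2_lie_val]
  ext i j
  fin_cases i <;> fin_cases j <;> norm_num [Matrix.mul_apply, Fin.sum_univ_two]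

variable {A : Type*} [Ring A] [Algebra ℂ A]

/-- The linear map on `sl(2)` with given values on the standard basis. -/
def sl2Map (e f h : A) : Sl2 →ₗ[ℂ] A where
  toFun x := x.1 0 1 • e + x.1 1 0 • f + (2 * x.1 0 0) • h
  map_add' x y := by
    change (x.1 0 1 + y.1 0 1) • e + (x.1 1 0 + y.1 1 0) • f + (2 * (x.1 0 0 + y.1 0 0)) • h = _
    module
  map_smul' c x := by
    change (c * x.1 0 1) • e + (c * x.1 1 0) • f + (2 * (c * x.1 0 0)) • h = c • _
    module

lemma sl2Map_apply (e f h : A) (x : Sl2) :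
    sl2Map e f h x = x.1 0 1 • e + x.1 1 0 • f + (2 * x.1 0 0) • h := rfl

lemma sl2Map_lie {e f h : A} (h_e : h * e - e * h = e) (h_f : h * f - f * h = -f)
    (e_f : e * f - f * e = (2 : ℂ) • h) (x y : Sl2) :
    sl2Map e f h ⁅x, y⁆ = sl2Map e f h x * sl2Map e f h y - sl2Map e f h y * sl2Map e f h x := by
  have hx := sl2_val_one_one x
  have hy := sl2_val_one_one y
  have e1 : h * e = e * h + e := by rw [← sub_eq_iff_eq_add']; exact h_e
  have e2 : f * h = h * f + f := by rw [sub_eq_iff_eq_add.1 h_f]; abel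
  have e3 : e * f = f * e + (2 : ℂ) • h := by rw [← e_f]; abel
  rw [sl2Map_apply, sl2_lie_val]
  simp only [sl2Map_apply, Matrix.sub_apply, Matrix.mul_apply, Fin.sum_univ_two, hx, hy, add_mul,
    mul_add, smul_mul_assoc, mul_smul_comm, e1, e2, e3]
  module

end Sl2

/-! ### The quotient by the augmentation ideal of the restricted quantum group -/

section NormalSubalgebra
variable {R A B : Type*} [CommRing R] [Ring A] [Algebra R A] [Ring B] [Algebra R B]
  {HA : HopfStructure R A} {HB : HopfStructure R B} {j : A →ₐ[R] B}

lemma HopfStructure.sub_counit_mem (HA : HopfStructure R A) (y : A) :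
    HA.counit (y - algebraMap R A (HA.counit y)) = 0 := by
  rw [map_sub, AlgHom.commutes, Algebra.algebraMap_self_apply, sub_self]

lemma mk_eq_algebraMap_counit {I : Ideal B} [I.IsTwoSided]
    (hI : ∀ x, HA.counit x = 0 → j x ∈ I) (y : A) :
    Ideal.Quotient.mk I (j y) = algebraMap R (B ⧸ I) (HA.counit y) := by
  have h := hI _ (HA.sub_counit_mem y)
  rw [map_sub, AlgHom.commutes, ← Ideal.Quotient.eq] at h
  rw [h]
  rfl

/-- The left ideal generated by the augmentation ideal of a Hopf subalgebra is a Hopf ideal if it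
is two-sided. -/
theorem isHopfIdeal_span_ker_counit (hj : HA.IsHom HB j) (I : Ideal B)
    (hI : I = Ideal.span (j '' {x | HA.counit x = 0})) [I.IsTwoSided] :
    letI := HB.toHopfAlgebra; I.IsHopfIdeal R := by
  let _ := HB.toHopfAlgebra
  have hmem : ∀ x, HA.counit x = 0 → j x ∈ I := fun x hx =>
    hI ▸ Ideal.subset_span ⟨x, hx, rfl⟩
  have hmk := mk_eq_algebraMap_counit hmem
  let mkI : B →ₐ[R] B ⧸ I := Ideal.Quotient.mkₐ R I
  have hle : ∀ P : Ideal B, (∀ y, HA.counit y = 0 → j y ∈ P) → I ≤ P := by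
    intro P hP
    rw [hI, Ideal.span_le]
    rintro _ ⟨y, hy, rfl⟩
    exact hP y hy
  have hcomul : ∀ y, HA.counit y = 0 →
      ((Algebra.TensorProduct.map mkI mkI).comp HB.comul) (j y) = 0 := by
    intro y hy
    have h1 : mkI.comp j = (Algebra.ofId R (B ⧸ I)).comp HA.counit := AlgHom.ext hmk
    -- Modulo the ideal `j` becomes the counit. Applying this in the left tensor factor and using
    -- the counit axiom, the class of the comultiplication of `j y` is `1` tensored with the class
    -- of `j y`.
    have h2 : (Algebra.TensorProduct.map mkI mkI).comp (Algebra.TensorProduct.map j j) =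
        (Algebra.TensorProduct.map (Algebra.ofId R (B ⧸ I)) (mkI.comp j)).comp
          (Algebra.TensorProduct.map HA.counit (.id R A)) := by
      ext x
      · have := AlgHom.congr_fun h1 x
        simp only [AlgHom.comp_apply] at this
        simp [this]
      · simp
    have h3 := AlgHom.congr_fun HA.rTensor_counit y
    rw [AlgHom.comp_apply] at h3
    rw [AlgHom.comp_apply, hj.comul, ← AlgHom.comp_apply, h2, AlgHom.comp_apply, h3]
    have h4 : mkI (j y) = 0 := by rw [← AlgHom.comp_apply, h1, AlgHom.comp_apply, hy, map_zero]
    change Algebra.TensorProduct.map _ _ ((1 : R) ⊗ₜ[R] y) = 0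
    rw [Algebra.TensorProduct.map_tmul, AlgHom.comp_apply, h4, TensorProduct.tmul_zero]
  refine { counit_eq_zero := ?_, map_mkQ_comul_eq_zero := ?_, antipode_mem := ?_ }
  · exact hle (RingHom.ker HB.counit) fun y hy => (hj.counit y).trans hy
  · exact hle (RingHom.ker ((Algebra.TensorProduct.map mkI mkI).comp HB.comul)) hcomul
  · intro x hx
    change HB.antipode x ∈ I
    rw [hI] at hx
    induction hx using Submodule.span_induction with
    | mem x hx =>
      obtain ⟨y, hy, rfl⟩ := hx
      rw [hj.antipode]
      refine hmem _ ?_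
      let _ := HA.toHopfAlgebra
      exact (HopfAlgebra.counit_antipode (R := R) y).trans hy
    | zero => rw [map_zero]; exact I.zero_mem
    | add x y _ _ hx hy => rw [map_add]; exact I.add_mem hx hy
    | smul a x _ hx =>
      -- The antipode reverses the product, so absorption from the right is needed here.
      rw [smul_eq_mul, HB.antipode_mul]
      exact I.mul_mem_right _ hx

end NormalSubalgebra

/-! ### The map to `U(sl(2))` and the quotient -/

namespace LU
variable {p : ℕ}

lemma algHom_ext {A : Type*} [Ring A] [Algebra ℂ A] {φ ψ : LU p →ₐ[ℂ] A}
    (hE : φ (E p) = ψ (E p)) (hF : φ (F p) = ψ (F p)) (hK : φ (K p) = ψ (K p))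
    (he : φ (e p) = ψ (e p)) (hf : φ (f p) = ψ (f p)) : φ = ψ := by
  refine AlgHom.ext_of_adjoin_eq_top adjoin_gen ?_
  have hKi : φ (Kinv p) = ψ (Kinv p) := by
    have Q := (isRestricted (p := p)).quantum
    refine left_inv_eq_right_inv (a := φ (K p)) ?_ ?_
    · rw [← map_mul, Q.Kinv_mul_K, map_one]
    · rw [hK, ← map_mul, Q.K_mul_Kinv, map_one]
  rintro _ ⟨(_ | _ | _ | _) | _ | _ | _, rfl⟩
  exacts [hE, hF, hK, hKi, he, hf, by
    change φ (h p) = ψ (h p)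
    rw [IsSpecialization.h_eq_LU, map_smul, map_smul, map_sub, map_sub, map_mul, map_mul, map_mul,
      map_mul, he, hf]]

/-- With `E = F = 0` and `K = 1` the mixed relations become trivial: as `p ≥ 2`, their right-hand
sides contain a positive power of `E` or `F`. The relations among `e, f, h` are those of sl(2). -/
lemma _root_.LusztigLimit.isLusztig_sl2 (hp : 2 ≤ p) : IsLusztig p (0 : USl2) 0 1 1
    (UniversalEnvelopingAlgebra.ι ℂ sl2e) (UniversalEnvelopingAlgebra.ι ℂ sl2f)
    (UniversalEnvelopingAlgebra.ι ℂ sl2h) where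
  restricted :=
    { quantum := ⟨mul_one 1, mul_one 1, by simp, by simp, by simp⟩
      E_pow := zero_pow (by omega)
      F_pow := zero_pow (by omega)
      K_pow := one_pow _ }
  E_e := by rw [zero_mul, mul_zero]
  K_e := by rw [one_mul, mul_one]
  F_f := by rw [zero_mul, mul_zero]
  K_f := by rw [one_mul, mul_one]
  F_e := by rw [zero_pow (by omega), zero_mul, mul_zero, mul_zero, smul_zero, sub_zero]
  E_f := by rw [zero_pow (by omega), zero_mul, mul_zero, zero_mul, smul_zero, sub_zero]
  h_e := by rw [← ι_lie, sl2h_lie_sl2e]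
  h_f := by rw [← ι_lie, sl2h_lie_sl2f, map_neg]
  e_f := by rw [← ι_lie, sl2e_lie_sl2f, map_smul]
  h_K := by rw [one_mul, mul_one]
  h_E := by rw [zero_mul, mul_zero, zero_mul, smul_zero, sub_zero]
  h_F := by rw [zero_mul, mul_zero, mul_zero, smul_zero, sub_zero, neg_zero]

/-- The homomorphism onto `U(sl(2))` that is the counit on `E, F, K`. -/
def toUSl2 (hp : 2 ≤ p) : LU p →ₐ[ℂ] USl2 := lift (isLusztig_sl2 hp)

section
variable (hp : 2 ≤ p)

lemma toUSl2_E : toUSl2 hp (E p) = 0 := lift_gen _ _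
lemma toUSl2_F : toUSl2 hp (F p) = 0 := lift_gen _ _
lemma toUSl2_K : toUSl2 hp (K p) = 1 := lift_gen _ _
lemma toUSl2_e : toUSl2 hp (e p) = UniversalEnvelopingAlgebra.ι ℂ sl2e := lift_gen _ _
lemma toUSl2_f : toUSl2 hp (f p) = UniversalEnvelopingAlgebra.ι ℂ sl2f := lift_gen _ _
lemma toUSl2_h : toUSl2 hp (h p) = UniversalEnvelopingAlgebra.ι ℂ sl2h := lift_gen _ _

variable {H : HopfStructure ℂ (LU p)} {Hsl : HopfStructure ℂ USl2}

lemma counit_comp_toUSl2 (hV : HasLusztigValues p H) (hS : HasPrimitiveValues Hsl) :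
    Hsl.counit.comp (toUSl2 hp) = H.counit := by
  refine algHom_ext ?_ ?_ ?_ ?_ ?_ <;> rw [AlgHom.comp_apply]
  · rw [toUSl2_E, hV.quantum.counit_E, map_zero]
  · rw [toUSl2_F, hV.quantum.counit_F, map_zero]
  · rw [toUSl2_K, hV.quantum.counit_K, map_one]
  · rw [toUSl2_e, hV.counit_e, hS.counit_ι]
  · rw [toUSl2_f, hV.counit_f, hS.counit_ι]

/-- The sums in the comultiplications of `e` and `f` vanish, since each term contains a positive
power of `E` or `F`. What remains says that the images of `e` and `f` are primitive. -/
lemma comul_comp_toUSl2 (hV : HasLusztigValues p H) (hS : HasPrimitiveValues Hsl) :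
    (Algebra.TensorProduct.map (toUSl2 hp) (toUSl2 hp)).comp H.comul =
      Hsl.comul.comp (toUSl2 hp) := by
  refine algHom_ext ?_ ?_ ?_ ?_ ?_ <;> rw [AlgHom.comp_apply, AlgHom.comp_apply]
  · rw [hV.quantum.comul_E, toUSl2_E]
    simp [toUSl2_E]
  · rw [hV.quantum.comul_F, toUSl2_F]
    simp [toUSl2_F]
  · rw [hV.quantum.comul_K, toUSl2_K]
    simp [toUSl2_K, Algebra.TensorProduct.one_def]
  · have h0 : ∀ r ∈ Finset.Icc 1 (p - 1), Algebra.TensorProduct.map (toUSl2 hp) (toUSl2 hp)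
        ((qRoot p ^ (r * (p - r)) / qInt (qRoot p) r) •
          ((K p ^ p * E p ^ (p - r)) ⊗ₜ[ℂ] (E p ^ r * Kinv p ^ r))) = 0 := by
      intro r hr
      have : r ≠ 0 := by have := (Finset.mem_Icc.1 hr).1; omega
      rw [map_smul, Algebra.TensorProduct.map_tmul, map_mul _ (E p ^ r), map_pow _ (E p) r,
        toUSl2_E, zero_pow this, zero_mul, TensorProduct.tmul_zero, smul_zero]
    rw [hV.comul_e, toUSl2_e, hS.comul_ι, map_add, map_smul, map_sum, Finset.sum_eq_zero h0]
    simp [toUSl2_K, toUSl2_e, -UniversalEnvelopingAlgebra.ι_apply]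
  · have h0 : ∀ s ∈ Finset.Icc 1 (p - 1), Algebra.TensorProduct.map (toUSl2 hp) (toUSl2 hp)
        (((qRoot p)⁻¹ ^ (s * (p - s)) / qInt (qRoot p) s) •
          ((K p ^ (p + s) * F p ^ s) ⊗ₜ[ℂ] (F p ^ (p - s)))) = 0 := by
      intro s hs
      have : s ≠ 0 := by have := (Finset.mem_Icc.1 hs).1; omega
      rw [map_smul, Algebra.TensorProduct.map_tmul, map_mul, map_pow _ (F p) s,
        toUSl2_F, zero_pow this, mul_zero, TensorProduct.zero_tmul, smul_zero]
    rw [hV.comul_f, toUSl2_f, hS.comul_ι, map_add, map_smul, map_sum, Finset.sum_eq_zero h0]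
    simp [toUSl2_K, toUSl2_f, -UniversalEnvelopingAlgebra.ι_apply]

variable {Hres : HopfStructure ℂ (Ures p)}

lemma toUSl2_ofUres (hV : HasLusztigValues p H) (hS : HasPrimitiveValues Hsl)
    (hj : Hres.IsHom H (ofUres p)) (y : Ures p) :
    toUSl2 hp (ofUres p y) = algebraMap ℂ USl2 (Hres.counit y) := by
  rw [← hj.counit, ← counit_comp_toUSl2 hp hV hS]
  have hg : ∀ g, toUSl2 hp (ofUres p (Ures.gen p g)) =
      algebraMap ℂ USl2 (Hsl.counit (toUSl2 hp (ofUres p (Ures.gen p g)))) := by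
    intro g
    rw [ofUres_gen, toUSl2, lift_gen]
    cases g <;> simp [genValue, Uq.genValue]
  have : (toUSl2 hp).comp (ofUres p) =
      (Algebra.ofId ℂ USl2).comp ((Hsl.counit.comp (toUSl2 hp)).comp (ofUres p)) := by
    refine AlgHom.ext_of_adjoin_eq_top Ures.adjoin_gen ?_
    rintro _ ⟨g, rfl⟩
    exact hg g
  exact AlgHom.congr_fun this y

/-- If `y` has counit zero, then `y b = b y + [y, b]`. For `b` one of `e, f, h` the commutator lies
in the restricted part, and its counit is zero because the counit takes values in a commutative
ring. So both summands lie in the left ideal. -/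
theorem augmentationIdeal_isTwoSided {p : ℕ} (hp : 2 ≤ p) {H : HopfStructure ℂ (LU p)}
    {Hres : HopfStructure ℂ (Ures p)} (hj : Hres.IsHom H (ofUres p)) :
    (augmentationIdeal Hres (ofUres p)).IsTwoSided := by
  set I := augmentationIdeal Hres (ofUres p) with hI
  have hmem : ∀ y, Hres.counit y = 0 → ofUres p y ∈ I := fun y hy =>
    Ideal.subset_span ⟨y, hy, rfl⟩
  have hcomm : ∀ y, Hres.counit y = 0 → ∀ b,
      ofUres p y * b - b * ofUres p y ∈ (ofUres p).range → ofUres p y * b ∈ I := by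
    rintro y hy b ⟨z, hz⟩
    have hz' : ofUres p z = ofUres p y * b - b * ofUres p y := hz
    have hcz : Hres.counit z = 0 := by
      rw [← hj.counit, hz', map_sub, map_mul, map_mul, mul_comm, sub_self]
    rw [← sub_add_cancel (ofUres p y * b) (b * ofUres p y), ← hz']
    exact I.add_mem (hmem z hcz) (I.mul_mem_left _ (hmem y hy))
  have hgen : ∀ y, Hres.counit y = 0 → ∀ g, ofUres p y * gen p g ∈ I := by
    intro y hy g
    have hr : ofUres p y ∈ (ofUres p).range := ⟨y, rfl⟩
    rcases g with g | _ | _ | _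
    · rw [← ofUres_gen, ← map_mul]
      exact hmem _ (by rw [map_mul, hy, zero_mul])
    · exact hcomm y hy _ (commutator_e_mem hp hr)
    · exact hcomm y hy _ (commutator_f_mem hp hr)
    · exact hcomm y hy _ (commutator_h_mem hp hr)
  have hgen' : ∀ g, ∀ x ∈ I, x * gen p g ∈ I := by
    intro g x hx
    induction hx using Submodule.span_induction with
    | mem x hx =>
      obtain ⟨y, hy, rfl⟩ := hx
      exact hgen y hy g
    | zero => rw [zero_mul]; exact I.zero_mem
    | add x y _ _ hx hy => rw [add_mul]; exact I.add_mem hx hy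
    | smul a x _ hx => rw [smul_eq_mul, mul_assoc]; exact I.mul_mem_left _ hx
  refine ⟨fun {x} b hx => ?_⟩
  have hb : b ∈ Algebra.adjoin ℂ (Set.range (gen p)) := adjoin_gen (p := p) ▸ Algebra.mem_top
  induction hb using Algebra.adjoin_induction generalizing x with
  | mem b hb =>
    obtain ⟨g, rfl⟩ := hb
    exact hgen' g x hx
  | algebraMap c => rw [← Algebra.commutes]; exact I.mul_mem_left _ hx
  | add b c _ _ hb hc => rw [mul_add]; exact I.add_mem (hb hx) (hc hx)
  | mul b c _ _ hb hc => rw [← mul_assoc]; exact hc (hb hx)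

/-- The map to `U(sl(2))` kills the ideal. Conversely, the classes of `e, f, h` satisfy the
relations of sl(2), which gives a map back from `U(sl(2))`. The composites are identities on
generators, because in the quotient `E, F, K` equal their counits `0, 0, 1`. -/
theorem isHopfIdealWithQuotientUSl2 {p : ℕ} (hp : 2 ≤ p) {H : HopfStructure ℂ (LU p)}
    {Hsl : HopfStructure ℂ USl2} {Hres : HopfStructure ℂ (Ures p)}
    (hV : HasLusztigValues p H) (hS : HasPrimitiveValues Hsl)
    (hQ : HasQuantumValues Hres (Ures.gen p .E) (Ures.gen p .F) (Ures.gen p .K) (Ures.gen p .Kinv))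
    (hj : Hres.IsHom H (ofUres p)) :
    IsHopfIdealWithQuotientUSl2 H Hsl (augmentationIdeal Hres (ofUres p)) := by
  let I := augmentationIdeal Hres (ofUres p)
  have htwo : I.IsTwoSided := augmentationIdeal_isTwoSided hp hj
  let _ := H.toHopfAlgebra
  let _ := Hsl.toHopfAlgebra
  have hhopf : I.IsHopfIdeal ℂ := isHopfIdeal_span_ker_counit hj I rfl
  have hker : ∀ x ∈ I, toUSl2 hp x = 0 := by
    have : I ≤ RingHom.ker (toUSl2 hp) := by
      refine Ideal.span_le.2 ?_
      rintro _ ⟨y, hy, rfl⟩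
      change toUSl2 hp (ofUres p y) = 0
      rw [toUSl2_ofUres hp hV hS hj, show Hres.counit y = 0 from hy, map_zero]
    exact fun x hx => this hx
  let mkI : LU p →ₐ[ℂ] LU p ⧸ I := Ideal.Quotient.mkₐ ℂ I
  have hmk : ∀ y, mkI (ofUres p y) = algebraMap ℂ _ (Hres.counit y) :=
    mk_eq_algebraMap_counit fun y hy => Ideal.subset_span ⟨y, hy, rfl⟩
  have hmk' : ∀ g, mkI (gen p (.q g)) = algebraMap ℂ _ (Hres.counit (Ures.gen p g)) := fun g => by
    rw [← ofUres_gen, hmk]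
  have L := isLusztig (p := p)
  let θ : USl2 →ₐ[ℂ] LU p ⧸ I := envLift (sl2Map (mkI (e p)) (mkI (f p)) (mkI (h p)))
    (sl2Map_lie (by rw [← map_mul, ← map_mul, ← map_sub, L.h_e])
      (by rw [← map_mul, ← map_mul, ← map_sub, L.h_f, map_neg])
      (by rw [← map_mul, ← map_mul, ← map_sub, L.e_f, map_smul]))
  have hθ : ∀ x, θ (UniversalEnvelopingAlgebra.ι ℂ x) =
      sl2Map (mkI (e p)) (mkI (f p)) (mkI (h p)) x := envLift_ι _ _
  let φ : (LU p ⧸ I) →ₐ[ℂ] USl2 := Ideal.Quotient.liftₐ I (toUSl2 hp) hker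
  have hφ : ∀ x, φ (mkI x) = toUSl2 hp x := fun _ => rfl
  have h1 : φ.comp θ = AlgHom.id ℂ USl2 := by
    refine env_algHom_ext fun x => ?_
    rw [AlgHom.comp_apply, hθ, sl2Map_apply, map_add, map_add, map_smul, map_smul, map_smul, hφ, hφ,
      hφ, toUSl2_e, toUSl2_f, toUSl2_h, AlgHom.id_apply]
    refine Eq.trans ?_ (congrArg (UniversalEnvelopingAlgebra.ι ℂ) (sl2_eq x)).symm
    rw [map_add, map_add, map_smul (UniversalEnvelopingAlgebra.ι ℂ) _ sl2e,
      map_smul (UniversalEnvelopingAlgebra.ι ℂ) _ sl2f,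
      map_smul (UniversalEnvelopingAlgebra.ι ℂ) _ sl2h]
  have h2 : θ.comp φ = AlgHom.id ℂ (LU p ⧸ I) := by
    refine Ideal.Quotient.algHom_ext ℂ (?_ : (θ.comp φ).comp mkI = (AlgHom.id ℂ _).comp mkI)
    refine algHom_ext ?_ ?_ ?_ ?_ ?_ <;>
      rw [AlgHom.comp_apply, AlgHom.comp_apply, AlgHom.comp_apply, AlgHom.id_apply, hφ]
    · rw [toUSl2_E, map_zero, hmk', hQ.counit_E, map_zero]
    · rw [toUSl2_F, map_zero, hmk', hQ.counit_F, map_zero]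
    · rw [toUSl2_K, map_one, hmk', hQ.counit_K, map_one]
    · rw [toUSl2_e, hθ, sl2Map_apply]
      simp
    · rw [toUSl2_f, hθ, sl2Map_apply]
      simp
  let Φ : (LU p ⧸ I) ≃ₐ[ℂ] USl2 := AlgEquiv.ofAlgHom φ θ h1 h2
  refine ⟨htwo, hhopf, BialgEquiv.ofAlgEquiv Φ ?_ ?_, toUSl2_e hp, toUSl2_f hp, toUSl2_h hp⟩
  · refine Ideal.Quotient.algHom_ext ℂ ?_
    exact counit_comp_toUSl2 hp hV hS
  · refine Ideal.Quotient.algHom_ext ℂ (AlgHom.ext fun x => ?_)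
    have hcomp : (Algebra.TensorProduct.map φ φ).comp (Algebra.TensorProduct.map mkI mkI) =
        Algebra.TensorProduct.map (toUSl2 hp) (toUSl2 hp) := by
      ext <;> simp [hφ]
    refine Eq.trans ?_ (AlgHom.congr_fun (comul_comp_toUSl2 hp hV hS) x)
    rw [← hcomp]
    rfl

end

end LU

open LusztigLimit in
theorem mainTheorem2 (p : ℕ) (hp : 2 ≤ p) :
    ∃ (Hgen : HopfStructure (RatFunc ℂ) Ugen) (Hres : HopfStructure ℂ (Ures p))
      (Hsl : HopfStructure ℂ USl2) (H : HopfStructure ℂ (LU p)),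
      HasQuantumValues Hgen Ugen.E Ugen.F Ugen.K Ugen.Kinv ∧
      HasQuantumValues Hres (Ures.gen p .E) (Ures.gen p .F) (Ures.gen p .K) (Ures.gen p .Kinv) ∧
      HasPrimitiveValues Hsl ∧
      HasLusztigValues p H ∧
      (∃ π : DividedForm p →+* LU p, IsLimitMap p Hgen H π) ∧
      ∃ j : Ures p →ₐ[ℂ] LU p, Function.Injective j ∧ Hres.IsHom H j ∧
        (∀ g : QGen, j (Ures.gen p g) = LU.gen p (.q g)) ∧
        IsHopfIdealWithQuotientUSl2 H Hsl (augmentationIdeal Hres j) := by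
  obtain ⟨HD, H, hD, hH⟩ := DividedForm.exists_hopf_LU hp
  have h : IsSpecialization hp HD H := ⟨hD, hH⟩
  obtain ⟨Hres, hQ, hj⟩ := h.exists_hopf_Ures
  have hV := h.hasLusztigValues
  exact ⟨DividedForm.genHopf, Hres, envHopf Sl2, H, Uq.hopf_hasQuantumValues _, hQ, envHopf_hasPrimitiveValues,
    hV, ⟨_, h.isLimitMap⟩, LU.ofUres p, LU.ofUres_injective hp, hj, LU.ofUres_gen,
    LU.isHopfIdealWithQuotientUSl2 hp hV envHopf_hasPrimitiveValues hQ hj⟩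

end LusztigLimit

end
open LusztigLimit in
theorem mainTheorem2 (p : ℕ) (hp : 2 ≤ p) :
    ∃ (Hgen : HopfStructure (RatFunc ℂ) Ugen) (Hres : HopfStructure ℂ (Ures p))
      (Hsl : HopfStructure ℂ USl2) (H : HopfStructure ℂ (LU p)),
      HasQuantumValues Hgen Ugen.E Ugen.F Ugen.K Ugen.Kinv ∧
      HasQuantumValues Hres (Ures.gen p .E) (Ures.gen p .F) (Ures.gen p .K) (Ures.gen p .Kinv) ∧
      HasPrimitiveValues Hsl ∧
      HasLusztigValues p H ∧
      (∃ π : DividedForm p →+* LU p, IsLimitMap p Hgen H π) ∧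
      ∃ j : Ures p →ₐ[ℂ] LU p, Function.Injective j ∧ Hres.IsHom H j ∧
        (∀ g : QGen, j (Ures.gen p g) = LU.gen p (.q g)) ∧
        IsHopfIdealWithQuotientUSl2 H Hsl (augmentationIdeal Hres j) := by
  obtain ⟨HD, H, hD, hH⟩ := DividedForm.exists_hopf_LU hp
  have h : IsSpecialization hp HD H := ⟨hD, hH⟩
  obtain ⟨Hres, hQ, hj⟩ := h.exists_hopf_Ures
  have hV := h.hasLusztigValues
  exact ⟨DividedForm.genHopf, Hres, envHopf Sl2, H, Uq.hopf_hasQuantumValues _, hQ, envHopf_hasPrimitiveValues,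
    hV, ⟨_, h.isLimitMap⟩, LU.ofUres p, LU.ofUres_injective hp, hj, LU.ofUres_gen,
    LU.isHopfIdealWithQuotientUSl2 hp hV envHopf_hasPrimitiveValues hQ hj⟩
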